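/- **Setting.** Let $\Bbbk$ be a complete normed field of characteristic $0$ containing an element $i$ with $i^2=-1$ and an element $q^{1/2}$ with $0<|q^{1/2}|<1$; put $q=(q^{1/2})^2$ (for instance $\Bbbk=\mathbb C$, or $\Bbbk=\mathbb C((q^{1/2}))$ with $q^{1/2}$ formal). Let $z$ be an indeterminate and $n\ge 1$. For $\mathbf m\in(\mathbb Z_{\ge0})^n$ put $|\mathbf m|=m_1+\dots+m_n$, let $\mathbf e_r$ be the $r$-th unit vector, $(x;b)_m=\prod_{k=1}^m(1-xb^{k-1})$, $(b)_m=(b;b)_m$, $(x;b)_\infty=\prod_{k\ge1}(1-xb^{k-1})$, $\binom mk_b=\frac{(b)_m}{(b)_k(b)_{m-k}}$ (zero unless $0\le k\le m$), $[m]_b=\frac{b^m-b^{-m}}{b-b^{-1}}$ and $[m]=[m]_q$. **The solutions $S^{s,t}(z)$.** The 3d $R$ is given by $$\mathscr R^{a,b,c}_{i,j,k}=\delta_{a+b,i+j}\,\delta_{b+c,j+k}\sum_{\lambda+\mu=b}(-1)^\lambda q^{i(c-j)+(k+1)\lambda+\mu(\mu-k)}\frac{(q^2)_{c+\mu}}{(q^2)_c}\binom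 i\mu_{q^2}\binom j\lambda_{q^2}.$$ For $s,t\in\{1,2\}$ and $\mathbf a,\mathbf b,\mathbf i,\mathbf j\in(\mathbb Z_{\ge0})^n$ define the power series in $z$ $$S^{s,t}(z)^{\mathbf a,\mathbf b}_{\mathbf i,\mathbf j}=\varrho^{s,t}(z)\sum_{c_0,\dots,c_n\ge0}\frac{z^{c_0}(q^2)_{sc_0}}{(q^{s^2})_{c_0}(q^{t^2})_{c_n}}\;\mathscr R^{a_1,b_1,d_0}_{i_1,j_1,d_1}\mathscr R^{a_2,b_2,d_1}_{i_2,j_2,d_2}\cdots\mathscr R^{a_n,b_n,d_{n-1}}_{i_n,j_n,d_n},$$ where $d_0=sc_0$, $d_n=tc_n$ and $d_r=c_r$ for $0<r<n$. Here $$\varrho^{1,1}(z)=\frac{(z;q)_\infty}{(-zq;q)_\infty},\qquad \varrho^{1,2}(z)=\frac{(z^2;q^2)_\infty}{(-z^2q;q^2)_\infty},$$ and for $(s,t)=(2,2)$ the factor $\varrho^{2,2}(z)$ is replaced by $\varrho^{\epsilon_1,\epsilon_2}(z)=\Bigl(\frac{(z;q^4)_\infty}{(zq^2;q^4)_\infty}\Bigr)^{\epsilon_1\epsilon_2}$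 with $\epsilon_1=(-1)^{|\mathbf i|}$, $\epsilon_2=(-1)^{|\mathbf j|}$. **The algebras.** For $\mathfrak g=D^{(2)}_{n+1},A^{(2)}_{2n},C^{(1)}_n$ let $(q_0,\dots,q_n)$ be $(q^{1/2},q,\dots,q,q^{1/2})$, $(q^{1/2},q,\dots,q,q^2)$, $(q^2,q,\dots,q,q^2)$ respectively; let $a_{rr}=2$, $a_{rr'}=-\max(\log q_{r'}/\log q_r,1)$ (the ratio of the exponents of $q$) if $|r-r'|=1$, and $a_{rr'}=0$ otherwise, except that for $n=1$ and $\mathfrak g=D^{(2)}_2$ or $C^{(1)}_1$ (regarded as $A^{(1)}_1$) $a_{01}=a_{10}=-2$. $U_q(\mathfrak g)$ is generated by $e_r,f_r,k_r^{\pm1}$ ($0\le r\le n$) with the relations: the $k_r$ are invertible and commute, $k_re_{r'}k_r^{-1}=q_r^{a_{rr'}}e_{r'}$, $k_rf_{r'}k_r^{-1}=q_r^{-a_{rr'}}f_{r'}$, $[e_r,f_{r'}]=\delta_{rr'}\frac{k_r-k_r^{-1}}{q_r-q_r^{-1}}$, and, for $r\ne r'$ and $g=e$ or $f$, $\sum_{\nu=0}^{1-a_{rr'}}(-1)^\nu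 g_r^{(1-a_{rr'}-\nu)}g_{r'}g_r^{(\nu)}=0$, where $g_r^{(\nu)}=g_r^\nu/([1]_{q_r}\cdots[\nu]_{q_r})$. Its coproduct is $\Delta k_r^{\pm1}=k_r^{\pm1}\otimes k_r^{\pm1}$, $\Delta e_r=1\otimes e_r+e_r\otimes k_r$, $\Delta f_r=f_r\otimes1+k_r^{-1}\otimes f_r$; $\Delta'$ is the opposite coproduct. **The $q$-oscillator representations.** Let $V$ be the $\Bbbk(z)$-vector space with basis $|\mathbf m\rangle$, $\mathbf m\in(\mathbb Z_{\ge0})^n$, let $\kappa=\frac{q+1}{q-1}$ and $x\in\Bbbk(z)^\times$. In $V_x=V$, for all three algebras and $1\le r\le n-1$, $$e_r|\mathbf m\rangle=[m_r]|\mathbf m-\mathbf e_r+\mathbf e_{r+1}\rangle,\quad f_r|\mathbf m\rangle=[m_{r+1}]|\mathbf m+\mathbf e_r-\mathbf e_{r+1}\rangle,\quad k_r|\mathbf m\rangle=q^{-m_r+m_{r+1}}|\mathbf m\rangle .$$ For $D^{(2)}_{n+1}$ and $A^{(2)}_{2n}$: $e_0|\mathbf m\rangle=x|\mathbf m+\mathbf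 e_1\rangle$, $f_0|\mathbf m\rangle=i\kappa[m_1]x^{-1}|\mathbf m-\mathbf e_1\rangle$, $k_0|\mathbf m\rangle=-iq^{m_1+1/2}|\mathbf m\rangle$. For $C^{(1)}_n$: $e_0|\mathbf m\rangle=x|\mathbf m+2\mathbf e_1\rangle$, $f_0|\mathbf m\rangle=\frac{[m_1][m_1-1]}{[2]^2}x^{-1}|\mathbf m-2\mathbf e_1\rangle$, $k_0|\mathbf m\rangle=-q^{2m_1+1}|\mathbf m\rangle$. For $D^{(2)}_{n+1}$: $e_n|\mathbf m\rangle=i\kappa[m_n]|\mathbf m-\mathbf e_n\rangle$, $f_n|\mathbf m\rangle=|\mathbf m+\mathbf e_n\rangle$, $k_n|\mathbf m\rangle=iq^{-m_n-1/2}|\mathbf m\rangle$. For $A^{(2)}_{2n}$ and $C^{(1)}_n$: $e_n|\mathbf m\rangle=\frac{[m_n][m_n-1]}{[2]^2}|\mathbf m-2\mathbf e_n\rangle$, $f_n|\mathbf m\rangle=|\mathbf m+2\mathbf e_n\rangle$, $k_n|\mathbf m\rangle=-q^{-2m_n-1}|\mathbf m\rangle$. **The quantum $R$ matrix.** A *quantum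 $R$ matrix* for $U_q(\mathfrak g)$ is an $R(z)\in\mathrm{End}_{\Bbbk(z)}(V\otimes V)$ such that, for all $x,y\in\Bbbk(z)^\times$ with $x/y=z$, the above formulas make $V_x$ and $V_y$ into $U_q(\mathfrak g)$-modules and $\Delta'(g)R(z)=R(z)\Delta(g)$ on $V_x\otimes V_y$ for $g=k_r^{\pm1},e_r,f_r$ ($0\le r\le n$), and which is normalized as follows. For $D^{(2)}_{n+1}$ and $A^{(2)}_{2n}$: $R(z)(|\mathbf 0\rangle\otimes|\mathbf 0\rangle)=|\mathbf 0\rangle\otimes|\mathbf 0\rangle$. For $C^{(1)}_n$: $R(z)$ is a direct sum of operators $R^{\epsilon_1,\epsilon_2}(z)\in\mathrm{End}(V^{\epsilon_1}\otimes V^{\epsilon_2})$, $\epsilon_1,\epsilon_2=\pm$, where $V^{\pm}$ is spanned by the $|\mathbf m\rangle$ with $(-1)^{|\mathbf m|}=\pm1$, and it multiplies $|\mathbf 0\rangle\otimes|\mathbf 0\rangle$, $|\mathbf 0\rangle\otimes|\mathbf e_1\rangle$, $|\mathbf e_1\rangle\otimes|\mathbf 0\rangle$, $|\mathbf e_1\rangle\otimes|\mathbf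 e_1\rangle$ by $1$, $\frac{-iq^{1/2}}{1-z}$, $\frac{-iq^{1/2}}{1-z}$, $\frac{z-q^2}{1-zq^2}$ respectively. With $K|\mathbf m\rangle=(-iq^{1/2})^{|\mathbf m|}|\mathbf m\rangle$ put $\tilde R(z)=(K^{-1}\otimes1)R(z)(1\otimes K)$. **Theorem.** For each of the three $\mathfrak g$ and each $n\ge1$ there is exactly one quantum $R$ matrix for $U_q(\mathfrak g)$. Let $\tilde R_{\mathfrak g}(z)$ be its gauge transform, with matrix elements in $\Bbbk(z)$ expanded at $z=0$ as Laurent series, so that $\tilde R_{\mathfrak g}(z)(|\mathbf i\rangle\otimes|\mathbf j\rangle)=\sum_{\mathbf a,\mathbf b}\tilde R_{\mathfrak g}(z)^{\mathbf a,\mathbf b}_{\mathbf i,\mathbf j}\,|\mathbf a\rangle\otimes|\mathbf b\rangle$. Then for all $\mathbf a,\mathbf b,\mathbf i,\mathbf j$ $$S^{1,1}(z)^{\mathbf a,\mathbf b}_{\mathbf i,\mathbf j}=\tilde R_{D^{(2)}_{n+1}}(z)^{\mathbf a,\mathbf b}_{\mathbf i,\mathbf j},\qquad S^{1,2}(z)^{\mathbf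 a,\mathbf b}_{\mathbf i,\mathbf j}=\tilde R_{A^{(2)}_{2n}}(z)^{\mathbf a,\mathbf b}_{\mathbf i,\mathbf j},\qquad S^{2,2}(z)^{\mathbf a,\mathbf b}_{\mathbf i,\mathbf j}=\tilde R_{C^{(1)}_n}(z)^{\mathbf a,\mathbf b}_{\mathbf i,\mathbf j}.$$ The last equality means $S^{\epsilon_1,\epsilon_2}(z)=\tilde R^{\epsilon_1,\epsilon_2}(z)$ on each $V^{\epsilon_1}\otimes V^{\epsilon_2}$, together with the vanishing of both sides between different parity sectors. -/

import Mathlib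

open Filter Topology TensorProduct

noncomputable section

namespace QOsc

/-! Throughout, the number of tensor factors is `n = N + 1 ≥ 1`; the factors are indexed by
`Fin (N + 1)` and the vertices `0, …, n` of the Dynkin diagram by `Fin (N + 2)`. -/

/-! ### The 3d R and the matrices built from it -/

section ThreeDR

variable {𝕜 : Type*} [Field 𝕜]

/-- `(b; b)_m = ∏_{k=1}^m (1 - b^k)`. -/
def qPoch (b : 𝕜) (m : ℕ) : 𝕜 := ∏ k ∈ Finset.range m, (1 - b ^ (k + 1))

/-- The binomial coefficient `(b)_m / ((b)_k (b)_{m-k})`, zero unless `0 ≤ k ≤ m`. -/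
def qBinom (b : 𝕜) (m k : ℕ) : 𝕜 :=
  if k ≤ m then qPoch b m / (qPoch b k * qPoch b (m - k)) else 0

/-- Matrix element `R^{a,b,c}_{i,j,k}` of the 3d R, the intertwiner of `A_q(sl_3)`. The sum is over
`λ + μ = b` with `lm = (λ, μ)`. -/
def threeDR (q : 𝕜) (a b c i j k : ℕ) : 𝕜 :=
  if a + b = i + j ∧ b + c = j + k then
    ∑ lm ∈ Finset.HasAntidiagonal.antidiagonal b,
      (-1) ^ lm.1
        * q ^ ((i : ℤ) * ((c : ℤ) - j) + ((k : ℤ) + 1) * lm.1 + (lm.2 : ℤ) * ((lm.2 : ℤ) - k))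
        * (qPoch (q ^ 2) (c + lm.2) / qPoch (q ^ 2) c)
        * qBinom (q ^ 2) i lm.2 * qBinom (q ^ 2) j lm.1
  else 0

/-- The matrix element of `⟨χ_s(z)| R_{α₁,β₁,3} ⋯ R_{αₙ,βₙ,3} |χ_t(1)⟩` from
`|i⟩ ⊗ |j⟩` to `|a⟩ ⊗ |b⟩`, without normalization, as a formal power series in `z`.
The coefficient of `z ^ c₀` is the sum over the remaining `c = (c₁, …, cₙ)`, in which at most one
term is nonzero. -/
def bareS (q : 𝕜) {N : ℕ} (s t : ℕ) (a b i j : Fin (N + 1) → ℕ) : PowerSeries 𝕜 :=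
  PowerSeries.mk fun c₀ => ∑ᶠ c : Fin (N + 1) → ℕ,
    qPoch (q ^ 2) (s * c₀) / (qPoch (q ^ (s ^ 2)) c₀ * qPoch (q ^ (t ^ 2)) (c (Fin.last N)))
      * ∏ r : Fin (N + 1),
          threeDR q (a r) (b r)
            ((Fin.cons (s * c₀) (fun r' : Fin N => c r'.castSucc) : Fin (N + 1) → ℕ) r)
            (i r) (j r)
            ((Fin.snoc (fun r' : Fin N => c r'.castSucc) (t * c (Fin.last N)) :
              Fin (N + 1) → ℕ) r)

/-- The sign `(-1)^{|m|}`, `|m| = m₁ + ⋯ + mₙ`. -/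
def parity {n : ℕ} (m : Fin n → ℕ) : ℤˣ := (-1) ^ (∑ r, m r)

end ThreeDR

section Normalization

variable {𝕜 : Type*} [NormedField 𝕜]

/-- `(α z^d; b)_∞ = ∏_{k ≥ 0} (1 - α b^k z^d)` as a formal power series in `z`: the
coefficientwise limit of the finite products. -/
def qPochInf (α : 𝕜) (d : ℕ) (b : 𝕜) : PowerSeries 𝕜 :=
  PowerSeries.mk fun m => limUnder atTop fun M : ℕ =>
    PowerSeries.coeff m
      (∏ k ∈ Finset.range M, (1 - PowerSeries.C (α * b ^ k) * PowerSeries.X ^ d))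

/-- `S^{1,1}(z)`, normalized by `(z; q)_∞ / (-zq; q)_∞`. -/
def S11 (q : 𝕜) {N : ℕ} (a b i j : Fin (N + 1) → ℕ) : PowerSeries 𝕜 :=
  qPochInf 1 1 q * (qPochInf (-q) 1 q)⁻¹ * bareS q 1 1 a b i j

/-- `S^{1,2}(z)`, normalized by `(z²; q²)_∞ / (-z²q; q²)_∞`. -/
def S12 (q : 𝕜) {N : ℕ} (a b i j : Fin (N + 1) → ℕ) : PowerSeries 𝕜 :=
  qPochInf 1 2 (q ^ 2) * (qPochInf (-q) 2 (q ^ 2))⁻¹ * bareS q 1 2 a b i j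

/-- `((z; q⁴)_∞ / (zq²; q⁴)_∞)^{ε₁ε₂}`. -/
def rho22 (q : 𝕜) (ε₁ ε₂ : ℤˣ) : PowerSeries 𝕜 :=
  if ε₁ * ε₂ = 1 then qPochInf 1 1 (q ^ 4) * (qPochInf (q ^ 2) 1 (q ^ 4))⁻¹
  else qPochInf (q ^ 2) 1 (q ^ 4) * (qPochInf 1 1 (q ^ 4))⁻¹

/-- `S^{2,2}(z)`, the sum of the `S^{ε₁,ε₂}(z)`: on `|i⟩ ⊗ |j⟩` of parities `ε₁, ε₂` it is
normalized by the factor with these signs. -/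
def S22 (q : 𝕜) {N : ℕ} (a b i j : Fin (N + 1) → ℕ) : PowerSeries 𝕜 :=
  rho22 q (parity i) (parity j) * bareS q 2 2 a b i j

end Normalization

/-! ### Representations of quantum affine algebras -/

section Representations

variable {E : Type*} [Field E]

/-- `[m]_b = (b^m - b^{-m}) / (b - b^{-1})`. -/
def qInt (b : E) (m : ℤ) : E := (b ^ m - b ^ (-m)) / (b - b⁻¹)

/-- `[m]_b! = [1]_b ⋯ [m]_b`. -/
def qFact (b : E) (m : ℕ) : E := ∏ k ∈ Finset.range m, qInt b ((k : ℤ) + 1)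

/-- A function on the vertices `0, …, n` from its values at `0`, at `1, …, n - 1` and at `n`. -/
def onVertices {N : ℕ} {α : Type*} (first : α) (mid : Fin N → α) (last : α) : Fin (N + 2) → α :=
  Fin.cons first (Fin.snoc mid last : Fin (N + 1) → α)

/-- The affine types `D^{(2)}_{n+1}`, `A^{(2)}_{2n}` and `C^{(1)}_n`. -/
inductive AffineType
  | D2
  | A2
  | C1

/-- The exponents `d_i` in `q_i = p^{d_i}`, where `p = q^{1/2}`. -/
def nodeExp (N : ℕ) : AffineType → Fin (N + 2) → ℕ
  | .D2 => onVertices 1 (fun _ => 2) 1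
  | .A2 => onVertices 1 (fun _ => 2) 4
  | .C1 => onVertices 4 (fun _ => 2) 4

/-- The Cartan matrix: `a_ii = 2`, `a_ij = -max(log q_j / log q_i, 1)` for adjacent vertices, and
`a_ij = 0` otherwise. For `n = 1` both `D^{(2)}_2` and `C^{(1)}_1` stand for `A^{(1)}_1`, whose
off-diagonal entries are `-2`. -/
def cartan (N : ℕ) (g : AffineType) (i j : Fin (N + 2)) : ℤ :=
  if i = j then 2
  else if N = 0 ∧ nodeExp N g i = nodeExp N g j then -2
  else if (i : ℕ) + 1 = j ∨ (j : ℕ) + 1 = i then -(max (nodeExp N g j / nodeExp N g i) 1 : ℕ)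
  else 0

/-- Operators for the generators `e_i, f_i, k_i, k_i^{-1}` (`0 ≤ i ≤ n`). -/
structure Generators (E V : Type*) [Field E] [AddCommGroup V] [Module E V] (N : ℕ) where
  e : Fin (N + 2) → Module.End E V
  f : Fin (N + 2) → Module.End E V
  k : Fin (N + 2) → Module.End E V
  kinv : Fin (N + 2) → Module.End E V

/-- The left-hand side of the Serre relation for `u = e_i`, `v = e_j` (or `f_i`, `f_j`), with
`b = q_i` and `c = a_ij`, in the divided powers `u^{(ν)} = u^ν / [ν]_b!`. -/
def serre {V : Type*} [AddCommGroup V] [Module E V] (b : E) (c : ℤ) (u v : Module.End E V) :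
    Module.End E V :=
  ∑ ν ∈ Finset.range ((1 - c).toNat + 1),
    ((-1) ^ ν * (qFact b ((1 - c).toNat - ν))⁻¹ * (qFact b ν)⁻¹) •
      (u ^ ((1 - c).toNat - ν) * v * u ^ ν)

/-- The operators satisfy the defining relations of the Drinfeld-Jimbo algebra `U_q(g)`, i.e. they
make `V` a `U_q(g)`-module. -/
structure IsUqModule {V : Type*} [AddCommGroup V] [Module E V] {N : ℕ} (p : E) (g : AffineType)
    (G : Generators E V N) : Prop where
  k_kinv : ∀ i, G.k i * G.kinv i = 1
  kinv_k : ∀ i, G.kinv i * G.k i = 1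
  k_k : ∀ i j, G.k i * G.k j = G.k j * G.k i
  k_e : ∀ i j, G.k i * G.e j * G.kinv i = ((p ^ nodeExp N g i) ^ cartan N g i j) • G.e j
  k_f : ∀ i j, G.k i * G.f j * G.kinv i = ((p ^ nodeExp N g i) ^ (-cartan N g i j)) • G.f j
  e_f : ∀ i j, G.e i * G.f j - G.f j * G.e i =
    if i = j then (p ^ nodeExp N g i - (p ^ nodeExp N g i)⁻¹)⁻¹ • (G.k i - G.kinv i) else 0
  serre_e : ∀ i j, i ≠ j → serre (p ^ nodeExp N g i) (cartan N g i j) (G.e i) (G.e j) = 0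
  serre_f : ∀ i j, i ≠ j → serre (p ^ nodeExp N g i) (cartan N g i j) (G.f i) (G.f j) = 0

/-- The `n`-fold tensor power of the Fock space, through its basis `|m⟩`, `m ∈ (ℤ_{≥0})^n`. -/
abbrev Fock (E : Type*) [Field E] (n : ℕ) : Type _ := (Fin n → ℕ) →₀ E

/-- The basis vector `|m⟩`. -/
def ket (E : Type*) [Field E] {n : ℕ} (m : Fin n → ℕ) : Fock E n := Finsupp.single m 1

/-- The operator `|m⟩ ↦ c(m) |φ(m)⟩`. -/
def ketOp {n : ℕ} (c : (Fin n → ℕ) → E) (φ : (Fin n → ℕ) → (Fin n → ℕ)) :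
    Module.End E (Fock E n) :=
  Finsupp.linearCombination E fun m => c m • ket E (φ m)

/-- `ε_r`, the multi-index with a single entry `1` at place `r`. -/
def unitVec {n : ℕ} (r : Fin n) : Fin n → ℕ := Pi.single r 1

/-- The `q`-oscillator representation with parameter `x`, where `q = p²`, `p = q^{1/2}` and
`im = √-1`. Subtraction of multi-indices truncates, but wherever it would the coefficient
vanishes. -/
def qOscillator (p im x : E) (N : ℕ) : AffineType → Generators E (Fock E (N + 1)) N
  | .D2 =>
    { e := onVertices
        (ketOp (fun _ => x) fun m => m + unitVec 0)
        (fun j => ketOp (fun m => qInt (p ^ 2) (m j.castSucc))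
          fun m => m - unitVec j.castSucc + unitVec j.succ)
        (ketOp (fun m => im * ((p ^ 2 + 1) / (p ^ 2 - 1)) * qInt (p ^ 2) (m (Fin.last N)))
          fun m => m - unitVec (Fin.last N))
      f := onVertices
        (ketOp (fun m => im * ((p ^ 2 + 1) / (p ^ 2 - 1)) * qInt (p ^ 2) (m 0) * x⁻¹)
          fun m => m - unitVec 0)
        (fun j => ketOp (fun m => qInt (p ^ 2) (m j.succ))
          fun m => m + unitVec j.castSucc - unitVec j.succ)
        (ketOp (fun _ => 1) fun m => m + unitVec (Fin.last N))
      k := onVertices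
        (ketOp (fun m => -im * (p ^ 2) ^ m 0 * p) id)
        (fun j => ketOp (fun m => (p ^ 2) ^ (-(m j.castSucc : ℤ) + m j.succ)) id)
        (ketOp (fun m => im * (p ^ 2) ^ (-(m (Fin.last N) : ℤ)) * p⁻¹) id)
      kinv := onVertices
        (ketOp (fun m => (-im * (p ^ 2) ^ m 0 * p)⁻¹) id)
        (fun j => ketOp (fun m => ((p ^ 2) ^ (-(m j.castSucc : ℤ) + m j.succ))⁻¹) id)
        (ketOp (fun m => (im * (p ^ 2) ^ (-(m (Fin.last N) : ℤ)) * p⁻¹)⁻¹) id) }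
  | .A2 =>
    { e := onVertices
        (ketOp (fun _ => x) fun m => m + unitVec 0)
        (fun j => ketOp (fun m => qInt (p ^ 2) (m j.castSucc))
          fun m => m - unitVec j.castSucc + unitVec j.succ)
        (ketOp (fun m => qInt (p ^ 2) (m (Fin.last N)) * qInt (p ^ 2) ((m (Fin.last N) : ℤ) - 1)
            / qInt (p ^ 2) 2 ^ 2)
          fun m => m - 2 • unitVec (Fin.last N))
      f := onVertices
        (ketOp (fun m => im * ((p ^ 2 + 1) / (p ^ 2 - 1)) * qInt (p ^ 2) (m 0) * x⁻¹)
          fun m => m - unitVec 0)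
        (fun j => ketOp (fun m => qInt (p ^ 2) (m j.succ))
          fun m => m + unitVec j.castSucc - unitVec j.succ)
        (ketOp (fun _ => 1) fun m => m + 2 • unitVec (Fin.last N))
      k := onVertices
        (ketOp (fun m => -im * (p ^ 2) ^ m 0 * p) id)
        (fun j => ketOp (fun m => (p ^ 2) ^ (-(m j.castSucc : ℤ) + m j.succ)) id)
        (ketOp (fun m => -(p ^ 2) ^ (-2 * (m (Fin.last N) : ℤ) - 1)) id)
      kinv := onVertices
        (ketOp (fun m => (-im * (p ^ 2) ^ m 0 * p)⁻¹) id)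
        (fun j => ketOp (fun m => ((p ^ 2) ^ (-(m j.castSucc : ℤ) + m j.succ))⁻¹) id)
        (ketOp (fun m => (-(p ^ 2) ^ (-2 * (m (Fin.last N) : ℤ) - 1))⁻¹) id) }
  | .C1 =>
    { e := onVertices
        (ketOp (fun _ => x) fun m => m + 2 • unitVec 0)
        (fun j => ketOp (fun m => qInt (p ^ 2) (m j.castSucc))
          fun m => m - unitVec j.castSucc + unitVec j.succ)
        (ketOp (fun m => qInt (p ^ 2) (m (Fin.last N)) * qInt (p ^ 2) ((m (Fin.last N) : ℤ) - 1)
            / qInt (p ^ 2) 2 ^ 2)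
          fun m => m - 2 • unitVec (Fin.last N))
      f := onVertices
        (ketOp (fun m => qInt (p ^ 2) (m 0) * qInt (p ^ 2) ((m 0 : ℤ) - 1)
            / qInt (p ^ 2) 2 ^ 2 * x⁻¹)
          fun m => m - 2 • unitVec 0)
        (fun j => ketOp (fun m => qInt (p ^ 2) (m j.succ))
          fun m => m + unitVec j.castSucc - unitVec j.succ)
        (ketOp (fun _ => 1) fun m => m + 2 • unitVec (Fin.last N))
      k := onVertices
        (ketOp (fun m => -(p ^ 2) ^ (2 * m 0 + 1)) id)
        (fun j => ketOp (fun m => (p ^ 2) ^ (-(m j.castSucc : ℤ) + m j.succ)) id)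
        (ketOp (fun m => -(p ^ 2) ^ (-2 * (m (Fin.last N) : ℤ) - 1)) id)
      kinv := onVertices
        (ketOp (fun m => (-(p ^ 2) ^ (2 * m 0 + 1))⁻¹) id)
        (fun j => ketOp (fun m => ((p ^ 2) ^ (-(m j.castSucc : ℤ) + m j.succ))⁻¹) id)
        (ketOp (fun m => (-(p ^ 2) ^ (-2 * (m (Fin.last N) : ℤ) - 1))⁻¹) id) }

/-! ### Quantum R matrices -/

/-- `A ⊗ B` acting on `V ⊗ W`. -/
local infixl:70 " ⊠ " => TensorProduct.map

/-- `Δ'(g) R = R Δ(g)` on `V ⊗ W` for the generators `g` of `U_q`, with the coproduct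
`Δ k = k ⊗ k`, `Δ e = 1 ⊗ e + e ⊗ k`, `Δ f = f ⊗ 1 + k⁻¹ ⊗ f` and the opposite coproduct `Δ'`. -/
structure Intertwines {V W : Type*} [AddCommGroup V] [Module E V] [AddCommGroup W] [Module E W]
    {N : ℕ} (G : Generators E V N) (H : Generators E W N) (R : Module.End E (V ⊗[E] W)) :
    Prop where
  k : ∀ r, (G.k r ⊠ H.k r) * R = R * (G.k r ⊠ H.k r)
  kinv : ∀ r, (G.kinv r ⊠ H.kinv r) * R = R * (G.kinv r ⊠ H.kinv r)
  e : ∀ r, ((G.e r ⊠ 1) + (G.k r ⊠ H.e r)) * R = R * ((1 ⊠ H.e r) + (G.e r ⊠ H.k r))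
  f : ∀ r, ((1 ⊠ H.f r) + (G.f r ⊠ H.kinv r)) * R = R * ((G.f r ⊠ 1) + (G.kinv r ⊠ H.f r))

/-- The span of the `|a⟩ ⊗ |b⟩` with `a` of parity `ε₁` and `b` of parity `ε₂`. -/
def sector (E : Type*) [Field E] (n : ℕ) (ε₁ ε₂ : ℤˣ) : Submodule E (Fock E n ⊗[E] Fock E n) :=
  Submodule.span E
    {v | ∃ a b : Fin n → ℕ, parity a = ε₁ ∧ parity b = ε₂ ∧ v = ket E a ⊗ₜ ket E b}

/-- The normalization of the quantum R matrix. For `C^{(1)}_n` the R matrix is moreover the direct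
sum of operators on the four parity sectors, each with its own normalization. -/
def IsNormalized (p im z : E) (N : ℕ) (R : Module.End E (Fock E (N + 1) ⊗[E] Fock E (N + 1))) :
    AffineType → Prop
  | .D2 | .A2 => R (ket E 0 ⊗ₜ ket E 0) = ket E 0 ⊗ₜ ket E 0
  | .C1 =>
    (∀ ε₁ ε₂ : ℤˣ, ∀ v ∈ sector E (N + 1) ε₁ ε₂, R v ∈ sector E (N + 1) ε₁ ε₂) ∧
    R (ket E 0 ⊗ₜ ket E 0) = ket E 0 ⊗ₜ ket E 0 ∧
    R (ket E 0 ⊗ₜ ket E (unitVec 0)) =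
      (-im * p / (1 - z)) • (ket E 0 ⊗ₜ ket E (unitVec 0)) ∧
    R (ket E (unitVec 0) ⊗ₜ ket E 0) =
      (-im * p / (1 - z)) • (ket E (unitVec 0) ⊗ₜ ket E 0) ∧
    R (ket E (unitVec 0) ⊗ₜ ket E (unitVec 0)) =
      ((z - p ^ 4) / (1 - z * p ^ 4)) • (ket E (unitVec 0) ⊗ₜ ket E (unitVec 0))

/-- `R` is the quantum R matrix `R(z)` for the `q`-oscillator representations of `U_q(g)`: for all
nonzero `x, y` with `x / y = z`, the `q`-oscillator representations `V_x, V_y` are `U_q(g)`-modules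
and `R` intertwines `Δ` and `Δ'` on `V_x ⊗ V_y`; and `R` is normalized. -/
structure IsQuantumR (p im z : E) (N : ℕ) (g : AffineType)
    (R : Module.End E (Fock E (N + 1) ⊗[E] Fock E (N + 1))) : Prop where
  isUqModule : ∀ x : E, x ≠ 0 → IsUqModule p g (qOscillator p im x N g)
  intertwines : ∀ x y : E, x ≠ 0 → y ≠ 0 → x / y = z →
    Intertwines (qOscillator p im x N g) (qOscillator p im y N g) R
  normalized : IsNormalized p im z N R g

/-- The operator `|m⟩ ↦ γ^{m₁ + ⋯ + mₙ} |m⟩`. -/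
def gaugeK (γ : E) (n : ℕ) : Module.End E (Fock E n) := ketOp (fun m => γ ^ ∑ r, m r) id

/-- `(K⁻¹ ⊗ 1) R (1 ⊗ K)` with `K |m⟩ = (-i q^{1/2})^{|m|} |m⟩`. -/
def gaugeTransform (p im : E) {n : ℕ} (R : Module.End E (Fock E n ⊗[E] Fock E n)) :
    Module.End E (Fock E n ⊗[E] Fock E n) :=
  (gaugeK (-im * p)⁻¹ n ⊠ 1) * R * (1 ⊠ gaugeK (-im * p) n)

/-- The coefficient of `|a⟩ ⊗ |b⟩` in `R (|i⟩ ⊗ |j⟩)`. -/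
def entry {n : ℕ} (R : Module.End E (Fock E n ⊗[E] Fock E n)) (a b i j : Fin n → ℕ) : E :=
  finsuppTensorFinsupp' E (Fin n → ℕ) (Fin n → ℕ) (R (ket E i ⊗ₜ ket E j)) (a, b)

end Representations

end QOsc

end

noncomputable section

/-! Fix the indices of the 3d R in its first two tensor factors. It becomes a family of operators
M^{a,b}_{i,j} on the third factor, where the q-oscillators A, B, K act. The closed formula for the
matrix elements yields two recursions, which raise i and j by multiplication from the left
(`tdr_raise_i`, `tdr_raise_j`). These recursions and the vacuum value determine M, and every other
intertwining relation (raising or lowering input or output indices by multiplication from the left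
or from the right) follows from them by induction; this is the theory of `IsSite`.

The series S is an ordered product of n such operators between two boundary vectors. Between
neighbouring sites the oscillators multiplying one factor from the right are the ones multiplying
the next from the left, and they cancel (`IsSite.mid_right`, `IsSite.mid_left`). At the two ends the
boundary vectors obey linear relations that eliminate A and B. Thus there are two relations for each
vertex of the Dynkin diagram. Since the gauge parameter γ = -i q^{1/2} has γ² = -q, they become,
after the gauge transformation, exactly the matrix elements of Δ'(g) R = R Δ(g) for g = e_r, f_r
(`gaugedSol_e`, `gaugedSol_f`); the relations for k_r express weight conservation. On the vacua S is
diagonal, and its values are q-binomial series, which are summed by comparing functional equations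
under z → uz (`qBinomial_thm`).

It remains to pass from power series to operators over 𝕜(z) and to prove uniqueness. Both rest on
one fact: V_z ⊗ V_1 is generated by the vacua (`generatedByVacua`). Two intertwiners that agree on
the vacua agree everywhere. The vectors whose image under S has rational, finitely supported
coefficients form a submodule that contains the vacua and is stable under all e_r and f_r, hence it
is everything.

Generation is proved by degenerating at z = 0. There Δ(e_0) acts on the second factor only and
zΔ(f_0) on the first factor only, so every basis vector is reached modulo z by elementary moves. In
each total degree the lattice over 𝕜[z] is finitely generated, and Nakayama's lemma removes the
error terms.

The defining relations of U_q are checked after extending vectors by zero to ℤ^n. There the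
generators are weighted shifts by simple roots, and each relation is a scalar identity between
q-integers (`serreId_e`, `serreId_f`, `eCoef_fCoef_self`). -/

namespace QOsc

/-! ### Intertwining relations of one site over the q-oscillator algebra -/

/-- The `q`-oscillator relations for a raising operator `A`, a lowering operator `B` and `K`. -/
structure IsOsc {𝕜 𝒜 : Type*} [Field 𝕜] [Ring 𝒜] [Algebra 𝕜 𝒜] (q : 𝕜) (A B K : 𝒜) : Prop where
  K_A : K * A = q • (A * K)
  K_B : K * B = q⁻¹ • (B * K)
  B_A : B * A = 1 - q ^ 2 • (K * K)
  A_B : A * B = 1 - K * K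

namespace IsOsc

variable {𝕜 𝒜 : Type*} [Field 𝕜] [Ring 𝒜] [Algebra 𝕜 𝒜] {q : 𝕜} {A B K : 𝒜}

theorem K_A_assoc (h : IsOsc q A B K) (x : 𝒜) : K * (A * x) = q • (A * (K * x)) := by
  rw [← mul_assoc, h.K_A, smul_mul_assoc, mul_assoc]

theorem K_B_assoc (h : IsOsc q A B K) (x : 𝒜) : K * (B * x) = q⁻¹ • (B * (K * x)) := by
  rw [← mul_assoc, h.K_B, smul_mul_assoc, mul_assoc]

theorem B_A_assoc (h : IsOsc q A B K) (x : 𝒜) : B * (A * x) = x - q ^ 2 • (K * (K * x)) := by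
  rw [← mul_assoc, h.B_A, sub_mul, one_mul, smul_mul_assoc, mul_assoc]

theorem A_B_assoc (h : IsOsc q A B K) (x : 𝒜) : A * (B * x) = x - K * (K * x) := by
  rw [← mul_assoc, h.A_B, sub_mul, one_mul, mul_assoc]

end IsOsc

/-- The matrix elements, with respect to the first two tensor factors, of the intertwiner of
`A_q(sl_3)`, as operators on the third one: the recursions that raise `i` and `j`. -/
structure IsSite {𝕜 𝒜 : Type*} [Field 𝕜] [Ring 𝒜] [Algebra 𝕜 𝒜] (q : 𝕜) (A B K : 𝒜)
    (M : ℤ → ℤ → ℕ → ℕ → 𝒜) : Prop where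
  osc : IsOsc q A B K
  ne_zero : q ≠ 0
  vac : ∀ a b, M a b 0 0 = if a = 0 ∧ b = 0 then 1 else 0
  -- The output indices are integers, so that `a - 1` and `b - 1` never truncate. Together with
  -- `vac` the two recursions determine `M`.
  raise_j : ∀ a b i j,
    M a b i (j + 1) = A * M (a - 1) b i j - (q * q ^ a) • (K * M a (b - 1) i j)
  raise_i : ∀ a b i j,
    q ^ j • M a b (i + 1) j = K * M (a - 1) b i j + q ^ a • (B * M a (b - 1) i j)

namespace IsSite

variable {𝕜 𝒜 : Type*} [Field 𝕜] [Ring 𝒜] [Algebra 𝕜 𝒜] {q : 𝕜} {A B K : 𝒜}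
  {M : ℤ → ℤ → ℕ → ℕ → 𝒜}

theorem raise_i_zero (h : IsSite q A B K M) (a b : ℤ) (i : ℕ) :
    M a b (i + 1) 0 = K * M (a - 1) b i 0 + q ^ a • (B * M a (b - 1) i 0) := by
  simpa using h.raise_i a b i 0

theorem one_zero (h : IsSite q A B K M) (a b : ℤ) :
    M a b 1 0 = if a = 1 ∧ b = 0 then K else if a = 0 ∧ b = 1 then B else 0 := by
  rw [← zero_add 1, h.raise_i_zero, h.vac, h.vac]
  split_ifs <;> first | omega | simp_all

theorem zero_one (h : IsSite q A B K M) (a b : ℤ) :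
    M a b 0 1 = if a = 1 ∧ b = 0 then A else if a = 0 ∧ b = 1 then -(q • K) else 0 := by
  rw [← zero_add 1, h.raise_j, h.vac, h.vac]
  split_ifs <;> first | omega | simp_all

/-- Base case of the lowering relations: the only nonzero matrix element has a = -1, and there q * q
^ a = 1 makes the coefficient vanish. -/
theorem vac_lower_a (h : IsSite q A B K M) (a b : ℤ) :
    (1 - (q * q ^ a) ^ 2) • M (a + 1) b 0 0 = 0 := by
  rw [h.vac]
  split_ifs with h1
  · obtain rfl : a = -1 := by omega
    simp [h.ne_zero]
  · simp

theorem vac_lower_b (h : IsSite q A B K M) (a b : ℤ) :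
    (1 - (q * q ^ b) ^ 2) • M a (b + 1) 0 0 = 0 := by
  rw [h.vac]
  split_ifs with h1
  · obtain rfl : b = -1 := by omega
    simp [h.ne_zero]
  · simp

/-- The factor 1 - q^{2j} makes the recursion valid at j = 0 as well, where `j - 1` truncates. -/
theorem smul_raise_j (h : IsSite q A B K M) (a b : ℤ) (i j : ℕ) :
    (1 - (q ^ j) ^ 2) • M a b i j = (1 - (q ^ j) ^ 2) •
      (A * M (a - 1) b i (j - 1) - (q * q ^ a) • (K * M a (b - 1) i (j - 1))) := by
  cases j with
  | zero => simp
  | succ j => rw [h.raise_j, Nat.add_sub_cancel]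

theorem smul_raise_i_zero (h : IsSite q A B K M) (a b : ℤ) (i : ℕ) :
    (1 - (q ^ i) ^ 2) • M a b i 0 = (1 - (q ^ i) ^ 2) •
      (K * M (a - 1) b (i - 1) 0 + q ^ a • (B * M a (b - 1) (i - 1) 0)) := by
  cases i with
  | zero => simp
  | succ i => rw [h.raise_i_zero, Nat.add_sub_cancel]

/-- The matrix elements conserve `a + b`. -/
theorem weight (h : IsSite q A B K M) (i j : ℕ) :
    ∀ a b : ℤ, a + b ≠ i + j → M a b i j = 0 := by
  induction j with
  | succ j ih =>
    intro a b hab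
    push_cast at hab
    rw [h.raise_j, ih _ _ (by omega), ih _ _ (by omega)]
    simp
  | zero =>
    induction i with
    | succ i ih =>
      intro a b hab
      push_cast at hab
      rw [h.raise_i_zero, ih _ _ (by push_cast; omega), ih _ _ (by push_cast; omega)]
      simp
    | zero =>
      intro a b hab
      rw [h.vac, if_neg]
      rintro ⟨rfl, rfl⟩
      simp at hab

/-- Conservation of a + b in a form that can be added to a linear combination without splitting into
cases. -/
theorem weight_smul (h : IsSite q A B K M) (a b : ℤ) (i j : ℕ) :
    (q ^ a * q ^ b) • M a b i j = (q ^ i * q ^ j) • M a b i j := by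
  by_cases hab : a + b = i + j
  · rw [← zpow_add₀ h.ne_zero, hab, zpow_add₀ h.ne_zero, zpow_natCast, zpow_natCast]
  · rw [h.weight i j a b hab, smul_zero, smul_zero]

/-- Model for all inductions of this part: first on j, then on i at j = 0. The recursion writes M as
a combination of two earlier elements. The induction hypotheses for `(a - 1, b)` and `(a, b - 1)`,
multiplied from the left by the oscillators of the recursion, are combined in the same way, and the
oscillator relations account for the reordering. -/
theorem K_comm (h : IsSite q A B K M) (i j : ℕ) :
    ∀ a b, q ^ b • (K * M a b i j) = q ^ j • (M a b i j * K) := by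
  have hq := h.ne_zero
  have ho := h.osc
  induction j with
  | succ j ih =>
    intro a b
    have h1 := congrArg (A * ·) (ih (a - 1) b)
    have h2 := congrArg (K * ·) (ih a (b - 1))
    simp only [h.raise_j, ho.K_A_assoc, zpow_sub₀ hq, zpow_one, mul_sub, sub_mul, smul_mul_assoc,
      mul_smul_comm, mul_assoc] at h1 h2 ⊢
    linear_combination (norm := skip) q • h1 - (q ^ 2 * q ^ a) • h2
    match_scalars <;> field_simp <;> ring
  | zero =>
    induction i with
    | succ i ih =>
      intro a b
      have h1 := congrArg (K * ·) (ih (a - 1) b)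
      have h2 := congrArg (B * ·) (ih a (b - 1))
      simp only [h.raise_i_zero, ho.K_B_assoc, zpow_sub₀ hq, zpow_one, mul_add, add_mul,
        smul_mul_assoc, mul_smul_comm, mul_assoc] at h1 h2 ⊢
      linear_combination (norm := skip) h1 + q ^ a • h2
      match_scalars <;> field_simp <;> ring
    | zero =>
      intro a b
      rw [h.vac]
      split_ifs with hab
      · simp [hab.2]
      · simp

/-- The defining recursions multiply M from the left. This relation and the next are their
counterparts with multiplication from the right, needed because in a product of sites the right side
of M faces the next site. -/
theorem left_raise_b (h : IsSite q A B K M) (i j : ℕ) : ∀ a b,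
    M a (b - 1) i j = M a b (i + 1) j * A - (q * q ^ i) • (M a b i (j + 1) * K) := by
  have hq := h.ne_zero
  have ho := h.osc
  induction j with
  | succ j ih =>
    intro a b
    have h1 := congrArg (A * ·) (ih (a - 1) b)
    have h2 := congrArg (K * ·) (ih a (b - 1))
    simp only [mul_sub, mul_smul_comm] at h1 h2
    rw [h.raise_j a (b - 1) i j, h.raise_j a b (i + 1) j, h.raise_j a b i (j + 1)]
    simp only [sub_mul, smul_mul_assoc, mul_assoc]
    linear_combination (norm := skip) h1 - (q * q ^ a) • h2
    match_scalars <;> field_simp <;> ring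
  | zero =>
    induction i with
    | succ i ih =>
      intro a b
      have h1 := congrArg (K * ·) (ih (a - 1) b)
      have h2 := congrArg (B * ·) (ih a (b - 1))
      have h3 := h.raise_i_zero a (b - 1) i
      have h4 := congrArg (· * A) (h.raise_i_zero a b (i + 1))
      -- The right-hand side contains an element with second input index 1, so `raise_i` is also
      -- needed at j = 1.
      have h5 := congrArg (· * K) (h.raise_i a b i 1)
      simp only [zero_add, pow_one, mul_sub, add_mul, smul_mul_assoc, mul_smul_comm,
        mul_assoc] at h1 h2 h3 h4 h5 ⊢
      linear_combination (norm := skip) h1 + q ^ a • h2 + h3 - h4 + (q * q ^ i) • h5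
      match_scalars <;> field_simp <;> ring
    | zero =>
      intro a b
      rw [h.vac, zero_add, h.one_zero, h.zero_one]
      split_ifs <;> first | omega | simp [ho.K_A, ho.B_A, smul_smul, pow_two]

theorem left_raise_a (h : IsSite q A B K M) (i j : ℕ) : ∀ a b,
    q ^ b • M (a - 1) b i j = M a b (i + 1) j * K + q ^ i • (M a b i (j + 1) * B) := by
  have hq := h.ne_zero
  have ho := h.osc
  induction j with
  | succ j ih =>
    intro a b
    have h1 := congrArg (A * ·) (ih (a - 1) b)
    have h2 := congrArg (K * ·) (ih a (b - 1))
    rw [h.raise_j (a - 1) b i j, h.raise_j a b (i + 1) j, h.raise_j a b i (j + 1)]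
    simp only [mul_add, mul_smul_comm, zpow_sub₀ hq, zpow_one, sub_mul, smul_mul_assoc,
      mul_assoc] at h1 h2 ⊢
    linear_combination (norm := skip) h1 - (q * q ^ a) • h2
    match_scalars <;> field_simp <;> ring
  | zero =>
    induction i with
    | succ i ih =>
      intro a b
      have h1 := congrArg (K * ·) (ih (a - 1) b)
      have h2 := congrArg (B * ·) (ih a (b - 1))
      have h3 := h.raise_i_zero (a - 1) b i
      have h4 := congrArg (· * K) (h.raise_i_zero a b (i + 1))
      have h5 := congrArg (· * B) (h.raise_i a b i 1)
      simp only [zero_add, pow_one, mul_add, add_mul, smul_mul_assoc, zpow_sub₀ hq, zpow_one,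
        mul_smul_comm, mul_assoc] at h1 h2 h3 h4 h5 ⊢
      linear_combination (norm := skip) h1 + q ^ a • h2 + q ^ b • h3 - h4 - q ^ i • h5
      match_scalars <;> field_simp <;> ring
    | zero =>
      intro a b
      rw [h.vac, zero_add, h.one_zero, h.zero_one]
      split_ifs with h1 h2 h3 h4 <;> first | omega | skip
      · obtain ⟨rfl, rfl⟩ := h2
        simp [ho.A_B]
      · simp [ho.K_B, smul_smul, hq]
      · simp

/-- Right multiplication by the raising operator. -/
theorem mul_A (h : IsSite q A B K M) (i j : ℕ) : ∀ a b,
    q ^ j • (M a b i j * A) =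
      q ^ a • (A * M a b i j) + (1 - (q * q ^ a) ^ 2) • (K * M (a + 1) (b - 1) i j) := by
  have hq := h.ne_zero
  have ho := h.osc
  induction j with
  | succ j ih =>
    intro a b
    have h1 := congrArg (A * ·) (ih (a - 1) b)
    have h2 := congrArg (K * ·) (ih a (b - 1))
    simp only [h.raise_j, ho.K_A_assoc, mul_add, mul_smul_comm, zpow_sub₀ hq, zpow_add₀ hq,
      zpow_one, sub_mul, mul_sub, smul_mul_assoc, add_sub_cancel_right, sub_add_cancel,
      mul_assoc] at h1 h2 ⊢
    linear_combination (norm := skip) q • h1 - (q ^ 2 * q ^ a) • h2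
    match_scalars <;> field_simp <;> ring
  | zero =>
    induction i with
    | succ i ih =>
      intro a b
      have h1 := congrArg (K * ·) (ih (a - 1) b)
      have h2 := congrArg (B * ·) (ih a (b - 1))
      simp only [h.raise_i_zero, ho.K_A_assoc, ho.K_B_assoc, ho.A_B_assoc, ho.B_A_assoc, mul_add,
        mul_smul_comm, zpow_sub₀ hq, zpow_add₀ hq, add_mul, zpow_one, smul_mul_assoc,
        add_sub_cancel_right, sub_add_cancel, mul_assoc] at h1 h2 ⊢
      linear_combination (norm := skip) h1 + q ^ a • h2
      match_scalars <;> field_simp <;> ring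
    | zero =>
      intro a b
      rw [h.vac, h.vac]
      split_ifs with h1 h2 h2 <;> first | omega | skip
      · simp [h1.1]
      · obtain rfl : a = -1 := by omega
        simp [hq]
      · simp

/-- The action of the first annihilation operator on the first two factors. -/
theorem right_lower_j (h : IsSite q A B K M) (i j : ℕ) : ∀ a b,
    (1 - (q ^ j) ^ 2) • M a b i (j - 1) = (1 - (q * q ^ a) ^ 2) • (B * M (a + 1) b i j) -
      (q * q ^ a * (1 - (q * q ^ b) ^ 2)) • (K * M a (b + 1) i j) := by
  have hq := h.ne_zero
  have ho := h.osc
  induction j with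
  | succ j ih =>
    intro a b
    have h1 := congrArg (A * ·) (ih (a - 1) b)
    have h2 := congrArg (K * ·) (ih a (b - 1))
    -- The induction hypotheses leave terms with `j - 1`; this recombines them into `M a b i j`.
    have h3 := h.smul_raise_j a b i j
    simp only [h.raise_j, ho.K_A_assoc, ho.K_B_assoc, ho.A_B_assoc, ho.B_A_assoc,
      Nat.add_sub_cancel, mul_smul_comm, zpow_sub₀ hq, zpow_add₀ hq, smul_sub, smul_smul, zpow_one,
      sub_mul, mul_sub, add_sub_cancel_right, sub_add_cancel, mul_assoc] at h1 h2 h3 ⊢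
    linear_combination (norm := skip) q ^ 2 • h1 - (q ^ 3 * q ^ a) • h2 + q ^ 2 • h3
    match_scalars <;> field_simp <;> ring
  | zero =>
    induction i with
    | succ i ih =>
      intro a b
      have h1 := congrArg (K * ·) (ih (a - 1) b)
      have h2 := congrArg (B * ·) (ih a (b - 1))
      simp only [h.raise_i_zero, ho.K_B_assoc, mul_add, mul_smul_comm, zpow_sub₀ hq, zpow_add₀ hq,
        mul_zero, zero_smul, pow_zero, one_pow, sub_self, smul_add, smul_smul, zpow_one, sub_mul,
        mul_sub, add_sub_cancel_right, sub_add_cancel, mul_assoc] at h1 h2 ⊢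
      linear_combination (norm := skip) q • h1 + (q * q ^ a) • h2
      match_scalars <;> field_simp <;> ring
    | zero =>
      intro a b
      rw [← mul_smul_comm, mul_smul, ← mul_smul_comm (_ - _), h.vac_lower_a, h.vac_lower_b]
      simp

theorem right_lower_i (h : IsSite q A B K M) (i j : ℕ) : ∀ a b,
    (q ^ j * (1 - (q ^ i) ^ 2)) • M a b (i - 1) j =
      (1 - (q * q ^ a) ^ 2) • (K * M (a + 1) b i j) +
      (q ^ a * (1 - (q * q ^ b) ^ 2)) • (A * M a (b + 1) i j) := by
  have hq := h.ne_zero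
  have ho := h.osc
  induction j with
  | succ j ih =>
    intro a b
    have h1 := congrArg (A * ·) (ih (a - 1) b)
    have h2 := congrArg (K * ·) (ih a (b - 1))
    simp only [h.raise_j, ho.K_A_assoc, mul_add, mul_smul_comm, zpow_sub₀ hq, zpow_add₀ hq,
      smul_sub, smul_smul, zpow_one, sub_mul, mul_sub, add_sub_cancel_right, sub_add_cancel,
      mul_assoc] at h1 h2 ⊢
    linear_combination (norm := skip) q • h1 - (q ^ 2 * q ^ a) • h2
    match_scalars <;> field_simp <;> ring
  | zero =>
    induction i with
    | succ i ih =>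
      intro a b
      have h1 := congrArg (K * ·) (ih (a - 1) b)
      have h2 := congrArg (B * ·) (ih a (b - 1))
      have h3 := h.smul_raise_i_zero a b i
      have h4 := h.weight_smul a b i 0
      simp only [h.raise_i_zero, ho.K_A_assoc, ho.K_B_assoc, ho.A_B_assoc, ho.B_A_assoc, mul_add,
        Nat.add_sub_cancel, mul_smul_comm, zpow_sub₀ hq, zpow_add₀ hq, pow_zero, smul_add,
        smul_smul, mul_one, one_mul, zpow_one, sub_mul, mul_sub, add_sub_cancel_right,
        sub_add_cancel, mul_assoc] at h1 h2 h3 h4 ⊢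
      linear_combination (norm := skip) h1 + q ^ a • h2 + h3 -
        ((1 - q ^ 2) * q ^ i + (1 - q ^ 2) * q ^ a * q ^ b) • h4
      match_scalars <;> field_simp <;> ring
    | zero =>
      intro a b
      have h1 := congrArg (K * ·) (h.vac_lower_a a b)
      have h2 := congrArg (A * ·) (h.vac_lower_b a b)
      simp only [mul_smul_comm, mul_zero] at h1 h2
      rw [h1, mul_smul (q ^ a), h2]
      simp

/-- Needed only at j = 0, for the induction on i in `left_lower_b`; `mul_K_zero` plays the same role
for `left_lower_a`. -/
theorem B_comm_zero (h : IsSite q A B K M) (i : ℕ) : ∀ a b,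
    q ^ b • (B * M a b i 0) = q ^ i • (M a b i 0 * B) := by
  have hq := h.ne_zero
  have ho := h.osc
  induction i with
  | succ i ih =>
    intro a b
    have h1 := congrArg (K * ·) (ih (a - 1) b)
    have h2 := congrArg (B * ·) (ih a (b - 1))
    simp only [h.raise_i_zero, ho.K_B_assoc, mul_add, add_mul, mul_smul_comm, zpow_sub₀ hq,
      zpow_one, smul_mul_assoc, mul_assoc] at h1 h2 ⊢
    linear_combination (norm := skip) q • h1 + (q * q ^ a) • h2
    match_scalars <;> field_simp <;> ring
  | zero =>
    intro a b
    rw [h.vac]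
    split_ifs with hab
    · simp [hab.2]
    · simp

theorem mul_K_zero (h : IsSite q A B K M) (i : ℕ) : ∀ a b,
    q ^ a • (K * M a b i 0) - (q⁻¹ * (1 - (q * q ^ a) ^ 2)) • (B * M (a + 1) (b - 1) i 0) =
      q ^ i • (M a b i 0 * K) := by
  have hq := h.ne_zero
  have ho := h.osc
  induction i with
  | succ i ih =>
    intro a b
    have h1 := congrArg (K * ·) (ih (a - 1) b)
    have h2 := congrArg (B * ·) (ih a (b - 1))
    simp only [h.raise_i_zero, ho.K_B_assoc, mul_add, add_mul, mul_sub, zpow_add₀ hq, mul_smul_comm,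
      zpow_sub₀ hq, zpow_one, smul_mul_assoc, add_sub_cancel_right, sub_add_cancel,
      mul_assoc] at h1 h2 ⊢
    linear_combination (norm := skip) q • h1 + (q * q ^ a) • h2
    match_scalars <;> field_simp <;> ring
  | zero =>
    intro a b
    rw [h.vac, h.vac]
    split_ifs with h1 h2 h2 <;> first | omega | skip
    · simp [h1.1]
    · obtain rfl : a = -1 := by omega
      simp [hq]
    · simp

/-- The coefficients depend on i, j and b, so the induction hypotheses do not close the step by
themselves. The defect is a multiple of 1 - q², and it cancels by a commutation relation (`K_comm`,
or `B_comm_zero` at j = 0) together with weight conservation. -/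
theorem left_lower_b (h : IsSite q A B K M) (i j : ℕ) : ∀ a b,
    (1 - (q * q ^ b) ^ 2) • M a (b + 1) i j = (1 - (q ^ i) ^ 2) • (M a b (i - 1) j * B) -
      (q * q ^ i * (1 - (q ^ j) ^ 2)) • (M a b i (j - 1) * K) := by
  have hq := h.ne_zero
  have ho := h.osc
  induction j with
  | succ j ih =>
    intro a b
    have h1 := congrArg (A * ·) (ih (a - 1) b)
    have h2 := congrArg (K * ·) (ih a (b - 1))
    have h3 := congrArg (· * K) (h.smul_raise_j a b i j)
    have h4 := h.K_comm i j a b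
    have h5 := congrArg (· * K) (h.weight_smul a b i j)
    rw [Nat.add_sub_cancel, h.raise_j a (b + 1) i j, h.raise_j a b (i - 1) j]
    simp only [mul_smul_comm, zpow_sub₀ hq, smul_sub, smul_smul, zpow_one, sub_mul, mul_sub,
      smul_mul_assoc, add_sub_cancel_right, sub_add_cancel, mul_assoc] at h1 h2 h3 h4 h5 ⊢
    linear_combination (norm := skip) h1 - (q * q ^ a) • h2 + (q * q ^ i) • h3
      - ((1 - q ^ 2) * q * q ^ a * q ^ b) • h4 - ((1 - q ^ 2) * q * q ^ j) • h5
    match_scalars <;> field_simp <;> ring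
  | zero =>
    induction i with
    | succ i ih =>
      intro a b
      have h1 := congrArg (K * ·) (ih (a - 1) b)
      have h2 := congrArg (B * ·) (ih a (b - 1))
      have h3 := congrArg (· * B) (h.smul_raise_i_zero a b i)
      have h4 := h.B_comm_zero i a b
      have h5 := congrArg (· * B) (h.weight_smul a b i 0)
      simp only [h.raise_i_zero, Nat.add_sub_cancel, mul_smul_comm, zpow_sub₀ hq, add_mul, mul_zero,
        zero_smul, pow_zero, one_pow, sub_self, smul_add, smul_smul, mul_one, sub_zero, zpow_one,
        smul_mul_assoc, add_sub_cancel_right, sub_add_cancel, mul_assoc] at h1 h2 h3 h4 h5 ⊢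
      linear_combination (norm := skip) h1 + q ^ a • h2 - h3 + ((1 - q ^ 2) * q ^ a * q ^ b) • h4
        + ((1 - q ^ 2) * q ^ i * q ^ 0) • h5
      match_scalars <;> field_simp <;> ring
    | zero =>
      intro a b
      rw [h.vac]
      split_ifs with h1
      · obtain rfl : b = -1 := by omega
        simp [hq]
      · simp

theorem left_lower_a (h : IsSite q A B K M) (i j : ℕ) : ∀ a b,
    (q ^ b * (1 - (q * q ^ a) ^ 2)) • M (a + 1) b i j = (1 - (q ^ i) ^ 2) • (M a b (i - 1) j * K) +
      (q ^ i * (1 - (q ^ j) ^ 2)) • (M a b i (j - 1) * A) := by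
  have hq := h.ne_zero
  have ho := h.osc
  induction j with
  | succ j ih =>
    intro a b
    have h1 := congrArg (A * ·) (ih (a - 1) b)
    have h2 := congrArg (K * ·) (ih a (b - 1))
    have h3 := congrArg (· * A) (h.smul_raise_j a b i j)
    have h4 := h.mul_A i j a b
    have h5 := congrArg (· * A) (h.weight_smul a b i j)
    rw [Nat.add_sub_cancel, h.raise_j (a + 1) b i j, h.raise_j a b (i - 1) j]
    simp only [mul_smul_comm, zpow_sub₀ hq, zpow_add₀ hq, smul_sub, smul_smul, mul_add, zpow_one,
      sub_mul, mul_sub, smul_mul_assoc, add_sub_cancel_right, sub_add_cancel,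
      mul_assoc] at h1 h2 h3 h4 h5 ⊢
    linear_combination (norm := skip) h1 - (q * q ^ a) • h2 - q ^ i • h3
      - ((1 - q ^ 2) * q ^ a * q ^ b) • h4 + ((1 - q ^ 2) * q ^ j) • h5
    match_scalars <;> field_simp <;> ring
  | zero =>
    induction i with
    | succ i ih =>
      intro a b
      have h1 := congrArg (K * ·) (ih (a - 1) b)
      have h2 := congrArg (B * ·) (ih a (b - 1))
      have h3 := congrArg (· * K) (h.smul_raise_i_zero a b i)
      have h4 := h.mul_K_zero i a b
      have h5 := congrArg (· * K) (h.weight_smul a b i 0)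
      simp only [h.raise_i_zero, Nat.add_sub_cancel, mul_smul_comm, zpow_sub₀ hq, zpow_add₀ hq,
        add_mul, mul_zero, zero_smul, pow_zero, one_pow, sub_self, smul_add, smul_smul, mul_one,
        add_zero, zpow_one, smul_mul_assoc, add_sub_cancel_right, sub_add_cancel,
        mul_assoc] at h1 h2 h3 h4 h5 ⊢
      linear_combination (norm := skip) h1 + q ^ a • h2 - h3 + ((1 - q ^ 2) * q ^ a * q ^ b) • h4
        + ((1 - q ^ 2) * q ^ i) • h5
      match_scalars <;> field_simp <;> ring
    | zero =>
      intro a b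
      rw [h.vac]
      split_ifs with h1
      · obtain rfl : a = -1 := by omega
        simp [hq]
      · simp

end IsSite

/-! ### q-Pochhammer symbols and q-binomial coefficients -/

section QBinomial

variable {𝕜 : Type*} [Field 𝕜] {b : 𝕜}

theorem qPoch_zero (b : 𝕜) : qPoch b 0 = 1 := by simp [qPoch]

theorem qPoch_succ (b : 𝕜) (m : ℕ) : qPoch b (m + 1) = qPoch b m * (1 - b ^ (m + 1)) := by
  simp [qPoch, Finset.prod_range_succ]

theorem qPoch_ne_zero (hb : ∀ m : ℕ, m ≠ 0 → b ^ m ≠ 1) (m : ℕ) : qPoch b m ≠ 0 :=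
  Finset.prod_ne_zero_iff.2 fun k _ => sub_ne_zero.2 (hb (k + 1) k.succ_ne_zero).symm

theorem qBinom_zero_right (hb : ∀ m : ℕ, m ≠ 0 → b ^ m ≠ 1) (m : ℕ) : qBinom b m 0 = 1 := by
  simp [qBinom, qPoch_zero, qPoch_ne_zero hb]

theorem qBinom_of_lt {m k : ℕ} (h : m < k) : qBinom b m k = 0 := by
  simp [qBinom, Nat.not_le.2 h]

/-- The truncated exponent `m - k` is harmless: for m < k both coefficients vanish, and for m = k
the factor 1 - b^0 does. -/
theorem qBinom_absorb (hb : ∀ m : ℕ, m ≠ 0 → b ^ m ≠ 1) (m k : ℕ) :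
    (1 - b ^ (m - k)) * qBinom b m k = (1 - b ^ (k + 1)) * qBinom b m (k + 1) := by
  rcases lt_trichotomy m k with h | rfl | h
  · simp [qBinom_of_lt h, qBinom_of_lt (h.trans k.lt_succ_self)]
  · simp [qBinom_of_lt (Nat.lt_succ_self m)]
  · obtain ⟨d, rfl⟩ := Nat.exists_eq_add_of_lt h
    have e1 : k + d + 1 - k = d + 1 := by omega
    have e2 : k + d + 1 - (k + 1) = d := by omega
    rw [qBinom, qBinom, if_pos (by omega), if_pos (by omega), e1, e2, qPoch_succ b k,
      qPoch_succ b d]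
    have h1 := qPoch_ne_zero hb k
    have h2 := qPoch_ne_zero hb d
    have h3 : 1 - b ^ (k + 1) ≠ 0 := sub_ne_zero.2 (hb _ k.succ_ne_zero).symm
    have h4 : 1 - b ^ (d + 1) ≠ 0 := sub_ne_zero.2 (hb _ d.succ_ne_zero).symm
    field_simp

theorem qBinom_succ_succ (hb : ∀ m : ℕ, m ≠ 0 → b ^ m ≠ 1) (m k : ℕ) :
    qBinom b (m + 1) (k + 1) = qBinom b m (k + 1) + b ^ (m - k) * qBinom b m k := by
  rcases lt_trichotomy m k with h | rfl | h
  · simp [qBinom_of_lt h, qBinom_of_lt (h.trans k.lt_succ_self), qBinom_of_lt (Nat.succ_lt_succ h)]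
  · simp [qBinom, qPoch_zero, qPoch_ne_zero hb]
  · obtain ⟨d, rfl⟩ := Nat.exists_eq_add_of_lt h
    have e1 : k + d + 1 - k = d + 1 := by omega
    have e2 : k + d + 1 - (k + 1) = d := by omega
    have e3 : k + d + 1 + 1 - (k + 1) = d + 1 := by omega
    rw [qBinom, qBinom, qBinom, if_pos (by omega), if_pos (by omega), if_pos (by omega), e1, e2,
      e3, qPoch_succ b k, qPoch_succ b d, qPoch_succ b (k + d + 1)]
    have h1 := qPoch_ne_zero hb k
    have h2 := qPoch_ne_zero hb d
    have h3 : 1 - b ^ (k + 1) ≠ 0 := sub_ne_zero.2 (hb _ k.succ_ne_zero).symm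
    have h4 : 1 - b ^ (d + 1) ≠ 0 := sub_ne_zero.2 (hb _ d.succ_ne_zero).symm
    field_simp
    ring

/-- `∏_{t = 1}^m (1 - b^{c + t})`. -/
def qRise (b : 𝕜) (c m : ℕ) : 𝕜 := ∏ t ∈ Finset.range m, (1 - b ^ (c + t + 1))

theorem qPoch_div (hb : ∀ m : ℕ, m ≠ 0 → b ^ m ≠ 1) (c m : ℕ) :
    qPoch b (c + m) / qPoch b c = qRise b c m := by
  rw [div_eq_iff (qPoch_ne_zero hb c), qPoch, Finset.prod_range_add, mul_comm]
  rfl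

theorem qRise_succ (b : 𝕜) (c m : ℕ) :
    qRise b c (m + 1) = qRise b c m * (1 - b ^ (c + m + 1)) := by
  simp [qRise, Finset.prod_range_succ]

theorem qRise_succ' (b : 𝕜) (c m : ℕ) :
    qRise b c (m + 1) = (1 - b ^ (c + 1)) * qRise b (c + 1) m := by
  rw [qRise, Finset.prod_range_succ', mul_comm, add_zero, qRise]
  congr 1
  refine Finset.prod_congr rfl fun t _ => ?_
  congr 2
  ring

end QBinomial

/-! ### The explicit 3d R satisfies the recursions -/

section ThreeDR

variable {𝕜 : Type*} [Field 𝕜] {q : 𝕜}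

/-- The summand in the formula for the 3d R. -/
def threeDRTerm (q : 𝕜) (c i j k l m : ℕ) : 𝕜 :=
  (-1) ^ l * q ^ ((i : ℤ) * ((c : ℤ) - j) + ((k : ℤ) + 1) * l + (m : ℤ) * ((m : ℤ) - k))
    * qRise (q ^ 2) c m * qBinom (q ^ 2) i m * qBinom (q ^ 2) j l

/-- The sum in the formula for the 3d R. -/
def threeDRSum (q : 𝕜) (b c i j k : ℕ) : 𝕜 :=
  ∑ lm ∈ Finset.HasAntidiagonal.antidiagonal b, threeDRTerm q c i j k lm.1 lm.2

theorem sq_pow_ne_one (hq : ∀ m : ℕ, m ≠ 0 → q ^ m ≠ 1) (m : ℕ) (hm : m ≠ 0) :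
    (q ^ 2) ^ m ≠ 1 := by
  rw [← pow_mul]
  exact hq _ (by omega)

theorem threeDR_eq (hq : ∀ m : ℕ, m ≠ 0 → q ^ m ≠ 1) {a b c i j k : ℕ} (h1 : a + b = i + j)
    (h2 : b + c = j + k) : threeDR q a b c i j k = threeDRSum q b c i j k := by
  rw [threeDR, if_pos ⟨h1, h2⟩, threeDRSum]
  refine Finset.sum_congr rfl fun lm _ => ?_
  rw [qPoch_div (sq_pow_ne_one hq), threeDRTerm]

/-- If λ + μ = b > i + j, then λ > j or μ > i, and a binomial coefficient vanishes. So the formula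
is zero by itself where a = i + j - b would be negative, which makes the extension by zero
compatible with the recursions. -/
theorem threeDRSum_eq_zero {b c i j k : ℕ} (h : i + j < b) : threeDRSum q b c i j k = 0 := by
  refine Finset.sum_eq_zero fun lm hlm => ?_
  rw [Finset.HasAntidiagonal.mem_antidiagonal] at hlm
  rcases Nat.lt_or_ge j lm.1 with h1 | h1
  · simp [threeDRTerm, qBinom_of_lt h1]
  · simp [threeDRTerm, qBinom_of_lt (show i < lm.2 by omega)]

theorem threeDRSum_zero (hq : ∀ m : ℕ, m ≠ 0 → q ^ m ≠ 1) (c i j k : ℕ) :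
    threeDRSum q 0 c i j k = q ^ ((i : ℤ) * ((c : ℤ) - j)) := by
  simp [threeDRSum, threeDRTerm, qBinom_zero_right (sq_pow_ne_one hq), qRise]

/-- Pascal's rule for the coefficient with upper index i + 1, applied term by term: its two parts
give the two terms on the right, the second after the shift μ → μ + 1. -/
theorem threeDRSum_raise_i (h0 : q ≠ 0) (hq : ∀ m : ℕ, m ≠ 0 → q ^ m ≠ 1) {a b c i j k : ℕ}
    (h1 : a + (b + 1) = i + 1 + j) (h2 : b + 1 + c = j + k) :
    q ^ j * threeDRSum q (b + 1) c (i + 1) j k = q ^ c * threeDRSum q (b + 1) c i j k +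
      q ^ a * (1 - (q ^ 2) ^ (c + 1)) * threeDRSum q b (c + 1) i j k := by
  have hQ := sq_pow_ne_one hq
  simp only [threeDRSum]
  rw [Finset.Nat.sum_antidiagonal_succ', Finset.Nat.sum_antidiagonal_succ', mul_add, mul_add,
    add_assoc, Finset.mul_sum, Finset.mul_sum, Finset.mul_sum, ← Finset.sum_add_distrib]
  have hstep (x y : ℤ) : q ^ j * q ^ (((i + 1 : ℕ) : ℤ) * ((c : ℤ) - j) + x + y) =
      q ^ c * q ^ ((i : ℤ) * ((c : ℤ) - j) + x + y) := by
    rw [← zpow_natCast q j, ← zpow_natCast q c, ← zpow_add₀ h0, ← zpow_add₀ h0]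
    congr 1
    push_cast
    ring
  congr 1
  · simp only [threeDRTerm, qBinom_zero_right hQ]
    linear_combination ((-1) ^ (b + 1) * qRise (q ^ 2) c 0 * qBinom (q ^ 2) j (b + 1)) *
      hstep (((k : ℤ) + 1) * ((b + 1 : ℕ) : ℤ)) (((0 : ℕ) : ℤ) * (((0 : ℕ) : ℤ) - k))
  · refine Finset.sum_congr rfl fun lm hlm => ?_
    obtain ⟨l, m⟩ := lm
    rw [Finset.HasAntidiagonal.mem_antidiagonal] at hlm
    simp only at hlm ⊢
    simp only [threeDRTerm, qBinom_succ_succ hQ, qRise_succ']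
    have e1 := hstep (((k : ℤ) + 1) * l) (((m + 1 : ℕ) : ℤ) * (((m + 1 : ℕ) : ℤ) - k))
    -- Pascal's rule produces the truncated exponent `i - m`; where truncation occurs its
    -- coefficient is zero.
    rcases Nat.lt_or_ge i m with him | him
    · rw [qBinom_of_lt him]
      linear_combination ((-1) ^ l * ((1 - (q ^ 2) ^ (c + 1)) * qRise (q ^ 2) (c + 1) m) *
        qBinom (q ^ 2) i (m + 1) * qBinom (q ^ 2) j l) * e1
    · have e2 : q ^ a * q ^ ((i : ℤ) * (((c + 1 : ℕ) : ℤ) - j) + ((k : ℤ) + 1) * l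
          + (m : ℤ) * ((m : ℤ) - k)) = q ^ j * q ^ (((i + 1 : ℕ) : ℤ) * ((c : ℤ) - j)
          + ((k : ℤ) + 1) * l + ((m + 1 : ℕ) : ℤ) * (((m + 1 : ℕ) : ℤ) - k)) *
            (q ^ 2) ^ (i - m) := by
        rw [← pow_mul, ← zpow_natCast q a, ← zpow_natCast q j, ← zpow_natCast q (2 * (i - m)),
          ← zpow_add₀ h0, ← zpow_add₀ h0, ← zpow_add₀ h0]
        congr 1
        have ha : (a : ℤ) = i + j - l - m := by omega
        have hk : (k : ℤ) = l + m + 1 + c - j := by omega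
        push_cast [Nat.cast_sub him]
        rw [ha, hk]
        ring
      linear_combination ((-1) ^ l * ((1 - (q ^ 2) ^ (c + 1)) * qRise (q ^ 2) (c + 1) m) *
        qBinom (q ^ 2) j l) * (qBinom (q ^ 2) i (m + 1) * e1 - qBinom (q ^ 2) i m * e2)

/-- Pascal's rule splits the coefficient with upper index j + 1. Lowering c changes the rising
product, and the difference q^{2c}(1 - q^{2μ}) times a q-binomial in i becomes, by `qBinom_absorb`,
a pair of terms with μ - 1: one cancels the second Pascal part, the other is the last term of the
claim. -/
theorem threeDRSum_raise_j (h0 : q ≠ 0) (hq : ∀ m : ℕ, m ≠ 0 → q ^ m ≠ 1) {a b c i j k : ℕ}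
    (h1 : a + (b + 1) = i + (j + 1)) (h2 : b + 1 + c = j + 1 + k) :
    threeDRSum q (b + 1) c i (j + 1) k =
      (if c = 0 then 0 else threeDRSum q (b + 1) (c - 1) i j k) -
        q * q ^ a * q ^ c * threeDRSum q b c i j k := by
  have hQ := sq_pow_ne_one hq
  set e : ℕ → ℕ → ℤ := fun l m =>
    (i : ℤ) * ((c : ℤ) - 1 - j) + ((k : ℤ) + 1) * l + (m : ℤ) * ((m : ℤ) - k) with he
  have hc : (if c = 0 then 0 else threeDRSum q (b + 1) (c - 1) i j k) =
      ∑ lm ∈ Finset.HasAntidiagonal.antidiagonal (b + 1), (-1) ^ lm.1 * q ^ e lm.1 lm.2 *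
        (if lm.2 = 0 then 1 else (1 - (q ^ 2) ^ c) * qRise (q ^ 2) c (lm.2 - 1)) *
        qBinom (q ^ 2) i lm.2 * qBinom (q ^ 2) j lm.1 := by
    -- For c = 0 the terms with μ > 0 carry the factor 1 - q^0, and μ = 0 forces λ = b + 1 > j by
    -- `h2`.
    rcases c with _ | c
    · rw [if_pos rfl]
      refine (Finset.sum_eq_zero fun lm hlm => ?_).symm
      rw [Finset.HasAntidiagonal.mem_antidiagonal] at hlm
      split_ifs with hm
      · rw [qBinom_of_lt (show j < lm.1 by omega), mul_zero]
      · simp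
    · rw [if_neg c.succ_ne_zero, Nat.add_sub_cancel, threeDRSum]
      refine Finset.sum_congr rfl fun lm _ => ?_
      rw [threeDRTerm, he]
      push_cast
      rw [add_sub_cancel_right]
      congr 3
      rcases lm.2 with _ | m
      · simp [qRise]
      · rw [if_neg m.succ_ne_zero, qRise_succ', Nat.add_sub_cancel]
  have hL : threeDRSum q (b + 1) c i (j + 1) k =
      ∑ lm ∈ Finset.HasAntidiagonal.antidiagonal (b + 1), (-1) ^ lm.1 * q ^ e lm.1 lm.2 *
        qRise (q ^ 2) c lm.2 * qBinom (q ^ 2) i lm.2 * qBinom (q ^ 2) j lm.1 +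
      ∑ lm ∈ Finset.HasAntidiagonal.antidiagonal b, (-1) ^ (lm.1 + 1) * q ^ e (lm.1 + 1) lm.2 *
        qRise (q ^ 2) c lm.2 * qBinom (q ^ 2) i lm.2 *
          ((q ^ 2) ^ (j - lm.1) * qBinom (q ^ 2) j lm.1) := by
    have e0 : (c : ℤ) - ((j + 1 : ℕ) : ℤ) = (c : ℤ) - 1 - j := by push_cast; ring
    rw [threeDRSum, Finset.Nat.sum_antidiagonal_succ, Finset.Nat.sum_antidiagonal_succ, add_assoc,
      ← Finset.sum_add_distrib]
    simp only [threeDRTerm, qBinom_zero_right hQ, e0, he]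
    congr 1
    refine Finset.sum_congr rfl fun lm _ => ?_
    rw [qBinom_succ_succ hQ]
    push_cast
    ring
  rw [hc, hL, Finset.Nat.sum_antidiagonal_succ', Finset.Nat.sum_antidiagonal_succ', threeDRSum,
    Finset.mul_sum, add_assoc, add_sub_assoc, ← Finset.sum_add_distrib, ← Finset.sum_sub_distrib]
  congr 1
  refine Finset.sum_congr rfl fun lm hlm => ?_
  obtain ⟨l, m⟩ := lm
  rw [Finset.HasAntidiagonal.mem_antidiagonal] at hlm
  simp only at hlm
  simp only [threeDRTerm, qRise_succ, if_neg m.succ_ne_zero, Nat.add_sub_cancel]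
  rcases Nat.lt_or_ge i m with him | him
  · rw [qBinom_of_lt him, qBinom_of_lt (him.trans m.lt_succ_self)]
    simp
  rcases Nat.lt_or_ge j l with hjl | hjl
  · rw [qBinom_of_lt hjl]
    simp
  have hk : (k : ℤ) = l + m + c - j := by omega
  have ha : (a : ℤ) = i + j - l - m := by omega
  have e1 : q ^ e l (m + 1) * (q ^ 2) ^ c = q ^ e (l + 1) m * (q ^ 2) ^ (j - l) := by
    rw [← pow_mul, ← pow_mul, ← zpow_natCast q (2 * c), ← zpow_natCast q (2 * (j - l)),
      ← zpow_add₀ h0, ← zpow_add₀ h0]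
    congr 1
    simp only [he]
    push_cast [Nat.cast_sub hjl]
    rw [hk]
    ring
  have e2 : q ^ e l (m + 1) * (q ^ 2) ^ c * (q ^ 2) ^ (i - m) = q * q ^ a * q ^ c *
      q ^ ((i : ℤ) * ((c : ℤ) - j) + ((k : ℤ) + 1) * l + (m : ℤ) * ((m : ℤ) - k)) := by
    rw [← pow_mul, ← pow_mul, ← pow_succ', ← zpow_natCast q (2 * c),
      ← zpow_natCast q (2 * (i - m)), ← zpow_natCast q (a + 1), ← zpow_natCast q c,
      ← zpow_add₀ h0, ← zpow_add₀ h0, ← zpow_add₀ h0, ← zpow_add₀ h0]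
    congr 1
    simp only [he]
    push_cast [Nat.cast_sub him]
    rw [hk, ha]
    ring
  have e3 := qBinom_absorb hQ i m
  linear_combination ((-1) ^ l * qRise (q ^ 2) c m * qBinom (q ^ 2) j l) *
    (qBinom (q ^ 2) i m * (e1 - e2) - q ^ e l (m + 1) * (q ^ 2) ^ c * e3)

/-- The matrix elements of the 3d R, extended by zero to negative output indices. -/
def tdr (q : 𝕜) (a b : ℤ) (c i j k : ℕ) : 𝕜 :=
  if 0 ≤ a ∧ 0 ≤ b then threeDR q a.toNat b.toNat c i j k else 0

theorem tdr_natCast (q : 𝕜) (a b c i j k : ℕ) : tdr q a b c i j k = threeDR q a b c i j k := by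
  simp [tdr]

theorem tdr_of_neg {a b : ℤ} (h : a < 0 ∨ b < 0) (q : 𝕜) (c i j k : ℕ) : tdr q a b c i j k = 0 := by
  rw [tdr, if_neg]
  omega

theorem tdr_weight {a b : ℤ} {c i j k : ℕ} (h : a + b ≠ i + j ∨ b + c ≠ j + k) (q : 𝕜) :
    tdr q a b c i j k = 0 := by
  rw [tdr]
  split_ifs with hab
  · rw [threeDR, if_neg]
    omega
  · rfl

/-- Here a may be negative: then both sides vanish, the right one by `threeDRSum_eq_zero`. This
covers the index a - 1 in the recursions. -/
theorem tdr_eq (hq : ∀ m : ℕ, m ≠ 0 → q ^ m ≠ 1) {a : ℤ} {b c i j k : ℕ}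
    (h1 : a + b = i + j) (h2 : b + c = j + k) : tdr q a b c i j k = threeDRSum q b c i j k := by
  rcases lt_or_ge a 0 with ha | ha
  · rw [tdr_of_neg (.inl ha), threeDRSum_eq_zero (by omega)]
  · lift a to ℕ using ha
    rw [tdr_natCast, threeDR_eq hq (by omega) h2]

theorem tdr_raise_i (h0 : q ≠ 0) (hq : ∀ m : ℕ, m ≠ 0 → q ^ m ≠ 1) (a b : ℤ) (c i j k : ℕ) :
    q ^ j * tdr q a b c (i + 1) j k = q ^ c * tdr q (a - 1) b c i j k +
      q ^ a * ((1 - (q ^ 2) ^ (c + 1)) * tdr q a (b - 1) (c + 1) i j k) := by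
  by_cases hw : a + b = i + 1 + j ∧ b + c = j + k
  swap
  · rw [tdr_weight (by push_cast; omega), tdr_weight (by omega),
      tdr_weight (by push_cast; omega)]
    simp
  rcases lt_or_ge a 0 with ha | ha
  · rw [tdr_of_neg (.inl ha), tdr_of_neg (.inl (by omega)), tdr_of_neg (.inl ha)]
    simp
  rcases lt_or_ge b 0 with hb | hb
  · rw [tdr_of_neg (.inr hb), tdr_of_neg (.inr hb), tdr_of_neg (.inr (by omega))]
    simp
  lift b to ℕ using hb
  lift a to ℕ using ha
  rw [zpow_natCast]
  rcases b with _ | b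
  · rw [tdr_eq hq (by push_cast; omega) (by omega), tdr_eq hq (by push_cast; omega) (by omega),
      tdr_of_neg (.inr (by simp)), threeDRSum_zero hq, threeDRSum_zero hq, mul_zero, mul_zero,
      add_zero, ← zpow_natCast, ← zpow_natCast, ← zpow_add₀ h0, ← zpow_add₀ h0]
    congr 1
    push_cast
    ring
  · have e : ((b + 1 : ℕ) : ℤ) - 1 = b := by push_cast; ring
    rw [e, tdr_eq hq (by push_cast; omega) (by omega), tdr_eq hq (by push_cast; omega) (by omega),
      tdr_eq hq (by omega) (by omega), ← mul_assoc (q ^ a)]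
    exact threeDRSum_raise_i h0 hq (by omega) (by omega)

theorem tdr_raise_j (h0 : q ≠ 0) (hq : ∀ m : ℕ, m ≠ 0 → q ^ m ≠ 1) (a b : ℤ) (c i j k : ℕ) :
    tdr q a b c i (j + 1) k = (if c = 0 then 0 else tdr q (a - 1) b (c - 1) i j k) -
      q * q ^ a * (q ^ c * tdr q a (b - 1) c i j k) := by
  by_cases hw : a + b = i + (j + 1) ∧ b + c = j + 1 + k
  swap
  · have e : (if c = 0 then 0 else tdr q (a - 1) b (c - 1) i j k) = 0 := by
      split_ifs with hc
      · rfl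
      · exact tdr_weight (by omega) q
    rw [tdr_weight (by push_cast; omega), e, tdr_weight (by omega)]
    simp
  rcases lt_or_ge a 0 with ha | ha
  · rw [tdr_of_neg (.inl ha), tdr_of_neg (.inl (by omega)), tdr_of_neg (.inl ha)]
    simp
  rcases lt_or_ge b 0 with hb | hb
  · rw [tdr_of_neg (.inr hb), tdr_of_neg (.inr hb), tdr_of_neg (.inr (by omega))]
    simp
  lift b to ℕ using hb
  lift a to ℕ using ha
  rw [zpow_natCast]
  rcases b with _ | b
  · rw [if_neg (by omega), tdr_eq hq (by push_cast; omega) (by omega),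
      tdr_eq hq (by push_cast; omega) (by omega),
      tdr_of_neg (.inr (by simp)), threeDRSum_zero hq, threeDRSum_zero hq, mul_zero, mul_zero,
      sub_zero]
    congr 1
    push_cast [Nat.cast_sub (show 1 ≤ c by omega)]
    ring
  · have e : ((b + 1 : ℕ) : ℤ) - 1 = b := by push_cast; ring
    have e1 : (if c = 0 then 0 else tdr q ((a : ℤ) - 1) ((b + 1 : ℕ) : ℤ) (c - 1) i j k) =
        if c = 0 then 0 else threeDRSum q (b + 1) (c - 1) i j k := by
      split_ifs with hc
      · rfl
      · exact tdr_eq hq (by push_cast; omega) (by omega)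
    rw [e, e1, tdr_eq hq (by push_cast; omega) (by omega),
      tdr_eq hq (by omega) (by omega), ← mul_assoc (q * q ^ a)]
    exact threeDRSum_raise_j h0 hq (by omega) (by omega)

theorem tdr_vac (hq : ∀ m : ℕ, m ≠ 0 → q ^ m ≠ 1) (a b : ℤ) (c k : ℕ) :
    tdr q a b c 0 0 k = if a = 0 ∧ b = 0 ∧ k = c then 1 else 0 := by
  split_ifs with h
  · obtain ⟨rfl, rfl, rfl⟩ := h
    have := tdr_eq hq (a := 0) (b := 0) (c := k) (i := 0) (j := 0) (k := k) (by simp) (by simp)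
    rw [Nat.cast_zero] at this
    rw [this, threeDRSum_zero hq]
    simp
  · by_cases h' : a < 0 ∨ b < 0
    · exact tdr_of_neg h' ..
    · exact tdr_weight (by push_cast; omega) q

/-! ### The `q`-oscillator algebra on sequences -/

/-- The raising operator `|m⟩ ↦ |m + 1⟩`. -/
def oscA (𝕜 : Type*) [Field 𝕜] : Module.End 𝕜 (ℕ → 𝕜) where
  toFun v c := if c = 0 then 0 else v (c - 1)
  map_add' v w := by ext c; by_cases hc : c = 0 <;> simp [hc]
  map_smul' x v := by ext c; by_cases hc : c = 0 <;> simp [hc]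

/-- The lowering operator `|m⟩ ↦ (1 - q^{2m}) |m - 1⟩`. -/
def oscB (q : 𝕜) : Module.End 𝕜 (ℕ → 𝕜) where
  toFun v c := (1 - (q ^ 2) ^ (c + 1)) * v (c + 1)
  map_add' v w := by ext c; simp [mul_add]
  map_smul' x v := by ext c; simp [mul_left_comm]

/-- The operator `|m⟩ ↦ q^m |m⟩`. -/
def oscK (q : 𝕜) : Module.End 𝕜 (ℕ → 𝕜) where
  toFun v c := q ^ c * v c
  map_add' v w := by ext c; simp [mul_add]
  map_smul' x v := by ext c; simp [mul_left_comm]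

/-- The matrix elements of the 3d R in the first two tensor factors, as operators on the third. -/
def site (q : 𝕜) (a b : ℤ) (i j : ℕ) : Module.End 𝕜 (ℕ → 𝕜) where
  toFun v c := ∑ k ∈ Finset.range (b.toNat + c + 1), tdr q a b c i j k * v k
  map_add' v w := by ext c; simp [mul_add, Finset.sum_add_distrib]
  map_smul' x v := by ext c; simp [mul_left_comm, Finset.mul_sum]

/-- The conservation law b + c = j + k bounds k by b + c, so any longer range gives the same sum. A
common range lets the recursions be compared term by term. -/
theorem site_apply {a b : ℤ} {c n : ℕ} (i j : ℕ) (hn : b.toNat + c < n) (v : ℕ → 𝕜) :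
    site q a b i j v c = ∑ k ∈ Finset.range n, tdr q a b c i j k * v k := by
  change ∑ k ∈ Finset.range (b.toNat + c + 1), tdr q a b c i j k * v k = _
  refine Finset.sum_subset (fun k hk => ?_) fun k _ hk => ?_
  · rw [Finset.mem_range] at hk ⊢
    omega
  · rw [Finset.mem_range] at hk
    by_cases h' : a < 0 ∨ b < 0
    · rw [tdr_of_neg h', zero_mul]
    · rw [tdr_weight (by omega), zero_mul]

theorem isOsc (h0 : q ≠ 0) : IsOsc q (oscA 𝕜) (oscB q) (oscK q) where
  K_A := by
    ext v c
    rcases c with _ | c <;> simp [oscA, oscK, pow_succ]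
    ring
  K_B := by
    ext v c
    simp [oscB, oscK, pow_succ]
    field_simp
  B_A := by
    ext v c
    simp [oscA, oscB, oscK, pow_succ]
    ring
  A_B := by
    ext v c
    rcases c with _ | c <;> simp [oscA, oscB, oscK, pow_succ]
    ring

theorem isSite (h0 : q ≠ 0) (hq : ∀ m : ℕ, m ≠ 0 → q ^ m ≠ 1) :
    IsSite q (oscA 𝕜) (oscB q) (oscK q) (site q) where
  osc := isOsc h0
  ne_zero := h0
  vac a b := by
    ext v c
    rw [site_apply 0 0 (Nat.lt_succ_self _)]
    simp only [tdr_vac hq]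
    by_cases hab : a = 0 ∧ b = 0
    · obtain ⟨rfl, rfl⟩ := hab
      simp
    · rw [if_neg hab]
      refine Finset.sum_eq_zero fun k _ => ?_
      rw [if_neg (by tauto), zero_mul]
  raise_i a b i j := by
    ext v c
    have hn : ∀ x ≤ b, ∀ c' ≤ c + 1, x.toNat + c' < b.toNat + c + 2 := by omega
    simp only [LinearMap.smul_apply, LinearMap.add_apply, Module.End.mul_apply, Pi.smul_apply,
      Pi.add_apply, smul_eq_mul]
    change _ = q ^ c * site q (a - 1) b i j v c + q ^ a * ((1 - (q ^ 2) ^ (c + 1)) *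
      site q a (b - 1) i j v (c + 1))
    rw [site_apply _ _ (hn b le_rfl c (by omega)), site_apply _ _ (hn b le_rfl c (by omega)),
      site_apply _ _ (hn (b - 1) (by omega) (c + 1) (by omega)), Finset.mul_sum, Finset.mul_sum,
      Finset.mul_sum, Finset.mul_sum, ← Finset.sum_add_distrib]
    refine Finset.sum_congr rfl fun k _ => ?_
    linear_combination v k * tdr_raise_i h0 hq a b c i j k
  raise_j a b i j := by
    ext v c
    have hn : ∀ x ≤ b, ∀ c' ≤ c, x.toNat + c' < b.toNat + c + 1 := by omega
    simp only [LinearMap.smul_apply, LinearMap.sub_apply, Module.End.mul_apply, Pi.smul_apply,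
      Pi.sub_apply, smul_eq_mul]
    change _ = (if c = 0 then 0 else site q (a - 1) b i j v (c - 1)) - q * q ^ a * (q ^ c *
      site q a (b - 1) i j v c)
    have e : (if c = 0 then 0 else site q (a - 1) b i j v (c - 1)) =
        ∑ k ∈ Finset.range (b.toNat + c + 1),
          (if c = 0 then 0 else tdr q (a - 1) b (c - 1) i j k) * v k := by
      split_ifs with hc
      · simp
      · exact site_apply _ _ (hn b le_rfl (c - 1) (by omega)) v
    rw [e, site_apply _ _ (hn b le_rfl c le_rfl),
      site_apply _ _ (hn (b - 1) (by omega) c le_rfl), Finset.mul_sum, Finset.mul_sum,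
      ← Finset.sum_sub_distrib]
    refine Finset.sum_congr rfl fun k _ => ?_
    linear_combination v k * tdr_raise_j h0 hq a b c i j k

end ThreeDR

theorem finsum_eq_finsum_comp {α β M : Type*} [AddCommMonoid M] {f : α → M} {g : β → α}
    (hg : Function.Injective g) (hf : ∀ x, x ∉ Set.range g → f x = 0) :
    ∑ᶠ x, f x = ∑ᶠ y, f (g y) := by
  rw [← finsum_mem_range hg, ← finsum_mem_univ]
  refine finsum_mem_inter_support_eq' f _ _ fun x hx => ?_
  simpa using by_contra fun h => hx (hf x h)

/-! ### Chains of sites between boundary vectors -/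

section Chain

variable {𝕜 : Type*} [Field 𝕜]

/-- The product `F 0 * ⋯ * F n`. -/
def opProd {R : Type*} [Monoid R] {n : ℕ} (F : Fin n → R) : R := (List.ofFn F).prod

theorem opProd_succ {R : Type*} [Monoid R] {n : ℕ} (F : Fin (n + 1) → R) :
    opProd F = F 0 * opProd fun r => F r.succ := by
  simp [opProd, List.ofFn_succ]

theorem opProd_succ_last {R : Type*} [Monoid R] {n : ℕ} (F : Fin (n + 1) → R) :
    opProd F = (opProd fun r => F r.castSucc) * F (Fin.last n) := by
  rw [opProd, List.ofFn_succ_last, List.prod_append, List.prod_singleton, opProd]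

/-- The remaining product `W` is chosen before `G`, so one `W` serves all terms of a relation in
which only the first site varies. The next two lemmas do this for the last site and for a pair of
neighbours. -/
theorem exists_opProd_eq_first {R : Type*} [Monoid R] {n : ℕ} (F : Fin (n + 1) → R) :
    ∃ W, ∀ G : Fin (n + 1) → R, (∀ r, r ≠ 0 → G r = F r) → opProd G = G 0 * W := by
  refine ⟨opProd fun r => F r.succ, fun G hG => ?_⟩
  rw [opProd_succ]
  congr 2
  ext r
  exact hG _ r.succ_ne_zero

theorem exists_opProd_eq_last {R : Type*} [Monoid R] {n : ℕ} (F : Fin (n + 1) → R) :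
    ∃ U, ∀ G : Fin (n + 1) → R, (∀ r, r ≠ Fin.last n → G r = F r) →
      opProd G = U * G (Fin.last n) := by
  refine ⟨opProd fun r => F r.castSucc, fun G hG => ?_⟩
  rw [opProd_succ_last]
  congr 2
  ext r
  exact hG _ r.castSucc_ne_last

theorem exists_opProd_eq_mid {R : Type*} [Monoid R] {n : ℕ} (F : Fin (n + 1) → R) (j : Fin n) :
    ∃ U W, ∀ G : Fin (n + 1) → R, (∀ r, r ≠ j.castSucc → r ≠ j.succ → G r = F r) →
      opProd G = U * (G j.castSucc * G j.succ) * W := by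
  induction n with
  | zero => exact j.elim0
  | succ n ih =>
    rcases Fin.eq_zero_or_eq_succ j with rfl | ⟨j, rfl⟩
    · refine ⟨1, opProd fun r : Fin n => F r.succ.succ, fun G hG => ?_⟩
      rw [opProd_succ, opProd_succ, one_mul, mul_assoc]
      congr 3
      ext r
      refine hG _ (by simp) ?_
      simp [Fin.ext_iff]
    · obtain ⟨U, W, h⟩ := ih (fun r => F r.succ) j
      refine ⟨F 0 * U, W, fun G hG => ?_⟩
      rw [opProd_succ, h (fun r => G r.succ) fun r h1 h2 => hG _ ?_ ?_, hG 0 ?_ ?_,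
        Fin.succ_castSucc]
      · simp only [mul_assoc]
      · rw [← Fin.succ_castSucc]
        exact (Fin.succ_ne_zero _).symm
      · exact (Fin.succ_ne_zero _).symm
      · rw [← Fin.succ_castSucc]
        simpa using h1
      · simpa using h2

/-- The product of the 3d R's with all matrix elements in the first two tensor factors fixed. -/
def siteProd (q : 𝕜) {n : ℕ} (a b : Fin n → ℤ) (i j : Fin n → ℕ) : Module.End 𝕜 (ℕ → 𝕜) :=
  opProd fun r => site q (a r) (b r) (i r) (j r)

/-- The boundary vector `|χ_t(1)⟩ = ∑_m |tm⟩ / (q^{t²})_m`. -/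
def boundaryKet (q : 𝕜) (t : ℕ) (d : ℕ) : 𝕜 :=
  if t ∣ d then (qPoch (q ^ t ^ 2) (d / t))⁻¹ else 0

/-- The boundary covector `⟨χ_s(z)|`. -/
def boundaryBra (q : 𝕜) (s : ℕ) : (ℕ → 𝕜) →ₗ[𝕜] PowerSeries 𝕜 where
  toFun v := PowerSeries.mk fun c =>
    qPoch (q ^ 2) (s * c) / qPoch (q ^ s ^ 2) c * v (s * c)
  map_add' v w := by ext c; simp [mul_add]
  map_smul' x v := by ext c; simp [mul_left_comm]

theorem coeff_boundaryBra (q : 𝕜) (s : ℕ) (v : ℕ → 𝕜) (c : ℕ) :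
    PowerSeries.coeff c (boundaryBra q s v) =
      qPoch (q ^ 2) (s * c) / qPoch (q ^ s ^ 2) c * v (s * c) :=
  PowerSeries.coeff_mk c fun c => qPoch (q ^ 2) (s * c) / qPoch (q ^ s ^ 2) c * v (s * c)

/-- The matrix elements between the boundary vectors, for integral output indices. -/
def bareZ (q : 𝕜) {n : ℕ} (s t : ℕ) (a b : Fin n → ℤ) (i j : Fin n → ℕ) : PowerSeries 𝕜 :=
  boundaryBra q s (siteProd q a b i j (boundaryKet q t))

theorem site_natCast_apply (q : 𝕜) (a b i j c : ℕ) (v : ℕ → 𝕜) :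
    site q a b i j v c = threeDR q a b c i j (b + c - j) * v (b + c - j) := by
  rw [site_apply i j (Nat.lt_succ_self _)]
  have h : b + c - j ∈ Finset.range ((b : ℤ).toNat + c + 1) := by
    rw [Finset.mem_range]
    omega
  rw [Finset.sum_eq_single_of_mem _ h, tdr_natCast]
  intro k _ hk
  rw [tdr_weight (by omega), zero_mul]

/-- The conservation law at the first site determines the intermediate index, c₁ = b₁ + d - j₁. The
sum therefore reduces to tuples beginning with this value, the first site splits off, and induction
on the length applies. -/
theorem finsum_chain (q : 𝕜) {t : ℕ} (ht : t ≠ 0) {N : ℕ} (a b i j : Fin (N + 1) → ℕ) (d : ℕ) :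
    ∑ᶠ c : Fin (N + 1) → ℕ, (qPoch (q ^ t ^ 2) (c (Fin.last N)))⁻¹ *
      ∏ r : Fin (N + 1), threeDR q (a r) (b r)
        ((Fin.cons d (fun r' : Fin N => c r'.castSucc) : Fin (N + 1) → ℕ) r) (i r) (j r)
        ((Fin.snoc (fun r' : Fin N => c r'.castSucc) (t * c (Fin.last N)) :
          Fin (N + 1) → ℕ) r) =
      siteProd q (fun r => a r) (fun r => b r) i j (boundaryKet q t) d := by
  induction N generalizing d with
  | zero =>
    have hs : siteProd q (fun r => (a r : ℤ)) (fun r => (b r : ℤ)) i j =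
        site q (a 0) (b 0) (i 0) (j 0) := by
      simp [siteProd, opProd]
    rw [hs, site_natCast_apply]
    have hs1 (k : ℕ) (hk : k ≠ b 0 + d - j 0) : threeDR q (a 0) (b 0) d (i 0) (j 0) k = 0 := by
      rw [threeDR, if_neg (by omega)]
    by_cases h : t ∣ b 0 + d - j 0
    · obtain ⟨k, hk⟩ := h
      rw [finsum_eq_single _ (fun _ => k)]
      · rw [hk, boundaryKet, if_pos (dvd_mul_right _ _),
          Nat.mul_div_cancel_left _ (Nat.pos_of_ne_zero ht)]
        simp [Fin.snoc, mul_comm]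
      · intro c hc
        have hck : c 0 ≠ k := fun h => hc (by ext r; rw [← h, Fin.eq_zero r])
        simp only [Fin.prod_univ_succ, Fin.prod_univ_zero, mul_one, Fin.cons_zero]
        refine mul_eq_zero_of_right _ (hs1 _ ?_)
        simp [Fin.snoc, hk, ht, hck]
    · rw [boundaryKet, if_neg h, mul_zero]
      refine finsum_eq_zero_of_forall_eq_zero fun c => ?_
      simp only [Fin.prod_univ_succ, Fin.prod_univ_zero, mul_one, Fin.cons_zero]
      refine mul_eq_zero_of_right _ (hs1 _ fun hc => h ?_)
      rw [← hc]
      simp [Fin.snoc]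
  | succ N ih =>
    have hs : siteProd q (fun r => (a r : ℤ)) (fun r => (b r : ℤ)) i j =
        site q (a 0) (b 0) (i 0) (j 0) * siteProd q (fun r => (a (Fin.succ r) : ℤ))
          (fun r => (b (Fin.succ r) : ℤ)) (fun r => i (Fin.succ r)) (fun r => j (Fin.succ r)) := by
      rw [siteProd, opProd_succ]
      rfl
    set k := b 0 + d - j 0 with hk
    -- The remaining sum is embedded into the full one by prefixing the forced index `k`; outside
    -- the image the first 3d R vanishes.
    rw [hs, Module.End.mul_apply, site_natCast_apply, ← ih, mul_finsum,
      finsum_eq_finsum_comp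
        (g := fun c : Fin (N + 1) → ℕ => (Fin.cons k c : Fin (N + 2) → ℕ))]
    · refine finsum_congr fun c => ?_
      rw [Fin.prod_univ_succ]
      have h0 : (Fin.snoc (fun r' : Fin (N + 1) => (Fin.cons k c : Fin (N + 2) → ℕ) r'.castSucc)
          (t * (Fin.cons k c : Fin (N + 2) → ℕ) (Fin.last (N + 1))) : Fin (N + 2) → ℕ) 0 = k := by
        rw [← Fin.castSucc_zero, Fin.snoc_castSucc]
        rfl
      have h1 (r : Fin (N + 1)) : (Fin.snoc (fun r' : Fin (N + 1) =>
          (Fin.cons k c : Fin (N + 2) → ℕ) r'.castSucc)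
          (t * (Fin.cons k c : Fin (N + 2) → ℕ) (Fin.last (N + 1))) : Fin (N + 2) → ℕ) r.succ =
            (Fin.snoc (fun r' : Fin N => c r'.castSucc) (t * c (Fin.last N)) :
              Fin (N + 1) → ℕ) r := by
        refine Fin.lastCases ?_ (fun r => ?_) r
        · rw [Fin.succ_last, Fin.snoc_last, Fin.snoc_last, ← Fin.succ_last, Fin.cons_succ]
        · rw [Fin.succ_castSucc, Fin.snoc_castSucc, Fin.snoc_castSucc, ← Fin.succ_castSucc,
            Fin.cons_succ]
      have h2 (r : Fin (N + 1)) : (Fin.cons k c : Fin (N + 2) → ℕ) r.castSucc =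
          (Fin.cons k (fun r' : Fin N => c r'.castSucc) : Fin (N + 1) → ℕ) r := by
        refine Fin.cases ?_ (fun r => ?_) r
        · rfl
        · rw [← Fin.succ_castSucc, Fin.cons_succ, Fin.cons_succ]
      have h3 : (Fin.cons k c : Fin (N + 2) → ℕ) (Fin.last (N + 1)) = c (Fin.last N) := by
        rw [← Fin.succ_last, Fin.cons_succ]
      simp only [h0, h1, Fin.cons_zero, Fin.cons_succ]
      simp only [h2, ← hk]
      rw [h3]
      ring
    · exact Fin.cons_right_injective (α := fun _ => ℕ) k
    · intro c hc
      refine mul_eq_zero_of_right _ (Finset.prod_eq_zero (Finset.mem_univ 0) ?_)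
      have h0 : (Fin.snoc (fun r' : Fin (N + 1) => c r'.castSucc) (t * c (Fin.last (N + 1))) :
          Fin (N + 2) → ℕ) 0 = c 0 := by
        rw [← Fin.castSucc_zero, Fin.snoc_castSucc]
      rw [h0, Fin.cons_zero, threeDR, if_neg]
      intro hw
      refine hc ⟨Fin.tail c, ?_⟩
      rw [show k = c 0 by omega]
      exact Fin.cons_self_tail c

theorem bareS_eq_bareZ (q : 𝕜) {N : ℕ} (s : ℕ) {t : ℕ} (ht : t ≠ 0) (a b i j : Fin (N + 1) → ℕ) :
    bareS q s t a b i j = bareZ q s t (fun r => a r) (fun r => b r) i j := by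
  ext c₀
  rw [bareS, PowerSeries.coeff_mk, bareZ, coeff_boundaryBra, ← finsum_chain q ht, mul_finsum]
  refine finsum_congr fun c => ?_
  rw [← div_div, div_eq_mul_inv _ (qPoch _ (c _)), mul_assoc]

end Chain

/-! ### Relations at the two ends and between neighbouring sites -/

namespace IsSite

variable {𝕜 𝒜 : Type*} [Field 𝕜] [Ring 𝒜] [Algebra 𝕜 𝒜] {q : 𝕜} {A B K : 𝒜}
  {M : ℤ → ℤ → ℕ → ℕ → 𝒜}

section Last

variable {P : 𝒜}

/-- `P` stands for the right boundary vector, on which `hA` and `hB` express A and B through K. The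
two right-multiplication relations are added so that the terms containing K cancel. -/
theorem last_one_raise (h : IsSite q A B K M) (hA : A * P = P - K * P)
    (hB : B * P = P + q • (K * P)) (a b : ℤ) (i j : ℕ) :
    M a (b - 1) i j * P + q ^ b • (M (a - 1) b i j * P) =
      M a b (i + 1) j * P + q ^ i • (M a b i (j + 1) * P) := by
  have h1 := congrArg (· * P) (h.left_raise_b i j a b)
  have h2 := congrArg (· * P) (h.left_raise_a i j a b)
  simp only [sub_mul, add_mul, smul_mul_assoc, mul_assoc, hA, hB, mul_sub, mul_add,
    mul_smul_comm] at h1 h2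
  linear_combination (norm := skip) h1 + h2
  match_scalars <;> ring

theorem last_one_lower (h : IsSite q A B K M) (hA : A * P = P - K * P)
    (hB : B * P = P + q • (K * P)) (a b : ℤ) (i j : ℕ) :
    (1 - (q * q ^ b) ^ 2) • (M a (b + 1) i j * P) -
        (q * q ^ b * (1 - (q * q ^ a) ^ 2)) • (M (a + 1) b i j * P) =
      (1 - (q ^ i) ^ 2) • (M a b (i - 1) j * P) -
        (q * q ^ i * (1 - (q ^ j) ^ 2)) • (M a b i (j - 1) * P) := by
  have h1 := congrArg (· * P) (h.left_lower_b i j a b)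
  have h2 := congrArg (· * P) (h.left_lower_a i j a b)
  simp only [sub_mul, add_mul, smul_mul_assoc, mul_assoc, hA, hB, mul_sub, mul_add,
    mul_smul_comm] at h1 h2
  linear_combination (norm := skip) h1 - q • h2
  match_scalars <;> ring

/-- For t = 2 only B P = A P is available, so the right-multiplication relations are applied twice.
The quadratic words that arise reduce by A A P = P - K K P and B K P = q² A K P, both consequences
of the oscillator relations. -/
theorem last_two_raise (h : IsSite q A B K M) (hP : B * P = A * P) (a b : ℤ) (i j : ℕ) :
    M a (b - 2) i j * P + (q ^ b) ^ 2 • (M (a - 2) b i j * P) =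
      M a b (i + 2) j * P + (q ^ i) ^ 2 • (M a b i (j + 2) * P) := by
  have hq := h.ne_zero
  have ho := h.osc
  have eb : b - 2 = b - 1 - 1 := by ring
  have ea : a - 2 = a - 1 - 1 := by ring
  have h1 := congrArg (· * P) (h.left_raise_b i j a (b - 1))
  have h2 := congrArg (· * (A * P)) (h.left_raise_b (i + 1) j a b)
  have h3 := congrArg (· * (K * P)) (h.left_raise_b i (j + 1) a b)
  have h4 := congrArg (· * P) (h.left_raise_a i j (a - 1) b)
  have h5 := congrArg (· * (K * P)) (h.left_raise_a (i + 1) j a b)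
  have h6 := congrArg (· * (A * P)) (h.left_raise_a i (j + 1) a b)
  have hAA : A * (A * P) = P - K * (K * P) := by rw [← hP, ho.A_B_assoc]
  have hBK : B * (K * P) = q ^ 2 • (A * (K * P)) := by
    have h7 := ho.K_B_assoc P
    rw [hP, ho.K_A_assoc] at h7
    rw [pow_two, mul_smul, h7, smul_smul, mul_inv_cancel₀ hq, one_smul]
  rw [eb, ea]
  simp only [sub_mul, add_mul, smul_mul_assoc, mul_assoc, mul_sub, hP, hAA, hBK, mul_smul_comm,
    ho.K_A_assoc, ho.B_A_assoc] at h1 h2 h3 h4 h5 h6 ⊢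
  linear_combination (norm := skip) h1 + h2 - (q * q ^ i) • h3 + q ^ b • h4 + h5 + q ^ i • h6
  match_scalars <;> ring

theorem last_two_lower (h : IsSite q A B K M) (hP : B * P = A * P) (a b : ℤ) (i j : ℕ) :
    ((1 - (q * q ^ b) ^ 2) * (1 - (q ^ 2 * q ^ b) ^ 2)) • (M a (b + 2) i j * P) +
        ((q * q ^ b) ^ 2 * ((1 - (q * q ^ a) ^ 2) * (1 - (q ^ 2 * q ^ a) ^ 2))) •
          (M (a + 2) b i j * P) =
      ((1 - (q ^ i) ^ 2) * (1 - (q ^ (i - 1)) ^ 2)) • (M a b (i - 2) j * P) +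
        ((q * q ^ i) ^ 2 * ((1 - (q ^ j) ^ 2) * (1 - (q ^ (j - 1)) ^ 2))) •
          (M a b i (j - 2) * P) := by
  have hq := h.ne_zero
  have ho := h.osc
  have eb : b + 2 = b + 1 + 1 := by ring
  have ea : a + 2 = a + 1 + 1 := by ring
  have ei : i - 2 = i - 1 - 1 := rfl
  have ej : j - 2 = j - 1 - 1 := rfl
  have h1 := congrArg (· * P) (h.left_lower_b i j a (b + 1))
  have h2 := congrArg (· * (A * P)) (h.left_lower_b (i - 1) j a b)
  have h3 := congrArg (· * (K * P)) (h.left_lower_b i (j - 1) a b)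
  have h4 := congrArg (· * P) (h.left_lower_a i j (a + 1) b)
  have h5 := congrArg (· * (K * P)) (h.left_lower_a (i - 1) j a b)
  have h6 := congrArg (· * (A * P)) (h.left_lower_a i (j - 1) a b)
  have hAA : A * (A * P) = P - K * (K * P) := by rw [← hP, ho.A_B_assoc]
  have hBK : B * (K * P) = q ^ 2 • (A * (K * P)) := by
    have h7 := ho.K_B_assoc P
    rw [hP, ho.K_A_assoc] at h7
    rw [pow_two, mul_smul, h7, smul_smul, mul_inv_cancel₀ hq, one_smul]
  rw [eb, ea, ei, ej]
  simp only [sub_mul, add_mul, smul_mul_assoc, mul_assoc, mul_sub, hP, hAA, hBK, mul_smul_comm,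
    ho.K_A_assoc, ho.B_A_assoc, zpow_add₀ hq, zpow_one] at h1 h2 h3 h4 h5 h6 ⊢
  linear_combination (norm := skip) (1 - (q * q ^ b) ^ 2) • h1 + (1 - (q ^ i) ^ 2) • h2
    - (q * q ^ i * (1 - (q ^ j) ^ 2)) • h3
    + q ^ 2 • ((q ^ b * (1 - (q * q ^ a) ^ 2)) • h4 + (1 - (q ^ i) ^ 2) • h5 +
      (q ^ i * (1 - (q ^ j) ^ 2)) • h6)
  rcases i with _ | i
  · match_scalars <;> ring
  · rw [Nat.add_sub_cancel]
    match_scalars <;> ring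

end Last

section First

variable {Y : Type*} [CommRing Y] [Algebra 𝕜 Y] {φ : 𝒜 →ₗ[𝕜] Y} {z : Y}

/-- `φ` stands for the left boundary covector applied to the rest of the chain. Its values are power
series, so its relation with B is only available after multiplication by z. -/
theorem first_one_raise (h : IsSite q A B K M) (hA : ∀ x, φ (A * x) = z * φ x + q • (z * φ (K * x)))
    (hB : ∀ x, z * φ (B * x) = φ x - φ (K * x)) (a b : ℤ) (i j : ℕ) :
    z * φ (M (a - 1) b i j) - (q * q ^ a) • φ (M a (b - 1) i j) =
      φ (M a b i (j + 1)) - (q * q ^ j) • (z * φ (M a b (i + 1) j)) := by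
  have h1 := congrArg φ (h.raise_j a b i j)
  have h2 := congrArg (z * φ ·) (h.raise_i a b i j)
  simp only [map_sub, map_add, map_smul, hA, hB, mul_add, mul_smul_comm] at h1 h2
  linear_combination (norm := skip) q • h2 - h1
  match_scalars <;> ring

theorem first_one_lower (h : IsSite q A B K M) (hA : ∀ x, φ (A * x) = z * φ x + q • (z * φ (K * x)))
    (hB : ∀ x, z * φ (B * x) = φ x - φ (K * x)) (a b : ℤ) (i j : ℕ) :
    (q ^ a * (1 - (q * q ^ b) ^ 2)) • (z * φ (M a (b + 1) i j)) +
        (1 - (q * q ^ a) ^ 2) • φ (M (a + 1) b i j) =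
      (q ^ j * (1 - (q ^ i) ^ 2)) • φ (M a b (i - 1) j) +
        (1 - (q ^ j) ^ 2) • (z * φ (M a b i (j - 1))) := by
  have h1 := congrArg φ (h.right_lower_i i j a b)
  have h2 := congrArg (z * φ ·) (h.right_lower_j i j a b)
  simp only [map_sub, map_add, map_smul, hA, hB, mul_sub, mul_smul_comm] at h1 h2
  linear_combination (norm := skip) - h1 - h2
  match_scalars <;> ring

/-- As at the right end, the recursions are applied twice. The hypothesis trades zφ(B x) for φ(A x),
and it is used for x beginning with each of A, K and B. -/
theorem first_two_raise (h : IsSite q A B K M) (hφ : ∀ x, z * φ (B * x) = φ (A * x))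
    (a b : ℤ) (i j : ℕ) :
    z * φ (M (a - 2) b i j) + (q * q ^ a) ^ 2 • φ (M a (b - 2) i j) =
      φ (M a b i (j + 2)) + (q * q ^ j) ^ 2 • (z * φ (M a b (i + 2) j)) := by
  have hq := h.ne_zero
  have ho := h.osc
  have eb : b - 2 = b - 1 - 1 := by ring
  have ea : a - 2 = a - 1 - 1 := by ring
  have h1 := congrArg φ (h.raise_j a b i (j + 1))
  have h2 := congrArg (fun x => φ (A * x)) (h.raise_j (a - 1) b i j)
  have h3 := congrArg (fun x => φ (K * x)) (h.raise_j a (b - 1) i j)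
  have h4 := congrArg (z * φ ·) (h.raise_i a b (i + 1) j)
  have h5 := congrArg (fun x => z * φ (K * x)) (h.raise_i (a - 1) b i j)
  have h6 := congrArg (fun x => z * φ (B * x)) (h.raise_i a (b - 1) i j)
  have h7 := hφ (A * M (a - 1 - 1) b i j)
  have h8 := hφ (K * M (a - 1) (b - 1) i j)
  have h9 := hφ (B * M a (b - 1 - 1) i j)
  rw [eb, ea]
  simp only [map_sub, map_add, map_smul, mul_add, mul_sub, mul_smul_comm, ho.K_A_assoc,
    ho.K_B_assoc, ho.A_B_assoc, ho.B_A_assoc, zpow_sub₀ hq, zpow_one]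
    at h1 h2 h3 h4 h5 h6 h7 h8 h9 ⊢
  linear_combination (norm := skip) - h1 - h2 + (q * q ^ a) • h3
    - q ^ 2 • (q ^ j • h4 + h5 + q ^ a • h6) + h7 - ((1 + q ^ 2) * q ^ a) • h8
    - (q * q ^ a) ^ 2 • h9
  match_scalars <;> field_simp <;> ring

theorem first_two_lower (h : IsSite q A B K M) (hφ : ∀ x, z * φ (B * x) = φ (A * x))
    (a b : ℤ) (i j : ℕ) :
    ((q ^ a) ^ 2 * ((1 - (q * q ^ b) ^ 2) * (1 - (q ^ 2 * q ^ b) ^ 2))) •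
        (z * φ (M a (b + 2) i j)) +
      ((1 - (q * q ^ a) ^ 2) * (1 - (q ^ 2 * q ^ a) ^ 2)) • φ (M (a + 2) b i j) =
      ((q ^ j) ^ 2 * ((1 - (q ^ i) ^ 2) * (1 - (q ^ (i - 1)) ^ 2))) • φ (M a b (i - 2) j) +
        ((1 - (q ^ j) ^ 2) * (1 - (q ^ (j - 1)) ^ 2)) • (z * φ (M a b i (j - 2))) := by
  have hq := h.ne_zero
  have ho := h.osc
  have eb : b + 2 = b + 1 + 1 := by ring
  have ea : a + 2 = a + 1 + 1 := by ring
  have ei : i - 2 = i - 1 - 1 := rfl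
  have ej : j - 2 = j - 1 - 1 := rfl
  have h1 := congrArg φ (h.right_lower_i (i - 1) j a b)
  have h2 := congrArg (fun x => φ (K * x)) (h.right_lower_i i j (a + 1) b)
  have h3 := congrArg (fun x => φ (A * x)) (h.right_lower_i i j a (b + 1))
  have h4 := congrArg (z * φ ·) (h.right_lower_j i (j - 1) a b)
  have h5 := congrArg (fun x => z * φ (B * x)) (h.right_lower_j i j (a + 1) b)
  have h6 := congrArg (fun x => z * φ (K * x)) (h.right_lower_j i j a (b + 1))
  have h7 := hφ (B * M (a + 1 + 1) b i j)
  have h8 := hφ (K * M (a + 1) (b + 1) i j)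
  have h9 := hφ (A * M a (b + 1 + 1) i j)
  rw [eb, ea, ei, ej]
  simp only [map_sub, map_add, map_smul, mul_add, mul_sub, mul_smul_comm, ho.K_A_assoc,
    ho.K_B_assoc, ho.A_B_assoc, ho.B_A_assoc, zpow_add₀ hq, zpow_one]
    at h1 h2 h3 h4 h5 h6 h7 h8 h9 ⊢
  linear_combination (norm := skip) - (q ^ j * (1 - (q ^ i) ^ 2)) • h1
    - (1 - (q * q ^ a) ^ 2) • h2 - (q ^ a * (1 - (q * q ^ b) ^ 2)) • h3
    - (1 - (q ^ j) ^ 2) • h4 - (1 - (q * q ^ a) ^ 2) • h5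
    + (q * q ^ a * (1 - (q * q ^ b) ^ 2)) • h6
    - ((1 - (q * q ^ a) ^ 2) * (1 - (q ^ 2 * q ^ a) ^ 2)) • h7
    + ((1 - (q * q ^ a) ^ 2) * (1 - (q * q ^ b) ^ 2) * (1 + q ^ 2) * q ^ a) • h8
    + ((q ^ a) ^ 2 * ((1 - (q * q ^ b) ^ 2) * (1 - (q ^ 2 * q ^ b) ^ 2))) • h9
  match_scalars <;> field_simp <;> ring

end First

section Mid

variable {M' : ℤ → ℤ → ℕ → ℕ → 𝒜}

/-- The lowering relations of the first site put A, B, K between the two factors from one side, the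
recursions of the second site put them there from the other. In the chosen combination all these
intermediate terms cancel; `mid_left` exchanges raising and lowering. -/
theorem mid_right (h : IsSite q A B K M) (h' : IsSite q A B K M') (a b a' b' : ℤ)
    (i j i' j' : ℕ) :
    (q ^ b * (1 - (q * q ^ a) ^ 2)) • (M (a + 1) b i j * M' (a' - 1) b' i' j') +
        (q ^ a' * (1 - (q * q ^ b) ^ 2)) • (M a (b + 1) i j * M' a' (b' - 1) i' j') =
      (q ^ j' * (1 - (q ^ i) ^ 2)) • (M a b (i - 1) j * M' a' b' (i' + 1) j') +
        (q ^ i * (1 - (q ^ j) ^ 2)) • (M a b i (j - 1) * M' a' b' i' (j' + 1)) := by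
  have h1 := congrArg (· * M' (a' - 1) b' i' j') (h.left_lower_a i j a b)
  have h2 := congrArg (· * M' a' (b' - 1) i' j') (h.left_lower_b i j a b)
  have h3 := congrArg (M a b (i - 1) j * ·) (h'.raise_i a' b' i' j')
  have h4 := congrArg (M a b i (j - 1) * ·) (h'.raise_j a' b' i' j')
  simp only [sub_mul, add_mul, smul_mul_assoc, mul_assoc, mul_sub, mul_add, mul_smul_comm]
    at h1 h2 h3 h4 ⊢
  linear_combination (norm := skip) h1 + q ^ a' • h2 - (1 - (q ^ i) ^ 2) • h3
    - (q ^ i * (1 - (q ^ j) ^ 2)) • h4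
  match_scalars <;> ring

theorem mid_left (h : IsSite q A B K M) (h' : IsSite q A B K M') (a b a' b' : ℤ)
    (i j i' j' : ℕ) :
    (q ^ a' * (1 - (q * q ^ b') ^ 2)) • (M a (b - 1) i j * M' a' (b' + 1) i' j') +
        (q ^ b * (1 - (q * q ^ a') ^ 2)) • (M (a - 1) b i j * M' (a' + 1) b' i' j') =
      (q ^ j' * (1 - (q ^ i') ^ 2)) • (M a b (i + 1) j * M' a' b' (i' - 1) j') +
        (q ^ i * (1 - (q ^ j') ^ 2)) • (M a b i (j + 1) * M' a' b' i' (j' - 1)) := by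
  have h1 := congrArg (· * M' a' (b' + 1) i' j') (h.left_raise_b i j a b)
  have h2 := congrArg (· * M' (a' + 1) b' i' j') (h.left_raise_a i j a b)
  have h3 := congrArg (M a b (i + 1) j * ·) (h'.right_lower_i i' j' a' b')
  have h4 := congrArg (M a b i (j + 1) * ·) (h'.right_lower_j i' j' a' b')
  simp only [sub_mul, add_mul, smul_mul_assoc, mul_assoc, mul_sub, mul_add, mul_smul_comm]
    at h1 h2 h3 h4 ⊢
  linear_combination (norm := skip) (q ^ a' * (1 - (q * q ^ b') ^ 2)) • h1
    + (1 - (q * q ^ a') ^ 2) • h2 - h3 - q ^ i • h4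
  match_scalars <;> ring

end Mid

end IsSite

/-! ### Eigenvector-type relations of the boundary vectors -/

section Boundary

variable {𝕜 : Type*} [Field 𝕜] {q : 𝕜}

/-- In components this is 1/(q)_{c-1} = (1 - q^c)/(q)_c. -/
theorem oscA_boundaryKet_one (hq : ∀ m : ℕ, m ≠ 0 → q ^ m ≠ 1) :
    oscA 𝕜 (boundaryKet q 1) = boundaryKet q 1 - oscK q (boundaryKet q 1) := by
  ext c
  rcases c with _ | c
  · simp [oscA, oscK]
  · have h1 := qPoch_ne_zero hq c
    have h2 : 1 - q ^ (c + 1) ≠ 0 := sub_ne_zero.2 (hq _ c.succ_ne_zero).symm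
    simp [oscA, oscK, boundaryKet, qPoch_succ]
    field_simp

theorem oscB_boundaryKet_one (hq : ∀ m : ℕ, m ≠ 0 → q ^ m ≠ 1) :
    oscB q (boundaryKet q 1) = boundaryKet q 1 + q • oscK q (boundaryKet q 1) := by
  ext c
  have h1 := qPoch_ne_zero hq c
  have h2 : 1 - q ^ (c + 1) ≠ 0 := sub_ne_zero.2 (hq _ c.succ_ne_zero).symm
  simp [oscB, oscK, boundaryKet, qPoch_succ]
  field_simp
  ring

/-- Both sides live on odd levels, where the claim is (1 - q^{4k+4})/(q⁴)_{k+1} = 1/(q⁴)_k. -/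
theorem oscB_boundaryKet_two (hq : ∀ m : ℕ, m ≠ 0 → q ^ m ≠ 1) :
    oscB q (boundaryKet q 2) = oscA 𝕜 (boundaryKet q 2) := by
  ext c
  rcases Nat.even_or_odd' c with ⟨k, rfl | rfl⟩
  · have h1 : ¬ 2 ∣ 2 * k + 1 := by omega
    have h2 : 2 * k ≠ 0 → ¬ 2 ∣ 2 * k - 1 := by omega
    simp only [oscA, oscB, boundaryKet, LinearMap.coe_mk, AddHom.coe_mk, if_neg h1, mul_zero]
    split_ifs <;> simp_all
  · have h1 := qPoch_ne_zero (b := q ^ 4) (fun m hm => by rw [← pow_mul]; exact hq _ (by omega)) k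
    have h2 : 1 - (q ^ 4) ^ (k + 1) ≠ 0 := by
      rw [← pow_mul]
      exact sub_ne_zero.2 (hq _ (by omega)).symm
    have h3 : (2 * k + 1 + 1) / 2 = k + 1 := by omega
    have h4 : 2 ∣ 2 * k + 1 + 1 := by omega
    simp only [oscA, oscB, boundaryKet, LinearMap.coe_mk, AddHom.coe_mk, if_pos h4, h3, qPoch_succ,
      Nat.add_sub_cancel, if_neg (Nat.succ_ne_zero _), dvd_mul_right, if_true,
      Nat.mul_div_cancel_left k two_pos]
    norm_num
    field_simp
    ring

/-- Raising the level shifts the power of z by one, and the weight (q²)_c/(q)_c grows by the factor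
1 + q^{c+1}. -/
theorem boundaryBra_one_oscA (hq : ∀ m : ℕ, m ≠ 0 → q ^ m ≠ 1) (v : ℕ → 𝕜) :
    boundaryBra q 1 (oscA 𝕜 v) =
      PowerSeries.X * boundaryBra q 1 v + q • (PowerSeries.X * boundaryBra q 1 (oscK q v)) := by
  ext c
  rcases c with _ | c
  · simp [coeff_boundaryBra, oscA]
  · have h1 := qPoch_ne_zero hq c
    have h2 : 1 - q ^ (c + 1) ≠ 0 := sub_ne_zero.2 (hq _ c.succ_ne_zero).symm
    simp only [map_add, coeff_boundaryBra, PowerSeries.coeff_succ_X_mul, map_smul]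
    simp [oscA, oscK, qPoch_succ]
    field_simp
    ring

theorem boundaryBra_one_oscB (hq : ∀ m : ℕ, m ≠ 0 → q ^ m ≠ 1) (v : ℕ → 𝕜) :
    PowerSeries.X * boundaryBra q 1 (oscB q v) =
      boundaryBra q 1 v - boundaryBra q 1 (oscK q v) := by
  ext c
  rcases c with _ | c
  · rw [PowerSeries.coeff_zero_X_mul, map_sub, coeff_boundaryBra, coeff_boundaryBra]
    simp [oscK]
  · have h1 := qPoch_ne_zero hq c
    have h2 : 1 - q ^ (c + 1) ≠ 0 := sub_ne_zero.2 (hq _ c.succ_ne_zero).symm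
    simp only [map_sub, coeff_boundaryBra, PowerSeries.coeff_succ_X_mul]
    simp [oscB, oscK, qPoch_succ]
    field_simp

theorem boundaryBra_two_oscB (hq : ∀ m : ℕ, m ≠ 0 → q ^ m ≠ 1) (v : ℕ → 𝕜) :
    PowerSeries.X * boundaryBra q 2 (oscB q v) = boundaryBra q 2 (oscA 𝕜 v) := by
  ext c
  rcases c with _ | c
  · simp [coeff_boundaryBra, oscA]
  · have h1 := qPoch_ne_zero (b := q ^ 4) (fun m hm => by rw [← pow_mul]; exact hq _ (by omega)) c
    have h2 : 1 - (q ^ 4) ^ (c + 1) ≠ 0 := by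
      rw [← pow_mul]
      exact sub_ne_zero.2 (hq _ (by omega)).symm
    have h3 : 2 * (c + 1) = 2 * c + 1 + 1 := by ring
    simp only [coeff_boundaryBra, PowerSeries.coeff_succ_X_mul, h3]
    simp [oscA, oscB, qPoch_succ]
    field_simp
    ring

end Boundary

/-! ### Relations among the matrix elements of the chain -/

section Relations

variable {𝕜 : Type*} [Field 𝕜] {q : 𝕜}

/-- The operator `v ↦ v 0 • χ`. -/
def rankOne (χ : ℕ → 𝕜) : Module.End 𝕜 (ℕ → 𝕜) := (LinearMap.proj 0).smulRight χ

/-- Turning the boundary vector into an operator lets it serve as the algebra element `P` of the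
relations at the last site; evaluation at the constant sequence 1 recovers the vector. -/
theorem rankOne_one (χ : ℕ → 𝕜) : rankOne χ (fun _ => 1) = χ := by
  simp [rankOne]

theorem mul_rankOne (T : Module.End 𝕜 (ℕ → 𝕜)) (χ : ℕ → 𝕜) : T * rankOne χ = rankOne (T χ) := by
  ext v c
  simp [rankOne]

theorem rankOne_add (χ ψ : ℕ → 𝕜) : rankOne (χ + ψ) = rankOne χ + rankOne ψ := by
  ext v c
  simp [rankOne, mul_add]

theorem rankOne_sub (χ ψ : ℕ → 𝕜) : rankOne (χ - ψ) = rankOne χ - rankOne ψ := by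
  ext v c
  simp [rankOne, mul_sub]

theorem rankOne_smul (x : 𝕜) (χ : ℕ → 𝕜) : rankOne (x • χ) = x • rankOne χ := by
  ext v c
  simp [rankOne, mul_left_comm]

/-- The integral unit vector. -/
def zvec {n : ℕ} (r : Fin n) : Fin n → ℤ := Pi.single r 1

theorem zvec_same {n : ℕ} (r : Fin n) : zvec r r = 1 := by simp [zvec]

theorem zvec_of_ne {n : ℕ} {r r' : Fin n} (h : r' ≠ r) : zvec r r' = 0 := by simp [zvec, h]

theorem unitVec_same {n : ℕ} (r : Fin n) : unitVec r r = 1 := by simp [unitVec]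

theorem unitVec_of_ne {n : ℕ} {r r' : Fin n} (h : r' ≠ r) : unitVec r r' = 0 := by
  simp [unitVec, h]

variable {N : ℕ}

theorem bareZ_last_one_raise (h0 : q ≠ 0) (hq : ∀ m : ℕ, m ≠ 0 → q ^ m ≠ 1) (s : ℕ)
    (a b : Fin (N + 1) → ℤ) (i j : Fin (N + 1) → ℕ) :
    bareZ q s 1 a (b - zvec (Fin.last N)) i j + q ^ b (Fin.last N) • bareZ q s 1 (a - zvec (Fin.last N)) b i j =
      bareZ q s 1 a b (i + unitVec (Fin.last N)) j + q ^ i (Fin.last N) • bareZ q s 1 a b i (j + unitVec (Fin.last N)) := by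
  obtain ⟨U, hU⟩ := exists_opProd_eq_last fun r => site q (a r) (b r) (i r) (j r)
  have h := (isSite h0 hq).last_one_raise (P := rankOne (boundaryKet q 1)) (by
    rw [mul_rankOne, mul_rankOne, oscA_boundaryKet_one hq, rankOne_sub]) (by
    rw [mul_rankOne, mul_rankOne, oscB_boundaryKet_one hq, rankOne_add, rankOne_smul])
    (a (Fin.last N)) (b (Fin.last N)) (i (Fin.last N)) (j (Fin.last N))
  -- The sites before the last one enter only through `U`, so the local relation passes to the whole
  -- chain.
  have h' := congrArg (fun T => boundaryBra q s (U (T fun _ => 1))) h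
  simp only [LinearMap.add_apply, LinearMap.smul_apply, Module.End.mul_apply, map_add, map_smul,
    rankOne_one] at h'
  simp only [bareZ, siteProd]
  rw [hU (fun r => site q ((a) r) ((b - zvec (Fin.last N)) r) ((i) r) ((j) r)) fun r hr => by
    simp [zvec_of_ne hr]]
  rw [hU (fun r => site q ((a - zvec (Fin.last N)) r) ((b) r) ((i) r) ((j) r)) fun r hr => by
    simp [zvec_of_ne hr]]
  rw [hU (fun r => site q ((a) r) ((b) r) ((i + unitVec (Fin.last N)) r) ((j) r)) fun r hr => by
    simp [unitVec_of_ne hr]]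
  rw [hU (fun r => site q ((a) r) ((b) r) ((i) r) ((j + unitVec (Fin.last N)) r)) fun r hr => by
    simp [unitVec_of_ne hr]]
  simpa [zvec_same, unitVec_same] using h'

theorem bareZ_last_one_lower (h0 : q ≠ 0) (hq : ∀ m : ℕ, m ≠ 0 → q ^ m ≠ 1) (s : ℕ)
    (a b : Fin (N + 1) → ℤ) (i j : Fin (N + 1) → ℕ) :
    (1 - (q * q ^ b (Fin.last N)) ^ 2) • bareZ q s 1 a (b + zvec (Fin.last N)) i j -
        (q * q ^ b (Fin.last N) * (1 - (q * q ^ a (Fin.last N)) ^ 2)) • bareZ q s 1 (a + zvec (Fin.last N)) b i j =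
      (1 - (q ^ i (Fin.last N)) ^ 2) • bareZ q s 1 a b (i - unitVec (Fin.last N)) j -
        (q * q ^ i (Fin.last N) * (1 - (q ^ j (Fin.last N)) ^ 2)) • bareZ q s 1 a b i (j - unitVec (Fin.last N)) := by
  obtain ⟨U, hU⟩ := exists_opProd_eq_last fun r => site q (a r) (b r) (i r) (j r)
  have h := (isSite h0 hq).last_one_lower (P := rankOne (boundaryKet q 1)) (by
    rw [mul_rankOne, mul_rankOne, oscA_boundaryKet_one hq, rankOne_sub]) (by
    rw [mul_rankOne, mul_rankOne, oscB_boundaryKet_one hq, rankOne_add, rankOne_smul])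
    (a (Fin.last N)) (b (Fin.last N)) (i (Fin.last N)) (j (Fin.last N))
  have h' := congrArg (fun T => boundaryBra q s (U (T fun _ => 1))) h
  simp only [LinearMap.sub_apply, LinearMap.smul_apply, Module.End.mul_apply, map_sub, map_smul,
    rankOne_one] at h'
  simp only [bareZ, siteProd]
  rw [hU (fun r => site q ((a) r) ((b + zvec (Fin.last N)) r) ((i) r) ((j) r)) fun r hr => by
    simp [zvec_of_ne hr]]
  rw [hU (fun r => site q ((a + zvec (Fin.last N)) r) ((b) r) ((i) r) ((j) r)) fun r hr => by
    simp [zvec_of_ne hr]]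
  rw [hU (fun r => site q ((a) r) ((b) r) ((i - unitVec (Fin.last N)) r) ((j) r)) fun r hr => by
    simp [unitVec_of_ne hr]]
  rw [hU (fun r => site q ((a) r) ((b) r) ((i) r) ((j - unitVec (Fin.last N)) r)) fun r hr => by
    simp [unitVec_of_ne hr]]
  simpa [zvec_same, unitVec_same] using h'

theorem bareZ_last_two_raise (h0 : q ≠ 0) (hq : ∀ m : ℕ, m ≠ 0 → q ^ m ≠ 1) (s : ℕ)
    (a b : Fin (N + 1) → ℤ) (i j : Fin (N + 1) → ℕ) :
    bareZ q s 2 a (b - 2 • zvec (Fin.last N)) i j + (q ^ b (Fin.last N)) ^ 2 • bareZ q s 2 (a - 2 • zvec (Fin.last N)) b i j =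
      bareZ q s 2 a b (i + 2 • unitVec (Fin.last N)) j + (q ^ i (Fin.last N)) ^ 2 • bareZ q s 2 a b i (j + 2 • unitVec (Fin.last N)) := by
  obtain ⟨U, hU⟩ := exists_opProd_eq_last fun r => site q (a r) (b r) (i r) (j r)
  have h := (isSite h0 hq).last_two_raise (P := rankOne (boundaryKet q 2)) (by
    rw [mul_rankOne, mul_rankOne, oscB_boundaryKet_two hq])
    (a (Fin.last N)) (b (Fin.last N)) (i (Fin.last N)) (j (Fin.last N))
  have h' := congrArg (fun T => boundaryBra q s (U (T fun _ => 1))) h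
  simp only [LinearMap.add_apply, LinearMap.smul_apply, Module.End.mul_apply, map_add, map_smul,
    rankOne_one] at h'
  simp only [bareZ, siteProd]
  rw [hU (fun r => site q ((a) r) ((b - 2 • zvec (Fin.last N)) r) ((i) r) ((j) r)) fun r hr => by
    simp [zvec_of_ne hr]]
  rw [hU (fun r => site q ((a - 2 • zvec (Fin.last N)) r) ((b) r) ((i) r) ((j) r)) fun r hr => by
    simp [zvec_of_ne hr]]
  rw [hU (fun r => site q ((a) r) ((b) r) ((i + 2 • unitVec (Fin.last N)) r) ((j) r)) fun r hr => by
    simp [unitVec_of_ne hr]]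
  rw [hU (fun r => site q ((a) r) ((b) r) ((i) r) ((j + 2 • unitVec (Fin.last N)) r)) fun r hr => by
    simp [unitVec_of_ne hr]]
  simpa [zvec_same, unitVec_same] using h'

theorem bareZ_last_two_lower (h0 : q ≠ 0) (hq : ∀ m : ℕ, m ≠ 0 → q ^ m ≠ 1) (s : ℕ)
    (a b : Fin (N + 1) → ℤ) (i j : Fin (N + 1) → ℕ) :
    ((1 - (q * q ^ b (Fin.last N)) ^ 2) * (1 - (q ^ 2 * q ^ b (Fin.last N)) ^ 2)) • bareZ q s 2 a (b + 2 • zvec (Fin.last N)) i j +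
        ((q * q ^ b (Fin.last N)) ^ 2 * ((1 - (q * q ^ a (Fin.last N)) ^ 2) * (1 - (q ^ 2 * q ^ a (Fin.last N)) ^ 2))) •
          bareZ q s 2 (a + 2 • zvec (Fin.last N)) b i j =
      ((1 - (q ^ i (Fin.last N)) ^ 2) * (1 - (q ^ (i (Fin.last N) - 1)) ^ 2)) • bareZ q s 2 a b (i - 2 • unitVec (Fin.last N)) j +
        ((q * q ^ i (Fin.last N)) ^ 2 * ((1 - (q ^ j (Fin.last N)) ^ 2) * (1 - (q ^ (j (Fin.last N) - 1)) ^ 2))) •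
          bareZ q s 2 a b i (j - 2 • unitVec (Fin.last N)) := by
  obtain ⟨U, hU⟩ := exists_opProd_eq_last fun r => site q (a r) (b r) (i r) (j r)
  have h := (isSite h0 hq).last_two_lower (P := rankOne (boundaryKet q 2)) (by
    rw [mul_rankOne, mul_rankOne, oscB_boundaryKet_two hq])
    (a (Fin.last N)) (b (Fin.last N)) (i (Fin.last N)) (j (Fin.last N))
  have h' := congrArg (fun T => boundaryBra q s (U (T fun _ => 1))) h
  simp only [LinearMap.add_apply, LinearMap.smul_apply, Module.End.mul_apply, map_add, map_smul,
    rankOne_one] at h'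
  simp only [bareZ, siteProd]
  rw [hU (fun r => site q ((a) r) ((b + 2 • zvec (Fin.last N)) r) ((i) r) ((j) r)) fun r hr => by
    simp [zvec_of_ne hr]]
  rw [hU (fun r => site q ((a + 2 • zvec (Fin.last N)) r) ((b) r) ((i) r) ((j) r)) fun r hr => by
    simp [zvec_of_ne hr]]
  rw [hU (fun r => site q ((a) r) ((b) r) ((i - 2 • unitVec (Fin.last N)) r) ((j) r)) fun r hr => by
    simp [unitVec_of_ne hr]]
  rw [hU (fun r => site q ((a) r) ((b) r) ((i) r) ((j - 2 • unitVec (Fin.last N)) r)) fun r hr => by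
    simp [unitVec_of_ne hr]]
  simpa [zvec_same, unitVec_same] using h'

theorem bareZ_first_one_raise (h0 : q ≠ 0) (hq : ∀ m : ℕ, m ≠ 0 → q ^ m ≠ 1) (t : ℕ)
    (a b : Fin (N + 1) → ℤ) (i j : Fin (N + 1) → ℕ) :
    PowerSeries.X * bareZ q 1 t (a - zvec 0) b i j - (q * q ^ a 0) • bareZ q 1 t a (b - zvec 0) i j =
      bareZ q 1 t a b i (j + unitVec 0) - (q * q ^ j 0) • (PowerSeries.X * bareZ q 1 t a b (i + unitVec 0) j) := by
  obtain ⟨W, hW⟩ := exists_opProd_eq_first fun r => site q (a r) (b r) (i r) (j r)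
  -- The functional sends an operator to its value on the vector produced by the other sites and the
  -- right boundary, paired with the left boundary.
  have h := (isSite h0 hq).first_one_raise (z := PowerSeries.X)
    (φ := boundaryBra q 1 ∘ₗ LinearMap.applyₗ (W (boundaryKet q t))) (fun x => boundaryBra_one_oscA hq _)
    (fun x => boundaryBra_one_oscB hq _)
    (a 0) (b 0) (i 0) (j 0)
  simp only [LinearMap.comp_apply, LinearMap.applyₗ_apply_apply] at h
  simp only [bareZ, siteProd]
  rw [hW (fun r => site q ((a - zvec (0 : Fin (N + 1))) r) ((b) r) ((i) r) ((j) r)) fun r hr => by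
    simp [zvec_of_ne hr]]
  rw [hW (fun r => site q ((a) r) ((b - zvec (0 : Fin (N + 1))) r) ((i) r) ((j) r)) fun r hr => by
    simp [zvec_of_ne hr]]
  rw [hW (fun r => site q ((a) r) ((b) r) ((i) r) ((j + unitVec (0 : Fin (N + 1))) r)) fun r hr => by
    simp [unitVec_of_ne hr]]
  rw [hW (fun r => site q ((a) r) ((b) r) ((i + unitVec (0 : Fin (N + 1))) r) ((j) r)) fun r hr => by
    simp [unitVec_of_ne hr]]
  simpa [zvec_same, unitVec_same] using h

theorem bareZ_first_one_lower (h0 : q ≠ 0) (hq : ∀ m : ℕ, m ≠ 0 → q ^ m ≠ 1) (t : ℕ)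
    (a b : Fin (N + 1) → ℤ) (i j : Fin (N + 1) → ℕ) :
    (q ^ a 0 * (1 - (q * q ^ b 0) ^ 2)) • (PowerSeries.X * bareZ q 1 t a (b + zvec 0) i j) +
        (1 - (q * q ^ a 0) ^ 2) • bareZ q 1 t (a + zvec 0) b i j =
      (q ^ j 0 * (1 - (q ^ i 0) ^ 2)) • bareZ q 1 t a b (i - unitVec 0) j +
        (1 - (q ^ j 0) ^ 2) • (PowerSeries.X * bareZ q 1 t a b i (j - unitVec 0)) := by
  obtain ⟨W, hW⟩ := exists_opProd_eq_first fun r => site q (a r) (b r) (i r) (j r)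
  have h := (isSite h0 hq).first_one_lower (z := PowerSeries.X)
    (φ := boundaryBra q 1 ∘ₗ LinearMap.applyₗ (W (boundaryKet q t))) (fun x => boundaryBra_one_oscA hq _)
    (fun x => boundaryBra_one_oscB hq _)
    (a 0) (b 0) (i 0) (j 0)
  simp only [LinearMap.comp_apply, LinearMap.applyₗ_apply_apply] at h
  simp only [bareZ, siteProd]
  rw [hW (fun r => site q ((a) r) ((b + zvec (0 : Fin (N + 1))) r) ((i) r) ((j) r)) fun r hr => by
    simp [zvec_of_ne hr]]
  rw [hW (fun r => site q ((a + zvec (0 : Fin (N + 1))) r) ((b) r) ((i) r) ((j) r)) fun r hr => by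
    simp [zvec_of_ne hr]]
  rw [hW (fun r => site q ((a) r) ((b) r) ((i - unitVec (0 : Fin (N + 1))) r) ((j) r)) fun r hr => by
    simp [unitVec_of_ne hr]]
  rw [hW (fun r => site q ((a) r) ((b) r) ((i) r) ((j - unitVec (0 : Fin (N + 1))) r)) fun r hr => by
    simp [unitVec_of_ne hr]]
  simpa [zvec_same, unitVec_same] using h

theorem bareZ_first_two_raise (h0 : q ≠ 0) (hq : ∀ m : ℕ, m ≠ 0 → q ^ m ≠ 1) (t : ℕ)
    (a b : Fin (N + 1) → ℤ) (i j : Fin (N + 1) → ℕ) :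
    PowerSeries.X * bareZ q 2 t (a - 2 • zvec 0) b i j + (q * q ^ a 0) ^ 2 • bareZ q 2 t a (b - 2 • zvec 0) i j =
      bareZ q 2 t a b i (j + 2 • unitVec 0) + (q * q ^ j 0) ^ 2 • (PowerSeries.X * bareZ q 2 t a b (i + 2 • unitVec 0) j) := by
  obtain ⟨W, hW⟩ := exists_opProd_eq_first fun r => site q (a r) (b r) (i r) (j r)
  have h := (isSite h0 hq).first_two_raise (z := PowerSeries.X)
    (φ := boundaryBra q 2 ∘ₗ LinearMap.applyₗ (W (boundaryKet q t))) (fun x => boundaryBra_two_oscB hq _)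
    (a 0) (b 0) (i 0) (j 0)
  simp only [LinearMap.comp_apply, LinearMap.applyₗ_apply_apply] at h
  simp only [bareZ, siteProd]
  rw [hW (fun r => site q ((a - 2 • zvec (0 : Fin (N + 1))) r) ((b) r) ((i) r) ((j) r)) fun r hr => by
    simp [zvec_of_ne hr]]
  rw [hW (fun r => site q ((a) r) ((b - 2 • zvec (0 : Fin (N + 1))) r) ((i) r) ((j) r)) fun r hr => by
    simp [zvec_of_ne hr]]
  rw [hW (fun r => site q ((a) r) ((b) r) ((i) r) ((j + 2 • unitVec (0 : Fin (N + 1))) r)) fun r hr => by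
    simp [unitVec_of_ne hr]]
  rw [hW (fun r => site q ((a) r) ((b) r) ((i + 2 • unitVec (0 : Fin (N + 1))) r) ((j) r)) fun r hr => by
    simp [unitVec_of_ne hr]]
  simpa [zvec_same, unitVec_same] using h

theorem bareZ_first_two_lower (h0 : q ≠ 0) (hq : ∀ m : ℕ, m ≠ 0 → q ^ m ≠ 1) (t : ℕ)
    (a b : Fin (N + 1) → ℤ) (i j : Fin (N + 1) → ℕ) :
    ((q ^ a 0) ^ 2 * ((1 - (q * q ^ b 0) ^ 2) * (1 - (q ^ 2 * q ^ b 0) ^ 2))) •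
        (PowerSeries.X * bareZ q 2 t a (b + 2 • zvec 0) i j) +
      ((1 - (q * q ^ a 0) ^ 2) * (1 - (q ^ 2 * q ^ a 0) ^ 2)) • bareZ q 2 t (a + 2 • zvec 0) b i j =
      ((q ^ j 0) ^ 2 * ((1 - (q ^ i 0) ^ 2) * (1 - (q ^ (i 0 - 1)) ^ 2))) • bareZ q 2 t a b (i - 2 • unitVec 0) j +
        ((1 - (q ^ j 0) ^ 2) * (1 - (q ^ (j 0 - 1)) ^ 2)) • (PowerSeries.X * bareZ q 2 t a b i (j - 2 • unitVec 0)) := by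
  obtain ⟨W, hW⟩ := exists_opProd_eq_first fun r => site q (a r) (b r) (i r) (j r)
  have h := (isSite h0 hq).first_two_lower (z := PowerSeries.X)
    (φ := boundaryBra q 2 ∘ₗ LinearMap.applyₗ (W (boundaryKet q t))) (fun x => boundaryBra_two_oscB hq _)
    (a 0) (b 0) (i 0) (j 0)
  simp only [LinearMap.comp_apply, LinearMap.applyₗ_apply_apply] at h
  simp only [bareZ, siteProd]
  rw [hW (fun r => site q ((a) r) ((b + 2 • zvec (0 : Fin (N + 1))) r) ((i) r) ((j) r)) fun r hr => by
    simp [zvec_of_ne hr]]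
  rw [hW (fun r => site q ((a + 2 • zvec (0 : Fin (N + 1))) r) ((b) r) ((i) r) ((j) r)) fun r hr => by
    simp [zvec_of_ne hr]]
  rw [hW (fun r => site q ((a) r) ((b) r) ((i - 2 • unitVec (0 : Fin (N + 1))) r) ((j) r)) fun r hr => by
    simp [unitVec_of_ne hr]]
  rw [hW (fun r => site q ((a) r) ((b) r) ((i) r) ((j - 2 • unitVec (0 : Fin (N + 1))) r)) fun r hr => by
    simp [unitVec_of_ne hr]]
  simpa [zvec_same, unitVec_same] using h

theorem bareZ_mid_right (h0 : q ≠ 0) (hq : ∀ m : ℕ, m ≠ 0 → q ^ m ≠ 1) (s t : ℕ) (r : Fin N)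
    (a b : Fin (N + 1) → ℤ) (i j : Fin (N + 1) → ℕ) :
    (q ^ b r.castSucc * (1 - (q * q ^ a r.castSucc) ^ 2)) •
        bareZ q s t (a + zvec r.castSucc - zvec r.succ) b i j +
      (q ^ a r.succ * (1 - (q * q ^ b r.castSucc) ^ 2)) •
        bareZ q s t a (b + zvec r.castSucc - zvec r.succ) i j =
      (q ^ j r.succ * (1 - (q ^ i r.castSucc) ^ 2)) •
        bareZ q s t a b (i - unitVec r.castSucc + unitVec r.succ) j +
      (q ^ i r.castSucc * (1 - (q ^ j r.castSucc) ^ 2)) •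
        bareZ q s t a b i (j - unitVec r.castSucc + unitVec r.succ) := by
  obtain ⟨U, W, hUW⟩ := exists_opProd_eq_mid (fun r => site q (a r) (b r) (i r) (j r)) r
  have h := (isSite h0 hq).mid_right (isSite h0 hq) (a r.castSucc) (b r.castSucc)
    (a r.succ) (b r.succ) (i r.castSucc) (j r.castSucc) (i r.succ) (j r.succ)
  have h' := congrArg (fun T => boundaryBra q s (U (T (W (boundaryKet q t))))) h
  simp only [LinearMap.add_apply, LinearMap.smul_apply, map_add, map_smul] at h'
  have hne : r.castSucc ≠ r.succ := r.castSucc_lt_succ.ne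
  simp only [bareZ, siteProd]
  rw [hUW (fun x => site q ((a + zvec r.castSucc - zvec r.succ) x) ((b) x) ((i) x) ((j) x))
    fun x h1 h2 => by simp [zvec_of_ne h1, zvec_of_ne h2]]
  rw [hUW (fun x => site q ((a) x) ((b + zvec r.castSucc - zvec r.succ) x) ((i) x) ((j) x))
    fun x h1 h2 => by simp [zvec_of_ne h1, zvec_of_ne h2]]
  rw [hUW (fun x => site q ((a) x) ((b) x) ((i - unitVec r.castSucc + unitVec r.succ) x) ((j) x))
    fun x h1 h2 => by simp [unitVec_of_ne h1, unitVec_of_ne h2]]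
  rw [hUW (fun x => site q ((a) x) ((b) x) ((i) x) ((j - unitVec r.castSucc + unitVec r.succ) x))
    fun x h1 h2 => by simp [unitVec_of_ne h1, unitVec_of_ne h2]]
  simpa [zvec_same, unitVec_same, zvec_of_ne hne, unitVec_of_ne hne, zvec_of_ne hne.symm,
    unitVec_of_ne hne.symm, sub_eq_add_neg] using h'

theorem bareZ_mid_left (h0 : q ≠ 0) (hq : ∀ m : ℕ, m ≠ 0 → q ^ m ≠ 1) (s t : ℕ) (r : Fin N)
    (a b : Fin (N + 1) → ℤ) (i j : Fin (N + 1) → ℕ) :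
    (q ^ a r.succ * (1 - (q * q ^ b r.succ) ^ 2)) •
        bareZ q s t a (b - zvec r.castSucc + zvec r.succ) i j +
      (q ^ b r.castSucc * (1 - (q * q ^ a r.succ) ^ 2)) •
        bareZ q s t (a - zvec r.castSucc + zvec r.succ) b i j =
      (q ^ j r.succ * (1 - (q ^ i r.succ) ^ 2)) •
        bareZ q s t a b (i + unitVec r.castSucc - unitVec r.succ) j +
      (q ^ i r.castSucc * (1 - (q ^ j r.succ) ^ 2)) •
        bareZ q s t a b i (j + unitVec r.castSucc - unitVec r.succ) := by
  obtain ⟨U, W, hUW⟩ := exists_opProd_eq_mid (fun r => site q (a r) (b r) (i r) (j r)) r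
  have h := (isSite h0 hq).mid_left (isSite h0 hq) (a r.castSucc) (b r.castSucc)
    (a r.succ) (b r.succ) (i r.castSucc) (j r.castSucc) (i r.succ) (j r.succ)
  have h' := congrArg (fun T => boundaryBra q s (U (T (W (boundaryKet q t))))) h
  simp only [LinearMap.add_apply, LinearMap.smul_apply, map_add, map_smul] at h'
  have hne : r.castSucc ≠ r.succ := r.castSucc_lt_succ.ne
  simp only [bareZ, siteProd]
  rw [hUW (fun x => site q ((a) x) ((b - zvec r.castSucc + zvec r.succ) x) ((i) x) ((j) x))
    fun x h1 h2 => by simp [zvec_of_ne h1, zvec_of_ne h2]]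
  rw [hUW (fun x => site q ((a - zvec r.castSucc + zvec r.succ) x) ((b) x) ((i) x) ((j) x))
    fun x h1 h2 => by simp [zvec_of_ne h1, zvec_of_ne h2]]
  rw [hUW (fun x => site q ((a) x) ((b) x) ((i + unitVec r.castSucc - unitVec r.succ) x) ((j) x))
    fun x h1 h2 => by simp [unitVec_of_ne h1, unitVec_of_ne h2]]
  rw [hUW (fun x => site q ((a) x) ((b) x) ((i) x) ((j + unitVec r.castSucc - unitVec r.succ) x))
    fun x h1 h2 => by simp [unitVec_of_ne h1, unitVec_of_ne h2]]
  simpa [zvec_same, unitVec_same, zvec_of_ne hne, unitVec_of_ne hne, zvec_of_ne hne.symm,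
    unitVec_of_ne hne.symm, sub_eq_add_neg] using h'

theorem bareZ_weight (h0 : q ≠ 0) (hq : ∀ m : ℕ, m ≠ 0 → q ^ m ≠ 1) (s t : ℕ) {n : ℕ}
    {a b : Fin n → ℤ} {i j : Fin n → ℕ} (r : Fin n) (h : a r + b r ≠ i r + j r) :
    bareZ q s t a b i j = 0 := by
  have : siteProd q a b i j = 0 :=
    List.prod_eq_zero ((List.mem_ofFn' _ _).2 ⟨r, (isSite h0 hq).weight _ _ _ _ h⟩)
  rw [bareZ, this, LinearMap.zero_apply, map_zero]

/-- Each site changes the level by b_r - j_r, so the level at the right end is c + ∑(b_r - j_r). If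
it is odd, only odd entries of `v` are met. -/
theorem siteProd_apply_eq_zero (q : 𝕜) {n : ℕ} (a b : Fin n → ℤ) (i j : Fin n → ℕ) {v : ℕ → 𝕜}
    (hv : ∀ c, ¬ 2 ∣ c → v c = 0) (c : ℕ) (hc : ¬ (2 : ℤ) ∣ c + ∑ r, (b r - j r)) :
    siteProd q a b i j v c = 0 := by
  induction n generalizing c with
  | zero =>
    simp only [Finset.univ_eq_empty, Finset.sum_empty, add_zero] at hc
    simpa [siteProd, opProd] using hv c (by omega)
  | succ n ih =>
    rw [siteProd, opProd_succ, Module.End.mul_apply, site_apply _ _ (Nat.lt_succ_self _)]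
    refine Finset.sum_eq_zero fun k _ => ?_
    by_cases hk : b 0 + c = j 0 + k
    · refine mul_eq_zero_of_right _ (ih _ _ _ _ k fun hd => hc ?_)
      rw [Fin.sum_univ_succ]
      omega
    · by_cases hneg : a 0 < 0 ∨ b 0 < 0
      · rw [tdr_of_neg hneg, zero_mul]
      · rw [tdr_weight (.inr hk), zero_mul]

theorem bareZ_two_two_parity (q : 𝕜) {n : ℕ} {a b : Fin n → ℤ} {i j : Fin n → ℕ}
    (h : ¬ (2 : ℤ) ∣ ∑ r, (b r - j r)) : bareZ q 2 2 a b i j = 0 := by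
  ext c
  rw [bareZ, coeff_boundaryBra, siteProd_apply_eq_zero, mul_zero, map_zero]
  · intro c hc
    rw [boundaryKet, if_neg hc]
  · push_cast
    omega

end Relations

/-! ### Infinite q-products as formal power series -/

section InfiniteProducts

variable {𝕜 : Type*} [NormedField 𝕜]

theorem rescale_C (u x : 𝕜) : PowerSeries.rescale u (PowerSeries.C x) = PowerSeries.C x := by
  ext m
  rw [PowerSeries.coeff_rescale, PowerSeries.coeff_C]
  split_ifs with h <;> simp [h]

open PowerSeries in
/-- The finite products approximating `qPochInf`. -/
def qPochFin (α : 𝕜) (d : ℕ) (b : 𝕜) (M : ℕ) : PowerSeries 𝕜 :=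
  ∏ k ∈ Finset.range M, (1 - C (α * b ^ k) * X ^ d)

theorem qPochFin_succ (α : 𝕜) (d : ℕ) (b : 𝕜) (M : ℕ) :
    qPochFin α d b (M + 1) =
      qPochFin α d b M * (1 - PowerSeries.C (α * b ^ M) * PowerSeries.X ^ d) :=
  Finset.prod_range_succ _ _

/-- The base is written as u^d because X ↦ uX multiplies X^d by u^d, and so moves every factor to
the next one. This peels off the first factor instead of the last. -/
theorem qPochFin_succ' (α : 𝕜) (d : ℕ) (u : 𝕜) (M : ℕ) :
    qPochFin α d (u ^ d) (M + 1) =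
      (1 - PowerSeries.C α * PowerSeries.X ^ d) *
        PowerSeries.rescale u (qPochFin α d (u ^ d) M) := by
  rw [qPochFin, qPochFin, Finset.prod_range_succ', mul_comm, map_prod]
  congr 1
  · simp
  · refine Finset.prod_congr rfl fun k _ => ?_
    rw [map_sub (PowerSeries.rescale u), map_one, map_mul (PowerSeries.rescale u),
      map_pow (PowerSeries.rescale u), PowerSeries.rescale_X, rescale_C, mul_pow, ← map_pow,
      ← mul_assoc, ← map_mul]
    congr 3
    ring

theorem coeff_one_sub_mul (α : 𝕜) (d m : ℕ) (F : PowerSeries 𝕜) :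
    PowerSeries.coeff m ((1 - PowerSeries.C α * PowerSeries.X ^ d) * F) =
      PowerSeries.coeff m F - if d ≤ m then α * PowerSeries.coeff (m - d) F else 0 := by
  rw [sub_mul, one_mul, map_sub, mul_assoc, PowerSeries.coeff_C_mul, PowerSeries.coeff_X_pow_mul']
  split_ifs <;> simp

/-- Peeling off the last or the first factor of the same product gives two expressions for the m-th
coefficient. Their difference expresses (1 - u^m) times this coefficient through the coefficient of
index m - d and u^{dM}, which tends to zero. Convergence follows by strong induction, since 1 - u^m
≠ 0 for m ≠ 0. -/
theorem exists_tendsto_coeff_qPochFin (α : 𝕜) {d : ℕ} (hd : d ≠ 0) {u : 𝕜} (hu : ‖u‖ < 1)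
    (hu' : ∀ m : ℕ, m ≠ 0 → u ^ m ≠ 1) (m : ℕ) :
    ∃ L, Tendsto (fun M => PowerSeries.coeff m (qPochFin α d (u ^ d) M)) atTop (𝓝 L) := by
  induction m using Nat.strong_induction_on with
  | _ m ih =>
    rcases eq_or_ne m 0 with rfl | hm
    · refine ⟨1, tendsto_const_nhds.congr fun M => ?_⟩
      rw [PowerSeries.coeff_zero_eq_constantCoeff_apply, qPochFin, map_prod]
      simp [hd]
    have key (M : ℕ) : PowerSeries.coeff m (qPochFin α d (u ^ d) M) * (1 - u ^ m) =
        if d ≤ m then (α * (u ^ d) ^ M) * PowerSeries.coeff (m - d) (qPochFin α d (u ^ d) M) -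
          α * (u ^ (m - d) * PowerSeries.coeff (m - d) (qPochFin α d (u ^ d) M)) else 0 := by
      have h := congrArg (PowerSeries.coeff m)
        ((qPochFin_succ α d (u ^ d) M).symm.trans (qPochFin_succ' α d u M))
      rw [mul_comm, coeff_one_sub_mul, coeff_one_sub_mul, PowerSeries.coeff_rescale,
        PowerSeries.coeff_rescale] at h
      split_ifs at h ⊢ <;> linear_combination h
    have hne : 1 - u ^ m ≠ 0 := sub_ne_zero.2 (hu' m hm).symm
    by_cases hdm : d ≤ m
    · obtain ⟨L, hL⟩ := ih (m - d) (by omega)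
      have hz : Tendsto (fun M : ℕ => (u ^ d) ^ M) atTop (𝓝 0) := by
        refine tendsto_pow_atTop_nhds_zero_of_norm_lt_one ?_
        rw [norm_pow]
        exact pow_lt_one₀ (norm_nonneg _) hu hd
      refine ⟨_, ((((hz.const_mul α).mul hL).sub ((hL.const_mul (u ^ (m - d))).const_mul α)).div_const
        (1 - u ^ m)).congr fun M => ?_⟩
      rw [div_eq_iff hne, key, if_pos hdm]
    · refine ⟨0, tendsto_const_nhds.congr fun M => ?_⟩
      have := key M
      rw [if_neg hdm] at this
      exact ((mul_eq_zero.1 this).resolve_right hne).symm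

theorem tendsto_coeff_qPochFin (α : 𝕜) {d : ℕ} (hd : d ≠ 0) {u : 𝕜} (hu : ‖u‖ < 1)
    (hu' : ∀ m : ℕ, m ≠ 0 → u ^ m ≠ 1) (m : ℕ) :
    Tendsto (fun M => PowerSeries.coeff m (qPochFin α d (u ^ d) M)) atTop
      (𝓝 (PowerSeries.coeff m (qPochInf α d (u ^ d)))) := by
  rw [qPochInf, PowerSeries.coeff_mk]
  exact tendsto_nhds_limUnder (exists_tendsto_coeff_qPochFin α hd hu hu' m)

theorem constantCoeff_qPochInf (α : 𝕜) {d : ℕ} (hd : d ≠ 0) {u : 𝕜} (hu : ‖u‖ < 1)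
    (hu' : ∀ m : ℕ, m ≠ 0 → u ^ m ≠ 1) :
    PowerSeries.constantCoeff (qPochInf α d (u ^ d)) = 1 := by
  rw [← PowerSeries.coeff_zero_eq_constantCoeff_apply]
  refine tendsto_nhds_unique (tendsto_coeff_qPochFin α hd hu hu' 0)
    (tendsto_const_nhds.congr fun M => ?_)
  rw [PowerSeries.coeff_zero_eq_constantCoeff_apply, qPochFin, map_prod]
  simp [hd]

theorem qPochInf_eq (α : 𝕜) {d : ℕ} (hd : d ≠ 0) {u : 𝕜} (hu : ‖u‖ < 1)
    (hu' : ∀ m : ℕ, m ≠ 0 → u ^ m ≠ 1) :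
    qPochInf α d (u ^ d) = (1 - PowerSeries.C α * PowerSeries.X ^ d) *
      PowerSeries.rescale u (qPochInf α d (u ^ d)) := by
  ext m
  refine tendsto_nhds_unique
    ((tendsto_coeff_qPochFin α hd hu hu' m).comp (tendsto_add_atTop_nat 1)) ?_
  simp only [Function.comp_def, qPochFin_succ', coeff_one_sub_mul, PowerSeries.coeff_rescale]
  refine ((tendsto_coeff_qPochFin α hd hu hu' m).const_mul _).sub ?_
  split_ifs
  · exact ((tendsto_coeff_qPochFin α hd hu hu' _).const_mul _).const_mul _
  · exact tendsto_const_nhds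

/-- Invariance says c_m u^m = c_m for each coefficient, and u is not a root of unity. This reduces
identities between infinite products to functional equations. -/
theorem eq_one_of_rescale_eq {u : 𝕜} (hu : ∀ m : ℕ, m ≠ 0 → u ^ m ≠ 1) {G : PowerSeries 𝕜}
    (h : PowerSeries.rescale u G = G) (h0 : PowerSeries.constantCoeff G = 1) : G = 1 := by
  ext m
  rcases eq_or_ne m 0 with rfl | hm
  · simpa using h0
  · have := congrArg (PowerSeries.coeff m) h
    rw [PowerSeries.coeff_rescale] at this
    rw [PowerSeries.coeff_one, if_neg hm]
    by_contra hne
    exact hu m hm (mul_right_cancel₀ hne (this.trans (one_mul _).symm))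

/-- The `q`-binomial theorem. -/
theorem qBinomial_thm (A : 𝕜) {d : ℕ} (hd : d ≠ 0) {u : 𝕜} (hu : ‖u‖ < 1)
    (hu' : ∀ m : ℕ, m ≠ 0 → u ^ m ≠ 1) {H : PowerSeries 𝕜}
    (h0 : PowerSeries.constantCoeff H = 1)
    (hH : (1 - PowerSeries.X ^ d) * H =
      (1 - PowerSeries.C A * PowerSeries.X ^ d) * PowerSeries.rescale u H) :
    qPochInf 1 d (u ^ d) * (qPochInf A d (u ^ d))⁻¹ * H = 1 := by
  have e1 := qPochInf_eq 1 hd hu hu'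
  have eA := qPochInf_eq A hd hu hu'
  have c1 := constantCoeff_qPochInf 1 hd hu hu'
  have cA := constantCoeff_qPochInf A hd hu hu'
  have iA := PowerSeries.mul_inv_cancel (qPochInf A d (u ^ d)) (by rw [cA]; exact one_ne_zero)
  have iA' := congrArg (PowerSeries.rescale u) iA
  rw [map_mul, map_one] at iA'
  -- The functional equations of the two infinite products and of `H` carry factors that cancel, so
  -- the product is invariant under X ↦ uX.
  refine eq_one_of_rescale_eq hu' ?_ (by simp [c1, cA, h0])
  rw [map_mul, map_mul]
  rw [map_one, one_mul] at e1
  generalize PowerSeries.rescale u H = h at *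
  generalize PowerSeries.rescale u (qPochInf 1 d (u ^ d)) = f1 at *
  generalize PowerSeries.rescale u (qPochInf A d (u ^ d)) = fA at *
  generalize PowerSeries.rescale u (qPochInf A d (u ^ d))⁻¹ = fi at *
  generalize qPochInf 1 d (u ^ d) = F1 at *
  generalize (qPochInf A d (u ^ d))⁻¹ = Fi at *
  generalize qPochInf A d (u ^ d) = FA at *
  generalize (PowerSeries.X ^ d : PowerSeries 𝕜) = x at *
  generalize PowerSeries.C A = y at *
  linear_combination (-Fi * H) * e1 - (f1 * Fi) * hH + (f1 * h * (1 - y * x) * Fi) * iA' -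
    (f1 * h * fi) * iA + (f1 * h * fi * Fi) * eA

/-- A two-term recursion for coefficients, read as a functional equation; this is the form in which
the vacuum sums enter the q-binomial theorem. -/
theorem one_sub_mul_eq_of_coeff (A : 𝕜) {d : ℕ} {u : 𝕜} {H : PowerSeries 𝕜} (hlt : ∀ m, m ≠ 0 → m < d → PowerSeries.coeff m H = 0)
    (hH : ∀ m, PowerSeries.coeff (m + d) H * (1 - u ^ (m + d)) =
      PowerSeries.coeff m H * (1 - A * u ^ m)) :
    (1 - PowerSeries.X ^ d) * H =
      (1 - PowerSeries.C A * PowerSeries.X ^ d) * PowerSeries.rescale u H := by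
  ext m
  have e : (1 - PowerSeries.X ^ d : PowerSeries 𝕜) = 1 - PowerSeries.C 1 * PowerSeries.X ^ d := by
    simp
  rw [e, coeff_one_sub_mul, coeff_one_sub_mul, PowerSeries.coeff_rescale, PowerSeries.coeff_rescale]
  split_ifs with hm
  · obtain ⟨k, rfl⟩ := Nat.exists_eq_add_of_le' hm
    rw [Nat.add_sub_cancel]
    linear_combination hH k
  · rcases eq_or_ne m 0 with rfl | h
    · simp
    · rw [hlt m h (not_le.1 hm), mul_zero]

end InfiniteProducts

/-! ### Values on the vacua -/

section Vacuum

variable {𝕜 : Type*} [NormedField 𝕜] {q : 𝕜}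

/-- The exponent `s` of the left boundary vector. -/
def leftExp : AffineType → ℕ
  | .D2 | .A2 => 1
  | .C1 => 2

/-- The exponent `t` of the right boundary vector. -/
def rightExp : AffineType → ℕ
  | .D2 => 1
  | .A2 | .C1 => 2

/-- The normalization factor `ϱ(z)`. -/
def normFactor (q : 𝕜) : AffineType → ℤˣ → ℤˣ → PowerSeries 𝕜
  | .D2 => fun _ _ => qPochInf 1 1 q * (qPochInf (-q) 1 q)⁻¹
  | .A2 => fun _ _ => qPochInf 1 2 (q ^ 2) * (qPochInf (-q) 2 (q ^ 2))⁻¹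
  | .C1 => rho22 q

/-- The integral multi-index underlying a multi-index. -/
def natVec {n : ℕ} (a : Fin n → ℕ) : Fin n → ℤ := fun r => a r

/-- The normalized matrix elements, for integral output indices. -/
def solZ (q : 𝕜) (g : AffineType) {n : ℕ} (a b : Fin n → ℤ) (i j : Fin n → ℕ) : PowerSeries 𝕜 :=
  normFactor q g (parity i) (parity j) * bareZ q (leftExp g) (rightExp g) a b i j

theorem S11_eq (q : 𝕜) {N : ℕ} (a b i j : Fin (N + 1) → ℕ) :
    S11 q a b i j = solZ q .D2 (natVec a) (natVec b) i j := by
  rw [S11, bareS_eq_bareZ q 1 one_ne_zero]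
  rfl

theorem S12_eq (q : 𝕜) {N : ℕ} (a b i j : Fin (N + 1) → ℕ) :
    S12 q a b i j = solZ q .A2 (natVec a) (natVec b) i j := by
  rw [S12, bareS_eq_bareZ q 1 two_ne_zero]
  rfl

theorem S22_eq (q : 𝕜) {N : ℕ} (a b i j : Fin (N + 1) → ℕ) :
    S22 q a b i j = solZ q .C1 (natVec a) (natVec b) i j := by
  rw [S22, bareS_eq_bareZ q 2 two_ne_zero]
  rfl

theorem siteProd_zero (h0 : q ≠ 0) (hq : ∀ m : ℕ, m ≠ 0 → q ^ m ≠ 1) (n : ℕ) :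
    siteProd q (n := n) 0 0 0 0 = 1 := by
  refine List.prod_eq_one fun x hx => ?_
  obtain ⟨r, rfl⟩ := (List.mem_ofFn' _ _).1 hx
  simpa using (isSite h0 hq).vac 0 0

theorem siteProd_first (h0 : q ≠ 0) (hq : ∀ m : ℕ, m ≠ 0 → q ^ m ≠ 1) {N : ℕ}
    {a b : Fin (N + 1) → ℤ} {i j : Fin (N + 1) → ℕ} (ha : ∀ r : Fin N, a r.succ = 0)
    (hb : ∀ r : Fin N, b r.succ = 0) (hi : ∀ r : Fin N, i r.succ = 0)
    (hj : ∀ r : Fin N, j r.succ = 0) :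
    siteProd q a b i j = site q (a 0) (b 0) (i 0) (j 0) := by
  rw [siteProd, opProd_succ]
  have := siteProd_zero h0 hq N
  simp only [siteProd, Pi.zero_apply] at this
  simp only [ha, hb, hi, hj, this, mul_one]

theorem natVec_zero (n : ℕ) : natVec (0 : Fin n → ℕ) = 0 := by
  ext r
  simp [natVec]

theorem natVec_unitVec {n : ℕ} (r : Fin n) : natVec (unitVec r) = zvec r := by
  ext x
  by_cases h : x = r
  · subst h
    simp [natVec, unitVec_same, zvec_same]
  · simp [natVec, unitVec_of_ne h, zvec_of_ne h]

theorem parity_zero (n : ℕ) : parity (0 : Fin n → ℕ) = 1 := by simp [parity]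

theorem parity_add {n : ℕ} (a b : Fin n → ℕ) : parity (a + b) = parity a * parity b := by
  simp [parity, Finset.sum_add_distrib, pow_add]

theorem sum_unitVec {n : ℕ} (r : Fin n) : ∑ x, unitVec r x = 1 := by
  simp [unitVec]

theorem parity_unitVec {n : ℕ} (r : Fin n) : parity (unitVec r) = -1 := by
  rw [parity, sum_unitVec, pow_one]

theorem site_one_zero (h0 : q ≠ 0) (hq : ∀ m : ℕ, m ≠ 0 → q ^ m ≠ 1) :
    site q 1 0 1 0 = oscK q := by
  simpa using (isSite h0 hq).one_zero 1 0

theorem site_zero_one (h0 : q ≠ 0) (hq : ∀ m : ℕ, m ≠ 0 → q ^ m ≠ 1) :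
    site q 0 1 0 1 = -(q • oscK q) := by
  have h := (isSite h0 hq).raise_j 0 1 0 0
  simp only [(isSite h0 hq).vac] at h
  simpa using h

theorem site_one_one (h0 : q ≠ 0) (hq : ∀ m : ℕ, m ≠ 0 → q ^ m ≠ 1) :
    site q 1 1 1 1 = 1 - (1 + q ^ 2) • (oscK q * oscK q) := by
  have h := (isSite h0 hq).raise_j 1 1 1 0
  simp only [(isSite h0 hq).one_zero] at h
  norm_num [(isOsc h0).A_B] at h
  rw [h]
  module

theorem pow_pow_ne_one (hq : ∀ m : ℕ, m ≠ 0 → q ^ m ≠ 1) {k : ℕ} (hk : k ≠ 0) (m : ℕ)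
    (hm : m ≠ 0) : (q ^ k) ^ m ≠ 1 := by
  rw [← pow_mul]
  exact hq _ (mul_ne_zero hk hm)

theorem norm_pow_lt_one (h1 : ‖q‖ < 1) {k : ℕ} (hk : k ≠ 0) : ‖q ^ k‖ < 1 := by
  rw [norm_pow]
  exact pow_lt_one₀ (norm_nonneg _) h1 hk

/-- The coefficients (q²)_m/(q)_m² have successive ratios (1 + q^{m+1})/(1 - q^{m+1}): a q-binomial
series with A = -q, whose sum is the inverse of the normalization factor. -/
theorem solZ_D2_vac (h0 : q ≠ 0) (h1 : ‖q‖ < 1) (hq : ∀ m : ℕ, m ≠ 0 → q ^ m ≠ 1) (N : ℕ) :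
    solZ q .D2 (n := N + 1) (natVec 0) (natVec 0) 0 0 = 1 := by
  have key := qBinomial_thm (-q) one_ne_zero h1 hq (H := bareZ q (n := N + 1) 1 1 0 0 0 0)
  simp only [solZ, natVec_zero, normFactor, leftExp, rightExp]
  simp only [pow_one] at key
  have hc (m : ℕ) : PowerSeries.coeff m (bareZ q (n := N + 1) 1 1 0 0 0 0) =
      qPoch (q ^ 2) m / qPoch q m * (qPoch q m)⁻¹ := by
    rw [bareZ, coeff_boundaryBra, siteProd_zero h0 hq]
    simp [boundaryKet]
  have h00 : PowerSeries.constantCoeff (bareZ q (n := N + 1) 1 1 0 0 0 0) = 1 := by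
    rw [← PowerSeries.coeff_zero_eq_constantCoeff_apply, hc]
    simp [qPoch_zero]
  have hr := one_sub_mul_eq_of_coeff (-q) (d := 1) (u := q)
    (H := bareZ q (n := N + 1) 1 1 0 0 0 0) (by omega) fun m => ?_
  · rw [pow_one] at hr
    exact key h00 hr
  rw [hc, hc, qPoch_succ, qPoch_succ]
  have e1 := qPoch_ne_zero hq m
  have e2 : 1 - q ^ (m + 1) ≠ 0 := sub_ne_zero.2 (hq _ m.succ_ne_zero).symm
  field_simp
  ring

/-- Only even powers of z occur, and the step from m to m + 2 has ratio (1 + q^{m+1})/(1 - q^{m+2}).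
This is the q-binomial series in z² with base q² and A = -q. -/
theorem solZ_A2_vac (h0 : q ≠ 0) (h1 : ‖q‖ < 1) (hq : ∀ m : ℕ, m ≠ 0 → q ^ m ≠ 1) (N : ℕ) :
    solZ q .A2 (n := N + 1) (natVec 0) (natVec 0) 0 0 = 1 := by
  have key := qBinomial_thm (-q) two_ne_zero h1 hq (H := bareZ q (n := N + 1) 1 2 0 0 0 0)
  simp only [solZ, natVec_zero, normFactor, leftExp, rightExp]
  have hc (m : ℕ) : PowerSeries.coeff m (bareZ q (n := N + 1) 1 2 0 0 0 0) =
      qPoch (q ^ 2) m / qPoch q m * if 2 ∣ m then (qPoch (q ^ 4) (m / 2))⁻¹ else 0 := by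
    rw [bareZ, coeff_boundaryBra, siteProd_zero h0 hq]
    simp [boundaryKet]
  have h00 : PowerSeries.constantCoeff (bareZ q (n := N + 1) 1 2 0 0 0 0) = 1 := by
    rw [← PowerSeries.coeff_zero_eq_constantCoeff_apply, hc]
    simp [qPoch_zero]
  refine key h00 (one_sub_mul_eq_of_coeff (-q) (fun m hm hm' => ?_)
    fun m => ?_)
  · obtain rfl : m = 1 := by omega
    rw [hc]
    simp
  rw [hc, hc]
  rcases Nat.even_or_odd' m with ⟨k, rfl | rfl⟩
  · rw [if_pos (by omega), if_pos (by omega), show (2 * k + 2) / 2 = k + 1 by omega,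
      show 2 * k / 2 = k by omega, qPoch_succ, qPoch_succ, qPoch_succ, qPoch_succ, qPoch_succ]
    have e1 := qPoch_ne_zero hq (2 * k)
    have e2 : 1 - q ^ (2 * k + 1) ≠ 0 := sub_ne_zero.2 (hq _ (by omega)).symm
    have e3 : 1 - q ^ (2 * k + 1 + 1) ≠ 0 := sub_ne_zero.2 (hq _ (by omega)).symm
    have e4 : 1 - (q ^ 4) ^ (k + 1) ≠ 0 :=
      sub_ne_zero.2 (pow_pow_ne_one hq (by norm_num) _ (by omega)).symm
    have e5 := qPoch_ne_zero (pow_pow_ne_one hq four_ne_zero) k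
    have f1 : (q ^ 2) ^ (2 * k + 1) = (q ^ (2 * k + 1)) ^ 2 := by ring
    have f2 : (q ^ 2) ^ (2 * k + 1 + 1) = (q * q ^ (2 * k + 1)) ^ 2 := by ring
    have f3 : (q ^ 4) ^ (k + 1) = (q * q ^ (2 * k + 1)) ^ 2 := by ring
    have f4 : q ^ (2 * k + 1 + 1) = q * q ^ (2 * k + 1) := by ring
    have f5 : -q * q ^ (2 * k) = -q ^ (2 * k + 1) := by ring
    rw [f3] at e4
    rw [f4] at e3
    rw [f1, f2, f3, show 2 * k + 2 = 2 * k + 1 + 1 from rfl, f4, f5]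
    generalize q ^ (2 * k + 1) = x at *
    generalize qPoch q (2 * k) = A at *
    generalize qPoch (q ^ 4) k = B at *
    have e6 : 1 + q * x ≠ 0 := by
      intro h
      exact e4 (by linear_combination (1 - q * x) * h)
    rw [show 1 - (q * x) ^ 2 = (1 - q * x) * (1 + q * x) by ring]
    field_simp
    ring
  · rw [if_neg (by omega), if_neg (by omega)]
    simp

/-- The weights of the vacuum sum for `s = t = 2`. -/
def vacSeries (q : 𝕜) : PowerSeries 𝕜 :=
  PowerSeries.mk fun c => qPoch (q ^ 2) (2 * c) / qPoch (q ^ 4) c * (qPoch (q ^ 4) c)⁻¹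

theorem constantCoeff_vacSeries (q : 𝕜) : PowerSeries.constantCoeff (vacSeries q) = 1 := by
  rw [← PowerSeries.coeff_zero_eq_constantCoeff_apply, vacSeries, PowerSeries.coeff_mk]
  simp [qPoch_zero]

/-- The coefficient ratio is (1 - q^{4m+2})/(1 - q^{4m+4}), a q-binomial series with base q⁴ and A =
q². -/
theorem vacSeries_rescale (hq : ∀ m : ℕ, m ≠ 0 → q ^ m ≠ 1) :
    (1 - PowerSeries.X) * vacSeries q =
      (1 - PowerSeries.C (q ^ 2) * PowerSeries.X) * PowerSeries.rescale (q ^ 4) (vacSeries q) := by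
  have hq4 := pow_pow_ne_one hq four_ne_zero
  have := one_sub_mul_eq_of_coeff (q ^ 2) (d := 1) (u := q ^ 4) (H := vacSeries q)
    (by omega) fun m => ?_
  · simpa only [pow_one] using this
  rw [vacSeries, PowerSeries.coeff_mk, PowerSeries.coeff_mk, show 2 * (m + 1) = 2 * m + 1 + 1 from rfl,
    qPoch_succ, qPoch_succ, qPoch_succ]
  have e4 : 1 - (q ^ 4) ^ (m + 1) ≠ 0 := sub_ne_zero.2 (hq4 _ (by omega)).symm
  have e5 := qPoch_ne_zero hq4 m
  field_simp
  ring

theorem rho22_same_mul_vacSeries (hq : ∀ m : ℕ, m ≠ 0 → q ^ m ≠ 1) (h1 : ‖q‖ < 1) {ε₁ ε₂ : ℤˣ}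
    (h : ε₁ * ε₂ = 1) : rho22 q ε₁ ε₂ * vacSeries q = 1 := by
  rw [rho22, if_pos h]
  have key := qBinomial_thm (q ^ 2) one_ne_zero (norm_pow_lt_one h1 four_ne_zero)
    (pow_pow_ne_one hq four_ne_zero) (constantCoeff_vacSeries q)
    (by simpa only [pow_one] using vacSeries_rescale hq)
  rwa [pow_one] at key

/-- By the q-binomial theorem the rescaled series is (q⁴z; q⁴)_∞/(q²z; q⁴)_∞. Multiplied by (q²z;
q⁴)_∞/(z; q⁴)_∞ it leaves 1/(1 - z). The code verifies invariance under z → q⁴z instead. -/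
theorem rho22_ne_mul_vacSeries (hq : ∀ m : ℕ, m ≠ 0 → q ^ m ≠ 1) (h1 : ‖q‖ < 1) {ε₁ ε₂ : ℤˣ}
    (h : ε₁ * ε₂ ≠ 1) :
    (1 - PowerSeries.X) * (rho22 q ε₁ ε₂ * PowerSeries.rescale (q ^ 2) (vacSeries q)) = 1 := by
  rw [rho22, if_neg h]
  have hu := norm_pow_lt_one h1 four_ne_zero
  have hu' := pow_pow_ne_one hq four_ne_zero
  have e1 := qPochInf_eq 1 one_ne_zero hu hu'
  have eA := qPochInf_eq (q ^ 2) one_ne_zero hu hu'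
  have c1 := constantCoeff_qPochInf 1 one_ne_zero hu hu'
  have cA := constantCoeff_qPochInf (q ^ 2) one_ne_zero hu hu'
  rw [pow_one] at e1 eA c1 cA
  have i1 := PowerSeries.mul_inv_cancel (qPochInf 1 1 (q ^ 4)) (by rw [c1]; exact one_ne_zero)
  have i1' := congrArg (PowerSeries.rescale (q ^ 4)) i1
  have hv := congrArg (PowerSeries.rescale (q ^ 2)) (vacSeries_rescale hq)
  rw [map_mul, map_mul, map_sub, map_sub, map_mul, map_one, PowerSeries.rescale_X,
    rescale_C, PowerSeries.rescale_rescale, mul_comm (q ^ 4), ← PowerSeries.rescale_rescale] at hv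
  rw [map_one] at i1'
  have cv : PowerSeries.constantCoeff (PowerSeries.rescale (q ^ 2) (vacSeries q)) = 1 := by
    rw [← PowerSeries.coeff_zero_eq_constantCoeff_apply, PowerSeries.coeff_rescale, pow_zero,
      one_mul, PowerSeries.coeff_zero_eq_constantCoeff_apply, constantCoeff_vacSeries]
  refine eq_one_of_rescale_eq hu' ?_ (by simp [c1, cA, cv])
  rw [map_mul, map_mul, map_mul, map_sub, map_one, PowerSeries.rescale_X]
  rw [map_one, one_mul, pow_one] at e1
  rw [pow_one] at eA
  have e4 : PowerSeries.C (q ^ 4) = PowerSeries.C (q ^ 2) * PowerSeries.C (q ^ 2) := by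
    rw [← map_mul, ← pow_add]
  rw [map_mul] at i1'
  rw [e4]
  generalize PowerSeries.rescale (q ^ 4) (PowerSeries.rescale (q ^ 2) (vacSeries q)) = h at *
  generalize PowerSeries.rescale (q ^ 2) (vacSeries q) = H at *
  generalize PowerSeries.rescale (q ^ 4) (qPochInf 1 1 (q ^ 4)) = f1 at *
  generalize PowerSeries.rescale (q ^ 4) (qPochInf (q ^ 2) 1 (q ^ 4)) = fA at *
  generalize PowerSeries.rescale (q ^ 4) (qPochInf 1 1 (q ^ 4))⁻¹ = fi at *
  generalize (qPochInf 1 1 (q ^ 4))⁻¹ = Fi at *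
  generalize qPochInf 1 1 (q ^ 4) = F1 at *
  generalize qPochInf (q ^ 2) 1 (q ^ 4) = FA at *
  generalize (PowerSeries.X : PowerSeries 𝕜) = x at *
  generalize PowerSeries.C (q ^ 2) = y at *
  linear_combination (-(fi * fA * (1 - y * y * x) * h)) * i1 +
    (fi * fA * (1 - y * y * x) * h * Fi) * e1 + ((1 - x) * Fi * fA * (1 - y * y * x) * h) * i1' -
    ((1 - x) * Fi * fA) * hv - ((1 - x) * Fi * H) * eA

/-- Only the levels 2c meet the left boundary, so an eigenvalue q^c of K at level c becomes q^{2c}: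
the series is rescaled by q². -/
theorem bareZ_two_two_of_diag (h0 : q ≠ 0) (hq : ∀ m : ℕ, m ≠ 0 → q ^ m ≠ 1) {N : ℕ}
    {a b : Fin (N + 1) → ℤ} {i j : Fin (N + 1) → ℕ} (ha : ∀ r : Fin N, a r.succ = 0)
    (hb : ∀ r : Fin N, b r.succ = 0) (hi : ∀ r : Fin N, i r.succ = 0)
    (hj : ∀ r : Fin N, j r.succ = 0) {f : ℕ → 𝕜}
    (hf : ∀ v c, site q (a 0) (b 0) (i 0) (j 0) v c = f c * v c) (c : ℕ) :
    PowerSeries.coeff c (bareZ q 2 2 a b i j) =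
      f (2 * c) * PowerSeries.coeff c (vacSeries q) := by
  rw [bareZ, coeff_boundaryBra, siteProd_first h0 hq ha hb hi hj, hf, vacSeries,
    PowerSeries.coeff_mk, boundaryKet, if_pos (dvd_mul_right _ _), Nat.mul_div_cancel_left _ two_pos]
  norm_num
  ring

theorem unitVec_zero_succ {N : ℕ} (r : Fin N) : unitVec (0 : Fin (N + 1)) r.succ = 0 :=
  unitVec_of_ne r.succ_ne_zero

theorem zvec_zero_succ {N : ℕ} (r : Fin N) : zvec (0 : Fin (N + 1)) r.succ = 0 :=
  zvec_of_ne r.succ_ne_zero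

theorem solZ_C1_vac (h0 : q ≠ 0) (h1 : ‖q‖ < 1) (hq : ∀ m : ℕ, m ≠ 0 → q ^ m ≠ 1) (N : ℕ) :
    solZ q .C1 (n := N + 1) (natVec 0) (natVec 0) 0 0 = 1 := by
  have : bareZ q 2 2 (0 : Fin (N + 1) → ℤ) 0 0 0 = vacSeries q := by
    ext c
    rw [bareZ_two_two_of_diag h0 hq (f := 1)] <;> simp [(isSite h0 hq).vac 0 0]
  simp only [solZ, natVec_zero, normFactor, leftExp, rightExp, this]
  exact rho22_same_mul_vacSeries hq h1 (by simp [parity_zero])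

theorem solZ_C1_zero_unit (h0 : q ≠ 0) (h1 : ‖q‖ < 1) (hq : ∀ m : ℕ, m ≠ 0 → q ^ m ≠ 1) (N : ℕ) :
    (1 - PowerSeries.X) * solZ q .C1 (n := N + 1) (natVec 0) (natVec (unitVec 0)) 0 (unitVec 0) =
      PowerSeries.C (-q) := by
  have : bareZ q 2 2 (0 : Fin (N + 1) → ℤ) (zvec 0) 0 (unitVec 0) =
      PowerSeries.C (-q) * PowerSeries.rescale (q ^ 2) (vacSeries q) := by
    ext c
    rw [bareZ_two_two_of_diag h0 hq (f := fun c => -q * q ^ c) (by simp) zvec_zero_succ (by simp)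
      unitVec_zero_succ, PowerSeries.coeff_C_mul, PowerSeries.coeff_rescale]
    · ring
    · intro v c
      simp [zvec_same, unitVec_same, site_zero_one h0 hq, oscK, mul_assoc]
  simp only [solZ, natVec_zero, natVec_unitVec, normFactor, leftExp, rightExp, this]
  have := rho22_ne_mul_vacSeries hq h1 (ε₁ := parity (0 : Fin (N + 1) → ℕ))
    (ε₂ := parity (unitVec (0 : Fin (N + 1)))) (by rw [parity_zero, parity_unitVec]; decide)
  linear_combination PowerSeries.C (-q) * this

theorem solZ_C1_unit_zero (h0 : q ≠ 0) (h1 : ‖q‖ < 1) (hq : ∀ m : ℕ, m ≠ 0 → q ^ m ≠ 1) (N : ℕ) :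
    (1 - PowerSeries.X) * solZ q .C1 (n := N + 1) (natVec (unitVec 0)) (natVec 0) (unitVec 0) 0 =
      1 := by
  have : bareZ q 2 2 (zvec (0 : Fin (N + 1))) 0 (unitVec 0) 0 =
      PowerSeries.rescale (q ^ 2) (vacSeries q) := by
    ext c
    rw [bareZ_two_two_of_diag h0 hq (f := fun c => q ^ c) zvec_zero_succ (by simp)
      unitVec_zero_succ (by simp), PowerSeries.coeff_rescale]
    · ring
    · intro v c
      simp [zvec_same, unitVec_same, site_one_zero h0 hq, oscK]
  simp only [solZ, natVec_zero, natVec_unitVec, normFactor, leftExp, rightExp, this]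
  exact rho22_ne_mul_vacSeries hq h1 (by rw [parity_zero, parity_unitVec]; decide)

/-- The first site acts as 1 - (1 + q²)K², which gives v(z) - (1 + q²) v(q⁴z) for the vacuum series
v. Since (1 - q²z) v(q⁴z) = (1 - z) v(z), the numerator is (1 - q²z) - (1 + q²)(1 - z) = z - q². -/
theorem solZ_C1_unit_unit (h0 : q ≠ 0) (h1 : ‖q‖ < 1) (hq : ∀ m : ℕ, m ≠ 0 → q ^ m ≠ 1) (N : ℕ) :
    (1 - PowerSeries.C (q ^ 2) * PowerSeries.X) *
      solZ q .C1 (n := N + 1) (natVec (unitVec 0)) (natVec (unitVec 0)) (unitVec 0) (unitVec 0) =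
      PowerSeries.X - PowerSeries.C (q ^ 2) := by
  have : bareZ q 2 2 (zvec (0 : Fin (N + 1))) (zvec 0) (unitVec 0) (unitVec 0) =
      vacSeries q - PowerSeries.C (1 + q ^ 2) * PowerSeries.rescale (q ^ 4) (vacSeries q) := by
    ext c
    rw [bareZ_two_two_of_diag h0 hq (f := fun c => 1 - (1 + q ^ 2) * (q ^ c * q ^ c))
      zvec_zero_succ zvec_zero_succ unitVec_zero_succ unitVec_zero_succ, map_sub,
      PowerSeries.coeff_C_mul, PowerSeries.coeff_rescale]
    · ring
    · intro v c
      simp [zvec_same, unitVec_same, site_one_one h0 hq, oscK]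
      ring
  simp only [solZ, natVec_unitVec, normFactor, leftExp, rightExp, this]
  have h := rho22_same_mul_vacSeries hq h1 (ε₁ := parity (unitVec (0 : Fin (N + 1))))
    (ε₂ := parity (unitVec (0 : Fin (N + 1)))) (by rw [parity_unitVec]; decide)
  have hv := vacSeries_rescale hq
  have e : PowerSeries.C (1 + q ^ 2) = 1 + PowerSeries.C (q ^ 2) := by rw [map_add, map_one]
  rw [e]
  linear_combination (1 - PowerSeries.C (q ^ 2) * PowerSeries.X -
    (1 + PowerSeries.C (q ^ 2)) * (1 - PowerSeries.X)) * h +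
    ((1 + PowerSeries.C (q ^ 2)) * rho22 q (parity (unitVec (0 : Fin (N + 1))))
      (parity (unitVec (0 : Fin (N + 1))))) * hv

end Vacuum

/-! ### The Serre relations as identities between q-integers -/

section SerreIdentities

variable {E : Type*} [Field E]

/-- `[y] [y - 1] ⋯ [y - k + 1]`. -/
def qFall (b : E) (k : ℕ) (y : ℤ) : E := ∏ s ∈ Finset.range k, qInt b (y - s)

theorem qFall_zero (b : E) (y : ℤ) : qFall b 0 y = 1 := by simp [qFall]

theorem qFall_one (b : E) (y : ℤ) : qFall b 1 y = qInt b y := by simp [qFall]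

theorem qFall_two (b : E) (y : ℤ) : qFall b 2 y = qInt b y * qInt b (y - 1) := by
  simp [qFall, Finset.prod_range_succ]

/-- The scalar form of the Serre relation for two weighted shifts. -/
def SerreId (b : E) (n : ℕ) (C : ℤ → E) (σ t : ℤ) (D : ℤ → E) (τ : ℤ) : Prop :=
  ∀ y w : ℤ, ∑ ν ∈ Finset.range (n + 1), (-1) ^ ν * (qFact b (n - ν))⁻¹ * (qFact b ν)⁻¹ *
    ((∏ s ∈ Finset.range (n - ν), C (y + t + (ν + s) * σ)) * D (w + ν * τ) *
      ∏ s ∈ Finset.range ν, C (y + s * σ)) = 0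

/-- If u does not change the site on which the weight of v depends, that weight is a common factor.
-/
theorem SerreId.of_const {b : E} {n : ℕ} {C : ℤ → E} {σ t : ℤ} {D : ℤ → E} {τ : ℤ}
    (hD : ∀ w (ν : ℕ), D (w + ν * τ) = D w) (h : SerreId b n C σ t (fun _ => 1) 0) :
    SerreId b n C σ t D τ := by
  intro y w
  rw [← zero_mul (D w), ← h y w, Finset.sum_mul]
  refine Finset.sum_congr rfl fun ν _ => ?_
  rw [hD]
  ring

theorem qFall_const {b : E} {k : ℕ} {τ : ℤ} (h : k = 0 ∨ τ = 0) (w : ℤ) (ν : ℕ) :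
    qFall b k (w + ν * τ) = qFall b k w := by
  rcases h with rfl | rfl
  · simp [qFall_zero]
  · simp

variable {p : E}

/-- The case of a zero Cartan entry, where the relation says that the two operators commute: neither
shift affects the weight of the other. -/
theorem serreId_one (b : E) {k l : ℕ} {σ t τ : ℤ} (ht : k = 0 ∨ t = 0) (hτ : l = 0 ∨ τ = 0) :
    SerreId b 1 (qFall (p ^ 2) k) σ t (qFall (p ^ 2) l) τ := by
  refine SerreId.of_const (qFall_const hτ) fun y w => ?_
  have h := qFall_const (b := p ^ 2) ht y 1
  rw [Nat.cast_one, one_mul] at h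
  simp [Finset.sum_range_succ, h]
  ring


theorem sq_sub_one_ne_zero {b : E} (hb : ∀ m : ℕ, m ≠ 0 → b ^ m ≠ 1) : b ^ 2 - 1 ≠ 0 :=
  sub_ne_zero.2 (hb 2 two_ne_zero)

theorem sub_inv_ne_zero {b : E} (h0 : b ≠ 0) (hb : ∀ m : ℕ, m ≠ 0 → b ^ m ≠ 1) :
    b - b⁻¹ ≠ 0 := by
  intro h
  refine sq_sub_one_ne_zero hb ?_
  linear_combination b * h + mul_inv_cancel₀ h0

theorem qInt_one {b : E} (h0 : b ≠ 0) (hb : ∀ m : ℕ, m ≠ 0 → b ^ m ≠ 1) : qInt b 1 = 1 := by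
  rw [qInt, zpow_neg, zpow_one, div_self (sub_inv_ne_zero h0 hb)]

theorem qInt_natCast_ne_zero {b : E} (h0 : b ≠ 0) (hb : ∀ m : ℕ, m ≠ 0 → b ^ m ≠ 1) {k : ℕ}
    (hk : k ≠ 0) : qInt b k ≠ 0 := by
  rw [qInt, zpow_neg, zpow_natCast]
  refine div_ne_zero (sub_inv_ne_zero (pow_ne_zero k h0) fun m hm => ?_) (sub_inv_ne_zero h0 hb)
  rw [← pow_mul]
  exact hb _ (mul_ne_zero hk hm)

theorem qFact_succ (b : E) (m : ℕ) : qFact b (m + 1) = qFact b m * qInt b ((m : ℤ) + 1) :=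
  Finset.prod_range_succ _ _

theorem qInt_succ {b : E} (h0 : b ≠ 0) (hb : ∀ m : ℕ, m ≠ 0 → b ^ m ≠ 1) (m : ℤ) :
    qInt b (m + 1) = b ^ m + b⁻¹ * qInt b m := by
  have h := sub_inv_ne_zero h0 hb
  have h' : b ^ m ≠ 0 := zpow_ne_zero _ h0
  rw [qInt, qInt, zpow_neg, zpow_neg, zpow_add_one₀ h0, div_eq_iff h, add_mul, mul_assoc,
    div_mul_cancel₀ _ h, mul_inv]
  ring

theorem qFact_zero (b : E) : qFact b 0 = 1 := by simp [qFact]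

theorem qFact_one {b : E} (h0 : b ≠ 0) (hb : ∀ m : ℕ, m ≠ 0 → b ^ m ≠ 1) : qFact b 1 = 1 := by
  simp [qFact, qInt_one h0 hb]

theorem qInt_two {b : E} (h0 : b ≠ 0) (hb : ∀ m : ℕ, m ≠ 0 → b ^ m ≠ 1) :
    qInt b 2 = b + b⁻¹ := by
  rw [show (2 : ℤ) = 1 + 1 from rfl, qInt_succ h0 hb, qInt_one h0 hb, zpow_one, mul_one]

theorem qInt_three {b : E} (h0 : b ≠ 0) (hb : ∀ m : ℕ, m ≠ 0 → b ^ m ≠ 1) :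
    qInt b 3 = b ^ 2 + 1 + b⁻¹ ^ 2 := by
  rw [show (3 : ℤ) = 2 + 1 from rfl, qInt_succ h0 hb, qInt_two h0 hb, zpow_ofNat]
  linear_combination inv_mul_cancel₀ h0

theorem qInt_four {b : E} (h0 : b ≠ 0) (hb : ∀ m : ℕ, m ≠ 0 → b ^ m ≠ 1) :
    qInt b 4 = qInt b 2 * (b ^ 2 + b⁻¹ ^ 2) := by
  rw [show (4 : ℤ) = 3 + 1 from rfl, qInt_succ h0 hb, qInt_three h0 hb, qInt_two h0 hb, zpow_ofNat]
  field_simp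
  ring

theorem qInt_five {b : E} (h0 : b ≠ 0) (hb : ∀ m : ℕ, m ≠ 0 → b ^ m ≠ 1) :
    qInt b 5 = b ^ 4 + b ^ 2 + 1 + b⁻¹ ^ 2 + b⁻¹ ^ 4 := by
  rw [show (5 : ℤ) = 4 + 1 from rfl, qInt_succ h0 hb, qInt_four h0 hb, qInt_two h0 hb, zpow_ofNat]
  field_simp
  ring

/-- Multiplying by [2]! turns the divided powers into q-binomial coefficients. The next two lemmas
do the same for three and five factors. -/
theorem SerreId.of_two {b : E} (h0 : b ≠ 0) (hb : ∀ m : ℕ, m ≠ 0 → b ^ m ≠ 1) {C D : ℤ → E}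
    {σ t τ : ℤ} (h : ∀ y w, C (y + t) * C (y + t + σ) * D w -
      qInt b 2 * (C (y + t + σ) * D (w + τ) * C y) +
      D (w + 2 * τ) * C y * C (y + σ) = 0) : SerreId b 2 C σ t D τ := by
  intro y w
  have h2 : qInt b 2 ≠ 0 := by exact_mod_cast qInt_natCast_ne_zero h0 hb (k := 2) two_ne_zero
  have e2 : qFact b 2 = qInt b 2 := by
    rw [qFact_succ, qFact_one h0 hb, one_mul]
    rfl
  simp only [Finset.sum_range_succ, Finset.sum_range_zero, Finset.prod_range_succ,
    Finset.prod_range_zero, Nat.sub_zero, Nat.sub_self, Nat.reduceSub, qFact_zero, e2,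
    qFact_one h0 hb, Nat.cast_zero, Nat.cast_one, zero_add, zero_mul, add_zero, one_mul, pow_zero,
    pow_one, mul_one, Nat.cast_ofNat, inv_one]
  rw [← mul_zero (qInt b 2)⁻¹, ← h y w]
  generalize qInt b 2 = s at *
  field_simp
  ring

theorem SerreId.of_three {b : E} (h0 : b ≠ 0) (hb : ∀ m : ℕ, m ≠ 0 → b ^ m ≠ 1) {C D : ℤ → E}
    {σ t τ : ℤ} (h : ∀ y w, C (y + t) * C (y + t + σ) * C (y + t + 2 * σ) * D w -
      qInt b 3 * (C (y + t + σ) * C (y + t + 2 * σ) * D (w + τ) * C y) +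
      qInt b 3 * (C (y + t + 2 * σ) * D (w + 2 * τ) * C y * C (y + σ)) -
      D (w + 3 * τ) * C y * C (y + σ) * C (y + 2 * σ) = 0) : SerreId b 3 C σ t D τ := by
  intro y w
  have h2 : qInt b 2 ≠ 0 := by exact_mod_cast qInt_natCast_ne_zero h0 hb (k := 2) two_ne_zero
  have h3 : qInt b 3 ≠ 0 := by exact_mod_cast qInt_natCast_ne_zero h0 hb (k := 3) three_ne_zero
  have e2 : qFact b 2 = qInt b 2 := by
    rw [qFact_succ, qFact_one h0 hb, one_mul]
    rfl
  have e3 : qFact b 3 = qInt b 2 * qInt b 3 := by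
    rw [qFact_succ, e2]
    rfl
  simp only [Finset.sum_range_succ, Finset.sum_range_zero, Finset.prod_range_succ,
    Finset.prod_range_zero, Nat.sub_zero, Nat.sub_self, Nat.reduceSub, qFact_zero, e2, e3,
    qFact_one h0 hb, Nat.cast_zero, Nat.cast_one, zero_add, zero_mul, add_zero, one_mul, pow_zero,
    pow_one, mul_one, Nat.cast_ofNat, inv_one, Int.reduceAdd]
  rw [← mul_zero (qInt b 2 * qInt b 3)⁻¹, ← h y w]
  generalize qInt b 2 = s at *
  generalize qInt b 3 = s' at *
  field_simp
  ring

theorem SerreId.of_five {b : E} (h0 : b ≠ 0) (hb : ∀ m : ℕ, m ≠ 0 → b ^ m ≠ 1) {C D : ℤ → E}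
    {σ t τ : ℤ} (h : ∀ y w,
      C (y + t) * C (y + t + σ) * C (y + t + 2 * σ) * C (y + t + 3 * σ) * C (y + t + 4 * σ) * D w -
      qInt b 5 * (C (y + t + σ) * C (y + t + 2 * σ) * C (y + t + 3 * σ) * C (y + t + 4 * σ) *
        D (w + τ) * C y) +
      qInt b 5 * (b ^ 2 + b⁻¹ ^ 2) * (C (y + t + 2 * σ) * C (y + t + 3 * σ) * C (y + t + 4 * σ) *
        D (w + 2 * τ) * C y * C (y + σ)) -
      qInt b 5 * (b ^ 2 + b⁻¹ ^ 2) * (C (y + t + 3 * σ) * C (y + t + 4 * σ) *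
        D (w + 3 * τ) * C y * C (y + σ) * C (y + 2 * σ)) +
      qInt b 5 * (C (y + t + 4 * σ) * D (w + 4 * τ) * C y * C (y + σ) * C (y + 2 * σ) *
        C (y + 3 * σ)) -
      D (w + 5 * τ) * C y * C (y + σ) * C (y + 2 * σ) * C (y + 3 * σ) * C (y + 4 * σ) = 0) :
    SerreId b 5 C σ t D τ := by
  intro y w
  have h2 : qInt b 2 ≠ 0 := by exact_mod_cast qInt_natCast_ne_zero h0 hb (k := 2) two_ne_zero
  have h3 : qInt b 3 ≠ 0 := by exact_mod_cast qInt_natCast_ne_zero h0 hb (k := 3) three_ne_zero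
  have h4 : qInt b 4 ≠ 0 := by exact_mod_cast qInt_natCast_ne_zero h0 hb (k := 4) four_ne_zero
  have h5 : qInt b 5 ≠ 0 := by exact_mod_cast qInt_natCast_ne_zero h0 hb (k := 5) (by norm_num)
  have e2 : qFact b 2 = qInt b 2 := by
    rw [qFact_succ, qFact_one h0 hb, one_mul]
    rfl
  have e3 : qFact b 3 = qInt b 2 * qInt b 3 := by
    rw [qFact_succ, e2]
    rfl
  have e4 : qFact b 4 = qInt b 2 * qInt b 3 * qInt b 4 := by
    rw [qFact_succ, e3]
    rfl
  have e5 : qFact b 5 = qInt b 2 * qInt b 3 * qInt b 4 * qInt b 5 := by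
    rw [qFact_succ, e4]
    rfl
  simp only [Finset.sum_range_succ, Finset.sum_range_zero, Finset.prod_range_succ,
    Finset.prod_range_zero, Nat.sub_zero, Nat.sub_self, Nat.reduceSub, qFact_zero, e2, e3, e4, e5,
    qFact_one h0 hb, Nat.cast_zero, Nat.cast_one, zero_add, zero_mul, add_zero, one_mul, pow_zero,
    pow_one, mul_one, Nat.cast_ofNat, inv_one, Int.reduceAdd]
  rw [← mul_zero (qInt b 2 * qInt b 3 * qInt b 4 * qInt b 5)⁻¹, ← h y w]
  -- The middle q-binomial coefficient is [5][4]/[2] = [5](b² + b⁻²).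
  have e := qInt_four h0 hb
  rw [e] at h4 ⊢
  have hr := right_ne_zero_of_mul h4
  generalize qInt b 2 = s at *
  generalize qInt b 3 = s' at *
  generalize qInt b 5 = s5 at *
  generalize b ^ 2 + b⁻¹ ^ 2 = r at *
  field_simp
  ring

/-- Separates the variable power b^y from the constant shift, so that a Serre identity becomes a
polynomial identity in p, b^y, b^w and their inverses. -/
theorem qInt_eq (b : E) (h0 : b ≠ 0) (y z : ℤ) :
    qInt b (y + z) = (b ^ y * b ^ z - (b ^ y)⁻¹ * b ^ (-z)) * (b - b⁻¹)⁻¹ := by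
  rw [qInt, zpow_neg, zpow_add₀ h0, zpow_neg, mul_inv, div_eq_mul_inv]

/-- The list that starts here has one entry for each way in which two neighbouring vertices can act.
The name records the number of quanta removed by u, and then either the number removed by v, when u
feeds the site that v empties, or the shift by v at the site that u empties. -/
theorem serreId_fall_one_fall_one (h0 : p ≠ 0) (hp : ∀ m : ℕ, m ≠ 0 → p ^ m ≠ 1) :
    SerreId (p ^ 2) 2 (qFall (p ^ 2) 1) (-1) 0 (qFall (p ^ 2) 1) 1 := by
  refine SerreId.of_two (pow_ne_zero _ h0) (fun m hm => by rw [← pow_mul]; exact hp _ (by omega)) fun y w => ?_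
  rw [qInt_two (pow_ne_zero _ h0) (fun m hm => by rw [← pow_mul]; exact hp _ (by omega))]
  simp only [qFall_one, mul_one, add_zero, sub_eq_add_neg, add_assoc]
  try norm_num only
  have hw (z : ℤ) : qInt (p ^ 2) (w + z) = _ := qInt_eq (p ^ 2) (pow_ne_zero _ h0) w z
  have hy (z : ℤ) : qInt (p ^ 2) (y + z) = _ := qInt_eq (p ^ 2) (pow_ne_zero _ h0) y z
  have hw0 := hw 0
  have hy0 := hy 0
  rw [add_zero] at hw0 hy0
  simp only [hw, hy, hw0, hy0]
  have hY := zpow_ne_zero y (pow_ne_zero 2 h0)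
  have hW := zpow_ne_zero w (pow_ne_zero 2 h0)
  generalize (p ^ 2) ^ y = Y at *
  generalize (p ^ 2) ^ w = W at *
  generalize (p ^ 2 + -(p ^ 2)⁻¹)⁻¹ = d at *
  norm_num [zpow_neg, zpow_ofNat]
  field_simp
  ring

theorem serreId_fall_one_shift_one (h0 : p ≠ 0) (hp : ∀ m : ℕ, m ≠ 0 → p ^ m ≠ 1) {l : ℕ} {τ : ℤ} (hτ : l = 0 ∨ τ = 0) :
    SerreId (p ^ 2) 2 (qFall (p ^ 2) 1) (-1) 1 (qFall (p ^ 2) l) τ := by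
  refine SerreId.of_const (qFall_const hτ) ?_
  refine SerreId.of_two (pow_ne_zero _ h0) (fun m hm => by rw [← pow_mul]; exact hp _ (by omega)) fun y w => ?_
  rw [qInt_two (pow_ne_zero _ h0) (fun m hm => by rw [← pow_mul]; exact hp _ (by omega))]
  simp only [qFall_one, one_mul, mul_one, sub_eq_add_neg, add_assoc]
  try norm_num only
  have hw (z : ℤ) : qInt (p ^ 2) (w + z) = _ := qInt_eq (p ^ 2) (pow_ne_zero _ h0) w z
  have hy (z : ℤ) : qInt (p ^ 2) (y + z) = _ := qInt_eq (p ^ 2) (pow_ne_zero _ h0) y z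
  have hw0 := hw 0
  have hy0 := hy 0
  rw [add_zero] at hw0 hy0
  simp only [hy, hy0]
  have hY := zpow_ne_zero y (pow_ne_zero 2 h0)
  have hW := zpow_ne_zero w (pow_ne_zero 2 h0)
  generalize (p ^ 2) ^ y = Y at *
  generalize (p ^ 2) ^ w = W at *
  generalize (p ^ 2 + -(p ^ 2)⁻¹)⁻¹ = d at *
  norm_num [zpow_neg, zpow_ofNat]
  field_simp
  ring

theorem serreId_const_fall_one (h0 : p ≠ 0) (hp : ∀ m : ℕ, m ≠ 0 → p ^ m ≠ 1) {σ t : ℤ} :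
    SerreId p 3 (qFall (p ^ 2) 0) σ t (qFall (p ^ 2) 1) 1 := by
  refine SerreId.of_three h0 hp fun y w => ?_
  rw [qInt_three h0 hp]
  simp only [qFall_zero, qFall_one, one_mul, mul_one, sub_eq_add_neg, add_assoc]
  try norm_num only
  have hw (z : ℤ) : qInt (p ^ 2) (w + z) = _ := qInt_eq (p ^ 2) (pow_ne_zero _ h0) w z
  have hy (z : ℤ) : qInt (p ^ 2) (y + z) = _ := qInt_eq (p ^ 2) (pow_ne_zero _ h0) y z
  have hw0 := hw 0
  have hy0 := hy 0
  rw [add_zero] at hw0 hy0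
  simp only [hw, hw0]
  have hY := zpow_ne_zero y (pow_ne_zero 2 h0)
  have hW := zpow_ne_zero w (pow_ne_zero 2 h0)
  generalize (p ^ 2) ^ y = Y at *
  generalize (p ^ 2) ^ w = W at *
  generalize (p ^ 2 + -(p ^ 2)⁻¹)⁻¹ = d at *
  norm_num [zpow_neg, zpow_ofNat]
  field_simp
  ring

theorem serreId_const_fall_one_two (h0 : p ≠ 0) (hp : ∀ m : ℕ, m ≠ 0 → p ^ m ≠ 1) {σ t : ℤ} :
    SerreId (p ^ 4) 2 (qFall (p ^ 2) 0) σ t (qFall (p ^ 2) 1) 2 := by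
  refine SerreId.of_two (pow_ne_zero _ h0) (fun m hm => by rw [← pow_mul]; exact hp _ (by omega)) fun y w => ?_
  rw [qInt_two (pow_ne_zero _ h0) (fun m hm => by rw [← pow_mul]; exact hp _ (by omega))]
  simp only [qFall_zero, qFall_one, one_mul, mul_one, sub_eq_add_neg, add_assoc]
  try norm_num only
  have hw (z : ℤ) : qInt (p ^ 2) (w + z) = _ := qInt_eq (p ^ 2) (pow_ne_zero _ h0) w z
  have hy (z : ℤ) : qInt (p ^ 2) (y + z) = _ := qInt_eq (p ^ 2) (pow_ne_zero _ h0) y z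
  have hw0 := hw 0
  have hy0 := hy 0
  rw [add_zero] at hw0 hy0
  simp only [hw, hw0]
  have hY := zpow_ne_zero y (pow_ne_zero 2 h0)
  have hW := zpow_ne_zero w (pow_ne_zero 2 h0)
  generalize (p ^ 2) ^ y = Y at *
  generalize (p ^ 2) ^ w = W at *
  generalize (p ^ 2 + -(p ^ 2)⁻¹)⁻¹ = d at *
  norm_num [zpow_neg, zpow_ofNat]
  field_simp
  ring

theorem serreId_fall_one_shift_two (h0 : p ≠ 0) (hp : ∀ m : ℕ, m ≠ 0 → p ^ m ≠ 1) {l : ℕ} {τ : ℤ} (hτ : l = 0 ∨ τ = 0) :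
    SerreId (p ^ 2) 3 (qFall (p ^ 2) 1) (-1) 2 (qFall (p ^ 2) l) τ := by
  refine SerreId.of_const (qFall_const hτ) ?_
  refine SerreId.of_three (pow_ne_zero _ h0) (fun m hm => by rw [← pow_mul]; exact hp _ (by omega)) fun y w => ?_
  rw [qInt_three (pow_ne_zero _ h0) (fun m hm => by rw [← pow_mul]; exact hp _ (by omega))]
  simp only [qFall_one, one_mul, mul_one, sub_eq_add_neg, add_assoc]
  try norm_num only
  have hw (z : ℤ) : qInt (p ^ 2) (w + z) = _ := qInt_eq (p ^ 2) (pow_ne_zero _ h0) w z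
  have hy (z : ℤ) : qInt (p ^ 2) (y + z) = _ := qInt_eq (p ^ 2) (pow_ne_zero _ h0) y z
  have hw0 := hw 0
  have hy0 := hy 0
  rw [add_zero] at hw0 hy0
  simp only [hy, hy0]
  have hY := zpow_ne_zero y (pow_ne_zero 2 h0)
  have hW := zpow_ne_zero w (pow_ne_zero 2 h0)
  generalize (p ^ 2) ^ y = Y at *
  generalize (p ^ 2) ^ w = W at *
  generalize (p ^ 2 + -(p ^ 2)⁻¹)⁻¹ = d at *
  norm_num [zpow_neg, zpow_ofNat]
  field_simp
  ring

theorem serreId_fall_one_shift_one' (h0 : p ≠ 0) (hp : ∀ m : ℕ, m ≠ 0 → p ^ m ≠ 1) {l : ℕ} {τ : ℤ} (hτ : l = 0 ∨ τ = 0) :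
    SerreId p 3 (qFall (p ^ 2) 1) (-1) 1 (qFall (p ^ 2) l) τ := by
  refine SerreId.of_const (qFall_const hτ) ?_
  refine SerreId.of_three h0 hp fun y w => ?_
  rw [qInt_three h0 hp]
  simp only [qFall_one, one_mul, mul_one, sub_eq_add_neg, add_assoc]
  try norm_num only
  have hw (z : ℤ) : qInt (p ^ 2) (w + z) = _ := qInt_eq (p ^ 2) (pow_ne_zero _ h0) w z
  have hy (z : ℤ) : qInt (p ^ 2) (y + z) = _ := qInt_eq (p ^ 2) (pow_ne_zero _ h0) y z
  have hw0 := hw 0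
  have hy0 := hy 0
  rw [add_zero] at hw0 hy0
  simp only [hy, hy0]
  have hY := zpow_ne_zero y (pow_ne_zero 2 h0)
  have hW := zpow_ne_zero w (pow_ne_zero 2 h0)
  generalize (p ^ 2) ^ y = Y at *
  generalize (p ^ 2) ^ w = W at *
  generalize (p ^ 2 + -(p ^ 2)⁻¹)⁻¹ = d at *
  norm_num [zpow_neg, zpow_ofNat]
  field_simp
  ring

theorem serreId_fall_two_shift_one (h0 : p ≠ 0) (hp : ∀ m : ℕ, m ≠ 0 → p ^ m ≠ 1) {l : ℕ} {τ : ℤ} (hτ : l = 0 ∨ τ = 0) :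
    SerreId (p ^ 4) 2 (qFall (p ^ 2) 2) (-2) 1 (qFall (p ^ 2) l) τ := by
  refine SerreId.of_const (qFall_const hτ) ?_
  refine SerreId.of_two (pow_ne_zero _ h0) (fun m hm => by rw [← pow_mul]; exact hp _ (by omega)) fun y w => ?_
  rw [qInt_two (pow_ne_zero _ h0) (fun m hm => by rw [← pow_mul]; exact hp _ (by omega))]
  simp only [qFall_two, one_mul, mul_one, sub_eq_add_neg, add_assoc]
  try norm_num only
  have hw (z : ℤ) : qInt (p ^ 2) (w + z) = _ := qInt_eq (p ^ 2) (pow_ne_zero _ h0) w z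
  have hy (z : ℤ) : qInt (p ^ 2) (y + z) = _ := qInt_eq (p ^ 2) (pow_ne_zero _ h0) y z
  have hw0 := hw 0
  have hy0 := hy 0
  rw [add_zero] at hw0 hy0
  simp only [hy, hy0]
  have hY := zpow_ne_zero y (pow_ne_zero 2 h0)
  have hW := zpow_ne_zero w (pow_ne_zero 2 h0)
  generalize (p ^ 2) ^ y = Y at *
  generalize (p ^ 2) ^ w = W at *
  generalize (p ^ 2 + -(p ^ 2)⁻¹)⁻¹ = d at *
  norm_num [zpow_neg, zpow_ofNat]
  field_simp
  ring

theorem serreId_fall_one_fall_two (h0 : p ≠ 0) (hp : ∀ m : ℕ, m ≠ 0 → p ^ m ≠ 1) :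
    SerreId (p ^ 2) 3 (qFall (p ^ 2) 1) (-1) 0 (qFall (p ^ 2) 2) 1 := by
  refine SerreId.of_three (pow_ne_zero _ h0) (fun m hm => by rw [← pow_mul]; exact hp _ (by omega)) fun y w => ?_
  rw [qInt_three (pow_ne_zero _ h0) (fun m hm => by rw [← pow_mul]; exact hp _ (by omega))]
  simp only [qFall_one, qFall_two, mul_one, add_zero, sub_eq_add_neg, add_assoc]
  try norm_num only
  have hw (z : ℤ) : qInt (p ^ 2) (w + z) = _ := qInt_eq (p ^ 2) (pow_ne_zero _ h0) w z
  have hy (z : ℤ) : qInt (p ^ 2) (y + z) = _ := qInt_eq (p ^ 2) (pow_ne_zero _ h0) y z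
  have hw0 := hw 0
  have hy0 := hy 0
  rw [add_zero] at hw0 hy0
  simp only [hw, hy, hw0, hy0]
  have hY := zpow_ne_zero y (pow_ne_zero 2 h0)
  have hW := zpow_ne_zero w (pow_ne_zero 2 h0)
  generalize (p ^ 2) ^ y = Y at *
  generalize (p ^ 2) ^ w = W at *
  generalize (p ^ 2 + -(p ^ 2)⁻¹)⁻¹ = d at *
  norm_num [zpow_neg, zpow_ofNat]
  field_simp
  ring

theorem serreId_const_fall_two_two (h0 : p ≠ 0) (hp : ∀ m : ℕ, m ≠ 0 → p ^ m ≠ 1) {σ t : ℤ} :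
    SerreId (p ^ 4) 3 (qFall (p ^ 2) 0) σ t (qFall (p ^ 2) 2) 2 := by
  refine SerreId.of_three (pow_ne_zero _ h0) (fun m hm => by rw [← pow_mul]; exact hp _ (by omega)) fun y w => ?_
  rw [qInt_three (pow_ne_zero _ h0) (fun m hm => by rw [← pow_mul]; exact hp _ (by omega))]
  simp only [qFall_zero, qFall_two, one_mul, mul_one, sub_eq_add_neg, add_assoc]
  try norm_num only
  have hw (z : ℤ) : qInt (p ^ 2) (w + z) = _ := qInt_eq (p ^ 2) (pow_ne_zero _ h0) w z
  have hy (z : ℤ) : qInt (p ^ 2) (y + z) = _ := qInt_eq (p ^ 2) (pow_ne_zero _ h0) y z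
  have hw0 := hw 0
  have hy0 := hy 0
  rw [add_zero] at hw0 hy0
  simp only [hw, hw0]
  have hY := zpow_ne_zero y (pow_ne_zero 2 h0)
  have hW := zpow_ne_zero w (pow_ne_zero 2 h0)
  generalize (p ^ 2) ^ y = Y at *
  generalize (p ^ 2) ^ w = W at *
  generalize (p ^ 2 + -(p ^ 2)⁻¹)⁻¹ = d at *
  norm_num [zpow_neg, zpow_ofNat]
  field_simp
  ring

/-- The relation with five factors arises only for A^{(2)}_2, whose Cartan matrix has an entry -4.
-/
theorem serreId_const_fall_two (h0 : p ≠ 0) (hp : ∀ m : ℕ, m ≠ 0 → p ^ m ≠ 1) {σ t : ℤ} :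
    SerreId p 5 (qFall (p ^ 2) 0) σ t (qFall (p ^ 2) 2) 1 := by
  refine SerreId.of_five h0 hp fun y w => ?_
  rw [qInt_five h0 hp]
  simp only [qFall_zero, qFall_two, one_mul, mul_one, sub_eq_add_neg, add_assoc]
  try norm_num only
  have hw (z : ℤ) : qInt (p ^ 2) (w + z) = _ := qInt_eq (p ^ 2) (pow_ne_zero _ h0) w z
  have hy (z : ℤ) : qInt (p ^ 2) (y + z) = _ := qInt_eq (p ^ 2) (pow_ne_zero _ h0) y z
  have hw0 := hw 0
  have hy0 := hy 0
  rw [add_zero] at hw0 hy0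
  simp only [hw, hw0]
  have hY := zpow_ne_zero y (pow_ne_zero 2 h0)
  have hW := zpow_ne_zero w (pow_ne_zero 2 h0)
  generalize (p ^ 2) ^ y = Y at *
  generalize (p ^ 2) ^ w = W at *
  generalize (p ^ 2 + -(p ^ 2)⁻¹)⁻¹ = d at *
  norm_num [zpow_neg, zpow_ofNat]
  field_simp
  ring

theorem serreId_fall_two_shift_two (h0 : p ≠ 0) (hp : ∀ m : ℕ, m ≠ 0 → p ^ m ≠ 1) {l : ℕ} {τ : ℤ} (hτ : l = 0 ∨ τ = 0) :
    SerreId (p ^ 4) 3 (qFall (p ^ 2) 2) (-2) 2 (qFall (p ^ 2) l) τ := by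
  refine SerreId.of_const (qFall_const hτ) ?_
  refine SerreId.of_three (pow_ne_zero _ h0) (fun m hm => by rw [← pow_mul]; exact hp _ (by omega)) fun y w => ?_
  rw [qInt_three (pow_ne_zero _ h0) (fun m hm => by rw [← pow_mul]; exact hp _ (by omega))]
  simp only [qFall_two, one_mul, mul_one, sub_eq_add_neg, add_assoc]
  try norm_num only
  have hw (z : ℤ) : qInt (p ^ 2) (w + z) = _ := qInt_eq (p ^ 2) (pow_ne_zero _ h0) w z
  have hy (z : ℤ) : qInt (p ^ 2) (y + z) = _ := qInt_eq (p ^ 2) (pow_ne_zero _ h0) y z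
  have hw0 := hw 0
  have hy0 := hy 0
  rw [add_zero] at hw0 hy0
  simp only [hy, hy0]
  have hY := zpow_ne_zero y (pow_ne_zero 2 h0)
  have hW := zpow_ne_zero w (pow_ne_zero 2 h0)
  generalize (p ^ 2) ^ y = Y at *
  generalize (p ^ 2) ^ w = W at *
  generalize (p ^ 2 + -(p ^ 2)⁻¹)⁻¹ = d at *
  norm_num [zpow_neg, zpow_ofNat]
  field_simp
  ring

theorem serreId_fall_one_shift_two' (h0 : p ≠ 0) (hp : ∀ m : ℕ, m ≠ 0 → p ^ m ≠ 1) {l : ℕ} {τ : ℤ} (hτ : l = 0 ∨ τ = 0) :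
    SerreId p 5 (qFall (p ^ 2) 1) (-1) 2 (qFall (p ^ 2) l) τ := by
  refine SerreId.of_const (qFall_const hτ) ?_
  refine SerreId.of_five h0 hp fun y w => ?_
  rw [qInt_five h0 hp]
  simp only [qFall_one, one_mul, mul_one, sub_eq_add_neg, add_assoc]
  try norm_num only
  have hw (z : ℤ) : qInt (p ^ 2) (w + z) = _ := qInt_eq (p ^ 2) (pow_ne_zero _ h0) w z
  have hy (z : ℤ) : qInt (p ^ 2) (y + z) = _ := qInt_eq (p ^ 2) (pow_ne_zero _ h0) y z
  have hw0 := hw 0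
  have hy0 := hy 0
  rw [add_zero] at hw0 hy0
  simp only [hy, hy0]
  have hY := zpow_ne_zero y (pow_ne_zero 2 h0)
  have hW := zpow_ne_zero w (pow_ne_zero 2 h0)
  generalize (p ^ 2) ^ y = Y at *
  generalize (p ^ 2) ^ w = W at *
  generalize (p ^ 2 + -(p ^ 2)⁻¹)⁻¹ = d at *
  norm_num [zpow_neg, zpow_ofNat]
  field_simp
  ring

end SerreIdentities

/-! ### Weighted shifts on the integral lattice -/

section Lattice

variable {E : Type*} [Field E] {n : ℕ}

/-- The weighted shift `|m⟩ ↦ c(m) |m + α⟩` on functions on the lattice. -/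
def latOp (c : (Fin n → ℤ) → E) (α : Fin n → ℤ) : Module.End E ((Fin n → ℤ) → E) where
  toFun f a := c (a - α) * f (a - α)
  map_add' f g := by ext a; simp [mul_add]
  map_smul' x f := by ext a; simp [mul_left_comm]

theorem latOp_apply (c : (Fin n → ℤ) → E) (α : Fin n → ℤ) (f : (Fin n → ℤ) → E) (a : Fin n → ℤ) :
    latOp c α f a = c (a - α) * f (a - α) := rfl

theorem latOp_mul (c d : (Fin n → ℤ) → E) (α β : Fin n → ℤ) :
    latOp c α * latOp d β = latOp (fun m => c (m + β) * d m) (α + β) := by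
  ext f a
  simp only [Module.End.mul_apply, latOp_apply, sub_sub, mul_assoc]
  congr 2
  abel

theorem latOp_one : latOp (fun _ : Fin n → ℤ => (1 : E)) 0 = 1 := by
  ext f a
  simp [latOp_apply]

theorem latOp_pow (c : (Fin n → ℤ) → E) (α : Fin n → ℤ) (k : ℕ) :
    latOp c α ^ k = latOp (fun m => ∏ s ∈ Finset.range k, c (m + s • α)) (k • α) := by
  induction k with
  | zero => simp [latOp_one]
  | succ k ih =>
    rw [pow_succ', ih, latOp_mul]
    congr 1
    · ext m
      rw [Finset.prod_range_succ, mul_comm]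
    · rw [succ_nsmul']

/-- Every word in the sum shifts by the same vector kα + β, so the relation reduces to the vanishing
of a sum of weights at each lattice point, which is the scalar identity. -/
theorem serre_latOp {b : E} {a : ℤ} {k : ℕ} (hk : (1 - a).toNat = k) {C D : ℤ → E} {σ t τ : ℤ}
    (h : SerreId b k C σ t D τ) {c d : (Fin n → ℤ) → E} {α β : Fin n → ℤ} {r r' : Fin n} (x y : E)
    (hc : ∀ m, c m = x * C (m r)) (hd : ∀ m, d m = y * D (m r')) (hσ : α r = σ) (ht : β r = t)
    (hτ : α r' = τ) : serre b a (latOp c α) (latOp d β) = 0 := by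
  ext f m
  rw [serre, hk, LinearMap.zero_apply, Pi.zero_apply,
    ← zero_mul (x ^ k * y * f (m - (k • α + β))),
    ← h ((m - (k • α + β)) r) ((m - (k • α + β)) r'), Finset.sum_mul, LinearMap.sum_apply,
    Finset.sum_apply]
  refine Finset.sum_congr rfl fun ν hν => ?_
  have hν' : k - ν + ν = k := Nat.sub_add_cancel (Finset.mem_range_succ_iff.1 hν)
  have e : (k - ν) • α + β + ν • α = k • α + β := by
    rw [add_right_comm, ← add_smul, hν']
  rw [LinearMap.smul_apply, Pi.smul_apply, latOp_pow, latOp_pow, latOp_mul, latOp_mul, latOp_apply,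
    e, smul_eq_mul]
  generalize m - (k • α + β) = m'
  simp only [hc, hd, Finset.prod_mul_distrib, Finset.prod_const, Finset.card_range]
  have hx : x ^ k = x ^ (k - ν) * x ^ ν := by rw [← pow_add, hν']
  have e1 (s : ℕ) : (m' + ν • α + β + s • α) r = m' r + t + (ν + s) * σ := by
    simp [hσ, ht]
    ring
  have e2 : (m' + ν • α) r' = m' r' + ν * τ := by simp [hτ]
  have e3 (s : ℕ) : (m' + s • α) r = m' r + s * σ := by simp [hσ]
  simp only [e1, e2, e3, hx]
  ring

/-- Extension of a vector by zero to the integral lattice. -/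
def latExt (E : Type*) [Field E] (n : ℕ) : Fock E n →ₗ[E] ((Fin n → ℤ) → E) where
  toFun v a := if ∀ r, 0 ≤ a r then v fun r => (a r).toNat else 0
  map_add' v w := by ext a; simp only [Pi.add_apply, Finsupp.add_apply]; split_ifs <;> simp
  map_smul' x v := by ext a; simp only [Pi.smul_apply, Finsupp.smul_apply]; split_ifs <;> simp

theorem natVec_injective : Function.Injective (natVec (n := n)) := fun a b h => by
  ext r
  simpa [natVec] using congrFun h r

theorem latExt_natVec (v : Fock E n) (a : Fin n → ℕ) : latExt E n v (natVec a) = v a := by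
  simp [latExt, natVec]

theorem latExt_of_neg (v : Fock E n) {a : Fin n → ℤ} {r : Fin n} (h : a r < 0) :
    latExt E n v a = 0 :=
  if_neg fun h' => (h' r).not_gt h

theorem latExt_injective : Function.Injective (latExt E n) := fun v w h => by
  ext a
  rw [← latExt_natVec, h, latExt_natVec]

theorem exists_natVec_or_neg (a : Fin n → ℤ) : (∃ b : Fin n → ℕ, a = natVec b) ∨ ∃ r, a r < 0 := by
  by_cases h : ∀ r, 0 ≤ a r
  · exact .inl ⟨fun r => (a r).toNat, by ext r; simp [natVec, h r]⟩
  · push Not at h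
    exact .inr h

theorem latExt_ket (m : Fin n → ℕ) (a : Fin n → ℤ) :
    latExt E n (ket E m) a = if natVec m = a then 1 else 0 := by
  rcases exists_natVec_or_neg a with ⟨b, rfl⟩ | ⟨r, hr⟩
  · simp only [latExt_natVec, ket, Finsupp.single_apply, natVec_injective.eq_iff]
  · rw [latExt_of_neg _ hr, if_neg]
    rintro rfl
    simp [natVec] at hr
    omega

theorem ketOp_ket (c : (Fin n → ℕ) → E) (φ : (Fin n → ℕ) → (Fin n → ℕ)) (m : Fin n → ℕ) :
    ketOp c φ (ket E m) = c m • ket E (φ m) := by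
  simp [ketOp, ket]

/-- The lattice operator `B` restricts to `A` on the Fock space. -/
def Lifts (A : Module.End E (Fock E n)) (B : Module.End E ((Fin n → ℤ) → E)) : Prop :=
  ∀ v, latExt E n (A v) = B (latExt E n v)

/-- Extension by zero is injective, so identities between operators on the Fock space may be checked
on the lattice, where no subtraction truncates. -/
theorem Lifts.eq {A A' : Module.End E (Fock E n)} {B B' : Module.End E ((Fin n → ℤ) → E)}
    (h : Lifts A B) (h' : Lifts A' B') (hB : B = B') : A = A' := by
  ext1 v
  exact LinearMap.ext fun w => latExt_injective (by
    rw [LinearMap.comp_apply, LinearMap.comp_apply, h, h', hB])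

theorem Lifts.mul {A A' : Module.End E (Fock E n)} {B B' : Module.End E ((Fin n → ℤ) → E)}
    (h : Lifts A B) (h' : Lifts A' B') : Lifts (A * A') (B * B') := fun v => by
  rw [Module.End.mul_apply, Module.End.mul_apply, h, h']

theorem Lifts.sub {A A' : Module.End E (Fock E n)} {B B' : Module.End E ((Fin n → ℤ) → E)}
    (h : Lifts A B) (h' : Lifts A' B') : Lifts (A - A') (B - B') := fun v => by
  rw [LinearMap.sub_apply, LinearMap.sub_apply, map_sub, h, h']

theorem Lifts.smul {A : Module.End E (Fock E n)} {B : Module.End E ((Fin n → ℤ) → E)}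
    (h : Lifts A B) (x : E) : Lifts (x • A) (x • B) := fun v => by
  rw [LinearMap.smul_apply, LinearMap.smul_apply, map_smul, h]

theorem Lifts.one : Lifts (1 : Module.End E (Fock E n)) 1 := fun _ => rfl

theorem Lifts.zero : Lifts (0 : Module.End E (Fock E n)) 0 := fun v => by simp

theorem Lifts.pow {A : Module.End E (Fock E n)} {B : Module.End E ((Fin n → ℤ) → E)}
    (h : Lifts A B) (k : ℕ) : Lifts (A ^ k) (B ^ k) := by
  induction k with
  | zero => exact Lifts.one
  | succ k ih => rw [pow_succ, pow_succ]; exact ih.mul h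

theorem Lifts.serre {A A' : Module.End E (Fock E n)} {B B' : Module.End E ((Fin n → ℤ) → E)}
    (h : Lifts A B) (h' : Lifts A' B') (b : E) (a : ℤ) : Lifts (serre b a A A') (serre b a B B') := by
  intro v
  simp only [QOsc.serre, LinearMap.sum_apply, map_sum]
  exact Finset.sum_congr rfl fun ν _ => (((h.pow _).mul h').mul (h.pow _)).smul _ v

/-- The target index must be the true translate only where the coefficient is nonzero. Thus
truncated subtraction does no harm when a q-integer factor vanishes there. -/
theorem lifts_ketOp {c : (Fin n → ℕ) → E} {φ : (Fin n → ℕ) → (Fin n → ℕ)} {d : (Fin n → ℤ) → E}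
    {α : Fin n → ℤ} (hc : ∀ m, d (natVec m) = c m)
    (hφ : ∀ m, c m ≠ 0 → natVec (φ m) = natVec m + α) : Lifts (ketOp c φ) (latOp d α) := by
  suffices (latExt E n) ∘ₗ (ketOp c φ) = (latOp d α) ∘ₗ (latExt E n) from LinearMap.congr_fun this
  refine Finsupp.lhom_ext fun m x => ?_
  have : Finsupp.single m x = x • ket E m := by simp [ket]
  rw [this, map_smul, map_smul]
  congr 1
  ext a
  rw [LinearMap.comp_apply, LinearMap.comp_apply, ketOp_ket, map_smul, latOp_apply, Pi.smul_apply,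
    latExt_ket, latExt_ket, smul_eq_mul]
  by_cases h : c m = 0
  · by_cases h' : natVec m = a - α
    · rw [← h', hc, h, zero_mul, zero_mul]
    · rw [if_neg h', h, mul_zero, zero_mul]
  · rw [hφ m h]
    by_cases h' : natVec m = a - α
    · rw [if_pos h', ← h', hc, if_pos (by rw [h', sub_add_cancel])]
    · rw [if_neg h', mul_zero, if_neg (fun h'' => h' (by rw [← h'', add_sub_cancel_right])), mul_zero]

end Lattice

/-! ### Simple roots and the Cartan matrix -/

section Vertices

variable {N : ℕ}

theorem onVertices_zero {α : Type*} (a : α) (f : Fin N → α) (b : α) : onVertices a f b 0 = a := rfl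

theorem onVertices_mid {α : Type*} (a : α) (f : Fin N → α) (b : α) (r : Fin N) :
    onVertices a f b r.castSucc.succ = f r := by
  simp [onVertices]

theorem onVertices_last {α : Type*} (a : α) (f : Fin N → α) (b : α) :
    onVertices a f b (Fin.last (N + 1)) = b := by
  rw [onVertices, ← Fin.succ_last]
  simp

theorem vertices_cases {P : Fin (N + 2) → Prop} (h0 : P 0) (hm : ∀ r : Fin N, P r.castSucc.succ)
    (hl : P (Fin.last (N + 1))) (i : Fin (N + 2)) : P i := by
  induction i using Fin.cases with
  | zero => exact h0
  | succ i =>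
    induction i using Fin.lastCases with
    | last => exact hl
    | cast r => exact hm r

theorem zvec_apply {n : ℕ} (r x : Fin n) : zvec r x = if (x : ℕ) = r then 1 else 0 := by
  simp [zvec, Pi.single_apply, Fin.ext_iff]

/-- The simple root of a vertex: the shift of `e_i` on the multi-indices. -/
def root (N : ℕ) (g : AffineType) : Fin (N + 2) → Fin (N + 1) → ℤ :=
  onVertices (leftExp g • zvec 0) (fun r => zvec r.succ - zvec r.castSucc)
    (-(rightExp g • zvec (Fin.last N)))

theorem nodeExp_eq (N : ℕ) (g : AffineType) :
    nodeExp N g = onVertices (leftExp g ^ 2) (fun _ => 2) (rightExp g ^ 2) := by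
  cases g <;> rfl

theorem sum_zvec_mul {n : ℕ} (r : Fin n) (f : Fin n → ℤ) : ∑ x, zvec r x * f x = f r := by
  simp [zvec, Pi.single_apply]

theorem root_zero_apply (g : AffineType) (x : Fin (N + 1)) :
    root N g 0 x = if (x : ℕ) = 0 then (leftExp g : ℤ) else 0 := by
  simp [root, onVertices_zero, zvec_apply]

theorem root_mid_apply (g : AffineType) (r : Fin N) (x : Fin (N + 1)) :
    root N g r.castSucc.succ x =
      (if (x : ℕ) = r + 1 then 1 else 0) - if (x : ℕ) = r then 1 else 0 := by
  simp [root, onVertices_mid, zvec_apply]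

theorem root_last_apply (g : AffineType) (x : Fin (N + 1)) :
    root N g (Fin.last (N + 1)) x = if (x : ℕ) = N then -(rightExp g : ℤ) else 0 := by
  simp only [root, onVertices_last, zvec_apply, Pi.neg_apply, Pi.smul_apply, Fin.val_last]
  split_ifs <;> simp

theorem sum_root_zero_mul (g : AffineType) (f : Fin (N + 1) → ℤ) :
    ∑ x, root N g 0 x * f x = leftExp g * f 0 := by
  rw [← sum_zvec_mul 0 f, Finset.mul_sum]
  refine Finset.sum_congr rfl fun x _ => ?_
  simp [root, onVertices_zero, mul_assoc]

theorem sum_root_mid_mul (g : AffineType) (r : Fin N) (f : Fin (N + 1) → ℤ) :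
    ∑ x, root N g r.castSucc.succ x * f x = f r.succ - f r.castSucc := by
  rw [← sum_zvec_mul r.succ f, ← sum_zvec_mul r.castSucc f, ← Finset.sum_sub_distrib]
  refine Finset.sum_congr rfl fun x _ => ?_
  simp [root, onVertices_mid, sub_mul]

theorem sum_root_last_mul (g : AffineType) (f : Fin (N + 1) → ℤ) :
    ∑ x, root N g (Fin.last (N + 1)) x * f x = -(rightExp g * f (Fin.last N)) := by
  rw [← sum_zvec_mul (Fin.last N) f, Finset.mul_sum, ← Finset.sum_neg_distrib]
  refine Finset.sum_congr rfl fun x _ => ?_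
  simp [root, onVertices_last, mul_assoc]

/-- The vectors `root` realize the symmetrized Cartan matrix by the standard inner product of ℤ^n,
uniformly in the three types and including n = 1. -/
theorem nodeExp_mul_cartan (g : AffineType) (i j : Fin (N + 2)) :
    (nodeExp N g i : ℤ) * cartan N g i j = 2 * ∑ x, root N g i x * root N g j x := by
  rw [cartan, nodeExp_eq]
  induction i using vertices_cases with
  | h0 =>
    rw [sum_root_zero_mul]
    induction j using vertices_cases with
    | h0 =>
      rw [root_zero_apply]
      cases g <;> simp [onVertices_zero, leftExp]
    | hm r =>
      have := r.2
      rw [root_mid_apply]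
      cases g <;> simp [onVertices_zero, onVertices_mid, Fin.ext_iff, leftExp] <;>
        split_ifs <;> omega
    | hl =>
      rw [root_last_apply]
      cases g <;> simp [onVertices_zero, onVertices_last, Fin.ext_iff, leftExp, rightExp] <;>
        split_ifs <;> omega
  | hm r =>
    have := r.2
    rw [sum_root_mid_mul]
    induction j using vertices_cases with
    | h0 =>
      rw [root_zero_apply, root_zero_apply]
      cases g <;> simp [onVertices_zero, onVertices_mid, Fin.ext_iff, leftExp] <;>
        split_ifs <;> omega
    | hm r' =>
      have := r'.2
      rw [root_mid_apply, root_mid_apply]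
      simp [onVertices_mid, Fin.ext_iff, leftExp]
      split_ifs <;> omega
    | hl =>
      rw [root_last_apply, root_last_apply]
      cases g <;> simp [onVertices_mid, onVertices_last, Fin.ext_iff, leftExp, rightExp] <;>
        split_ifs <;> omega
  | hl =>
    rw [sum_root_last_mul]
    induction j using vertices_cases with
    | h0 =>
      rw [root_zero_apply]
      cases g <;> simp [onVertices_zero, onVertices_last, Fin.ext_iff, leftExp, rightExp] <;>
        split_ifs <;> omega
    | hm r =>
      have := r.2
      rw [root_mid_apply]
      cases g <;> simp [onVertices_mid, onVertices_last, Fin.ext_iff, rightExp] <;>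
        split_ifs <;> omega
    | hl =>
      rw [root_last_apply]
      cases g <;> simp [onVertices_last, rightExp]

/-- The number of quanta that `e_i` removes. -/
def eDeg (N : ℕ) (g : AffineType) : Fin (N + 2) → ℕ := onVertices 0 (fun _ => 1) (rightExp g)

/-- The site at which `e_i` removes quanta. -/
def eSite (N : ℕ) : Fin (N + 2) → Fin (N + 1) := onVertices 0 Fin.castSucc (Fin.last N)

/-- The number of quanta that `f_i` removes. -/
def fDeg (N : ℕ) (g : AffineType) : Fin (N + 2) → ℕ := onVertices (leftExp g) (fun _ => 1) 0

/-- The site at which `f_i` removes quanta. -/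
def fSite (N : ℕ) : Fin (N + 2) → Fin (N + 1) := onVertices 0 Fin.succ (Fin.last N)

theorem SerreId.congr {E : Type*} [Field E] {p : E} {e e' n n' k k' l l' : ℕ} {σ σ' t t' τ τ' : ℤ}
    (h : SerreId (p ^ e) n (qFall (p ^ 2) k) σ t (qFall (p ^ 2) l) τ) (he : e' = e) (hn : n' = n)
    (hk : k' = k) (hσ : σ' = σ) (ht : t' = t) (hl : l' = l) (hτ : τ' = τ) :
    SerreId (p ^ e') n' (qFall (p ^ 2) k') σ' t' (qFall (p ^ 2) l') τ' := by
  subst he hn hk hσ ht hl hτ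
  exact h

variable {E : Type*} [Field E] {p : E}

theorem SerreId.congr_one {n n' e' k k' l l' : ℕ} {σ σ' t t' τ τ' : ℤ}
    (h : SerreId p n (qFall (p ^ 2) k) σ t (qFall (p ^ 2) l) τ) (he : e' = 1) (hn : n' = n)
    (hk : k' = k) (hσ : σ' = σ) (ht : t' = t) (hl : l' = l) (hτ : τ' = τ) :
    SerreId (p ^ e') n' (qFall (p ^ 2) k') σ' t' (qFall (p ^ 2) l') τ' := by
  subst hn hk hσ ht hl hτ
  rw [he, pow_one]
  exact h

/-- Commuting vertices are covered by `one`. For the others the degrees, shifts and Cartan entry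
match one item of the list of identities, with separate cases for n = 1, where the two end vertices
act on the same site. -/
theorem serreId_e (h0 : p ≠ 0) (hp : ∀ m : ℕ, m ≠ 0 → p ^ m ≠ 1) (g : AffineType)
    {i j : Fin (N + 2)} (hij : i ≠ j) :
    SerreId (p ^ nodeExp N g i) (1 - cartan N g i j).toNat (qFall (p ^ 2) (eDeg N g i))
      (root N g i (eSite N i)) (root N g j (eSite N i)) (qFall (p ^ 2) (eDeg N g j))
      (root N g i (eSite N j)) := by
  have one (h : cartan N g i j = 0) (h1 : root N g j (eSite N i) = 0)
      (h2 : root N g i (eSite N j) = 0) :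
      SerreId (p ^ nodeExp N g i) (1 - cartan N g i j).toNat (qFall (p ^ 2) (eDeg N g i))
        (root N g i (eSite N i)) (root N g j (eSite N i))
        (qFall (p ^ 2) (eDeg N g j)) (root N g i (eSite N j)) := by
    rw [h]
    exact serreId_one _ (.inr (by simp [h1])) (.inr (by simp [h2]))
  induction i using vertices_cases with
  | h0 =>
    induction j using vertices_cases with
    | h0 => exact absurd rfl hij
    | hm r =>
      have hN : N ≠ 0 := r.pos.ne'
      by_cases hr : (r : ℕ) = 0
      · cases g
        · refine SerreId.congr_one (serreId_const_fall_one h0 hp) ?_ ?_ ?_ rfl rfl ?_ ?_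
          all_goals simp [nodeExp_eq, cartan, onVertices_zero, onVertices_mid, Fin.ext_iff, eDeg,
            eSite, root_zero_apply, leftExp, rightExp, hr, hN]
        · refine SerreId.congr_one (serreId_const_fall_one h0 hp) ?_ ?_ ?_ rfl rfl ?_ ?_
          all_goals simp [nodeExp_eq, cartan, onVertices_zero, onVertices_mid, Fin.ext_iff, eDeg,
            eSite, root_zero_apply, leftExp, rightExp, hr, hN]
        · refine SerreId.congr (serreId_const_fall_one_two h0 hp) ?_ ?_ ?_ rfl rfl ?_ ?_
          all_goals simp [nodeExp_eq, cartan, onVertices_zero, onVertices_mid, Fin.ext_iff, eDeg,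
            eSite, root_zero_apply, leftExp, rightExp, hr, hN]
      · refine one ?_ ?_ ?_
        all_goals simp [nodeExp_eq, cartan, onVertices_zero, onVertices_mid, Fin.ext_iff, eSite,
          root_zero_apply, root_mid_apply, leftExp, rightExp, hr, hN, Ne.symm hr]
    | hl =>
      by_cases hN : N = 0
      · cases g
        · refine SerreId.congr_one (serreId_const_fall_one h0 hp) ?_ ?_ ?_ rfl rfl ?_ ?_
          all_goals simp [nodeExp_eq, cartan, onVertices_zero, onVertices_last, Fin.ext_iff, eDeg,
            eSite, root_zero_apply, leftExp, rightExp, hN]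
        · refine SerreId.congr_one (serreId_const_fall_two h0 hp) ?_ ?_ ?_ rfl rfl ?_ ?_
          all_goals simp [nodeExp_eq, cartan, onVertices_zero, onVertices_last, Fin.ext_iff, eDeg,
            eSite, root_zero_apply, leftExp, rightExp, hN]
        · refine SerreId.congr (serreId_const_fall_two_two h0 hp) ?_ ?_ ?_ rfl rfl ?_ ?_
          all_goals simp [nodeExp_eq, cartan, onVertices_zero, onVertices_last, Fin.ext_iff, eDeg,
            eSite, root_zero_apply, leftExp, rightExp, hN]
      · refine one ?_ ?_ ?_
        all_goals simp [nodeExp_eq, cartan, onVertices_zero, onVertices_last, Fin.ext_iff, eSite,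
          root_zero_apply, root_last_apply, leftExp, rightExp, hN, Ne.symm hN]
  | hm r =>
    have hN : N ≠ 0 := r.pos.ne'
    have hr' := r.2.ne
    induction j using vertices_cases with
    | h0 =>
      by_cases hr : (r : ℕ) = 0
      · cases g
        · refine SerreId.congr (serreId_fall_one_shift_one h0 hp (l := 0) (.inl rfl)) ?_ ?_ ?_ ?_ ?_ ?_ rfl
          all_goals simp [nodeExp_eq, cartan, onVertices_zero, onVertices_mid, Fin.ext_iff, eDeg,
            eSite, root_zero_apply, root_mid_apply, leftExp, rightExp, hr, hN]
        · refine SerreId.congr (serreId_fall_one_shift_one h0 hp (l := 0) (.inl rfl)) ?_ ?_ ?_ ?_ ?_ ?_ rfl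
          all_goals simp [nodeExp_eq, cartan, onVertices_zero, onVertices_mid, Fin.ext_iff, eDeg,
            eSite, root_zero_apply, root_mid_apply, leftExp, rightExp, hr, hN]
        · refine SerreId.congr (serreId_fall_one_shift_two h0 hp (l := 0) (.inl rfl)) ?_ ?_ ?_ ?_ ?_ ?_ rfl
          all_goals simp [nodeExp_eq, cartan, onVertices_zero, onVertices_mid, Fin.ext_iff, eDeg,
            eSite, root_zero_apply, root_mid_apply, leftExp, rightExp, hr, hN]
      · refine one ?_ ?_ ?_
        all_goals simp [nodeExp_eq, cartan, onVertices_zero, onVertices_mid, Fin.ext_iff, eSite,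
          root_zero_apply, root_mid_apply, leftExp, rightExp, hr, hN, Ne.symm hr]
    | hm r' =>
      by_cases hr : (r' : ℕ) = r + 1
      · refine SerreId.congr (serreId_fall_one_fall_one h0 hp) ?_ ?_ ?_ ?_ ?_ ?_ ?_
        all_goals simp [nodeExp_eq, cartan, onVertices_mid, Fin.ext_iff, eDeg, eSite,
          root_mid_apply, leftExp, rightExp, hr, hN]
        all_goals omega
      by_cases hr₂ : (r : ℕ) = r' + 1
      · refine SerreId.congr (serreId_fall_one_shift_one h0 hp (τ := 0) (.inr rfl)) ?_ ?_ ?_ ?_ ?_ rfl ?_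
        all_goals simp [nodeExp_eq, cartan, onVertices_mid, Fin.ext_iff, eDeg, eSite,
          root_mid_apply, leftExp, rightExp, hr₂, hN]
        all_goals omega
      · have hr₃ : (r : ℕ) ≠ r' := fun h => hij (by rw [Fin.ext h])
        refine one ?_ ?_ ?_
        all_goals simp [nodeExp_eq, cartan, onVertices_mid, Fin.ext_iff, eSite, root_mid_apply,
          leftExp, rightExp, hr, hr₂, hr₃, hr₃.symm, Ne.symm hr, Ne.symm hr₂, hN]
    | hl =>
      by_cases hr : (r : ℕ) + 1 = N
      · cases g
        · refine SerreId.congr (serreId_fall_one_fall_one h0 hp) ?_ ?_ ?_ ?_ ?_ ?_ ?_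
          all_goals simp [nodeExp_eq, cartan, onVertices_mid, onVertices_last, Fin.ext_iff, eDeg,
            eSite, root_mid_apply, root_last_apply, leftExp, rightExp, hr, hr', hN]
          all_goals omega
        · refine SerreId.congr (serreId_fall_one_fall_two h0 hp) ?_ ?_ ?_ ?_ ?_ ?_ ?_
          all_goals simp [nodeExp_eq, cartan, onVertices_mid, onVertices_last, Fin.ext_iff, eDeg,
            eSite, root_mid_apply, root_last_apply, leftExp, rightExp, hr, hr', hN]
          all_goals omega
        · refine SerreId.congr (serreId_fall_one_fall_two h0 hp) ?_ ?_ ?_ ?_ ?_ ?_ ?_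
          all_goals simp [nodeExp_eq, cartan, onVertices_mid, onVertices_last, Fin.ext_iff, eDeg,
            eSite, root_mid_apply, root_last_apply, leftExp, rightExp, hr, hr', hN]
          all_goals omega
      · refine one ?_ ?_ ?_
        all_goals simp [nodeExp_eq, cartan, onVertices_mid, onVertices_last, Fin.ext_iff, eSite,
          root_mid_apply, root_last_apply, leftExp, rightExp, hr, hr', Ne.symm hr, hN]
        all_goals omega
  | hl =>
    induction j using vertices_cases with
    | h0 =>
      by_cases hN : N = 0
      · cases g
        · refine SerreId.congr_one (serreId_fall_one_shift_one' h0 hp (l := 0) (.inl rfl)) ?_ ?_ ?_ ?_ ?_ ?_ rfl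
          all_goals simp [nodeExp_eq, cartan, onVertices_zero, onVertices_last, Fin.ext_iff, eDeg,
            eSite, root_zero_apply, root_last_apply, leftExp, rightExp, hN]
        · refine SerreId.congr (serreId_fall_two_shift_one h0 hp (l := 0) (.inl rfl)) ?_ ?_ ?_ ?_ ?_ ?_ rfl
          all_goals simp [nodeExp_eq, cartan, onVertices_zero, onVertices_last, Fin.ext_iff, eDeg,
            eSite, root_zero_apply, root_last_apply, leftExp, rightExp, hN]
        · refine SerreId.congr (serreId_fall_two_shift_two h0 hp (l := 0) (.inl rfl)) ?_ ?_ ?_ ?_ ?_ ?_ rfl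
          all_goals simp [nodeExp_eq, cartan, onVertices_zero, onVertices_last, Fin.ext_iff, eDeg,
            eSite, root_zero_apply, root_last_apply, leftExp, rightExp, hN]
      · refine one ?_ ?_ ?_
        all_goals simp [nodeExp_eq, cartan, onVertices_zero, onVertices_last, Fin.ext_iff, eSite,
          root_zero_apply, root_last_apply, leftExp, rightExp, hN, Ne.symm hN]
    | hm r =>
      have hN : N ≠ 0 := r.pos.ne'
      have hr' := r.2.ne
      by_cases hr : (r : ℕ) + 1 = N
      · cases g
        · refine SerreId.congr_one (serreId_fall_one_shift_one' h0 hp (τ := 0) (.inr rfl)) ?_ ?_ ?_ ?_ ?_ rfl ?_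
          all_goals simp [nodeExp_eq, cartan, onVertices_mid, onVertices_last, Fin.ext_iff, eDeg,
            eSite, root_mid_apply, root_last_apply, leftExp, rightExp, hr, hr', hN]
          all_goals omega
        · refine SerreId.congr (serreId_fall_two_shift_one h0 hp (τ := 0) (.inr rfl)) ?_ ?_ ?_ ?_ ?_ rfl ?_
          all_goals simp [nodeExp_eq, cartan, onVertices_mid, onVertices_last, Fin.ext_iff, eDeg,
            eSite, root_mid_apply, root_last_apply, leftExp, rightExp, hr, hr', hN]
          all_goals omega
        · refine SerreId.congr (serreId_fall_two_shift_one h0 hp (τ := 0) (.inr rfl)) ?_ ?_ ?_ ?_ ?_ rfl ?_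
          all_goals simp [nodeExp_eq, cartan, onVertices_mid, onVertices_last, Fin.ext_iff, eDeg,
            eSite, root_mid_apply, root_last_apply, leftExp, rightExp, hr, hr', hN]
          all_goals omega
      · refine one ?_ ?_ ?_
        all_goals simp [nodeExp_eq, cartan, onVertices_mid, onVertices_last, Fin.ext_iff, eSite,
          root_mid_apply, root_last_apply, leftExp, rightExp, hr, hr', Ne.symm hr, hN]
        all_goals (try split_ifs) <;> omega
    | hl => exact absurd rfl hij

/-- The same case analysis with reversed shifts: f_0 now removes quanta, while f_n only adds them.
-/
theorem serreId_f (h0 : p ≠ 0) (hp : ∀ m : ℕ, m ≠ 0 → p ^ m ≠ 1) (g : AffineType)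
    {i j : Fin (N + 2)} (hij : i ≠ j) :
    SerreId (p ^ nodeExp N g i) (1 - cartan N g i j).toNat (qFall (p ^ 2) (fDeg N g i))
      (-root N g i (fSite N i)) (-root N g j (fSite N i)) (qFall (p ^ 2) (fDeg N g j))
      (-root N g i (fSite N j)) := by
  have one (h : cartan N g i j = 0) (h1 : root N g j (fSite N i) = 0)
      (h2 : root N g i (fSite N j) = 0) :
      SerreId (p ^ nodeExp N g i) (1 - cartan N g i j).toNat (qFall (p ^ 2) (fDeg N g i))
        (-root N g i (fSite N i)) (-root N g j (fSite N i))
        (qFall (p ^ 2) (fDeg N g j)) (-root N g i (fSite N j)) := by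
    rw [h]
    exact serreId_one _ (.inr (by simp [h1])) (.inr (by simp [h2]))
  induction i using vertices_cases with
  | h0 =>
    induction j using vertices_cases with
    | h0 => exact absurd rfl hij
    | hm r =>
      have hN : N ≠ 0 := r.pos.ne'
      by_cases hr : (r : ℕ) = 0
      · cases g
        · refine SerreId.congr_one (serreId_fall_one_shift_one' h0 hp (τ := 0) (.inr rfl)) ?_ ?_ ?_ ?_ ?_ rfl ?_
          all_goals simp [nodeExp_eq, cartan, onVertices_zero, onVertices_mid, Fin.ext_iff, fDeg,
            fSite, root_zero_apply, root_mid_apply, leftExp, rightExp, hr, hN]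
        · refine SerreId.congr_one (serreId_fall_one_shift_one' h0 hp (τ := 0) (.inr rfl)) ?_ ?_ ?_ ?_ ?_ rfl ?_
          all_goals simp [nodeExp_eq, cartan, onVertices_zero, onVertices_mid, Fin.ext_iff, fDeg,
            fSite, root_zero_apply, root_mid_apply, leftExp, rightExp, hr, hN]
        · refine SerreId.congr (serreId_fall_two_shift_one h0 hp (τ := 0) (.inr rfl)) ?_ ?_ ?_ ?_ ?_ rfl ?_
          all_goals simp [nodeExp_eq, cartan, onVertices_zero, onVertices_mid, Fin.ext_iff, fDeg,
            fSite, root_zero_apply, root_mid_apply, leftExp, rightExp, hr, hN]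
      · refine one ?_ ?_ ?_
        all_goals simp [nodeExp_eq, cartan, onVertices_zero, onVertices_mid, Fin.ext_iff, fSite,
          root_zero_apply, root_mid_apply, leftExp, rightExp, hr, hN, Ne.symm hr]
    | hl =>
      by_cases hN : N = 0
      · cases g
        · refine SerreId.congr_one (serreId_fall_one_shift_one' h0 hp (l := 0) (.inl rfl)) ?_ ?_ ?_ ?_ ?_ ?_ rfl
          all_goals simp [nodeExp_eq, cartan, onVertices_zero, onVertices_last, Fin.ext_iff, fDeg,
            fSite, root_zero_apply, root_last_apply, leftExp, rightExp, hN]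
        · refine SerreId.congr_one (serreId_fall_one_shift_two' h0 hp (l := 0) (.inl rfl)) ?_ ?_ ?_ ?_ ?_ ?_ rfl
          all_goals simp [nodeExp_eq, cartan, onVertices_zero, onVertices_last, Fin.ext_iff, fDeg,
            fSite, root_zero_apply, root_last_apply, leftExp, rightExp, hN]
        · refine SerreId.congr (serreId_fall_two_shift_two h0 hp (l := 0) (.inl rfl)) ?_ ?_ ?_ ?_ ?_ ?_ rfl
          all_goals simp [nodeExp_eq, cartan, onVertices_zero, onVertices_last, Fin.ext_iff, fDeg,
            fSite, root_zero_apply, root_last_apply, leftExp, rightExp, hN]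
      · refine one ?_ ?_ ?_
        all_goals simp [nodeExp_eq, cartan, onVertices_zero, onVertices_last, Fin.ext_iff, fSite,
          root_zero_apply, root_last_apply, leftExp, rightExp, hN, Ne.symm hN]
  | hm r =>
    have hN : N ≠ 0 := r.pos.ne'
    have hr' := r.2.ne
    induction j using vertices_cases with
    | h0 =>
      by_cases hr : (r : ℕ) = 0
      · cases g
        · refine SerreId.congr (serreId_fall_one_fall_one h0 hp) ?_ ?_ ?_ ?_ ?_ ?_ ?_
          all_goals simp [nodeExp_eq, cartan, onVertices_zero, onVertices_mid, Fin.ext_iff, fDeg,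
            fSite, root_zero_apply, root_mid_apply, leftExp, rightExp, hr, hN]
        · refine SerreId.congr (serreId_fall_one_fall_one h0 hp) ?_ ?_ ?_ ?_ ?_ ?_ ?_
          all_goals simp [nodeExp_eq, cartan, onVertices_zero, onVertices_mid, Fin.ext_iff, fDeg,
            fSite, root_zero_apply, root_mid_apply, leftExp, rightExp, hr, hN]
        · refine SerreId.congr (serreId_fall_one_fall_two h0 hp) ?_ ?_ ?_ ?_ ?_ ?_ ?_
          all_goals simp [nodeExp_eq, cartan, onVertices_zero, onVertices_mid, Fin.ext_iff, fDeg,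
            fSite, root_zero_apply, root_mid_apply, leftExp, rightExp, hr, hN]
      · refine one ?_ ?_ ?_
        all_goals simp [nodeExp_eq, cartan, onVertices_zero, onVertices_mid, Fin.ext_iff, fSite,
          root_zero_apply, root_mid_apply, leftExp, rightExp, hr, hN, Ne.symm hr]
    | hm r' =>
      by_cases hr : (r' : ℕ) = r + 1
      · refine SerreId.congr (serreId_fall_one_shift_one h0 hp (τ := 0) (.inr rfl)) ?_ ?_ ?_ ?_ ?_ rfl ?_
        all_goals simp [nodeExp_eq, cartan, onVertices_mid, Fin.ext_iff, fDeg, fSite,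
          root_mid_apply, leftExp, rightExp, hr, hN]
        all_goals omega
      by_cases hr₂ : (r : ℕ) = r' + 1
      · refine SerreId.congr (serreId_fall_one_fall_one h0 hp) ?_ ?_ ?_ ?_ ?_ ?_ ?_
        all_goals simp [nodeExp_eq, cartan, onVertices_mid, Fin.ext_iff, fDeg, fSite,
          root_mid_apply, leftExp, rightExp, hr₂, hN]
        all_goals omega
      · have hr₃ : (r : ℕ) ≠ r' := fun h => hij (by rw [Fin.ext h])
        refine one ?_ ?_ ?_
        all_goals simp [nodeExp_eq, cartan, onVertices_mid, Fin.ext_iff, fSite, root_mid_apply,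
          leftExp, rightExp, hr₃, hr₃.symm, Ne.symm hr, Ne.symm hr₂, hN]
    | hl =>
      by_cases hr : (r : ℕ) + 1 = N
      · cases g
        · refine SerreId.congr (serreId_fall_one_shift_one h0 hp (l := 0) (.inl rfl)) ?_ ?_ ?_ ?_ ?_ ?_ rfl
          all_goals simp [nodeExp_eq, cartan, onVertices_mid, onVertices_last, Fin.ext_iff, fDeg,
            fSite, root_mid_apply, root_last_apply, leftExp, rightExp, hr, hN]
          all_goals omega
        · refine SerreId.congr (serreId_fall_one_shift_two h0 hp (l := 0) (.inl rfl)) ?_ ?_ ?_ ?_ ?_ ?_ rfl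
          all_goals simp [nodeExp_eq, cartan, onVertices_mid, onVertices_last, Fin.ext_iff, fDeg,
            fSite, root_mid_apply, root_last_apply, leftExp, rightExp, hr, hN]
          all_goals omega
        · refine SerreId.congr (serreId_fall_one_shift_two h0 hp (l := 0) (.inl rfl)) ?_ ?_ ?_ ?_ ?_ ?_ rfl
          all_goals simp [nodeExp_eq, cartan, onVertices_mid, onVertices_last, Fin.ext_iff, fDeg,
            fSite, root_mid_apply, root_last_apply, leftExp, rightExp, hr, hN]
          all_goals omega
      · refine one ?_ ?_ ?_
        all_goals simp [nodeExp_eq, cartan, onVertices_mid, onVertices_last, Fin.ext_iff, fSite,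
          root_mid_apply, root_last_apply, leftExp, rightExp, hr, hr', Ne.symm hr, hN]
        all_goals omega
  | hl =>
    induction j using vertices_cases with
    | h0 =>
      by_cases hN : N = 0
      · cases g
        · refine SerreId.congr_one (serreId_const_fall_one h0 hp) ?_ ?_ ?_ rfl rfl ?_ ?_
          all_goals simp [nodeExp_eq, cartan, onVertices_zero, onVertices_last, Fin.ext_iff, fDeg,
            fSite, root_last_apply, leftExp, rightExp, hN]
        · refine SerreId.congr (serreId_const_fall_one_two h0 hp) ?_ ?_ ?_ rfl rfl ?_ ?_
          all_goals simp [nodeExp_eq, cartan, onVertices_zero, onVertices_last, Fin.ext_iff, fDeg,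
            fSite, root_last_apply, leftExp, rightExp, hN]
        · refine SerreId.congr (serreId_const_fall_two_two h0 hp) ?_ ?_ ?_ rfl rfl ?_ ?_
          all_goals simp [nodeExp_eq, cartan, onVertices_zero, onVertices_last, Fin.ext_iff, fDeg,
            fSite, root_last_apply, leftExp, rightExp, hN]
      · refine one ?_ ?_ ?_
        all_goals simp [nodeExp_eq, cartan, onVertices_zero, onVertices_last, Fin.ext_iff, fSite,
          root_zero_apply, root_last_apply, leftExp, rightExp, hN, Ne.symm hN]
    | hm r =>
      have hN : N ≠ 0 := r.pos.ne'
      have hr' := r.2.ne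
      by_cases hr : (r : ℕ) + 1 = N
      · cases g
        · refine SerreId.congr_one (serreId_const_fall_one h0 hp) ?_ ?_ ?_ rfl rfl ?_ ?_
          all_goals simp [nodeExp_eq, cartan, onVertices_mid, onVertices_last, Fin.ext_iff, fDeg,
            fSite, root_last_apply, leftExp, rightExp, hr, hN]
        · refine SerreId.congr (serreId_const_fall_one_two h0 hp) ?_ ?_ ?_ rfl rfl ?_ ?_
          all_goals simp [nodeExp_eq, cartan, onVertices_mid, onVertices_last, Fin.ext_iff, fDeg,
            fSite, root_last_apply, leftExp, rightExp, hr, hN]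
        · refine SerreId.congr (serreId_const_fall_one_two h0 hp) ?_ ?_ ?_ rfl rfl ?_ ?_
          all_goals simp [nodeExp_eq, cartan, onVertices_mid, onVertices_last, Fin.ext_iff, fDeg,
            fSite, root_last_apply, leftExp, rightExp, hr, hN]
      · refine one ?_ ?_ ?_
        all_goals simp [nodeExp_eq, cartan, onVertices_mid, onVertices_last, Fin.ext_iff, fSite,
          root_mid_apply, root_last_apply, leftExp, rightExp, hr, Ne.symm hr, hN]
        all_goals (try split_ifs) <;> omega
    | hl => exact absurd rfl hij

end Vertices

/-! ### The q-oscillator representations are modules -/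

section Module

variable {E : Type*} [Field E] {N : ℕ} (p im x : E)

/-- The constants `iκ` and `1 / [2]²` in the actions that lower the boundary site by `1` and `2`. -/
def lowScale (p im : E) (k : ℕ) : E :=
  if k = 1 then im * ((p ^ 2 + 1) / (p ^ 2 - 1)) else (qInt (p ^ 2) 2 ^ 2)⁻¹

/-- The constant factor of `e_i`. -/
def eScale (N : ℕ) (g : AffineType) : Fin (N + 2) → E :=
  onVertices x (fun _ => 1) (lowScale p im (rightExp g))

/-- The constant factor of `f_i`. -/
def fScale (N : ℕ) (g : AffineType) : Fin (N + 2) → E :=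
  onVertices (lowScale p im (leftExp g) * x⁻¹) (fun _ => 1) 1

/-- The matrix elements of `e_i` on the lattice. -/
def eCoef (N : ℕ) (g : AffineType) (i : Fin (N + 2)) (m : Fin (N + 1) → ℤ) : E :=
  eScale p im x N g i * qFall (p ^ 2) (eDeg N g i) (m (eSite N i))

/-- The matrix elements of `f_i` on the lattice. -/
def fCoef (N : ℕ) (g : AffineType) (i : Fin (N + 2)) (m : Fin (N + 1) → ℤ) : E :=
  fScale p im x N g i * qFall (p ^ 2) (fDeg N g i) (m (fSite N i))

/-- The eigenvalues of `k_i` on the lattice. -/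
def kCoef (N : ℕ) (g : AffineType) (i : Fin (N + 2)) (m : Fin (N + 1) → ℤ) : E :=
  ∏ r, (-im * p * (p ^ 2) ^ m r) ^ root N g i r

variable {p im x}

theorem prod_zpow_zvec {n : ℕ} (r : Fin n) (f : Fin n → E) : ∏ s, f s ^ zvec r s = f r := by
  rw [Finset.prod_eq_single r (fun s _ hs => by rw [zvec_of_ne hs, zpow_zero]) (by simp),
    zvec_same, zpow_one]

theorem kCoef_zero (g : AffineType) (m : Fin (N + 1) → ℤ) :
    kCoef p im N g 0 m = (-im * p * (p ^ 2) ^ m 0) ^ leftExp g := by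
  rw [kCoef, ← prod_zpow_zvec 0 fun r => (-im * p * (p ^ 2) ^ m r), ← Finset.prod_pow]
  refine Finset.prod_congr rfl fun s _ => ?_
  rw [root, onVertices_zero, Pi.smul_apply, nsmul_eq_mul,
    mul_comm (leftExp g : ℤ), zpow_mul, zpow_natCast]

theorem kCoef_last (g : AffineType) (m : Fin (N + 1) → ℤ) :
    kCoef p im N g (Fin.last (N + 1)) m =
      ((-im * p * (p ^ 2) ^ m (Fin.last N)) ^ rightExp g)⁻¹ := by
  rw [kCoef, ← prod_zpow_zvec (Fin.last N) fun r => (-im * p * (p ^ 2) ^ m r), ← Finset.prod_pow,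
    ← Finset.prod_inv_distrib]
  refine Finset.prod_congr rfl fun s _ => ?_
  rw [root, onVertices_last, Pi.neg_apply, Pi.smul_apply, nsmul_eq_mul,
    mul_comm (rightExp g : ℤ), zpow_neg, zpow_mul, zpow_natCast]

theorem pow_pow_ne_one' (hp : ∀ m : ℕ, m ≠ 0 → p ^ m ≠ 1) {k : ℕ} (hk : k ≠ 0) (m : ℕ)
    (hm : m ≠ 0) : (p ^ k) ^ m ≠ 1 := by
  rw [← pow_mul]
  exact hp _ (mul_ne_zero hk hm)

theorem im_ne_zero (him : im ^ 2 = -1) : im ≠ 0 := by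
  rintro rfl
  simp at him

theorem kCoef_mid (h0 : p ≠ 0) (him : im ^ 2 = -1) (g : AffineType) (r : Fin N)
    (m : Fin (N + 1) → ℤ) :
    kCoef p im N g r.castSucc.succ m = (p ^ 2) ^ (-m r.castSucc + m r.succ) := by
  have hi := im_ne_zero him
  have hq : p ^ 2 ≠ 0 := pow_ne_zero _ h0
  have hne (y : ℤ) : -im * p * (p ^ 2) ^ y ≠ 0 :=
    mul_ne_zero (mul_ne_zero (neg_ne_zero.2 hi) h0) (zpow_ne_zero _ hq)
  have : kCoef p im N g r.castSucc.succ m = (-im * p * (p ^ 2) ^ m r.succ) /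
      (-im * p * (p ^ 2) ^ m r.castSucc) := by
    rw [kCoef, ← prod_zpow_zvec r.succ fun r => (-im * p * (p ^ 2) ^ m r),
      ← prod_zpow_zvec r.castSucc fun r => (-im * p * (p ^ 2) ^ m r), ← Finset.prod_div_distrib]
    refine Finset.prod_congr rfl fun s _ => ?_
    rw [root, onVertices_mid, Pi.sub_apply, zpow_sub₀ (hne _)]
  rw [this, mul_div_mul_left _ _ (mul_ne_zero (neg_ne_zero.2 hi) h0), add_comm, ← sub_eq_add_neg,
    zpow_sub₀ hq]

theorem kCoef_ne_zero (h0 : p ≠ 0) (him : im ^ 2 = -1) (g : AffineType) (i : Fin (N + 2))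
    (m : Fin (N + 1) → ℤ) : kCoef p im N g i m ≠ 0 :=
  Finset.prod_ne_zero_iff.2 fun _ _ => zpow_ne_zero _ (mul_ne_zero
    (mul_ne_zero (neg_ne_zero.2 (im_ne_zero him)) h0) (zpow_ne_zero _ (pow_ne_zero _ h0)))

theorem kCoef_add (h0 : p ≠ 0) (g : AffineType) (i : Fin (N + 2))
    (m α : Fin (N + 1) → ℤ) :
    kCoef p im N g i (m + α) = (p ^ 2) ^ (∑ r, root N g i r * α r) * kCoef p im N g i m := by
  have hq : p ^ 2 ≠ 0 := pow_ne_zero _ h0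
  have hs (f : Fin (N + 1) → ℤ) : (p ^ 2) ^ (∑ r, f r) = ∏ r, (p ^ 2) ^ f r := by
    induction (Finset.univ : Finset (Fin (N + 1))) using Finset.cons_induction with
    | empty => simp
    | cons a s ha ih => rw [Finset.sum_cons, Finset.prod_cons, zpow_add₀ hq, ih]
  rw [hs, kCoef, kCoef, ← Finset.prod_mul_distrib]
  refine Finset.prod_congr rfl fun r _ => ?_
  rw [Pi.add_apply, zpow_add₀ hq, ← mul_assoc, mul_zpow, mul_comm, mul_comm (root N g i r),
    zpow_mul]

/-- In the product form of `kCoef` a translation by α multiplies the eigenvalue by q to the inner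
product with the root. For α a simple root this is q_i^{a_ij} by `nodeExp_mul_cartan`. -/
theorem kCoef_add_root (h0 : p ≠ 0) (g : AffineType) (i j : Fin (N + 2))
    (m : Fin (N + 1) → ℤ) :
    kCoef p im N g i (m + root N g j) =
      (p ^ nodeExp N g i) ^ cartan N g i j * kCoef p im N g i m := by
  rw [kCoef_add h0]
  congr 1
  rw [← zpow_natCast p (nodeExp N g i), ← zpow_mul, nodeExp_mul_cartan, zpow_mul, zpow_ofNat]

theorem kCoef_sub_root (h0 : p ≠ 0) (g : AffineType) (i j : Fin (N + 2))
    (m : Fin (N + 1) → ℤ) :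
    kCoef p im N g i (m - root N g j) =
      (p ^ nodeExp N g i) ^ (-cartan N g i j) * kCoef p im N g i m := by
  have h := kCoef_add_root (im := im) h0 g i j (m - root N g j)
  rw [sub_add_cancel] at h
  rw [h, zpow_neg, inv_mul_cancel_left₀ (zpow_ne_zero _ (pow_ne_zero _ h0))]

theorem natVec_add (a b : Fin N → ℕ) : natVec (a + b) = natVec a + natVec b := by
  ext r
  simp [natVec]

theorem natVec_nsmul (k : ℕ) (a : Fin N → ℕ) : natVec (k • a) = k • natVec a := by
  ext r
  simp [natVec]

theorem natVec_sub {a b : Fin N → ℕ} (h : b ≤ a) : natVec (a - b) = natVec a - natVec b := by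
  ext r
  simp [natVec, h r]

theorem nsmul_unitVec_le {k : ℕ} {r : Fin N} {m : Fin N → ℕ} (h : k ≤ m r) : k • unitVec r ≤ m := by
  intro s
  by_cases hs : s = r
  · subst hs
    simpa [unitVec_same] using h
  · simp [unitVec_of_ne hs]

theorem unitVec_le {r : Fin N} {m : Fin N → ℕ} (h : m r ≠ 0) : unitVec r ≤ m := by
  simpa using nsmul_unitVec_le (k := 1) (Nat.one_le_iff_ne_zero.2 h)

theorem qInt_zero (b : E) : qInt b 0 = 0 := by simp [qInt]

theorem two_le_of_qInt_mul_ne_zero {b : E} {k : ℕ} (h : qInt b k * qInt b ((k : ℤ) - 1) ≠ 0) :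
    2 ≤ k := by
  by_contra hk
  interval_cases k <;> simp [qInt_zero] at h

theorem lifts_e (p im x : E) (N : ℕ) (g : AffineType) (i : Fin (N + 2)) :
    Lifts ((qOscillator p im x N g).e i) (latOp (eCoef p im x N g i) (root N g i)) := by
  have hmid (r : Fin N) : Lifts (ketOp (fun m => qInt (p ^ 2) (m r.castSucc))
      fun m => m - unitVec r.castSucc + unitVec r.succ)
      (latOp (eCoef p im x N g r.castSucc.succ) (root N g r.castSucc.succ)) := by
    refine lifts_ketOp (fun m => ?_) fun m hm => ?_
    · simp [eCoef, eScale, eDeg, eSite, onVertices_mid, qFall_one, natVec]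
    · have h : m r.castSucc ≠ 0 := fun h => hm (by rw [h]; exact qInt_zero _)
      rw [natVec_add, natVec_sub (unitVec_le h), natVec_unitVec, natVec_unitVec, root,
        onVertices_mid]
      abel
  have htwo (h2 : rightExp g = 2) : Lifts (ketOp (fun m => qInt (p ^ 2) (m (Fin.last N)) *
      qInt (p ^ 2) ((m (Fin.last N) : ℤ) - 1) / qInt (p ^ 2) 2 ^ 2)
      fun m => m - 2 • unitVec (Fin.last N))
      (latOp (eCoef p im x N g (Fin.last (N + 1))) (root N g (Fin.last (N + 1)))) := by
    refine lifts_ketOp (fun m => ?_) fun m hm => ?_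
    · simp [eCoef, eScale, eDeg, eSite, onVertices_last, qFall_two, natVec, h2, lowScale]
      ring
    · have h := two_le_of_qInt_mul_ne_zero (div_ne_zero_iff.1 hm).1
      rw [natVec_sub (nsmul_unitVec_le h), natVec_nsmul, natVec_unitVec, root,
        onVertices_last, h2, sub_eq_add_neg]
  have hone (h1 : leftExp g = 1) : Lifts (ketOp (fun _ => x) fun m => m + unitVec 0)
      (latOp (eCoef p im x N g 0) (root N g 0)) := by
    refine lifts_ketOp (fun m => ?_) fun m hm => ?_
    · simp [eCoef, eScale, eDeg, eSite, onVertices_zero, qFall_zero]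
    · rw [natVec_add, natVec_unitVec, root, onVertices_zero, h1, one_smul]
  induction i using vertices_cases with
  | h0 =>
    cases g
    · exact hone rfl
    · exact hone rfl
    · refine lifts_ketOp (fun m => ?_) fun m hm => ?_
      · simp [eCoef, eScale, eDeg, eSite, onVertices_zero, qFall_zero]
      · rw [natVec_add, natVec_nsmul, natVec_unitVec, root, onVertices_zero, leftExp]
  | hm r => cases g <;> simp only [qOscillator, onVertices_mid] <;> exact hmid r
  | hl =>
    cases g <;> simp only [qOscillator, onVertices_last]
    · refine lifts_ketOp (fun m => ?_) fun m hm => ?_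
      · simp [eCoef, eScale, eDeg, eSite, onVertices_last, qFall_one, natVec, rightExp, lowScale]
      · have h : m (Fin.last N) ≠ 0 := fun h => hm (by rw [h, Nat.cast_zero, qInt_zero, mul_zero])
        rw [natVec_sub (unitVec_le h), natVec_unitVec, root, onVertices_last, rightExp, one_smul,
          sub_eq_add_neg]
    · exact htwo rfl
    · exact htwo rfl

theorem lifts_f (p im x : E) (N : ℕ) (g : AffineType) (i : Fin (N + 2)) :
    Lifts ((qOscillator p im x N g).f i) (latOp (fCoef p im x N g i) (-root N g i)) := by
  have hmid (r : Fin N) : Lifts (ketOp (fun m => qInt (p ^ 2) (m r.succ))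
      fun m => m + unitVec r.castSucc - unitVec r.succ)
      (latOp (fCoef p im x N g r.castSucc.succ) (-root N g r.castSucc.succ)) := by
    refine lifts_ketOp (fun m => ?_) fun m hm => ?_
    · simp [fCoef, fScale, fDeg, fSite, onVertices_mid, qFall_one, natVec]
    · have h : m r.succ ≠ 0 := fun h => hm (by rw [h]; exact qInt_zero _)
      rw [natVec_sub ((unitVec_le h).trans le_self_add), natVec_add, natVec_unitVec,
        natVec_unitVec, root, onVertices_mid]
      abel
  have htwo (h2 : rightExp g = 2) : Lifts (ketOp (fun _ => 1) fun m => m + 2 • unitVec (Fin.last N))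
      (latOp (fCoef p im x N g (Fin.last (N + 1))) (-root N g (Fin.last (N + 1)))) := by
    refine lifts_ketOp (fun m => ?_) fun m hm => ?_
    · simp [fCoef, fScale, fDeg, fSite, onVertices_last, qFall_zero]
    · rw [natVec_add, natVec_nsmul, natVec_unitVec, root, onVertices_last, h2, neg_neg]
  have hone (h1 : leftExp g = 1) : Lifts (ketOp
      (fun m => im * ((p ^ 2 + 1) / (p ^ 2 - 1)) * qInt (p ^ 2) (m 0) * x⁻¹)
      fun m => m - unitVec 0) (latOp (fCoef p im x N g 0) (-root N g 0)) := by
    refine lifts_ketOp (fun m => ?_) fun m hm => ?_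
    · simp [fCoef, fScale, fDeg, fSite, onVertices_zero, qFall_one, natVec, h1, lowScale]
      ring
    · have h : m 0 ≠ 0 := fun h => hm (by rw [h, Nat.cast_zero, qInt_zero, mul_zero, zero_mul])
      rw [natVec_sub (unitVec_le h), natVec_unitVec, root, onVertices_zero, h1, one_smul,
        sub_eq_add_neg]
  induction i using vertices_cases with
  | h0 =>
    cases g
    · exact hone rfl
    · exact hone rfl
    · refine lifts_ketOp (fun m => ?_) fun m hm => ?_
      · simp [fCoef, fScale, fDeg, fSite, onVertices_zero, qFall_two, natVec, leftExp, lowScale]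
        ring
      · have h := two_le_of_qInt_mul_ne_zero (div_ne_zero_iff.1 (left_ne_zero_of_mul hm)).1
        rw [natVec_sub (nsmul_unitVec_le h), natVec_nsmul, natVec_unitVec, root,
          onVertices_zero, leftExp, sub_eq_add_neg]
  | hm r => cases g <;> simp only [qOscillator, onVertices_mid] <;> exact hmid r
  | hl =>
    cases g <;> simp only [qOscillator, onVertices_last]
    · refine lifts_ketOp (fun m => ?_) fun m hm => ?_
      · simp [fCoef, fScale, fDeg, fSite, onVertices_last, qFall_zero]
      · rw [natVec_add, natVec_unitVec, root, onVertices_last, rightExp, one_smul, neg_neg]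
    · exact htwo rfl
    · exact htwo rfl

/-- The eigenvalues of `k_i` on the basis. -/
theorem qOscillator_k_apply (h0 : p ≠ 0) (him : im ^ 2 = -1) (x : E) (g : AffineType)
    (i : Fin (N + 2)) :
    (qOscillator p im x N g).k i = ketOp (fun m => kCoef p im N g i (natVec m)) id ∧
      (qOscillator p im x N g).kinv i = ketOp (fun m => (kCoef p im N g i (natVec m))⁻¹) id := by
  have hq : p ^ 2 ≠ 0 := pow_ne_zero _ h0
  have hi := im_ne_zero him
  induction i using vertices_cases with
  | h0 =>
    cases g <;> simp only [qOscillator, onVertices_zero, kCoef_zero, natVec, leftExp, pow_one,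
      zpow_natCast]
    · exact ⟨congrArg (ketOp · id) (by ext m; ring), congrArg (ketOp · id) (by ext m; ring_nf)⟩
    · exact ⟨congrArg (ketOp · id) (by ext m; ring), congrArg (ketOp · id) (by ext m; ring_nf)⟩
    · have e (m : Fin (N + 1) → ℕ) : -(p ^ 2) ^ (2 * m 0 + 1) = (-im * p * (p ^ 2) ^ m 0) ^ 2 := by
        linear_combination -(p * (p ^ 2) ^ m 0) ^ 2 * him
      simp only [e, and_self]
  | hm r =>
    cases g <;> simp only [qOscillator, onVertices_mid, kCoef_mid h0 him, natVec, and_self]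
  | hl =>
    have e (m : Fin (N + 1) → ℕ) : -(p ^ 2) ^ (-2 * (m (Fin.last N) : ℤ) - 1) =
        ((-im * p * (p ^ 2) ^ (m (Fin.last N) : ℤ)) ^ 2)⁻¹ := by
      have : (-2 * (m (Fin.last N) : ℤ) - 1) = -(m (Fin.last N) + m (Fin.last N) + 1) := by ring
      rw [this, zpow_neg, zpow_add_one₀ hq, zpow_add₀ hq, ← inv_neg]
      congr 1
      linear_combination -(p * (p ^ 2) ^ (m (Fin.last N) : ℤ)) ^ 2 * him
    cases g <;> simp only [qOscillator, onVertices_last, kCoef_last, natVec, rightExp, pow_one]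
    · have e (m : Fin (N + 1) → ℕ) : im * (p ^ 2) ^ (-(m (Fin.last N) : ℤ)) * p⁻¹ =
          (-im * p * (p ^ 2) ^ (m (Fin.last N) : ℤ))⁻¹ := by
        have hz := zpow_ne_zero (m (Fin.last N) : ℤ) hq
        refine eq_inv_of_mul_eq_one_left ?_
        rw [zpow_neg]
        field_simp
        linear_combination -him
      simp only [e, and_self]
    · simp only [e, and_self]
    · simp only [e, and_self]

theorem end_ext_ket {V : Type*} [AddCommGroup V] [Module E V] {A B : Fock E N →ₗ[E] V}
    (h : ∀ m, A (ket E m) = B (ket E m)) : A = B := by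
  refine Finsupp.lhom_ext fun m y => ?_
  have : Finsupp.single m y = y • ket E m := by simp [ket]
  rw [this, map_smul, map_smul, h]

theorem ketOp_id_mul (c d : (Fin N → ℕ) → E) : ketOp c id * ketOp d id = ketOp (c * d) id :=
  end_ext_ket fun m => by
    rw [Module.End.mul_apply, ketOp_ket, map_smul, ketOp_ket, ketOp_ket, Pi.mul_apply, smul_smul,
      mul_comm]
    rfl

theorem ketOp_one : ketOp (1 : (Fin N → ℕ) → E) id = 1 :=
  end_ext_ket fun m => by
    rw [ketOp_ket, Pi.one_apply, one_smul]
    rfl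

theorem lifts_ketOp_id {c : (Fin N → ℕ) → E} {d : (Fin N → ℤ) → E} (h : ∀ m, d (natVec m) = c m) :
    Lifts (ketOp c id) (latOp d 0) :=
  lifts_ketOp h fun m _ => by simp

theorem latOp_diag_conj {c : (Fin N → ℤ) → E} (hc : ∀ m, c m ≠ 0) (d : (Fin N → ℤ) → E)
    {α : Fin N → ℤ} {y : E} (h : ∀ m, c (m + α) = y * c m) :
    latOp c 0 * latOp d α * latOp (fun m => (c m)⁻¹) 0 = y • latOp d α := by
  rw [latOp_mul, latOp_mul]
  ext f a
  rw [latOp_apply, LinearMap.smul_apply, Pi.smul_apply, latOp_apply]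
  simp only [zero_add, add_zero, h, smul_eq_mul]
  field_simp [hc]

theorem latOp_comm {c d : (Fin N → ℤ) → E} {α β : Fin N → ℤ}
    (h : ∀ m, c (m + β) * d m = d (m + α) * c m) :
    latOp c α * latOp d β - latOp d β * latOp c α = 0 := by
  rw [latOp_mul, latOp_mul, add_comm β α, sub_eq_zero]
  congr 1
  exact funext h

/-- Both sides are the falling product of length k + l that starts at y. -/
theorem qFall_comm (b : E) {k l : ℕ} (hk : k ≤ 2) (hl : l ≤ 2) (y : ℤ) :
    qFall b k (y - l) * qFall b l y = qFall b l (y - k) * qFall b k y := by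
  interval_cases k <;> interval_cases l <;> simp [qFall, Finset.prod_range_succ] <;> ring_nf

theorem leftExp_le (g : AffineType) : leftExp g ≤ 2 := by cases g <;> simp [leftExp]

theorem rightExp_le (g : AffineType) : rightExp g ≤ 2 := by cases g <;> simp [rightExp]

theorem eDeg_le (g : AffineType) (i : Fin (N + 2)) : eDeg N g i ≤ 2 := by
  induction i using vertices_cases with
  | h0 => simp [eDeg, onVertices_zero]
  | hm r => simp [eDeg, onVertices_mid]
  | hl => rw [eDeg, onVertices_last]; exact rightExp_le g

theorem fDeg_le (g : AffineType) (i : Fin (N + 2)) : fDeg N g i ≤ 2 := by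
  induction i using vertices_cases with
  | h0 => rw [fDeg, onVertices_zero]; exact leftExp_le g
  | hm r => simp [fDeg, onVertices_mid]
  | hl => simp [fDeg, onVertices_last]

/-- For distinct vertices there are two possibilities: each operator leaves the weight of the other
unchanged (`hne`), or both remove quanta from the same site (`heq`), and then `qFall_comm` applies.
-/
theorem eCoef_fCoef_comm (p im x : E) (g : AffineType) {i j : Fin (N + 2)} (hij : i ≠ j)
    (m : Fin (N + 1) → ℤ) :
    eCoef p im x N g i (m + -root N g j) * fCoef p im x N g j m =
      fCoef p im x N g j (m + root N g i) * eCoef p im x N g i m := by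
  have key : qFall (p ^ 2) (eDeg N g i) (m (eSite N i) - root N g j (eSite N i)) *
      qFall (p ^ 2) (fDeg N g j) (m (fSite N j)) =
      qFall (p ^ 2) (fDeg N g j) (m (fSite N j) + root N g i (fSite N j)) *
        qFall (p ^ 2) (eDeg N g i) (m (eSite N i)) := by
    have hne (h1 : root N g j (eSite N i) = 0 ∨ eDeg N g i = 0)
        (h2 : root N g i (fSite N j) = 0 ∨ fDeg N g j = 0) :
        qFall (p ^ 2) (eDeg N g i) (m (eSite N i) - root N g j (eSite N i)) *
          qFall (p ^ 2) (fDeg N g j) (m (fSite N j)) =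
        qFall (p ^ 2) (fDeg N g j) (m (fSite N j) + root N g i (fSite N j)) *
          qFall (p ^ 2) (eDeg N g i) (m (eSite N i)) := by
      rw [mul_comm]
      congr 1
      · rcases h2 with h | h <;> simp [h, qFall_zero]
      · rcases h1 with h | h <;> simp [h, qFall_zero]
    have heq (hs : eSite N i = fSite N j) (h1 : root N g j (eSite N i) = fDeg N g j)
        (h2 : root N g i (fSite N j) = -eDeg N g i) :
        qFall (p ^ 2) (eDeg N g i) (m (eSite N i) - root N g j (eSite N i)) *
          qFall (p ^ 2) (fDeg N g j) (m (fSite N j)) =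
        qFall (p ^ 2) (fDeg N g j) (m (fSite N j) + root N g i (fSite N j)) *
          qFall (p ^ 2) (eDeg N g i) (m (eSite N i)) := by
      rw [h1, h2, hs, qFall_comm _ (eDeg_le g i) (fDeg_le g j), sub_eq_add_neg]
    induction i using vertices_cases with
    | h0 =>
      induction j using vertices_cases with
      | h0 => exact absurd rfl hij
      | hm r => exact hne (.inr rfl) (.inl (by simp [root_zero_apply, fSite, onVertices_mid]))
      | hl => exact hne (.inr rfl) (.inr (by simp [fDeg, onVertices_last]))
    | hm r =>
      have hr' := r.2.ne
      induction j using vertices_cases with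
      | h0 =>
        by_cases hr : (r : ℕ) = 0
        · have : r.castSucc = 0 := Fin.ext hr
          refine heq (by simpa [eSite, fSite, onVertices_mid, onVertices_zero] using this) ?_ ?_ <;>
            simp [root_zero_apply, root_mid_apply, eSite, fSite, onVertices_mid, onVertices_zero,
              eDeg, fDeg, hr]
        · apply hne <;> simp [root_zero_apply, root_mid_apply, eSite, fSite, onVertices_mid,
            onVertices_zero, eDeg, fDeg, hr, Ne.symm hr]
      | hm r' =>
        by_cases hr : (r : ℕ) = r' + 1
        · have : r.castSucc = r'.succ := Fin.ext hr
          refine heq (by simpa [eSite, fSite, onVertices_mid] using this) ?_ ?_ <;>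
            simp [root_mid_apply, eSite, fSite, onVertices_mid, eDeg, fDeg, hr]
        · have hr₃ : (r : ℕ) ≠ r' := fun h => hij (by rw [Fin.ext h])
          apply hne <;> simp [root_mid_apply, eSite, fSite, onVertices_mid, eDeg, fDeg, hr, hr₃,
            hr₃.symm, Ne.symm hr]
      | hl =>
        refine hne (.inl ?_) (.inr (by simp [fDeg, onVertices_last]))
        simp [root_last_apply, eSite, onVertices_mid, hr']
    | hl =>
      induction j using vertices_cases with
      | h0 =>
        by_cases hN : N = 0
        · have h (x : Fin (N + 1)) : (x : ℕ) = 0 := by omega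
          refine heq (Fin.ext ((h _).trans (h _).symm)) ?_ ?_
          · rw [root_zero_apply, if_pos (h _), fDeg, onVertices_zero]
          · rw [root_last_apply, if_pos ((h _).trans hN.symm), eDeg, onVertices_last]
        · apply hne <;> simp [root_zero_apply, root_last_apply, eSite, fSite, onVertices_last,
            onVertices_zero, eDeg, fDeg, hN, Ne.symm hN]
      | hm r =>
        have hr' := r.2.ne
        by_cases hr : (r : ℕ) + 1 = N
        · have : Fin.last N = r.succ := Fin.ext hr.symm
          refine heq (by simpa [eSite, fSite, onVertices_mid, onVertices_last] using this) ?_ ?_ <;>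
            simp [root_last_apply, root_mid_apply, eSite, fSite, onVertices_mid, onVertices_last,
              eDeg, fDeg, hr, hr'.symm]
        · apply hne <;> simp [root_last_apply, root_mid_apply, eSite, fSite, onVertices_mid,
            onVertices_last, eDeg, fDeg, hr, Ne.symm hr, Ne.symm hr']
      | hl => exact absurd rfl hij
  simp only [eCoef, fCoef, Pi.add_apply, Pi.neg_apply, ← sub_eq_add_neg]
  linear_combination (eScale p im x N g i * fScale p im x N g j) * key

/-- This is the relation for [e, f] at an end vertex; it is what fixes the constants iκ and 1/[2]²
and the factor -i q^{1/2} in the eigenvalues of k. -/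
theorem lowScale_mul (h0 : p ≠ 0) (hp : ∀ m : ℕ, m ≠ 0 → p ^ m ≠ 1) (him : im ^ 2 = -1) {k : ℕ}
    (hk : k = 1 ∨ k = 2) (y : ℤ) :
    lowScale p im k * (qFall (p ^ 2) k y - qFall (p ^ 2) k (y + k)) =
      (p ^ k ^ 2 - (p ^ k ^ 2)⁻¹)⁻¹ *
        ((-im * p * (p ^ 2) ^ y) ^ k - ((-im * p * (p ^ 2) ^ y) ^ k)⁻¹) := by
  have hq : p ^ 2 ≠ 0 := pow_ne_zero _ h0
  have hi := im_ne_zero him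
  have e2 : p ^ 2 - 1 ≠ 0 := sub_ne_zero.2 (hp 2 two_ne_zero)
  have e4 : p ^ 4 - 1 ≠ 0 := sub_ne_zero.2 (hp 4 four_ne_zero)
  have e8 : p ^ 8 - 1 ≠ 0 := sub_ne_zero.2 (hp 8 (by norm_num))
  have e2' : p ^ 2 + 1 ≠ 0 := fun h => e4 (by linear_combination (p ^ 2 - 1) * h)
  have e4' : p ^ 4 + 1 ≠ 0 := fun h => e8 (by linear_combination (p ^ 4 - 1) * h)
  have hY := zpow_ne_zero y hq
  have hy0 := qInt_eq (p ^ 2) hq y 0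
  rw [add_zero] at hy0
  rcases hk with rfl | rfl
  · rw [qFall_one, qFall_one, Nat.cast_one, qInt_eq _ hq y 1, hy0, lowScale, if_pos rfl]
    have hinv : (-im * p * (p ^ 2) ^ y)⁻¹ = im * p⁻¹ * ((p ^ 2) ^ y)⁻¹ := by
      refine inv_eq_of_mul_eq_one_left ?_
      field_simp
      linear_combination -him
    rw [pow_one, hinv]
    -- The factor p² - p⁻² is written in factored form so that denominators clear using only p² ± 1
    -- ≠ 0.
    generalize (p ^ 2) ^ y = Y at *
    rw [show p ^ 2 - (p ^ 2)⁻¹ = (p ^ 2 - 1) * (p ^ 2 + 1) / p ^ 2 by field_simp; ring,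
      show p ^ 1 ^ 2 - (p ^ 1 ^ 2)⁻¹ = (p ^ 2 - 1) / p by
        rw [one_pow, pow_one]; field_simp]
    simp only [zpow_neg, zpow_zero, zpow_one]
    field_simp
    ring
  · have hm1 := qInt_eq (p ^ 2) hq y (-1)
    rw [← sub_eq_add_neg] at hm1
    rw [qFall_two, qFall_two, Nat.cast_ofNat, show y + 2 - 1 = y + 1 by ring, qInt_eq _ hq y 1,
      qInt_eq _ hq y 2, hy0, hm1, lowScale, if_neg (by norm_num),
      qInt_two hq (pow_pow_ne_one' hp two_ne_zero)]
    have hsq : (-im * p * (p ^ 2) ^ y) ^ 2 = -(p ^ 2 * ((p ^ 2) ^ y) ^ 2) := by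
      linear_combination (p * (p ^ 2) ^ y) ^ 2 * him
    rw [hsq]
    generalize (p ^ 2) ^ y = Y at *
    rw [show p ^ 2 - (p ^ 2)⁻¹ = (p ^ 2 - 1) * (p ^ 2 + 1) / p ^ 2 by field_simp; ring,
      show p ^ 2 + (p ^ 2)⁻¹ = (p ^ 4 + 1) / p ^ 2 by field_simp,
      show p ^ 2 ^ 2 - (p ^ 2 ^ 2)⁻¹ = (p ^ 2 - 1) * (p ^ 2 + 1) * (p ^ 4 + 1) / p ^ 4 by
        norm_num; field_simp; ring]
    simp only [zpow_neg, neg_neg, zpow_ofNat, inv_neg]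
    field_simp
    ring

theorem eCoef_fCoef_self (h0 : p ≠ 0) (hp : ∀ m : ℕ, m ≠ 0 → p ^ m ≠ 1) (him : im ^ 2 = -1)
    (hx : x ≠ 0) (g : AffineType) (i : Fin (N + 2)) (m : Fin (N + 1) → ℤ) :
    eCoef p im x N g i (m + -root N g i) * fCoef p im x N g i m -
      fCoef p im x N g i (m + root N g i) * eCoef p im x N g i m =
      (p ^ nodeExp N g i - (p ^ nodeExp N g i)⁻¹)⁻¹ *
        (kCoef p im N g i m - (kCoef p im N g i m)⁻¹) := by
  have hq : p ^ 2 ≠ 0 := pow_ne_zero _ h0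
  induction i using vertices_cases with
  | h0 =>
    rw [kCoef_zero, nodeExp_eq, onVertices_zero, ← lowScale_mul h0 hp him (by cases g <;> simp [leftExp])]
    simp only [eCoef, fCoef, eScale, fScale, eDeg, fDeg, eSite, fSite, onVertices_zero, qFall_zero,
      Pi.add_apply, root_zero_apply, Fin.val_zero, if_true]
    field_simp
  | hm r =>
    have hne : (r.castSucc : Fin (N + 1)) ≠ r.succ := r.castSucc_lt_succ.ne
    rw [kCoef_mid h0 him, nodeExp_eq, onVertices_mid]
    simp only [eCoef, fCoef, eScale, fScale, eDeg, fDeg, eSite, fSite, onVertices_mid, qFall_one,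
      Pi.add_apply, Pi.neg_apply, root_mid_apply, Fin.val_succ, Fin.val_castSucc]
    have e1 : ((r : ℕ) = r + 1) = False := by simp
    simp only [e1, if_true, if_false, Nat.add_eq_left, one_ne_zero, sub_zero, zero_sub, neg_neg]
    rw [qInt_eq _ hq, qInt_eq _ hq (m r.succ)]
    have ha := qInt_eq (p ^ 2) hq (m r.castSucc) 0
    have hb := qInt_eq (p ^ 2) hq (m r.succ) 0
    rw [add_zero] at ha hb
    have h := sub_inv_ne_zero hq (pow_pow_ne_one' hp two_ne_zero)
    rw [ha, hb, neg_add_eq_sub, zpow_sub₀ hq]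
    have hA := zpow_ne_zero (m r.castSucc) hq
    have hB := zpow_ne_zero (m r.succ) hq
    generalize (p ^ 2) ^ m r.castSucc = A at *
    generalize (p ^ 2) ^ m r.succ = B at *
    simp only [zpow_neg, zpow_zero, zpow_one]
    have e : (p ^ 2 - (p ^ 2)⁻¹)⁻¹ * (B / A - (B / A)⁻¹) = (p ^ 2 - (p ^ 2)⁻¹)⁻¹ *
        (p ^ 2 - (p ^ 2)⁻¹)⁻¹ * ((p ^ 2 - (p ^ 2)⁻¹) * (B / A - (B / A)⁻¹)) := by
      field_simp
    rw [e]
    generalize (p ^ 2 - (p ^ 2)⁻¹)⁻¹ = d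
    field_simp
    ring
  | hl =>
    have hk := lowScale_mul h0 hp him (k := rightExp g) (by cases g <;> simp [rightExp])
      (m (Fin.last N))
    rw [kCoef_last, nodeExp_eq, onVertices_last, inv_inv,
      ← neg_sub (_ ^ rightExp g : E), mul_neg, ← hk]
    simp only [eCoef, fCoef, eScale, fScale, eDeg, fDeg, eSite, fSite, onVertices_last, qFall_zero,
      Pi.add_apply, Pi.neg_apply, root_last_apply, Fin.val_last, if_true, neg_neg]
    ring

theorem isUqModule_qOscillator (h0 : p ≠ 0) (hp : ∀ m : ℕ, m ≠ 0 → p ^ m ≠ 1)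
    (him : im ^ 2 = -1) (hx : x ≠ 0) (g : AffineType) :
    IsUqModule p g (qOscillator p im x N g) := by
  have hk (i : Fin (N + 2)) := (qOscillator_k_apply h0 him x g i).1
  have hki (i : Fin (N + 2)) := (qOscillator_k_apply h0 him x g i).2
  have hne (i : Fin (N + 2)) (m : Fin (N + 1) → ℤ) : kCoef p im N g i m ≠ 0 :=
    kCoef_ne_zero h0 him g i m
  have lk (i : Fin (N + 2)) : Lifts ((qOscillator p im x N g).k i) (latOp (kCoef p im N g i) 0) := by
    rw [hk]
    exact lifts_ketOp_id fun m => rfl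
  have lki (i : Fin (N + 2)) : Lifts ((qOscillator p im x N g).kinv i)
      (latOp (fun m => (kCoef p im N g i m)⁻¹) 0) := by
    rw [hki]
    exact lifts_ketOp_id fun m => rfl
  have le := lifts_e p im x N g
  have lf := lifts_f p im x N g
  refine ⟨fun i => ?_, fun i => ?_, fun i j => ?_, fun i j => ?_, fun i j => ?_, fun i j => ?_,
    fun i j hij => ?_, fun i j hij => ?_⟩
  · rw [hk, hki, ketOp_id_mul, ← ketOp_one]
    congr 1
    ext m
    exact mul_inv_cancel₀ (hne _ _)
  · rw [hk, hki, ketOp_id_mul, ← ketOp_one]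
    congr 1
    ext m
    exact inv_mul_cancel₀ (hne _ _)
  · rw [hk, hk, ketOp_id_mul, ketOp_id_mul, mul_comm]
  · exact (((lk i).mul (le j)).mul (lki i)).eq ((le j).smul _)
      (latOp_diag_conj (hne i) _ fun m => kCoef_add_root h0 g i j m)
  · exact (((lk i).mul (lf j)).mul (lki i)).eq ((lf j).smul _)
      (latOp_diag_conj (hne i) _ fun m => by rw [← sub_eq_add_neg]; exact kCoef_sub_root h0 g i j m)
  · have hl := ((le i).mul (lf j)).sub ((lf j).mul (le i))
    split_ifs with hij
    · subst hij
      refine hl.eq (((lk i).sub (lki i)).smul _) ?_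
      rw [latOp_mul, latOp_mul, add_neg_cancel, neg_add_cancel]
      ext f a
      simp only [LinearMap.sub_apply, LinearMap.smul_apply, Pi.sub_apply, Pi.smul_apply,
        latOp_apply, smul_eq_mul]
      rw [← sub_mul, eCoef_fCoef_self h0 hp him hx]
      ring
    · exact hl.eq Lifts.zero (latOp_comm fun m => eCoef_fCoef_comm p im x g hij m)
  · exact ((le i).serre (le j) _ _).eq Lifts.zero
      (serre_latOp rfl (serreId_e h0 hp g hij) _ _ (fun m => rfl) (fun m => rfl) rfl rfl rfl)
  · exact ((lf i).serre (lf j) _ _).eq Lifts.zero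
      (serre_latOp rfl (serreId_f h0 hp g hij) _ _ (fun m => rfl) (fun m => rfl) rfl rfl rfl)

end Module

/-! ### The chain relations for the normalized solution -/

section Relations

variable {𝕜 K : Type*} [NormedField 𝕜] [Field K] {N : ℕ}

/-- The image in `K` of a matrix element of the solution. -/
def solK (ι : PowerSeries 𝕜 →+* K) (q : 𝕜) (g : AffineType) {n : ℕ} (a b : Fin n → ℤ)
    (i j : Fin n → ℕ) : K := ι (solZ q g a b i j)

variable {q : 𝕜} (ι : PowerSeries 𝕜 →+* K)

/-- The normalization factor depends on the inputs at most through their parities. A relation whose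
terms all have equal factors can be multiplied by that factor and rewritten for the solution. -/
theorem map_normFactor_mul {g : AffineType} {n s t : ℕ} (hs : s = leftExp g) (ht : t = rightExp g)
    {i' j' i j : Fin n → ℕ} (h : normFactor q g (parity i) (parity j) =
      normFactor q g (parity i') (parity j')) (a b : Fin n → ℤ) :
    ι (normFactor q g (parity i) (parity j)) * ι (bareZ q s t a b i' j') =
      solK ι q g a b i' j' := by
  rw [h, solK, solZ, map_mul, hs, ht]

theorem map_smul_powerSeries (x : 𝕜) (F : PowerSeries 𝕜) :
    ι (x • F) = (ι.comp PowerSeries.C) x * ι F := by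
  rw [PowerSeries.smul_eq_C_mul, map_mul]
  rfl

theorem solK_weight (h0 : q ≠ 0) (hq : ∀ m : ℕ, m ≠ 0 → q ^ m ≠ 1) (g : AffineType) {n : ℕ}
    {a b : Fin n → ℤ} {i j : Fin n → ℕ} (r : Fin n) (h : a r + b r ≠ i r + j r) :
    solK ι q g a b i j = 0 := by
  rw [solK, solZ, bareZ_weight h0 hq _ _ r h, mul_zero, map_zero]

theorem normFactor_of_leftExp {g : AffineType} (h : leftExp g = 1) (ε₁ ε₂ ε₁' ε₂' : ℤˣ) :
    normFactor q g ε₁ ε₂ = normFactor q g ε₁' ε₂' := by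
  cases g
  · rfl
  · rfl
  · simp [leftExp] at h

theorem normFactor_of_rightExp {g : AffineType} (h : rightExp g = 1) (ε₁ ε₂ ε₁' ε₂' : ℤˣ) :
    normFactor q g ε₁ ε₂ = normFactor q g ε₁' ε₂' := by
  cases g
  · rfl
  · simp [rightExp] at h
  · simp [rightExp] at h

theorem parity_add_two {n : ℕ} (i : Fin n → ℕ) (r : Fin n) :
    parity (i + 2 • unitVec r) = parity i := by
  rw [parity_add, two_nsmul, parity_add, parity_unitVec]
  simp

theorem parity_sub_two {n : ℕ} {i : Fin n → ℕ} {r : Fin n} (h : 2 ≤ i r) :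
    parity (i - 2 • unitVec r) = parity i := by
  rw [← parity_add_two (i - 2 • unitVec r) r, tsub_add_cancel_of_le (nsmul_unitVec_le h)]

theorem parity_move {n : ℕ} {i : Fin n → ℕ} {r r' : Fin n} (h : i r ≠ 0) :
    parity (i - unitVec r + unitVec r') = parity i := by
  rw [parity_add, parity_unitVec, ← parity_unitVec r, ← parity_add,
    tsub_add_cancel_of_le (unitVec_le h)]

theorem parity_move' {n : ℕ} {i : Fin n → ℕ} {r r' : Fin n} (h : i r ≠ 0) :
    parity (i + unitVec r' - unitVec r) = parity i := by
  rw [← parity_move (r' := r') h, tsub_add_eq_add_tsub (unitVec_le h)]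

theorem one_sub_zpow_sq {Q : K} (h0 : Q ≠ 0) (hQ : ∀ m : ℕ, m ≠ 0 → Q ^ m ≠ 1) (z : ℤ) :
    1 - (Q ^ z) ^ 2 = -(Q - Q⁻¹) * (Q ^ z * qInt Q z) := by
  have h1 := sub_inv_ne_zero h0 hQ
  have h2 := zpow_ne_zero z h0
  rw [qInt, zpow_neg, mul_div_assoc', neg_mul, mul_div_cancel₀ _ h1]
  field_simp
  ring

theorem solK_raise_first (h0 : q ≠ 0) (hq : ∀ m : ℕ, m ≠ 0 → q ^ m ≠ 1) (g : AffineType) {Q : K}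
    (hQ : ι (PowerSeries.C q) = Q) (a b : Fin (N + 1) → ℤ) (i j : Fin (N + 1) → ℕ) :
    ι PowerSeries.X * solK ι q g (a - leftExp g • zvec 0) b i j +
        (-(Q * Q ^ a 0)) ^ leftExp g * solK ι q g a (b - leftExp g • zvec 0) i j =
      solK ι q g a b i (j + leftExp g • unitVec 0) +
        (-(Q * Q ^ (j 0 : ℤ))) ^ leftExp g *
          (ι PowerSeries.X * solK ι q g a b (i + leftExp g • unitVec 0) j) := by
  have hQ' : (ι.comp PowerSeries.C) q = Q := hQ
  have hz (y : ℤ) : (ι.comp PowerSeries.C) (q ^ y) = Q ^ y := by rw [map_zpow₀, hQ']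
  obtain hg | hg : leftExp g = 1 ∨ leftExp g = 2 := by cases g <;> simp [leftExp]
  · have h := congrArg (fun F => ι (normFactor q g (parity i) (parity j)) * ι F)
      (bareZ_first_one_raise h0 hq (rightExp g) a b i j)
    have e := fun a b i' j' => map_normFactor_mul (q := q) (n := N + 1) (g := g) (i := i) (j := j) (i' := i')
      (j' := j') ι hg.symm rfl (normFactor_of_leftExp hg _ _ _ _) a b
    simp only [map_sub, map_smul_powerSeries, map_mul, hQ', hz, ← zpow_natCast q] at h
    simp only [hg, one_smul, pow_one, ← e]
    linear_combination h
  · have h := congrArg (fun F => ι (normFactor q g (parity i) (parity j)) * ι F)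
      (bareZ_first_two_raise h0 hq (rightExp g) a b i j)
    simp only [map_add, map_smul_powerSeries, map_mul, map_pow, hQ', hz, ← zpow_natCast q] at h
    simp only [hg]
    rw [← map_normFactor_mul ι hg.symm rfl rfl, ← map_normFactor_mul ι hg.symm rfl rfl,
      ← map_normFactor_mul (i := i) (j := j) ι hg.symm rfl (by rw [parity_add_two]),
      ← map_normFactor_mul (i := i) (j := j) ι hg.symm rfl (by rw [parity_add_two])]
    linear_combination h

theorem solK_raise_last (h0 : q ≠ 0) (hq : ∀ m : ℕ, m ≠ 0 → q ^ m ≠ 1) (g : AffineType) {Q : K}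
    (hQ : ι (PowerSeries.C q) = Q) (a b : Fin (N + 1) → ℤ) (i j : Fin (N + 1) → ℕ) :
    solK ι q g a (b - rightExp g • zvec (Fin.last N)) i j +
        (Q ^ b (Fin.last N)) ^ rightExp g * solK ι q g (a - rightExp g • zvec (Fin.last N)) b i j =
      solK ι q g a b (i + rightExp g • unitVec (Fin.last N)) j +
        (Q ^ (i (Fin.last N) : ℤ)) ^ rightExp g *
          solK ι q g a b i (j + rightExp g • unitVec (Fin.last N)) := by
  have hQ' : (ι.comp PowerSeries.C) q = Q := hQ
  have hz (y : ℤ) : (ι.comp PowerSeries.C) (q ^ y) = Q ^ y := by rw [map_zpow₀, hQ']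
  obtain hg | hg : rightExp g = 1 ∨ rightExp g = 2 := by cases g <;> simp [rightExp]
  · have h := congrArg (fun F => ι (normFactor q g (parity i) (parity j)) * ι F)
      (bareZ_last_one_raise h0 hq (leftExp g) a b i j)
    have e := fun a b i' j' => map_normFactor_mul (q := q) (n := N + 1) (g := g) (i := i) (j := j) (i' := i')
      (j' := j') ι rfl hg.symm (normFactor_of_rightExp hg _ _ _ _) a b
    simp only [map_add, map_smul_powerSeries, hz, ← zpow_natCast q] at h
    simp only [hg, one_smul, pow_one, ← e]
    linear_combination h
  · have h := congrArg (fun F => ι (normFactor q g (parity i) (parity j)) * ι F)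
      (bareZ_last_two_raise h0 hq (leftExp g) a b i j)
    simp only [map_add, map_smul_powerSeries, map_pow, hz, ← zpow_natCast q] at h
    simp only [hg]
    rw [← map_normFactor_mul ι rfl hg.symm rfl, ← map_normFactor_mul ι rfl hg.symm rfl,
      ← map_normFactor_mul (i := i) (j := j) ι rfl hg.symm (by rw [parity_add_two]),
      ← map_normFactor_mul (i := i) (j := j) ι rfl hg.symm (by rw [parity_add_two])]
    linear_combination h

/-- Used with a falling product as `x`: where an input index would truncate the product vanishes, so
elsewhere the subtraction may be taken as exact. -/
theorem mul_eq_mul_of_imp {M : Type*} [MulZeroClass M] {x y z : M} (h : x ≠ 0 → y = z) :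
    x * y = x * z := by
  by_cases hx : x = 0
  · rw [hx, zero_mul, zero_mul]
  · rw [h hx]

theorem qFall_one_eq {Q : K} (h0 : Q ≠ 0) (hQ : ∀ m : ℕ, m ≠ 0 → Q ^ m ≠ 1) (y : ℤ) :
    1 - (Q * Q ^ y) ^ 2 = -(Q - Q⁻¹) * (Q * Q ^ y) * qFall Q 1 (y + 1) := by
  rw [← zpow_one_add₀ h0, one_sub_zpow_sq h0 hQ, qFall_one, add_comm y, mul_assoc]

theorem qFall_two_eq {Q : K} (h0 : Q ≠ 0) (hQ : ∀ m : ℕ, m ≠ 0 → Q ^ m ≠ 1) (y : ℤ) :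
    (1 - (Q * Q ^ y) ^ 2) * (1 - (Q ^ 2 * Q ^ y) ^ 2) =
      (Q - Q⁻¹) ^ 2 * (Q ^ 3 * (Q ^ y) ^ 2) * qFall Q 2 (y + 2) := by
  have e : Q ^ 2 * Q ^ y = Q ^ (y + 2) := by
    rw [zpow_add₀ h0, mul_comm, zpow_ofNat]
  have e' : Q * Q ^ y = Q ^ (y + 1) := by rw [zpow_add_one₀ h0, mul_comm]
  rw [e, e', one_sub_zpow_sq h0 hQ, one_sub_zpow_sq h0 hQ, ← e, ← e', qFall_two,
    show y + 2 - 1 = y + 1 by ring]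
  ring

theorem qFall_one_nat {Q : K} (h0 : Q ≠ 0) (hQ : ∀ m : ℕ, m ≠ 0 → Q ^ m ≠ 1) (m : ℕ) :
    1 - (Q ^ m) ^ 2 = -(Q - Q⁻¹) * Q ^ m * qFall Q 1 m := by
  rw [← zpow_natCast Q m, one_sub_zpow_sq h0 hQ, qFall_one, mul_assoc]

theorem qFall_two_nat {Q : K} (h0 : Q ≠ 0) (hQ : ∀ m : ℕ, m ≠ 0 → Q ^ m ≠ 1) (m : ℕ) :
    (1 - (Q ^ m) ^ 2) * (1 - (Q ^ (m - 1)) ^ 2) =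
      (Q - Q⁻¹) ^ 2 * ((Q ^ m) ^ 2 * Q⁻¹) * qFall Q 2 m := by
  cases m with
  | zero => simp [qFall_two, qInt_zero]
  | succ m =>
    rw [qFall_one_nat h0 hQ, Nat.add_sub_cancel, qFall_one_nat h0 hQ, qFall_two, qFall_one,
      qFall_one, Nat.cast_succ, add_sub_cancel_right]
    have e : Q * Q⁻¹ = 1 := mul_inv_cancel₀ h0
    linear_combination -(Q - Q⁻¹) ^ 2 * Q ^ (2 * m) * Q * qInt Q (m + 1) * qInt Q m * e

theorem le_of_qFall_ne_zero {Q : K} {k m : ℕ} (h : qFall Q k m ≠ 0) : k ≤ m := by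
  by_contra hk
  push Not at hk
  exact h (Finset.prod_eq_zero (Finset.mem_range.2 hk) (by rw [sub_self, qInt_zero]))

theorem weight_of_add {k : ℕ} {n : ℕ} {x y : Fin n → ℤ} {i j : Fin n → ℕ} {r : Fin n}
    (h : ¬ x r + y r + k = i r + j r) : (x + k • zvec r) r + y r ≠ i r + j r := by
  rw [Pi.add_apply, Pi.smul_apply, zvec_same, nsmul_eq_mul, mul_one]
  omega

theorem qFall_mul_solK_sub_left (h0 : q ≠ 0) (hq : ∀ m : ℕ, m ≠ 0 → q ^ m ≠ 1) (g : AffineType)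
    {Q : K} {k n : ℕ} {a b : Fin n → ℤ} {i j : Fin n → ℕ} {r : Fin n}
    (h : ¬ a r + b r + k = i r + j r) :
    qFall Q k (i r) * solK ι q g a b (i - k • unitVec r) j = 0 := by
  refine (mul_eq_mul_of_imp fun hk => ?_).trans (mul_zero _)
  have hk := le_of_qFall_ne_zero hk
  refine solK_weight ι h0 hq g r ?_
  rw [Pi.sub_apply, Pi.smul_apply, unitVec_same, smul_eq_mul, mul_one]
  omega

theorem qFall_mul_solK_sub_right (h0 : q ≠ 0) (hq : ∀ m : ℕ, m ≠ 0 → q ^ m ≠ 1) (g : AffineType)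
    {Q : K} {k n : ℕ} {a b : Fin n → ℤ} {i j : Fin n → ℕ} {r : Fin n}
    (h : ¬ a r + b r + k = i r + j r) :
    qFall Q k (j r) * solK ι q g a b i (j - k • unitVec r) = 0 := by
  refine (mul_eq_mul_of_imp fun hk => ?_).trans (mul_zero _)
  have hk := le_of_qFall_ne_zero hk
  refine solK_weight ι h0 hq g r ?_
  rw [Pi.sub_apply, Pi.smul_apply, unitVec_same, smul_eq_mul, mul_one]
  omega

theorem qFall_mul_normFactor_left {g : AffineType} {s t n : ℕ} (hs : s = leftExp g)
    (ht : t = rightExp g) {Q : K} (a b : Fin n → ℤ) (i j : Fin n → ℕ) (r : Fin n) :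
    qFall Q 2 (i r) * (ι (normFactor q g (parity i) (parity j)) *
      ι (bareZ q s t a b (i - 2 • unitVec r) j)) =
    qFall Q 2 (i r) * solK ι q g a b (i - 2 • unitVec r) j :=
  mul_eq_mul_of_imp fun h =>
    map_normFactor_mul ι hs ht (by rw [parity_sub_two (le_of_qFall_ne_zero h)]) a b

theorem qFall_mul_normFactor_right {g : AffineType} {s t n : ℕ} (hs : s = leftExp g)
    (ht : t = rightExp g) {Q : K} (a b : Fin n → ℤ) (i j : Fin n → ℕ) (r : Fin n) :
    qFall Q 2 (j r) * (ι (normFactor q g (parity i) (parity j)) *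
      ι (bareZ q s t a b i (j - 2 • unitVec r))) =
    qFall Q 2 (j r) * solK ι q g a b i (j - 2 • unitVec r) :=
  mul_eq_mul_of_imp fun h =>
    map_normFactor_mul ι hs ht (by rw [parity_sub_two (le_of_qFall_ne_zero h)]) a b

section Algebra

variable {A B I J Q d Z f₁ f₂ f₃ f₄ S₁ S₂ S₃ S₄ : K}

/-- The letters A, B, I, J stand for powers of Q with the four site indices as exponents, and `hw`
is weight conservation. Passing from 1 - Q^{2m} to q-integers produces a common factor, which `hw`
makes equal on both sides and which is then cancelled. -/
theorem lower_first_one_of (hA : A ≠ 0) (hB : B ≠ 0) (hI : I ≠ 0) (hQ : Q ≠ 0) (hd : d ≠ 0)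
    (hw : A * B * Q = I * J)
    (h : A * (-d * (Q * B) * f₁) * (Z * S₁) + -d * (Q * A) * f₂ * S₂ =
      J * (-d * I * f₃) * S₃ + -d * J * f₄ * (Z * S₄)) :
    Z * (f₁ * S₁) + B⁻¹ * (f₂ * S₂) = f₃ * S₃ + I⁻¹ * (Z * (f₄ * S₄)) := by
  have eB := mul_inv_cancel₀ hB
  have eI := mul_inv_cancel₀ hI
  refine mul_left_cancel₀ (mul_ne_zero (neg_ne_zero.2 hd) (mul_ne_zero (mul_ne_zero hA hB) hQ)) ?_
  linear_combination h + (-d * Q * A * f₂ * S₂) * eB +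
    d * (f₃ * S₃ + I⁻¹ * (Z * (f₄ * S₄))) * hw + d * J * f₄ * Z * S₄ * eI

theorem lower_first_two_of (hA : A ≠ 0) (hB : B ≠ 0) (hI : I ≠ 0) (hQ : Q ≠ 0) (hd : d ≠ 0)
    (hw : A * B * Q ^ 2 = I * J)
    (h : A ^ 2 * (d ^ 2 * (Q ^ 3 * B ^ 2) * f₁) * (Z * S₁) + d ^ 2 * (Q ^ 3 * A ^ 2) * f₂ * S₂ =
      J ^ 2 * (d ^ 2 * (I ^ 2 * Q⁻¹) * f₃) * S₃ + d ^ 2 * (J ^ 2 * Q⁻¹) * f₄ * (Z * S₄)) :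
    Z * (f₁ * S₁) + (B ^ 2)⁻¹ * (f₂ * S₂) = f₃ * S₃ + (I ^ 2)⁻¹ * (Z * (f₄ * S₄)) := by
  have eB := mul_inv_cancel₀ (pow_ne_zero 2 hB)
  have eI := mul_inv_cancel₀ (pow_ne_zero 2 hI)
  have eQ := mul_inv_cancel₀ hQ
  have hw' : d ^ 2 * A ^ 2 * B ^ 2 * Q ^ 3 = d ^ 2 * I ^ 2 * J ^ 2 * Q⁻¹ := by
    linear_combination d ^ 2 * Q⁻¹ * (A * B * Q ^ 2 + I * J) * hw -
      d ^ 2 * A ^ 2 * B ^ 2 * Q ^ 3 * eQ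
  refine mul_left_cancel₀ (a := d ^ 2 * A ^ 2 * B ^ 2 * Q ^ 3) (by positivity) ?_
  linear_combination h + (d ^ 2 * Q ^ 3 * A ^ 2 * f₂ * S₂) * eB +
    (-(f₃ * S₃ + (I ^ 2)⁻¹ * (Z * (f₄ * S₄)))) * hw' - d ^ 2 * J ^ 2 * Q⁻¹ * f₄ * Z * S₄ * eI

theorem lower_last_one_of (hA : A ≠ 0) (hB : B ≠ 0) (hJ : J ≠ 0) (hQ : Q ≠ 0) (hd : d ≠ 0)
    (hw : A * B * Q = I * J)
    (h : -d * (Q * B) * f₁ * S₁ - Q * B * (-d * (Q * A) * f₂) * S₂ =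
      -d * I * f₃ * S₃ - Q * I * (-d * J * f₄) * S₄) :
    f₂ * S₂ + (-(Q * A))⁻¹ * (f₁ * S₁) = f₄ * S₄ + (-(Q * J))⁻¹ * (f₃ * S₃) := by
  have eA := mul_inv_cancel₀ (neg_ne_zero.2 (mul_ne_zero hQ hA))
  have eJ := mul_inv_cancel₀ (neg_ne_zero.2 (mul_ne_zero hQ hJ))
  refine mul_left_cancel₀ (mul_ne_zero hd (mul_ne_zero (mul_ne_zero hA hB) (pow_ne_zero 2 hQ))) ?_
  linear_combination h - (d * Q * B * f₁ * S₁) * eA -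
    d * Q * (f₄ * S₄ + (-(Q * J))⁻¹ * (f₃ * S₃)) * hw + d * I * f₃ * S₃ * eJ

theorem lower_last_two_of (hA : A ≠ 0) (hB : B ≠ 0) (hJ : J ≠ 0) (hQ : Q ≠ 0) (hd : d ≠ 0)
    (hw : A * B * Q ^ 2 = I * J)
    (h : d ^ 2 * (Q ^ 3 * B ^ 2) * f₁ * S₁ + (Q * B) ^ 2 * (d ^ 2 * (Q ^ 3 * A ^ 2) * f₂) * S₂ =
      d ^ 2 * (I ^ 2 * Q⁻¹) * f₃ * S₃ + (Q * I) ^ 2 * (d ^ 2 * (J ^ 2 * Q⁻¹) * f₄) * S₄) :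
    f₂ * S₂ + ((-(Q * A)) ^ 2)⁻¹ * (f₁ * S₁) = f₄ * S₄ + ((-(Q * J)) ^ 2)⁻¹ * (f₃ * S₃) := by
  have eA := mul_inv_cancel₀ (pow_ne_zero 2 (neg_ne_zero.2 (mul_ne_zero hQ hA)))
  have eJ := mul_inv_cancel₀ (pow_ne_zero 2 (neg_ne_zero.2 (mul_ne_zero hQ hJ)))
  have eQ := mul_inv_cancel₀ hQ
  have hw' : d ^ 2 * A ^ 2 * B ^ 2 * Q ^ 5 = d ^ 2 * I ^ 2 * J ^ 2 * Q ^ 2 * Q⁻¹ := by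
    linear_combination d ^ 2 * Q ^ 2 * Q⁻¹ * (A * B * Q ^ 2 + I * J) * hw -
      d ^ 2 * A ^ 2 * B ^ 2 * Q ^ 5 * eQ
  refine mul_left_cancel₀ (a := d ^ 2 * A ^ 2 * B ^ 2 * Q ^ 5) (by positivity) ?_
  linear_combination h + (d ^ 2 * Q ^ 3 * B ^ 2 * f₁ * S₁) * eA +
    (-(f₄ * S₄ + ((-(Q * J)) ^ 2)⁻¹ * (f₃ * S₃))) * hw' - d ^ 2 * I ^ 2 * Q⁻¹ * f₃ * S₃ * eJ

/-- Also serves `solK_mid_left`, with the roles of the two tensor factors exchanged. -/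
theorem mid_of {A' J' : K} (hA : A ≠ 0) (hB : B ≠ 0) (hJ : J ≠ 0) (hQ : Q ≠ 0) (hd : d ≠ 0)
    (hw : A * B * Q = I * J)
    (h : B * (-d * (Q * A) * f₁) * S₁ + A' * (-d * (Q * B) * f₂) * S₂ =
      J' * (-d * I * f₄) * S₄ + I * (-d * J * f₃) * S₃) :
    f₁ * S₁ + A⁻¹ * A' * (f₂ * S₂) = f₃ * S₃ + J⁻¹ * J' * (f₄ * S₄) := by
  have eA := mul_inv_cancel₀ hA
  have eJ := mul_inv_cancel₀ hJ
  refine mul_left_cancel₀ (mul_ne_zero (neg_ne_zero.2 hd) (mul_ne_zero (mul_ne_zero hA hB) hQ)) ?_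
  linear_combination h - d * Q * B * A' * f₂ * S₂ * eA +
    d * (f₃ * S₃ + J⁻¹ * J' * (f₄ * S₄)) * hw + d * I * J' * f₄ * S₄ * eJ

end Algebra

/-- The relation in terms of q-integers, as they occur in f_0. Rewriting 1 - q^{2m} as a multiple of
[m] leaves powers of q that match only by weight conservation. -/
theorem solK_lower_first (h0 : q ≠ 0) (hq : ∀ m : ℕ, m ≠ 0 → q ^ m ≠ 1) (g : AffineType) {Q : K}
    (hQ : ι (PowerSeries.C q) = Q) (a b : Fin (N + 1) → ℤ) (i j : Fin (N + 1) → ℕ) :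
    ι PowerSeries.X * (qFall Q (leftExp g) (b 0 + leftExp g) *
        solK ι q g a (b + leftExp g • zvec 0) i j) +
      ((Q ^ b 0) ^ leftExp g)⁻¹ * (qFall Q (leftExp g) (a 0 + leftExp g) *
        solK ι q g (a + leftExp g • zvec 0) b i j) =
      qFall Q (leftExp g) (i 0) * solK ι q g a b (i - leftExp g • unitVec 0) j +
        ((Q ^ i 0) ^ leftExp g)⁻¹ * (ι PowerSeries.X * (qFall Q (leftExp g) (j 0) *
          solK ι q g a b i (j - leftExp g • unitVec 0))) := by
  have hQ' : (ι.comp PowerSeries.C) q = Q := hQ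
  have hz (y : ℤ) : (ι.comp PowerSeries.C) (q ^ y) = Q ^ y := by rw [map_zpow₀, hQ']
  have hQ0 : Q ≠ 0 := by rw [← hQ']; exact (map_ne_zero _).2 h0
  have hQ1 (m : ℕ) (hm : m ≠ 0) : Q ^ m ≠ 1 := by
    rw [← hQ', ← map_pow]
    exact fun h => hq m hm ((ι.comp PowerSeries.C).injective (h.trans (map_one _).symm))
  have hd := sub_inv_ne_zero hQ0 hQ1
  have hne (y : ℤ) : Q ^ y ≠ 0 := zpow_ne_zero _ hQ0
  -- If the weights do not balance every term is zero, so conservation may be assumed afterwards.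
  by_cases hw : a 0 + b 0 + leftExp g = i 0 + j 0
  swap
  · rw [qFall_mul_solK_sub_left ι h0 hq g hw, qFall_mul_solK_sub_right ι h0 hq g hw,
      solK_weight ι h0 hq g 0 (weight_of_add hw),
      solK_weight ι h0 hq g 0 (by rw [add_comm]; exact weight_of_add (by rwa [add_comm (b 0)]))]
    simp
  obtain hg | hg : leftExp g = 1 ∨ leftExp g = 2 := by cases g <;> simp [leftExp]
  · have h := congrArg (fun F => ι (normFactor q g (parity i) (parity j)) * ι F)
      (bareZ_first_one_lower h0 hq (rightExp g) a b i j)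
    have e := fun a b i' j' => map_normFactor_mul (q := q) (n := N + 1) (g := g) (i := i) (j := j)
      (i' := i') (j' := j') ι hg.symm rfl (normFactor_of_leftExp hg _ _ _ _) a b
    simp only [map_add, map_sub, map_smul_powerSeries, map_mul, map_one, map_pow, hQ', hz,
      qFall_one_eq hQ0 hQ1, qFall_one_nat hQ0 hQ1] at h
    rw [hg] at hw
    simp only [hg, one_smul, pow_one, ← e, Nat.cast_one]
    refine lower_first_one_of (hne (a 0)) (hne _) (pow_ne_zero _ hQ0) hQ0 hd (J := Q ^ j 0) ?_ ?_
    · rw [← zpow_add₀ hQ0, ← zpow_add_one₀ hQ0, ← pow_add, ← zpow_natCast]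
      congr 1
    · linear_combination h
  · have h := congrArg (fun F => ι (normFactor q g (parity i) (parity j)) * ι F)
      (bareZ_first_two_lower h0 hq (rightExp g) a b i j)
    simp only [map_add, map_sub, map_smul_powerSeries, map_mul, map_one, map_pow, hQ', hz,
      qFall_two_eq hQ0 hQ1, qFall_two_nat hQ0 hQ1] at h
    rw [hg] at hw
    simp only [hg]
    rw [← map_normFactor_mul ι hg.symm rfl rfl, ← map_normFactor_mul ι hg.symm rfl rfl,
      ← qFall_mul_normFactor_left ι hg.symm rfl, ← qFall_mul_normFactor_right ι hg.symm rfl]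
    refine lower_first_two_of (hne (a 0)) (hne _) (pow_ne_zero _ hQ0) hQ0 hd (J := Q ^ j 0) ?_ ?_
    · rw [← zpow_add₀ hQ0, ← zpow_ofNat, ← zpow_add₀ hQ0, ← pow_add, ← zpow_natCast]
      congr 1
    · linear_combination h

theorem solK_lower_last (h0 : q ≠ 0) (hq : ∀ m : ℕ, m ≠ 0 → q ^ m ≠ 1) (g : AffineType) {Q : K}
    (hQ : ι (PowerSeries.C q) = Q) (a b : Fin (N + 1) → ℤ) (i j : Fin (N + 1) → ℕ) :
    qFall Q (rightExp g) (a (Fin.last N) + rightExp g) *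
        solK ι q g (a + rightExp g • zvec (Fin.last N)) b i j +
      ((-(Q * Q ^ a (Fin.last N))) ^ rightExp g)⁻¹ *
        (qFall Q (rightExp g) (b (Fin.last N) + rightExp g) *
          solK ι q g a (b + rightExp g • zvec (Fin.last N)) i j) =
      qFall Q (rightExp g) (j (Fin.last N)) *
        solK ι q g a b i (j - rightExp g • unitVec (Fin.last N)) +
        ((-(Q * Q ^ j (Fin.last N))) ^ rightExp g)⁻¹ * (qFall Q (rightExp g) (i (Fin.last N)) *
          solK ι q g a b (i - rightExp g • unitVec (Fin.last N)) j) := by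
  have hQ' : (ι.comp PowerSeries.C) q = Q := hQ
  have hz (y : ℤ) : (ι.comp PowerSeries.C) (q ^ y) = Q ^ y := by rw [map_zpow₀, hQ']
  have hQ0 : Q ≠ 0 := by rw [← hQ']; exact (map_ne_zero _).2 h0
  have hQ1 (m : ℕ) (hm : m ≠ 0) : Q ^ m ≠ 1 := by
    rw [← hQ', ← map_pow]
    exact fun h => hq m hm ((ι.comp PowerSeries.C).injective (h.trans (map_one _).symm))
  have hd := sub_inv_ne_zero hQ0 hQ1
  have hne (y : ℤ) : Q ^ y ≠ 0 := zpow_ne_zero _ hQ0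
  by_cases hw : a (Fin.last N) + b (Fin.last N) + rightExp g = i (Fin.last N) + j (Fin.last N)
  swap
  · rw [qFall_mul_solK_sub_left ι h0 hq g hw, qFall_mul_solK_sub_right ι h0 hq g hw,
      solK_weight ι h0 hq g _ (weight_of_add hw), solK_weight ι h0 hq g (Fin.last N) (by
        rw [add_comm]; exact weight_of_add (by rwa [add_comm (b (Fin.last N))]))]
    simp
  obtain hg | hg : rightExp g = 1 ∨ rightExp g = 2 := by cases g <;> simp [rightExp]
  · have h := congrArg (fun F => ι (normFactor q g (parity i) (parity j)) * ι F)
      (bareZ_last_one_lower h0 hq (leftExp g) a b i j)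
    have e := fun a b i' j' => map_normFactor_mul (q := q) (n := N + 1) (g := g) (i := i) (j := j)
      (i' := i') (j' := j') ι rfl hg.symm (normFactor_of_rightExp hg _ _ _ _) a b
    simp only [map_sub, map_smul_powerSeries, map_mul, map_one, map_pow, hQ', hz,
      qFall_one_eq hQ0 hQ1, qFall_one_nat hQ0 hQ1] at h
    rw [hg] at hw
    simp only [hg, one_smul, pow_one, ← e, Nat.cast_one]
    refine lower_last_one_of (hne _) (hne (b (Fin.last N))) (pow_ne_zero _ hQ0) hQ0 hd
      (I := Q ^ i (Fin.last N)) ?_ ?_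
    · rw [← zpow_add₀ hQ0, ← zpow_add_one₀ hQ0, ← pow_add, ← zpow_natCast]
      congr 1
    · linear_combination h
  · have h := congrArg (fun F => ι (normFactor q g (parity i) (parity j)) * ι F)
      (bareZ_last_two_lower h0 hq (leftExp g) a b i j)
    simp only [map_add, map_sub, map_smul_powerSeries, map_mul, map_one, map_pow, hQ', hz,
      qFall_two_eq hQ0 hQ1, qFall_two_nat hQ0 hQ1] at h
    rw [hg] at hw
    simp only [hg]
    rw [← map_normFactor_mul ι rfl hg.symm rfl, ← map_normFactor_mul ι rfl hg.symm rfl,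
      ← qFall_mul_normFactor_left ι rfl hg.symm, ← qFall_mul_normFactor_right ι rfl hg.symm]
    refine lower_last_two_of (hne _) (hne (b (Fin.last N))) (pow_ne_zero _ hQ0) hQ0 hd
      (I := Q ^ i (Fin.last N)) ?_ ?_
    · rw [← zpow_add₀ hQ0, ← zpow_ofNat, ← zpow_add₀ hQ0, ← pow_add, ← zpow_natCast]
      congr 1
    · linear_combination h

theorem solK_mid_right (h0 : q ≠ 0) (hq : ∀ m : ℕ, m ≠ 0 → q ^ m ≠ 1) (g : AffineType) {Q : K}
    (hQ : ι (PowerSeries.C q) = Q) (r : Fin N) (a b : Fin (N + 1) → ℤ) (i j : Fin (N + 1) → ℕ) :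
    qFall Q 1 (a r.castSucc + 1) * solK ι q g (a + zvec r.castSucc - zvec r.succ) b i j +
      Q ^ (-a r.castSucc + a r.succ) * (qFall Q 1 (b r.castSucc + 1) *
        solK ι q g a (b + zvec r.castSucc - zvec r.succ) i j) =
      qFall Q 1 (j r.castSucc) * solK ι q g a b i (j - unitVec r.castSucc + unitVec r.succ) +
      Q ^ (-(j r.castSucc : ℤ) + j r.succ) * (qFall Q 1 (i r.castSucc) *
        solK ι q g a b (i - unitVec r.castSucc + unitVec r.succ) j) := by
  have hQ' : (ι.comp PowerSeries.C) q = Q := hQ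
  have hz (y : ℤ) : (ι.comp PowerSeries.C) (q ^ y) = Q ^ y := by rw [map_zpow₀, hQ']
  have hQ0 : Q ≠ 0 := by rw [← hQ']; exact (map_ne_zero _).2 h0
  have hQ1 (m : ℕ) (hm : m ≠ 0) : Q ^ m ≠ 1 := by
    rw [← hQ', ← map_pow]
    exact fun h => hq m hm ((ι.comp PowerSeries.C).injective (h.trans (map_one _).symm))
  have hd := sub_inv_ne_zero hQ0 hQ1
  have hne (y : ℤ) : Q ^ y ≠ 0 := zpow_ne_zero _ hQ0
  have hr : r.castSucc ≠ r.succ := r.castSucc_lt_succ.ne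
  by_cases hw : a r.castSucc + b r.castSucc + 1 = i r.castSucc + j r.castSucc
  · have h := congrArg (fun F => ι (normFactor q g (parity i) (parity j)) * ι F)
      (bareZ_mid_right h0 hq (leftExp g) (rightExp g) r a b i j)
    simp only [map_add, map_sub, map_smul_powerSeries, map_mul, map_one, map_pow, hQ', hz,
      qFall_one_eq hQ0 hQ1, qFall_one_nat hQ0 hQ1] at h
    have e₁ : qFall Q 1 (i r.castSucc) * (ι (normFactor q g (parity i) (parity j)) *
        ι (bareZ q (leftExp g) (rightExp g) a b (i - unitVec r.castSucc + unitVec r.succ) j)) =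
        qFall Q 1 (i r.castSucc) *
          solK ι q g a b (i - unitVec r.castSucc + unitVec r.succ) j :=
      mul_eq_mul_of_imp fun h => map_normFactor_mul ι rfl rfl
        (by rw [parity_move (Nat.one_le_iff_ne_zero.1 (le_of_qFall_ne_zero h))]) a b
    have e₂ : qFall Q 1 (j r.castSucc) * (ι (normFactor q g (parity i) (parity j)) *
        ι (bareZ q (leftExp g) (rightExp g) a b i (j - unitVec r.castSucc + unitVec r.succ))) =
        qFall Q 1 (j r.castSucc) *
          solK ι q g a b i (j - unitVec r.castSucc + unitVec r.succ) :=
      mul_eq_mul_of_imp fun h => map_normFactor_mul ι rfl rfl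
        (by rw [parity_move (Nat.one_le_iff_ne_zero.1 (le_of_qFall_ne_zero h))]) a b
    rw [← e₁, ← e₂, ← map_normFactor_mul ι rfl rfl rfl, ← map_normFactor_mul ι rfl rfl rfl,
      zpow_add₀ hQ0, zpow_add₀ hQ0, zpow_neg, zpow_neg]
    refine mid_of (hne _) (hne (b r.castSucc)) (hne _) hQ0 hd (I := Q ^ i r.castSucc) ?_ ?_
    · rw [← zpow_add₀ hQ0, ← zpow_add_one₀ hQ0, hw, zpow_add₀ hQ0, zpow_natCast]
    · simp only [zpow_natCast]
      linear_combination h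
  · have e₁ : qFall Q 1 (i r.castSucc) *
        solK ι q g a b (i - unitVec r.castSucc + unitVec r.succ) j = 0 := by
      refine (mul_eq_mul_of_imp fun hk => ?_).trans (mul_zero _)
      have hk := le_of_qFall_ne_zero hk
      refine solK_weight ι h0 hq g r.castSucc ?_
      rw [Pi.add_apply, Pi.sub_apply, unitVec_same, unitVec_of_ne hr]
      omega
    have e₂ : qFall Q 1 (j r.castSucc) *
        solK ι q g a b i (j - unitVec r.castSucc + unitVec r.succ) = 0 := by
      refine (mul_eq_mul_of_imp fun hk => ?_).trans (mul_zero _)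
      have hk := le_of_qFall_ne_zero hk
      refine solK_weight ι h0 hq g r.castSucc ?_
      rw [Pi.add_apply, Pi.sub_apply, unitVec_same, unitVec_of_ne hr]
      omega
    rw [e₁, e₂, solK_weight ι h0 hq g r.castSucc, solK_weight ι h0 hq g r.castSucc]
    · simp
    · rw [Pi.sub_apply, Pi.add_apply, zvec_same, zvec_of_ne hr]
      omega
    · rw [Pi.sub_apply, Pi.add_apply, zvec_same, zvec_of_ne hr]
      omega

theorem solK_mid_left (h0 : q ≠ 0) (hq : ∀ m : ℕ, m ≠ 0 → q ^ m ≠ 1) (g : AffineType) {Q : K}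
    (hQ : ι (PowerSeries.C q) = Q) (r : Fin N) (a b : Fin (N + 1) → ℤ) (i j : Fin (N + 1) → ℕ) :
    qFall Q 1 (b r.succ + 1) * solK ι q g a (b - zvec r.castSucc + zvec r.succ) i j +
      Q ^ (-b r.succ + b r.castSucc) * (qFall Q 1 (a r.succ + 1) *
        solK ι q g (a - zvec r.castSucc + zvec r.succ) b i j) =
      qFall Q 1 (i r.succ) * solK ι q g a b (i + unitVec r.castSucc - unitVec r.succ) j +
      Q ^ (-(i r.succ : ℤ) + i r.castSucc) * (qFall Q 1 (j r.succ) *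
        solK ι q g a b i (j + unitVec r.castSucc - unitVec r.succ)) := by
  have hQ' : (ι.comp PowerSeries.C) q = Q := hQ
  have hz (y : ℤ) : (ι.comp PowerSeries.C) (q ^ y) = Q ^ y := by rw [map_zpow₀, hQ']
  have hQ0 : Q ≠ 0 := by rw [← hQ']; exact (map_ne_zero _).2 h0
  have hQ1 (m : ℕ) (hm : m ≠ 0) : Q ^ m ≠ 1 := by
    rw [← hQ', ← map_pow]
    exact fun h => hq m hm ((ι.comp PowerSeries.C).injective (h.trans (map_one _).symm))
  have hd := sub_inv_ne_zero hQ0 hQ1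
  have hne (y : ℤ) : Q ^ y ≠ 0 := zpow_ne_zero _ hQ0
  have hr : r.castSucc ≠ r.succ := r.castSucc_lt_succ.ne
  by_cases hw : b r.succ + a r.succ + 1 = j r.succ + i r.succ
  · have h := congrArg (fun F => ι (normFactor q g (parity i) (parity j)) * ι F)
      (bareZ_mid_left h0 hq (leftExp g) (rightExp g) r a b i j)
    simp only [map_add, map_sub, map_smul_powerSeries, map_mul, map_one, map_pow, hQ', hz,
      qFall_one_eq hQ0 hQ1, qFall_one_nat hQ0 hQ1] at h
    have e₁ : qFall Q 1 (i r.succ) * (ι (normFactor q g (parity i) (parity j)) *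
        ι (bareZ q (leftExp g) (rightExp g) a b (i + unitVec r.castSucc - unitVec r.succ) j)) =
        qFall Q 1 (i r.succ) *
          solK ι q g a b (i + unitVec r.castSucc - unitVec r.succ) j :=
      mul_eq_mul_of_imp fun h => map_normFactor_mul ι rfl rfl
        (by rw [parity_move' (Nat.one_le_iff_ne_zero.1 (le_of_qFall_ne_zero h))]) a b
    have e₂ : qFall Q 1 (j r.succ) * (ι (normFactor q g (parity i) (parity j)) *
        ι (bareZ q (leftExp g) (rightExp g) a b i (j + unitVec r.castSucc - unitVec r.succ))) =
        qFall Q 1 (j r.succ) *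
          solK ι q g a b i (j + unitVec r.castSucc - unitVec r.succ) :=
      mul_eq_mul_of_imp fun h => map_normFactor_mul ι rfl rfl
        (by rw [parity_move' (Nat.one_le_iff_ne_zero.1 (le_of_qFall_ne_zero h))]) a b
    rw [← e₁, ← e₂, ← map_normFactor_mul ι rfl rfl rfl, ← map_normFactor_mul ι rfl rfl rfl,
      zpow_add₀ hQ0, zpow_add₀ hQ0, zpow_neg, zpow_neg]
    refine mid_of (hne _) (hne (a r.succ)) (hne _) hQ0 hd (I := Q ^ j r.succ) ?_ ?_
    · rw [← zpow_add₀ hQ0, ← zpow_add_one₀ hQ0, hw, zpow_add₀ hQ0, zpow_natCast]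
    · simp only [zpow_natCast]
      linear_combination h
  · have e₁ : qFall Q 1 (i r.succ) *
        solK ι q g a b (i + unitVec r.castSucc - unitVec r.succ) j = 0 := by
      refine (mul_eq_mul_of_imp fun hk => ?_).trans (mul_zero _)
      have hk := le_of_qFall_ne_zero hk
      refine solK_weight ι h0 hq g r.succ ?_
      rw [Pi.sub_apply, Pi.add_apply, unitVec_same, unitVec_of_ne hr.symm]
      omega
    have e₂ : qFall Q 1 (j r.succ) *
        solK ι q g a b i (j + unitVec r.castSucc - unitVec r.succ) = 0 := by
      refine (mul_eq_mul_of_imp fun hk => ?_).trans (mul_zero _)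
      have hk := le_of_qFall_ne_zero hk
      refine solK_weight ι h0 hq g r.succ ?_
      rw [Pi.sub_apply, Pi.add_apply, unitVec_same, unitVec_of_ne hr.symm]
      omega
    rw [e₁, e₂, solK_weight ι h0 hq g r.succ, solK_weight ι h0 hq g r.succ]
    · simp
    · rw [Pi.add_apply, Pi.sub_apply, zvec_same, zvec_of_ne hr.symm]
      omega
    · rw [Pi.add_apply, Pi.sub_apply, zvec_same, zvec_of_ne hr.symm]
      omega

theorem solK_C1_parity {n : ℕ} (a b : Fin n → ℤ) (i j : Fin n → ℕ)
    (h : ¬ (2 : ℤ) ∣ ∑ r, (b r - j r)) : solK ι q .C1 a b i j = 0 := by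
  rw [solK, solZ, leftExp, rightExp, bareZ_two_two_parity q h, mul_zero, map_zero]

end Relations

/-! ### Generators on basis vectors -/

section Maps

variable {E : Type*} [Field E] {N : ℕ}

/-- The action of `e_i` on multi-indices. -/
def eMap (N : ℕ) (g : AffineType) : Fin (N + 2) → (Fin (N + 1) → ℕ) → (Fin (N + 1) → ℕ) :=
  onVertices (fun m => m + leftExp g • unitVec 0)
    (fun r m => m - unitVec r.castSucc + unitVec r.succ)
    (fun m => m - rightExp g • unitVec (Fin.last N))

/-- The action of `f_i` on multi-indices. -/
def fMap (N : ℕ) (g : AffineType) : Fin (N + 2) → (Fin (N + 1) → ℕ) → (Fin (N + 1) → ℕ) :=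
  onVertices (fun m => m - leftExp g • unitVec 0)
    (fun r m => m + unitVec r.castSucc - unitVec r.succ)
    (fun m => m + rightExp g • unitVec (Fin.last N))

theorem natVec_eMap (g : AffineType) (i : Fin (N + 2)) {m : Fin (N + 1) → ℕ}
    (h : eDeg N g i ≤ m (eSite N i)) : natVec (eMap N g i m) = natVec m + root N g i := by
  induction i using vertices_cases with
  | h0 => rw [eMap, onVertices_zero, natVec_add, natVec_nsmul, natVec_unitVec, root,
      onVertices_zero]
  | hm r =>
    rw [eDeg, eSite, onVertices_mid, onVertices_mid] at h
    rw [eMap, onVertices_mid, natVec_add, natVec_sub (unitVec_le (by omega)), natVec_unitVec,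
      natVec_unitVec, root, onVertices_mid]
    abel
  | hl =>
    rw [eDeg, eSite, onVertices_last, onVertices_last] at h
    rw [eMap, onVertices_last, natVec_sub (nsmul_unitVec_le h), natVec_nsmul, natVec_unitVec, root,
      onVertices_last, sub_eq_add_neg]

theorem natVec_fMap (g : AffineType) (i : Fin (N + 2)) {m : Fin (N + 1) → ℕ}
    (h : fDeg N g i ≤ m (fSite N i)) : natVec (fMap N g i m) = natVec m - root N g i := by
  induction i using vertices_cases with
  | h0 =>
    rw [fDeg, fSite, onVertices_zero, onVertices_zero] at h
    rw [fMap, onVertices_zero, natVec_sub (nsmul_unitVec_le h), natVec_nsmul, natVec_unitVec, root,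
      onVertices_zero]
  | hm r =>
    rw [fDeg, fSite, onVertices_mid, onVertices_mid] at h
    rw [fMap, onVertices_mid, natVec_sub ((unitVec_le (by omega)).trans le_self_add), natVec_add,
      natVec_unitVec, natVec_unitVec, root, onVertices_mid]
    abel
  | hl => rw [fMap, onVertices_last, natVec_add, natVec_nsmul, natVec_unitVec, root,
      onVertices_last, sub_neg_eq_add]

theorem Lifts.apply_ket {n : ℕ} {A : Module.End E (Fock E n)} {c : (Fin n → ℤ) → E}
    {α : Fin n → ℤ} (hA : Lifts A (latOp c α)) {m m' : Fin n → ℕ}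
    (h : c (natVec m) ≠ 0 → natVec m' = natVec m + α) : A (ket E m) = c (natVec m) • ket E m' := by
  apply latExt_injective
  ext a
  rw [hA, latOp_apply, latExt_ket, map_smul, Pi.smul_apply, latExt_ket, smul_eq_mul]
  by_cases hc : c (natVec m) = 0
  · rw [hc, zero_mul]
    split_ifs with ha
    · rw [← ha, hc, zero_mul]
    · rw [mul_zero]
  · rw [h hc]
    by_cases ha : natVec m + α = a
    · rw [if_pos ha, if_pos (by rw [← ha, add_sub_cancel_right]), ← ha, add_sub_cancel_right]
    · rw [if_neg ha, if_neg (by rw [eq_sub_iff_add_eq]; exact ha), mul_zero, mul_zero]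

theorem qOscillator_e_ket (p im x : E) (g : AffineType) (i : Fin (N + 2)) (m : Fin (N + 1) → ℕ) :
    (qOscillator p im x N g).e i (ket E m) =
      eCoef p im x N g i (natVec m) • ket E (eMap N g i m) :=
  (lifts_e p im x N g i).apply_ket fun h =>
    natVec_eMap g i (le_of_qFall_ne_zero (right_ne_zero_of_mul h))

theorem qOscillator_f_ket (p im x : E) (g : AffineType) (i : Fin (N + 2)) (m : Fin (N + 1) → ℕ) :
    (qOscillator p im x N g).f i (ket E m) =
      fCoef p im x N g i (natVec m) • ket E (fMap N g i m) :=
  (lifts_f p im x N g i).apply_ket fun h => by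
    rw [natVec_fMap g i (le_of_qFall_ne_zero (right_ne_zero_of_mul h)), sub_eq_add_neg]

end Maps

/-! ### Vectors of V ⊗ V as functions on the lattice with values in an extension field -/

section Extension

variable {E K : Type*} [Field E] [Field K] [Algebra E K] {n : ℕ}

/-- The linear map on `V ⊗ V` with prescribed values on the basis. -/
def tensorExt {X : Type*} [AddCommGroup X] [Module E X] (T : (Fin n → ℕ) → (Fin n → ℕ) → X) :
    Fock E n ⊗[E] Fock E n →ₗ[E] X :=
  (Finsupp.linearCombination E fun m : (Fin n → ℕ) × (Fin n → ℕ) => T m.1 m.2) ∘ₗ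
    (finsuppTensorFinsupp' E (Fin n → ℕ) (Fin n → ℕ)).toLinearMap

theorem tensorExt_ket {X : Type*} [AddCommGroup X] [Module E X]
    (T : (Fin n → ℕ) → (Fin n → ℕ) → X) (i j : Fin n → ℕ) :
    tensorExt T (ket E i ⊗ₜ ket E j) = T i j := by
  rw [tensorExt, LinearMap.comp_apply, LinearEquiv.coe_coe, ket, ket,
    finsuppTensorFinsupp'_single_tmul_single, Finsupp.linearCombination_single, mul_one, one_smul]

theorem tensor_ext_ket {X : Type*} [AddCommGroup X] [Module E X]
    {A B : Fock E n ⊗[E] Fock E n →ₗ[E] X}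
    (h : ∀ i j, A (ket E i ⊗ₜ ket E j) = B (ket E i ⊗ₜ ket E j)) : A = B :=
  TensorProduct.ext (end_ext_ket fun i => end_ext_ket fun j => h i j)

variable (E K n)

/-- The coefficients of a vector of `V ⊗ V` in an extension field, as a function on the lattice. -/
def latExt₂ : Fock E n ⊗[E] Fock E n →ₗ[E] ((Fin n → ℤ) → (Fin n → ℤ) → K) :=
  TensorProduct.lift (LinearMap.mk₂ E
    (fun v w a b => algebraMap E K (latExt E n v a * latExt E n w b))
    (fun _ _ _ => by ext; simp [add_mul]) (fun _ _ _ => by ext; simp [mul_assoc, Algebra.smul_def])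
    (fun _ _ _ => by ext; simp [mul_add])
    (fun _ _ _ => by ext; simp [mul_left_comm, Algebra.smul_def]))

variable {E n}

theorem latExt₂_tmul (v w : Fock E n) (a b : Fin n → ℤ) :
    latExt₂ E K n (v ⊗ₜ w) a b = algebraMap E K (latExt E n v a * latExt E n w b) := rfl

theorem latExt₂_natVec (t : Fock E n ⊗[E] Fock E n) (a b : Fin n → ℕ) :
    latExt₂ E K n t (natVec a) (natVec b) =
      algebraMap E K (finsuppTensorFinsupp' E (Fin n → ℕ) (Fin n → ℕ) t (a, b)) := by
  induction t using TensorProduct.induction_on with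
  | zero => simp
  | tmul v w => rw [latExt₂_tmul, latExt_natVec, latExt_natVec, finsuppTensorFinsupp'_apply_apply]
  | add s t hs ht => rw [map_add, Pi.add_apply, Pi.add_apply, hs, ht, map_add, Finsupp.add_apply,
      map_add]

/-- Allows an element of V ⊗ V over E to be recovered from its coefficients in the larger field,
where the power series live. -/
theorem latExt₂_injective : Function.Injective (latExt₂ E K n) := fun s t h => by
  refine (finsuppTensorFinsupp' E (Fin n → ℕ) (Fin n → ℕ)).injective ?_
  ext ⟨a, b⟩
  exact (algebraMap E K).injective (by rw [← latExt₂_natVec, h, latExt₂_natVec])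

/-- The tensor product of two lattice operators, with coefficients in an extension field. -/
def latOp₂ (c : (Fin n → ℤ) → E) (α : Fin n → ℤ) (d : (Fin n → ℤ) → E) (β : Fin n → ℤ) :
    Module.End E ((Fin n → ℤ) → (Fin n → ℤ) → K) where
  toFun F a b := algebraMap E K (c (a - α) * d (b - β)) * F (a - α) (b - β)
  map_add' F G := by ext; simp [mul_add]
  map_smul' x F := by ext; simp

theorem latExt₂_map {A B : Module.End E (Fock E n)} {c d : (Fin n → ℤ) → E} {α β : Fin n → ℤ}
    (hA : Lifts A (latOp c α)) (hB : Lifts B (latOp d β)) (t : Fock E n ⊗[E] Fock E n) :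
    latExt₂ E K n (TensorProduct.map A B t) = latOp₂ K c α d β (latExt₂ E K n t) := by
  induction t using TensorProduct.induction_on with
  | zero => simp
  | tmul v w =>
    ext a b
    rw [TensorProduct.map_tmul, latExt₂_tmul, hA, hB, latOp_apply, latOp_apply]
    change _ = algebraMap E K (c (a - α) * d (b - β)) * latExt₂ E K n (v ⊗ₜ w) (a - α) (b - β)
    rw [latExt₂_tmul, ← map_mul]
    congr 1
    ring
  | add s t hs ht => rw [map_add, map_add, hs, ht, map_add, map_add]

variable (p im x y : E) {N : ℕ} (g : AffineType)

/-- The lattice version of `Δ'(e_r)`. -/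
def latE (r : Fin (N + 2)) : Module.End E ((Fin (N + 1) → ℤ) → (Fin (N + 1) → ℤ) → K) :=
  latOp₂ K (eCoef p im x N g r) (root N g r) (fun _ => 1) 0 +
    latOp₂ K (kCoef p im N g r) 0 (eCoef p im y N g r) (root N g r)

/-- The lattice version of `Δ'(f_r)`. -/
def latF (r : Fin (N + 2)) : Module.End E ((Fin (N + 1) → ℤ) → (Fin (N + 1) → ℤ) → K) :=
  latOp₂ K (fun _ => 1) 0 (fCoef p im y N g r) (-root N g r) +
    latOp₂ K (fCoef p im x N g r) (-root N g r) (fun m => (kCoef p im N g r m)⁻¹) 0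

variable {p im}

theorem lifts_one : Lifts (1 : Module.End E (Fock E n)) (latOp (fun _ => 1) 0) := by
  rw [latOp_one]
  exact Lifts.one

theorem lifts_k (h0 : p ≠ 0) (him : im ^ 2 = -1) (r : Fin (N + 2)) :
    Lifts ((qOscillator p im x N g).k r) (latOp (kCoef p im N g r) 0) := by
  rw [(qOscillator_k_apply h0 him x g r).1]
  exact lifts_ketOp_id fun _ => rfl

theorem lifts_kinv (h0 : p ≠ 0) (him : im ^ 2 = -1) (r : Fin (N + 2)) :
    Lifts ((qOscillator p im x N g).kinv r) (latOp (fun m => (kCoef p im N g r m)⁻¹) 0) := by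
  rw [(qOscillator_k_apply h0 him x g r).2]
  exact lifts_ketOp_id fun _ => rfl

theorem latExt₂_e (h0 : p ≠ 0) (him : im ^ 2 = -1) (r : Fin (N + 2))
    (t : Fock E (N + 1) ⊗[E] Fock E (N + 1)) :
    latExt₂ E K (N + 1) ((TensorProduct.map ((qOscillator p im x N g).e r) 1 +
      TensorProduct.map ((qOscillator p im x N g).k r) ((qOscillator p im y N g).e r) : Module.End E _) t) =
      latE K p im x y g r (latExt₂ E K (N + 1) t) := by
  rw [LinearMap.add_apply, map_add, latExt₂_map K (lifts_e p im x N g r) lifts_one,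
    latExt₂_map K (lifts_k x g h0 him r) (lifts_e p im y N g r)]
  rfl

theorem latExt₂_f (h0 : p ≠ 0) (him : im ^ 2 = -1) (r : Fin (N + 2))
    (t : Fock E (N + 1) ⊗[E] Fock E (N + 1)) :
    latExt₂ E K (N + 1) ((TensorProduct.map 1 ((qOscillator p im y N g).f r) +
      TensorProduct.map ((qOscillator p im x N g).f r) ((qOscillator p im y N g).kinv r) : Module.End E _) t) =
      latF K p im x y g r (latExt₂ E K (N + 1) t) := by
  rw [LinearMap.add_apply, map_add, latExt₂_map K lifts_one (lifts_f p im y N g r),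
    latExt₂_map K (lifts_f p im x N g r) (lifts_kinv y g h0 him r)]
  rfl

end Extension

/-! ### Compatibility of the coefficients with field homomorphisms -/

section MapCoef

variable {E K : Type*} [Field E] [Field K] (φ : E →+* K) (p im x : E) {N : ℕ} (g : AffineType)

theorem map_qInt (b : E) (m : ℤ) : φ (qInt b m) = qInt (φ b) m := by
  simp [qInt, map_div₀, map_zpow₀, map_inv₀]

theorem map_qFall (b : E) (k : ℕ) (y : ℤ) : φ (qFall b k y) = qFall (φ b) k y := by
  simp [qFall, map_qInt]

theorem map_lowScale (k : ℕ) : φ (lowScale p im k) = lowScale (φ p) (φ im) k := by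
  unfold lowScale
  split_ifs <;> simp [map_qInt]

theorem map_eCoef (r : Fin (N + 2)) (m : Fin (N + 1) → ℤ) :
    φ (eCoef p im x N g r m) = eCoef (φ p) (φ im) (φ x) N g r m := by
  rw [eCoef, eCoef, map_mul, map_qFall, map_pow]
  congr 1
  induction r using vertices_cases with
  | h0 => simp [eScale, onVertices_zero]
  | hm r => simp [eScale, onVertices_mid]
  | hl => simp [eScale, onVertices_last, map_lowScale]

theorem map_fCoef (r : Fin (N + 2)) (m : Fin (N + 1) → ℤ) :
    φ (fCoef p im x N g r m) = fCoef (φ p) (φ im) (φ x) N g r m := by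
  rw [fCoef, fCoef, map_mul, map_qFall, map_pow]
  congr 1
  induction r using vertices_cases with
  | h0 => simp [fScale, onVertices_zero, map_lowScale]
  | hm r => simp [fScale, onVertices_mid]
  | hl => simp [fScale, onVertices_last]

theorem map_kCoef (r : Fin (N + 2)) (m : Fin (N + 1) → ℤ) :
    φ (kCoef p im N g r m) = kCoef (φ p) (φ im) N g r m := by
  simp [kCoef, map_prod, map_zpow₀]

end MapCoef

/-! ### The intertwining relations for matrix elements -/

section Gauged

variable {𝕜 K : Type*} [NormedField 𝕜] [Field K] {N : ℕ} {q : 𝕜} (ι : PowerSeries 𝕜 →+* K)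

/-- The matrix elements of the inverse gauge transform of the solution. -/
def gaugedSol (q : 𝕜) (g : AffineType) (γ : K) {n : ℕ} (a b : Fin n → ℤ) (i j : Fin n → ℕ) : K :=
  γ ^ (∑ r, a r - ∑ r, natVec j r) * solK ι q g a b i j

theorem sum_add_zvec {n : ℕ} (a : Fin n → ℤ) (k : ℕ) (r : Fin n) :
    ∑ s, (a + k • zvec r) s = ∑ s, a s + k := by
  simp [Finset.sum_add_distrib, zvec, ← Finset.mul_sum]

theorem add_nsmul_zvec_apply {n : ℕ} (a : Fin n → ℤ) (k : ℕ) (r : Fin n) :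
    (a + k • zvec r) r = a r + k := by
  rw [Pi.add_apply, Pi.smul_apply, zvec_same, nsmul_eq_mul, mul_one]

theorem sum_sub_zvec {n : ℕ} (a : Fin n → ℤ) (k : ℕ) (r : Fin n) :
    ∑ s, (a - k • zvec r) s = ∑ s, a s - k := by
  simp [zvec, ← Finset.mul_sum]

theorem sum_add_sub_zvec {n : ℕ} (a : Fin n → ℤ) (r r' : Fin n) :
    ∑ s, (a + zvec r - zvec r') s = ∑ s, a s := by
  simp [Finset.sum_add_distrib, zvec]

theorem sum_sub_add_zvec {n : ℕ} (a : Fin n → ℤ) (r r' : Fin n) :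
    ∑ s, (a - zvec r + zvec r') s = ∑ s, a s := by
  simp [Finset.sum_add_distrib, zvec]

variable {P I X Y : K} (g : AffineType)

/-- The reason for the gauge transformation: γ = -i q^{1/2} has γ² = -q. This turns the factors
-q·q^a of the chain relations into the eigenvalues γ q^a from which the k_r are built. -/
theorem neg_mul_sq_of (hI : I ^ 2 = -1) : -I * P * (-I * P) = -P ^ 2 := by
  linear_combination P ^ 2 * hI

theorem inv_gauge_mul_pow {γ c : K} (hγ : γ ≠ 0) (hγ2 : γ * γ = -c) (x : K) (k : ℕ) :
    ((γ * x) ^ k)⁻¹ = γ ^ k * ((-(c * x)) ^ k)⁻¹ := by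
  rw [← neg_mul, ← hγ2, mul_assoc, mul_pow γ (γ * x), mul_inv,
    mul_inv_cancel_left₀ (pow_ne_zero _ hγ)]

/-- This is the matrix element of Δ'(e_r) R = R Δ(e_r). The vertex 0 uses raising at the first site,
an inner vertex the relation between neighbours, the vertex n lowering at the last site; the powers
of γ account for the change of |a| - |j|. -/
theorem gaugedSol_e (h0 : q ≠ 0) (hq : ∀ m : ℕ, m ≠ 0 → q ^ m ≠ 1) (hI : I ^ 2 = -1) (hP : P ≠ 0)
    (hQ : ι (PowerSeries.C q) = P ^ 2) (hX : X = ι PowerSeries.X * Y) (r : Fin (N + 2))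
    (a b : Fin (N + 1) → ℤ) (i j : Fin (N + 1) → ℕ) :
    eCoef P I X N g r (a - root N g r) * gaugedSol ι q g (-I * P) (a - root N g r) b i j +
      kCoef P I N g r a * (eCoef P I Y N g r (b - root N g r) *
        gaugedSol ι q g (-I * P) a (b - root N g r) i j) =
    eCoef P I Y N g r (natVec j) * gaugedSol ι q g (-I * P) a b i (eMap N g r j) +
      eCoef P I X N g r (natVec i) * (kCoef P I N g r (natVec j) *
        gaugedSol ι q g (-I * P) a b (eMap N g r i) j) := by
  have hγ : -I * P ≠ 0 := mul_ne_zero (neg_ne_zero.2 (im_ne_zero hI)) hP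
  have hγ2 := neg_mul_sq_of (P := P) hI
  simp only [gaugedSol]
  induction r using vertices_cases with
  | h0 =>
    have h := solK_raise_first ι h0 hq g hQ a b i j
    simp only [eCoef, eScale, eDeg, onVertices_zero, qFall_zero, mul_one, root, eMap, kCoef_zero,
      sum_sub_zvec, natVec_add, natVec_nsmul, natVec_unitVec, sum_add_zvec]
    generalize -I * P = γ at *
    have e (x : K) : (γ * x) ^ leftExp g * γ ^ leftExp g = (-(P ^ 2 * x)) ^ leftExp g := by
      rw [← mul_pow, mul_right_comm, hγ2, neg_mul]
    have e' : γ ^ (∑ r, a r - ∑ r, natVec j r) =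
        γ ^ leftExp g * γ ^ (∑ r, a r - leftExp g - ∑ r, natVec j r) := by
      rw [← zpow_natCast γ, ← zpow_add₀ hγ]
      congr 1
      ring
    rw [sub_add_eq_sub_sub, sub_right_comm _ _ (leftExp g : ℤ), e', hX]
    have e₁ := e ((P ^ 2) ^ a 0)
    have e₂ := e ((P ^ 2) ^ natVec j 0)
    rw [show natVec j 0 = (j 0 : ℤ) from rfl] at *
    linear_combination (Y * γ ^ (∑ r, a r - leftExp g - ∑ r, natVec j r)) * h +
      Y * γ ^ (∑ r, a r - leftExp g - ∑ r, natVec j r) *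
        solK ι q g a (b - leftExp g • zvec 0) i j * e₁ -
      ι PowerSeries.X * Y * γ ^ (∑ r, a r - leftExp g - ∑ r, natVec j r) *
        solK ι q g a b (i + leftExp g • unitVec 0) j * e₂
  | hm r =>
    have h := solK_mid_right ι h0 hq g hQ r a b i j
    have hs : ∑ s, (a - (zvec r.succ - zvec r.castSucc)) s = ∑ s, a s := by
      rw [sub_sub_eq_add_sub, sum_add_sub_zvec]
    -- Moving a quantum keeps |j|, hence the gauge factor, but only if a quantum is present;
    -- otherwise both sides are zero.
    have hj : qFall (P ^ 2) 1 (j r.castSucc) * ((-I * P) ^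
        (∑ s, a s - ∑ s, natVec (j - unitVec r.castSucc + unitVec r.succ) s) *
        solK ι q g a b i (j - unitVec r.castSucc + unitVec r.succ)) =
        qFall (P ^ 2) 1 (j r.castSucc) * ((-I * P) ^ (∑ s, a s - ∑ s, natVec j s) *
          solK ι q g a b i (j - unitVec r.castSucc + unitVec r.succ)) := by
      refine mul_eq_mul_of_imp fun hk => ?_
      have hk := le_of_qFall_ne_zero hk
      rw [natVec_add, natVec_sub (unitVec_le (by omega)), natVec_unitVec, natVec_unitVec,
        sum_sub_add_zvec]
    have hne : r.castSucc ≠ r.succ := r.castSucc_lt_succ.ne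
    simp only [eCoef, eScale, eDeg, eSite, onVertices_mid, one_mul, root, eMap, kCoef_mid hP hI, hs]
    rw [show natVec j r.castSucc = (j r.castSucc : ℤ) from rfl, hj]
    simp only [Pi.sub_apply, zvec_same, zvec_of_ne hne, zero_sub, sub_neg_eq_add, natVec, ← sub_add,
      sub_add_eq_add_sub]
    linear_combination (-I * P) ^ (∑ s, a s - ∑ s, (j s : ℤ)) * h
  | hl =>
    have h := solK_lower_last ι h0 hq g hQ a b i j
    have hj : qFall (P ^ 2) (rightExp g) (j (Fin.last N)) * ((-I * P) ^
        (∑ s, a s - ∑ s, natVec (j - rightExp g • unitVec (Fin.last N)) s) *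
        solK ι q g a b i (j - rightExp g • unitVec (Fin.last N))) =
        qFall (P ^ 2) (rightExp g) (j (Fin.last N)) * ((-I * P) ^
          (∑ s, a s - ∑ s, natVec j s + rightExp g) *
          solK ι q g a b i (j - rightExp g • unitVec (Fin.last N))) := by
      refine mul_eq_mul_of_imp fun hk => ?_
      have hk := le_of_qFall_ne_zero hk
      rw [natVec_sub (nsmul_unitVec_le hk), natVec_nsmul, natVec_unitVec, sum_sub_zvec, sub_sub_eq_add_sub,
        sub_add_eq_add_sub]
    simp only [eCoef, eScale, eDeg, eSite, onVertices_last, root, eMap, kCoef_last]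
    rw [mul_assoc _ _ (_ * solK ι q g a b i (j - _)), show natVec j (Fin.last N) = (j (Fin.last N) : ℤ) from rfl,
      show natVec i (Fin.last N) = (i (Fin.last N) : ℤ) from rfl, hj]
    simp only [sub_neg_eq_add, sum_add_zvec, add_nsmul_zvec_apply, inv_gauge_mul_pow hγ hγ2]
    rw [← sub_add_eq_add_sub, zpow_add₀ hγ _ (rightExp g : ℤ), zpow_natCast _ (rightExp g),
      zpow_natCast _ (j (Fin.last N))]
    linear_combination lowScale P I (rightExp g) * (-I * P) ^ (∑ s, a s - ∑ s, natVec j s) *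
      (-I * P) ^ rightExp g * h

/-- Dual to the case of e_r: lowering at the first site for r = 0, raising at the last site for r =
n. The ratio of the two spectral parameters supplies the factor z at vertex 0. -/
theorem gaugedSol_f (h0 : q ≠ 0) (hq : ∀ m : ℕ, m ≠ 0 → q ^ m ≠ 1) (hI : I ^ 2 = -1) (hP : P ≠ 0)
    (hQ : ι (PowerSeries.C q) = P ^ 2) (hX : X = ι PowerSeries.X * Y) (hX0 : X ≠ 0)
    (r : Fin (N + 2)) (a b : Fin (N + 1) → ℤ) (i j : Fin (N + 1) → ℕ) :
    fCoef P I Y N g r (b + root N g r) * gaugedSol ι q g (-I * P) a (b + root N g r) i j +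
      fCoef P I X N g r (a + root N g r) * ((kCoef P I N g r b)⁻¹ *
        gaugedSol ι q g (-I * P) (a + root N g r) b i j) =
    fCoef P I X N g r (natVec i) * gaugedSol ι q g (-I * P) a b (fMap N g r i) j +
      (kCoef P I N g r (natVec i))⁻¹ * (fCoef P I Y N g r (natVec j) *
        gaugedSol ι q g (-I * P) a b i (fMap N g r j)) := by
  have hγ : -I * P ≠ 0 := mul_ne_zero (neg_ne_zero.2 (im_ne_zero hI)) hP
  have hγ2 := neg_mul_sq_of (P := P) hI
  simp only [gaugedSol]
  induction r using vertices_cases with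
  | h0 =>
    have h := solK_lower_first ι h0 hq g hQ a b i j
    have hj : qFall (P ^ 2) (leftExp g) (j 0) * ((-I * P) ^
        (∑ s, a s - ∑ s, natVec (j - leftExp g • unitVec 0) s) *
        solK ι q g a b i (j - leftExp g • unitVec 0)) =
        qFall (P ^ 2) (leftExp g) (j 0) * ((-I * P) ^
          (∑ s, a s - ∑ s, natVec j s + leftExp g) *
          solK ι q g a b i (j - leftExp g • unitVec 0)) := by
      refine mul_eq_mul_of_imp fun hk => ?_
      have hk := le_of_qFall_ne_zero hk
      rw [natVec_sub (nsmul_unitVec_le hk), natVec_nsmul, natVec_unitVec, sum_sub_zvec,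
        sub_sub_eq_add_sub, sub_add_eq_add_sub]
    simp only [fCoef, fScale, fDeg, fSite, onVertices_zero, root, fMap, kCoef_zero]
    rw [mul_assoc _ _ (_ * solK ι q g a b i (j - _)), show natVec j 0 = (j 0 : ℤ) from rfl,
      show natVec i 0 = (i 0 : ℤ) from rfl, hj]
    simp only [sum_add_zvec, add_nsmul_zvec_apply, mul_pow (-I * P), mul_inv]
    rw [← sub_add_eq_add_sub, zpow_add₀ hγ _ (leftExp g : ℤ), zpow_natCast _ (leftExp g),
      zpow_natCast _ (i 0)]
    have hZ : ι PowerSeries.X ≠ 0 := left_ne_zero_of_mul (hX ▸ hX0)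
    have hc := mul_inv_cancel₀ (pow_ne_zero (leftExp g) hγ)
    have hY : Y⁻¹ = ι PowerSeries.X * X⁻¹ := by
      rw [hX, mul_inv, mul_inv_cancel_left₀ hZ]
    rw [hY]
    generalize -I * P = γ at *
    generalize γ ^ (∑ r, a r - ∑ r, natVec j r) = G
    generalize γ ^ leftExp g = c at *
    linear_combination lowScale P I (leftExp g) * X⁻¹ * G * h +
      lowScale P I (leftExp g) * X⁻¹ * G *
        ((((P ^ 2) ^ b 0) ^ leftExp g)⁻¹ * qFall (P ^ 2) (leftExp g) (a 0 + leftExp g) *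
            solK ι q g (a + leftExp g • zvec 0) b i j -
          (((P ^ 2) ^ i 0) ^ leftExp g)⁻¹ * ι PowerSeries.X * qFall (P ^ 2) (leftExp g) (j 0) *
            solK ι q g a b i (j - leftExp g • unitVec 0)) * hc
  | hm r =>
    have h := solK_mid_left ι h0 hq g hQ r a b i j
    have hs : ∑ s, (a + (zvec r.succ - zvec r.castSucc)) s = ∑ s, a s := by
      rw [← add_sub_assoc, sum_add_sub_zvec]
    have hj : qFall (P ^ 2) 1 (j r.succ) * ((-I * P) ^
        (∑ s, a s - ∑ s, natVec (j + unitVec r.castSucc - unitVec r.succ) s) *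
        solK ι q g a b i (j + unitVec r.castSucc - unitVec r.succ)) =
        qFall (P ^ 2) 1 (j r.succ) * ((-I * P) ^ (∑ s, a s - ∑ s, natVec j s) *
          solK ι q g a b i (j + unitVec r.castSucc - unitVec r.succ)) := by
      refine mul_eq_mul_of_imp fun hk => ?_
      have hk := le_of_qFall_ne_zero hk
      rw [natVec_sub ((unitVec_le (by omega)).trans le_self_add), natVec_add, natVec_unitVec,
        natVec_unitVec, sum_add_sub_zvec]
    have hne : r.succ ≠ r.castSucc := r.castSucc_lt_succ.ne'
    simp only [fCoef, fScale, fDeg, fSite, onVertices_mid, one_mul, root, fMap, kCoef_mid hP hI, hs]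
    rw [show natVec j r.succ = (j r.succ : ℤ) from rfl, hj]
    simp only [Pi.add_apply, Pi.sub_apply, zvec_same, zvec_of_ne hne, sub_zero, natVec, ← zpow_neg,
      neg_add, neg_neg, ← add_sub_assoc]
    simp only [sub_add_eq_add_sub, add_comm _ ((b r.castSucc)), add_comm _ (i r.castSucc : ℤ)] at h ⊢
    linear_combination (-I * P) ^ (∑ s, a s - ∑ s, (j s : ℤ)) * h
  | hl =>
    have h := solK_raise_last ι h0 hq g hQ a b i j
    simp only [fCoef, fScale, fDeg, onVertices_last, qFall_zero, mul_one, root, fMap, kCoef_last,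
      natVec_add, natVec_nsmul, natVec_unitVec, sum_add_zvec, ← sub_eq_add_neg, sum_sub_zvec,
      inv_inv, mul_pow (-I * P)]
    rw [sub_add_eq_sub_sub, sub_right_comm _ _ (rightExp g : ℤ)]
    have e' : (-I * P) ^ (∑ r, a r - ∑ r, natVec j r) =
        (-I * P) ^ rightExp g * (-I * P) ^ (∑ r, a r - rightExp g - ∑ r, natVec j r) := by
      rw [← zpow_natCast (-I * P) (rightExp g), ← zpow_add₀ hγ]
      congr 1
      ring
    rw [e', show natVec i (Fin.last N) = (i (Fin.last N) : ℤ) from rfl]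
    linear_combination (-I * P) ^ rightExp g *
      (-I * P) ^ (∑ r, a r - rightExp g - ∑ r, natVec j r) * h

end Gauged

/-! ### Support of the solution -/

section Weight

theorem bareZ_of_neg {𝕜 : Type*} [Field 𝕜] (q : 𝕜) (s t : ℕ) {n : ℕ} {a b : Fin n → ℤ}
    {i j : Fin n → ℕ} (r : Fin n) (h : a r < 0 ∨ b r < 0) : bareZ q s t a b i j = 0 := by
  have : siteProd q a b i j = 0 := List.prod_eq_zero ((List.mem_ofFn' _ _).2 ⟨r, by
    ext v c
    simp [site, tdr_of_neg h]⟩)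
  rw [bareZ, this, LinearMap.zero_apply, map_zero]

variable {𝕜 K : Type*} [NormedField 𝕜] [Field K] {q : 𝕜} (ι : PowerSeries 𝕜 →+* K) {γ : K}
  {g : AffineType} {n : ℕ} {a b : Fin n → ℤ} {i j : Fin n → ℕ}

theorem nonneg_of_gaugedSol_ne_zero (h : gaugedSol ι q g γ a b i j ≠ 0) (r : Fin n) :
    0 ≤ a r ∧ 0 ≤ b r := by
  by_contra hr
  refine h ?_
  rw [gaugedSol, solK, solZ, bareZ_of_neg q _ _ r (by omega), mul_zero, map_zero, mul_zero]

theorem weight_of_gaugedSol_ne_zero (h0 : q ≠ 0) (hq : ∀ m : ℕ, m ≠ 0 → q ^ m ≠ 1)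
    (h : gaugedSol ι q g γ a b i j ≠ 0) : a + b = natVec i + natVec j := by
  ext r
  by_contra hr
  exact h (by rw [gaugedSol, solK_weight ι h0 hq g r hr, mul_zero])

theorem parity_of_gaugedSol_ne_zero (h : gaugedSol ι q .C1 γ a b i j ≠ 0) :
    (2 : ℤ) ∣ ∑ r, (b r - j r) := by
  by_contra hr
  exact h (by rw [gaugedSol, solK_C1_parity ι a b i j hr, mul_zero])

end Weight

/-! ### Matrix elements, parity sectors and the gauge transformation -/

section Coefficients

variable {E K : Type*} [Field E] [Field K] [Algebra E K] {n : ℕ}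

theorem entry_eq (R : Module.End E (Fock E n ⊗[E] Fock E n)) (a b i j : Fin n → ℕ) :
    algebraMap E K (entry R a b i j) =
      latExt₂ E K n (R (ket E i ⊗ₜ ket E j)) (natVec a) (natVec b) := by
  rw [latExt₂_natVec, entry]

theorem latExt₂_ket (i j : Fin n → ℕ) (a b : Fin n → ℤ) :
    latExt₂ E K n (ket E i ⊗ₜ ket E j) a b = if natVec i = a ∧ natVec j = b then 1 else 0 := by
  rw [latExt₂_tmul, latExt_ket, latExt_ket]
  split_ifs <;> simp_all

theorem mem_sector_of {ε₁ ε₂ : ℤˣ} {t : Fock E n ⊗[E] Fock E n}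
    (h : ∀ a b, finsuppTensorFinsupp' E (Fin n → ℕ) (Fin n → ℕ) t (a, b) ≠ 0 →
      parity a = ε₁ ∧ parity b = ε₂) : t ∈ sector E n ε₁ ε₂ := by
  set e := finsuppTensorFinsupp' E (Fin n → ℕ) (Fin n → ℕ)
  have : t = (e t).sum fun m x => x • (ket E m.1 ⊗ₜ[E] ket E m.2) := by
    apply e.injective
    rw [map_finsuppSum]
    conv_lhs => rw [← Finsupp.sum_single (e t)]
    refine Finset.sum_congr rfl fun m _ => ?_
    dsimp only
    rw [map_smul, ket, ket, finsuppTensorFinsupp'_single_tmul_single]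
    simp
  rw [this]
  refine Submodule.sum_mem _ fun m hm => Submodule.smul_mem _ _ (Submodule.subset_span ?_)
  obtain ⟨h1, h2⟩ := h m.1 m.2 (Finsupp.mem_support_iff.1 hm)
  exact ⟨m.1, m.2, h1, h2, rfl⟩

theorem gaugeTransform_entry (p im : E) (R : Module.End E (Fock E n ⊗[E] Fock E n))
    (a b i j : Fin n → ℕ) : entry (gaugeTransform p im R) a b i j =
      ((-im * p) ^ ∑ r, a r)⁻¹ * (-im * p) ^ (∑ r, j r) * entry R a b i j := by
  have h (t : Fock E n ⊗[E] Fock E n) (γ : E) : finsuppTensorFinsupp' E (Fin n → ℕ) (Fin n → ℕ)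
      (TensorProduct.map (gaugeK γ n) 1 t) (a, b) = γ ^ (∑ r, a r) *
        finsuppTensorFinsupp' E (Fin n → ℕ) (Fin n → ℕ) t (a, b) := by
    suffices (Finsupp.lapply (a, b) ∘ₗ
        (finsuppTensorFinsupp' E (Fin n → ℕ) (Fin n → ℕ)).toLinearMap) ∘ₗ
        TensorProduct.map (gaugeK γ n) 1 = γ ^ (∑ r, a r) • (Finsupp.lapply (a, b) ∘ₗ
        (finsuppTensorFinsupp' E (Fin n → ℕ) (Fin n → ℕ)).toLinearMap) from
      LinearMap.congr_fun this t
    refine tensor_ext_ket fun i j => ?_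
    simp only [LinearMap.comp_apply, LinearMap.smul_apply, TensorProduct.map_tmul, gaugeK,
      ketOp_ket, ← TensorProduct.smul_tmul', map_smul, id_eq, Module.End.one_apply, smul_eq_mul,
      LinearEquiv.coe_coe, Finsupp.lapply_apply]
    rw [ket, ket, finsuppTensorFinsupp'_single_tmul_single, Finsupp.single_apply]
    split_ifs with hab
    · rw [Prod.mk.injEq] at hab
      rw [hab.1]
    · rw [mul_zero, mul_zero]
  rw [entry, gaugeTransform, Module.End.mul_apply, Module.End.mul_apply, h, TensorProduct.map_tmul,
    gaugeK, ketOp_ket, Module.End.one_apply, id, TensorProduct.tmul_smul, map_smul, map_smul,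
    Finsupp.smul_apply, smul_eq_mul, inv_pow, mul_assoc, entry]

/-- The eigenvalue of k_r ⊗ k_r depends only on the sum of the two multi-indices, so weight
conservation implies commutation with k_r ⊗ k_r. -/
theorem kCoef_mul_kCoef {p im : E} (h0 : p ≠ 0) {N : ℕ} (g : AffineType) (r : Fin (N + 2))
    {a b c d : Fin (N + 1) → ℤ} (h : a + b = c + d) :
    kCoef p im N g r a * kCoef p im N g r b = kCoef p im N g r c * kCoef p im N g r d := by
  have hq : p ^ 2 ≠ 0 := pow_ne_zero _ h0
  simp only [kCoef, ← Finset.prod_mul_distrib, ← mul_zpow]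
  refine Finset.prod_congr rfl fun s _ => ?_
  have : (p ^ 2) ^ a s * (p ^ 2) ^ b s = (p ^ 2) ^ c s * (p ^ 2) ^ d s := by
    rw [← zpow_add₀ hq, ← zpow_add₀ hq, show a s + b s = c s + d s from congrFun h s]
  congr 1
  linear_combination (-im * p) ^ 2 * this

end Coefficients

/-! ### The solution as an intertwining map into functions on the lattice -/

section Solution

variable {𝕜 E K : Type*} [NormedField 𝕜] [Field E] [Field K] [Algebra E K] {N : ℕ} {q : 𝕜}
  (ι : PowerSeries 𝕜 →+* K) {p im z : E} (g : AffineType)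

/-- The vectors with the matrix elements of the solution, as functions on the lattice. -/
def solExt (E : Type*) [Field E] [Algebra E K] (q : 𝕜) (γ : K) (n : ℕ) :
    Fock E n ⊗[E] Fock E n →ₗ[E] ((Fin n → ℤ) → (Fin n → ℤ) → K) :=
  tensorExt fun i j a b => gaugedSol ι q g γ a b i j

theorem solExt_ket (γ : K) {n : ℕ} (i j : Fin n → ℕ) (a b : Fin n → ℤ) :
    solExt ι g E q γ n (ket E i ⊗ₜ ket E j) a b = gaugedSol ι q g γ a b i j := by
  rw [solExt, tensorExt_ket]

theorem latE_apply (x y : E) (r : Fin (N + 2)) (F : (Fin (N + 1) → ℤ) → (Fin (N + 1) → ℤ) → K)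
    (a b : Fin (N + 1) → ℤ) : latE K p im x y g r F a b =
      algebraMap E K (eCoef p im x N g r (a - root N g r) * 1) * F (a - root N g r) (b - 0) +
      algebraMap E K (kCoef p im N g r (a - 0) * eCoef p im y N g r (b - root N g r)) *
        F (a - 0) (b - root N g r) := rfl

theorem latF_apply (x y : E) (r : Fin (N + 2)) (F : (Fin (N + 1) → ℤ) → (Fin (N + 1) → ℤ) → K)
    (a b : Fin (N + 1) → ℤ) : latF K p im x y g r F a b =
      algebraMap E K (1 * fCoef p im y N g r (b - -root N g r)) * F (a - 0) (b - -root N g r) +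
      algebraMap E K (fCoef p im x N g r (a - -root N g r) * (kCoef p im N g r (b - 0))⁻¹) *
        F (a - -root N g r) (b - 0) := rfl

/-- The relation holds for every pair x = z y, while generation by the vacua is needed later only
for one such pair. -/
theorem solExt_e (h0 : q ≠ 0) (hq : ∀ m : ℕ, m ≠ 0 → q ^ m ≠ 1) (hp : p ≠ 0) (him : im ^ 2 = -1)
    (hQ : ι (PowerSeries.C q) = algebraMap E K p ^ 2) (hz : algebraMap E K z = ι PowerSeries.X)
    {x y : E} (hx : x = z * y) (r : Fin (N + 2)) (t : Fock E (N + 1) ⊗[E] Fock E (N + 1)) :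
    solExt ι g E q (algebraMap E K (-im * p)) (N + 1)
      ((TensorProduct.map 1 ((qOscillator p im y N g).e r) +
        TensorProduct.map ((qOscillator p im x N g).e r) ((qOscillator p im y N g).k r) :
          Module.End E _) t) =
      latE K p im x y g r (solExt ι g E q (algebraMap E K (-im * p)) (N + 1) t) := by
  have hI : algebraMap E K im ^ 2 = -1 := by rw [← map_pow, him, map_neg, map_one]
  have hP : algebraMap E K p ≠ 0 := (map_ne_zero _).2 hp
  have hX : algebraMap E K x = ι PowerSeries.X * algebraMap E K y := by rw [hx, map_mul, hz]
  suffices solExt ι g E q (algebraMap E K (-im * p)) (N + 1) ∘ₗ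
      (TensorProduct.map 1 ((qOscillator p im y N g).e r) +
        TensorProduct.map ((qOscillator p im x N g).e r) ((qOscillator p im y N g).k r)) =
      latE K p im x y g r ∘ₗ solExt ι g E q (algebraMap E K (-im * p)) (N + 1) from
    LinearMap.congr_fun this t
  refine tensor_ext_ket fun i j => ?_
  ext a b
  rw [LinearMap.comp_apply, LinearMap.add_apply, TensorProduct.map_tmul, TensorProduct.map_tmul,
    Module.End.one_apply, (qOscillator_k_apply hp him y g r).1, ketOp_ket, qOscillator_e_ket,
    qOscillator_e_ket, TensorProduct.tmul_smul, TensorProduct.tmul_smul,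
    ← TensorProduct.smul_tmul', map_add, map_smul, map_smul, map_smul]
  have h := gaugedSol_e ι g h0 hq hI hP hQ hX r a b i j
  simp only [← map_eCoef, ← map_kCoef, ← map_neg, ← map_mul] at h
  simp only [Pi.add_apply, Pi.smul_apply, solExt_ket] at h ⊢
  simp only [LinearMap.comp_apply, latE_apply, solExt_ket, Algebra.smul_def, id_eq, sub_zero,
    map_mul, mul_one] at h ⊢
  linear_combination -h

theorem solExt_f (h0 : q ≠ 0) (hq : ∀ m : ℕ, m ≠ 0 → q ^ m ≠ 1) (hp : p ≠ 0) (him : im ^ 2 = -1)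
    (hQ : ι (PowerSeries.C q) = algebraMap E K p ^ 2) (hz : algebraMap E K z = ι PowerSeries.X)
    {x y : E} (hx : x = z * y) (hx0 : x ≠ 0) (r : Fin (N + 2))
    (t : Fock E (N + 1) ⊗[E] Fock E (N + 1)) :
    solExt ι g E q (algebraMap E K (-im * p)) (N + 1)
      ((TensorProduct.map ((qOscillator p im x N g).f r) 1 +
        TensorProduct.map ((qOscillator p im x N g).kinv r) ((qOscillator p im y N g).f r) :
          Module.End E _) t) =
      latF K p im x y g r (solExt ι g E q (algebraMap E K (-im * p)) (N + 1) t) := by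
  have hI : algebraMap E K im ^ 2 = -1 := by rw [← map_pow, him, map_neg, map_one]
  have hP : algebraMap E K p ≠ 0 := (map_ne_zero _).2 hp
  have hX : algebraMap E K x = ι PowerSeries.X * algebraMap E K y := by rw [hx, map_mul, hz]
  have hX0 : algebraMap E K x ≠ 0 := (map_ne_zero _).2 hx0
  suffices solExt ι g E q (algebraMap E K (-im * p)) (N + 1) ∘ₗ
      (TensorProduct.map ((qOscillator p im x N g).f r) 1 +
        TensorProduct.map ((qOscillator p im x N g).kinv r) ((qOscillator p im y N g).f r)) =
      latF K p im x y g r ∘ₗ solExt ι g E q (algebraMap E K (-im * p)) (N + 1) from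
    LinearMap.congr_fun this t
  refine tensor_ext_ket fun i j => ?_
  ext a b
  rw [LinearMap.comp_apply, LinearMap.add_apply, TensorProduct.map_tmul, TensorProduct.map_tmul,
    Module.End.one_apply, (qOscillator_k_apply hp him x g r).2, ketOp_ket, qOscillator_f_ket,
    qOscillator_f_ket, TensorProduct.tmul_smul, ← TensorProduct.smul_tmul',
    ← TensorProduct.smul_tmul', map_add, map_smul, map_smul, map_smul]
  have h := gaugedSol_f ι g h0 hq hI hP hQ hX hX0 r a b i j
  simp only [← map_fCoef, ← map_kCoef, ← map_neg, ← map_mul] at h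
  simp only [Pi.add_apply, Pi.smul_apply, solExt_ket] at h ⊢
  simp only [LinearMap.comp_apply, latF_apply, solExt_ket, Algebra.smul_def, id_eq, sub_zero,
    map_mul, one_mul, map_inv₀, sub_neg_eq_add] at h ⊢
  linear_combination -h

/-- The highest weight vectors `|i⟩ ⊗ |j⟩` on which the R matrix is normalized. -/
def IsVacuum {N : ℕ} (g : AffineType) (i j : Fin (N + 1) → ℕ) : Prop :=
  match g with
  | .C1 => (i = 0 ∨ i = unitVec 0) ∧ (j = 0 ∨ j = unitVec 0)
  | _ => i = 0 ∧ j = 0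

theorem IsVacuum.le_unitVec {i j : Fin (N + 1) → ℕ} (h : IsVacuum g i j) :
    i ≤ unitVec 0 ∧ j ≤ unitVec 0 := by
  cases g <;> obtain ⟨hi, hj⟩ := h
  · simp [hi, hj]
  · simp [hi, hj]
  · exact ⟨by rcases hi with rfl | rfl <;> simp, by rcases hj with rfl | rfl <;> simp⟩

/-- A vacuum has at most one quantum in each factor, both at the first site. Weight conservation
together with nonnegativity leaves the output a choice only between the factors, and in type
C^{(1)}_n the parity condition settles it. -/
theorem eq_of_isVacuum (h0 : q ≠ 0) (hq : ∀ m : ℕ, m ≠ 0 → q ^ m ≠ 1) {γ : K}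
    {i j : Fin (N + 1) → ℕ} (h : IsVacuum g i j) {a b : Fin (N + 1) → ℤ}
    (hab : gaugedSol ι q g γ a b i j ≠ 0) : natVec i = a ∧ natVec j = b := by
  have hw (r : Fin (N + 1)) : a r + b r = i r + j r :=
    congrFun (weight_of_gaugedSol_ne_zero ι h0 hq hab) r
  have hn := nonneg_of_gaugedSol_ne_zero ι hab
  obtain ⟨hi, hj⟩ := h.le_unitVec
  have hr (r : Fin (N + 1)) (h : r ≠ 0) : (i r = 0 ∧ j r = 0) ∧ a r = 0 ∧ b r = 0 := by
    have h1 : i r ≤ unitVec 0 r := hi r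
    have h2 : j r ≤ unitVec 0 r := hj r
    rw [unitVec_of_ne h] at h1 h2
    have := hw r
    have := hn r
    omega
  have h1 : i 0 ≤ unitVec 0 0 := hi 0
  have h2 : j 0 ≤ unitVec 0 0 := hj 0
  rw [unitVec_same] at h1 h2
  have h3 := hw 0
  have h4 := hn 0
  have h5 : b 0 = j 0 := by
    cases g
    · rw [h.2]
      simp [h.1, h.2] at h3 ⊢
      omega
    · rw [h.2]
      simp [h.1, h.2] at h3 ⊢
      omega
    · have h6 := parity_of_gaugedSol_ne_zero ι hab
      rw [Fin.sum_univ_succ, Finset.sum_eq_zero fun r _ => by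
        have := hr r.succ r.succ_ne_zero
        omega] at h6
      omega
  refine ⟨?_, ?_⟩ <;> ext r <;> by_cases h : r = 0
  · subst h
    rw [natVec]
    omega
  · have := hr r h
    rw [natVec]
    omega
  · subst h
    rw [natVec]
    omega
  · have := hr r h
    rw [natVec]
    omega

theorem solExt_vacuum (h0 : q ≠ 0) (hq : ∀ m : ℕ, m ≠ 0 → q ^ m ≠ 1) {γ : K}
    {i j : Fin (N + 1) → ℕ} (h : IsVacuum g i j) {c : E}
    (hc : gaugedSol ι q g γ (natVec i) (natVec j) i j = algebraMap E K c) :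
    solExt ι g E q γ (N + 1) (ket E i ⊗ₜ ket E j) =
      latExt₂ E K (N + 1) (c • (ket E i ⊗ₜ ket E j)) := by
  ext a b
  rw [solExt_ket, map_smul, Pi.smul_apply, Pi.smul_apply, latExt₂_ket]
  by_cases hab : gaugedSol ι q g γ a b i j = 0
  · rw [hab]
    split_ifs with h'
    · rw [← h'.1, ← h'.2, hc] at hab
      rw [(map_eq_zero _).1 hab, zero_smul]
    · rw [smul_zero]
  · have h' := eq_of_isVacuum ι g h0 hq h hab
    rw [if_pos h', ← h'.1, ← h'.2, hc, Algebra.smul_def, mul_one]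

/-- The eigenvalue of the R matrix on a highest weight vector. -/
def vacuumValue (p im z : E) (i j : Fin (N + 1) → ℕ) : E :=
  if i = 0 ∧ j = 0 then 1
  else if i = 0 ∨ j = 0 then -im * p / (1 - z)
  else (z - p ^ 4) / (1 - z * p ^ 4)

theorem gaugedSol_vacuum (h0 : q ≠ 0) (h1 : ‖q‖ < 1) (hq : ∀ m : ℕ, m ≠ 0 → q ^ m ≠ 1)
    (hp : p ≠ 0) (him : im ^ 2 = -1) (hQ : ι (PowerSeries.C q) = algebraMap E K p ^ 2)
    (hz : algebraMap E K z = ι PowerSeries.X) {i j : Fin (N + 1) → ℕ} (h : IsVacuum g i j) :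
    gaugedSol ι q g (algebraMap E K (-im * p)) (natVec i) (natVec j) i j =
      algebraMap E K (vacuumValue p im z i j) := by
  have hu : unitVec (0 : Fin (N + 1)) ≠ 0 := fun h => by
    simpa [unitVec_same] using congrFun h 0
  have hI : algebraMap E K im ^ 2 = -1 := by rw [← map_pow, him, map_neg, map_one]
  have hP : algebraMap E K p ≠ 0 := (map_ne_zero _).2 hp
  have hi0 := im_ne_zero hI
  -- Justifies dividing by 1 - z and 1 - q²z.
  have hunit (F : PowerSeries 𝕜) (hF : PowerSeries.constantCoeff F = 1) : ι F ≠ 0 :=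
    ((PowerSeries.isUnit_iff_constantCoeff.2 (hF ▸ isUnit_one)).map ι).ne_zero
  have hX := hunit (1 - PowerSeries.X) (by simp)
  have hX' := hunit (1 - PowerSeries.C (q ^ 2) * PowerSeries.X) (by simp)
  rw [gaugedSol, solK]
  have h00 (e : solZ q g (n := N + 1) (natVec 0) (natVec 0) 0 0 = 1) :
      algebraMap E K (-im * p) ^ (∑ r, natVec (0 : Fin (N + 1) → ℕ) r -
        ∑ r, natVec (0 : Fin (N + 1) → ℕ) r) * ι (solZ q g (n := N + 1) (natVec 0) (natVec 0) 0 0) =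
        algebraMap E K (vacuumValue p im z (0 : Fin (N + 1) → ℕ) 0) := by
    rw [e, sub_self, zpow_zero, map_one, one_mul, vacuumValue, if_pos ⟨rfl, rfl⟩, map_one]
  have hs : ∑ r, natVec (unitVec (0 : Fin (N + 1))) r = 1 := by
    simp [natVec, unitVec, Pi.single_apply]
  have hs0 : ∑ r, natVec (0 : Fin (N + 1) → ℕ) r = 0 := by simp [natVec]
  cases g
  · obtain ⟨rfl, rfl⟩ := h
    exact h00 (solZ_D2_vac h0 h1 hq N)
  · obtain ⟨rfl, rfl⟩ := h
    exact h00 (solZ_A2_vac h0 h1 hq N)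
  · obtain ⟨rfl | rfl, rfl | rfl⟩ := h
    · exact h00 (solZ_C1_vac h0 h1 hq N)
    · have e := congrArg ι (solZ_C1_zero_unit h0 h1 hq N)
      rw [map_mul] at e
      rw [hs, hs0, vacuumValue, if_neg (by simp [hu]), if_pos (.inl rfl), map_div₀, map_sub,
        map_one, hz, eq_div_iff (by simpa using hX)]
      simp only [map_sub, map_one, map_neg, hQ] at e
      simp only [zero_sub, zpow_neg, zpow_one, map_mul, map_neg]
      rw [mul_assoc, inv_mul_eq_iff_eq_mul₀ (mul_ne_zero (neg_ne_zero.2 hi0) hP)]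
      linear_combination e - algebraMap E K p ^ 2 * hI
    · have e := congrArg ι (solZ_C1_unit_zero h0 h1 hq N)
      rw [map_mul] at e
      rw [hs, hs0, vacuumValue, if_neg (by simp [hu]), if_pos (.inr rfl), map_div₀, map_sub,
        map_one, hz, eq_div_iff (by simpa using hX)]
      simp only [map_sub, map_one] at e
      simp only [sub_zero, zpow_one, map_mul, map_neg]
      linear_combination (-algebraMap E K im * algebraMap E K p) * e
    · have e := congrArg ι (solZ_C1_unit_unit h0 h1 hq N)
      rw [map_mul] at e
      rw [sub_self, vacuumValue, if_neg (by simp [hu]), if_neg (by simp [hu]), map_div₀, map_sub,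
        map_sub, map_mul _ z, map_pow, map_one, hz, zpow_zero, one_mul, eq_div_iff (by
          convert hX' using 1
          simp [hQ]
          ring)]
      simp only [map_sub, map_one, map_mul, map_pow, hQ] at e
      linear_combination e

end Solution

/-! ### Uniqueness and existence of the quantum R matrix -/

section QuantumR

variable {E : Type*} [Field E] {N : ℕ}

/-- The tensor product of two `q`-oscillator representations is generated by the vacua. -/
def GeneratedByVacua (p im x y : E) (N : ℕ) (g : AffineType) : Prop :=
  ∀ W : Submodule E (Fock E (N + 1) ⊗[E] Fock E (N + 1)),
    (∀ i j, IsVacuum g i j → ket E i ⊗ₜ ket E j ∈ W) →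
    (∀ r, ∀ w ∈ W, (TensorProduct.map 1 ((qOscillator p im y N g).e r) +
      TensorProduct.map ((qOscillator p im x N g).e r) ((qOscillator p im y N g).k r) :
        Module.End E _) w ∈ W) →
    (∀ r, ∀ w ∈ W, (TensorProduct.map ((qOscillator p im x N g).f r) 1 +
      TensorProduct.map ((qOscillator p im x N g).kinv r) ((qOscillator p im y N g).f r) :
        Module.End E _) w ∈ W) → W = ⊤

theorem unitVec_zero_ne_zero : unitVec (0 : Fin (N + 1)) ≠ 0 := fun h => by
  simpa [unitVec_same] using congrFun h 0

theorem IsNormalized.apply_vacuum {p im z : E} {g : AffineType}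
    {R : Module.End E (Fock E (N + 1) ⊗[E] Fock E (N + 1))} (h : IsNormalized p im z N R g)
    {i j : Fin (N + 1) → ℕ} (hv : IsVacuum g i j) :
    R (ket E i ⊗ₜ ket E j) = vacuumValue p im z i j • (ket E i ⊗ₜ ket E j) := by
  have hu := unitVec_zero_ne_zero (N := N)
  cases g
  · obtain ⟨rfl, rfl⟩ := hv
    rw [vacuumValue, if_pos ⟨rfl, rfl⟩, one_smul]
    exact h
  · obtain ⟨rfl, rfl⟩ := hv
    rw [vacuumValue, if_pos ⟨rfl, rfl⟩, one_smul]
    exact h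
  · obtain ⟨-, h00, h01, h10, h11⟩ := h
    obtain ⟨rfl | rfl, rfl | rfl⟩ := hv
    · rw [vacuumValue, if_pos ⟨rfl, rfl⟩, one_smul, h00]
    · rw [vacuumValue, if_neg (by simp [hu]), if_pos (.inl rfl), h01]
    · rw [vacuumValue, if_neg (by simp [hu]), if_pos (.inr rfl), h10]
    · rw [vacuumValue, if_neg (by simp [hu]), if_neg (by simp [hu]), h11]

/-- The equalizer of two R matrices contains the vacua by normalization and is stable under Δ(e_r)
and Δ(f_r) by the intertwining property. -/
theorem IsQuantumR.unique {p im z : E} {g : AffineType} (hz : z ≠ 0)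
    (hgen : GeneratedByVacua p im z 1 N g)
    {R R' : Module.End E (Fock E (N + 1) ⊗[E] Fock E (N + 1))} (h : IsQuantumR p im z N g R)
    (h' : IsQuantumR p im z N g R') : R = R' := by
  have hi := h.intertwines z 1 hz one_ne_zero (div_one z)
  have hi' := h'.intertwines z 1 hz one_ne_zero (div_one z)
  refine LinearMap.ext fun w => ?_
  rw [← LinearMap.mem_eqLocus]
  suffices LinearMap.eqLocus R R' = ⊤ by rw [this]; trivial
  refine hgen _ (fun i j hv => ?_) (fun r w hw => ?_) fun r w hw => ?_
  · rw [LinearMap.mem_eqLocus, h.normalized.apply_vacuum hv, h'.normalized.apply_vacuum hv]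
  · rw [LinearMap.mem_eqLocus] at hw ⊢
    rw [← Module.End.mul_apply, ← Module.End.mul_apply, ← hi.e r, ← hi'.e r, Module.End.mul_apply,
      Module.End.mul_apply, hw]
  · rw [LinearMap.mem_eqLocus] at hw ⊢
    rw [← Module.End.mul_apply, ← Module.End.mul_apply, ← hi.f r, ← hi'.f r, Module.End.mul_apply,
      Module.End.mul_apply, hw]

variable {𝕜 K : Type*} [NormedField 𝕜] [Field K] [Algebra E K] {q : 𝕜}
  (ι : PowerSeries 𝕜 →+* K) {p im z : E} (g : AffineType)

theorem solExt_diag {n : ℕ} {c d : (Fin n → ℤ) → E} (h0 : q ≠ 0)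
    (hq : ∀ m : ℕ, m ≠ 0 → q ^ m ≠ 1) (γ : K)
    (hcd : ∀ a b i j, a + b = i + j → c a * d b = c i * d j) (t : Fock E n ⊗[E] Fock E n) :
    solExt ι g E q γ n (TensorProduct.map (ketOp (fun m => c (natVec m)) id)
      (ketOp (fun m => d (natVec m)) id) t) = latOp₂ K c 0 d 0 (solExt ι g E q γ n t) := by
  suffices solExt ι g E q γ n ∘ₗ TensorProduct.map (ketOp (fun m => c (natVec m)) id)
      (ketOp (fun m => d (natVec m)) id) = latOp₂ K c 0 d 0 ∘ₗ solExt ι g E q γ n from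
    LinearMap.congr_fun this t
  refine tensor_ext_ket fun i j => ?_
  ext a b
  change _ = algebraMap E K (c (a - 0) * d (b - 0)) * solExt ι g E q γ n (ket E i ⊗ₜ ket E j)
    (a - 0) (b - 0)
  rw [LinearMap.comp_apply, TensorProduct.map_tmul, ketOp_ket, ketOp_ket,
    ← TensorProduct.smul_tmul', TensorProduct.tmul_smul, smul_smul, map_smul, Pi.smul_apply,
    Pi.smul_apply, id, id, solExt_ket, sub_zero, sub_zero, solExt_ket, Algebra.smul_def]
  by_cases hab : gaugedSol ι q g γ a b i j = 0
  · rw [hab, mul_zero, mul_zero]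
  · rw [hcd a b _ _ (weight_of_gaugedSol_ne_zero ι h0 hq hab)]

/-- The solution gives a map `F` whose values have coefficients in K. By the intertwining relations
and generation, all its values come from V ⊗ V over E, which yields R; the remaining properties are
read off from `F` through the injection. -/
theorem exists_isQuantumR (h0 : q ≠ 0) (h1 : ‖q‖ < 1) (hq : ∀ m : ℕ, m ≠ 0 → q ^ m ≠ 1)
    (hp : ∀ m : ℕ, m ≠ 0 → p ^ m ≠ 1) (hp0 : p ≠ 0) (him : im ^ 2 = -1)
    (hQ : ι (PowerSeries.C q) = algebraMap E K p ^ 2)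
    (hz : algebraMap E K z = ι PowerSeries.X) (hz0 : z ≠ 0)
    (hgen : GeneratedByVacua p im z 1 N g) :
    ∃ R, IsQuantumR p im z N g R ∧ ∀ a b i j, algebraMap E K (entry R a b i j) =
      gaugedSol ι q g (algebraMap E K (-im * p)) (natVec a) (natVec b) i j := by
  set F := solExt ι g E q (algebraMap E K (-im * p)) (N + 1) with hF
  have hinj := latExt₂_injective K (E := E) (n := N + 1)
  -- Rationality of the matrix elements: the vectors with image in the range contain the vacua and
  -- are stable under the coproducts.
  have hrange : (LinearMap.range (latExt₂ E K (N + 1))).comap F = ⊤ := by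
    refine hgen _ (fun i j hv => ?_) (fun r w hw => ?_) fun r w hw => ?_
    · exact ⟨_, (solExt_vacuum ι g h0 hq hv
        (gaugedSol_vacuum ι g h0 h1 hq hp0 him hQ hz hv)).symm⟩
    · obtain ⟨v, hv⟩ := hw
      rw [Submodule.mem_comap, hF,
        solExt_e ι g h0 hq hp0 him hQ hz (y := 1) (mul_one z).symm, ← hF, ← hv,
        ← latExt₂_e K z 1 g hp0 him]
      exact ⟨_, rfl⟩
    · obtain ⟨v, hv⟩ := hw
      rw [Submodule.mem_comap, hF,
        solExt_f ι g h0 hq hp0 him hQ hz (y := 1) (mul_one z).symm hz0, ← hF, ← hv,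
        ← latExt₂_f K z 1 g hp0 him]
      exact ⟨_, rfl⟩
  have hmem (w : Fock E (N + 1) ⊗[E] Fock E (N + 1)) :
      F w ∈ LinearMap.range (latExt₂ E K (N + 1)) := by
    rw [← Submodule.mem_comap, hrange]
    trivial
  -- `R` is `F` followed by the inverse of the injection on its range.
  let R : Module.End E (Fock E (N + 1) ⊗[E] Fock E (N + 1)) :=
    (LinearEquiv.ofInjective (latExt₂ E K (N + 1)) hinj).symm.toLinearMap ∘ₗ
      LinearMap.codRestrict _ F hmem
  have hR (w : Fock E (N + 1) ⊗[E] Fock E (N + 1)) : latExt₂ E K (N + 1) (R w) = F w :=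
    congrArg Subtype.val
      ((LinearEquiv.ofInjective (latExt₂ E K (N + 1)) hinj).apply_symm_apply ⟨F w, hmem w⟩)
  have hent (a b i j : Fin (N + 1) → ℕ) : algebraMap E K (entry R a b i j) =
      gaugedSol ι q g (algebraMap E K (-im * p)) (natVec a) (natVec b) i j := by
    rw [entry_eq, hR, hF, solExt_ket]
  have hvac {i j : Fin (N + 1) → ℕ} (hv : IsVacuum g i j) :
      R (ket E i ⊗ₜ ket E j) = vacuumValue p im z i j • (ket E i ⊗ₜ ket E j) :=
    hinj (by rw [hR, hF, solExt_vacuum ι g h0 hq hv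
      (gaugedSol_vacuum ι g h0 h1 hq hp0 him hQ hz hv)])
  refine ⟨R, ⟨fun x hx => isUqModule_qOscillator hp0 hp him hx g, fun x y hx hy hxy => ?_, ?_⟩,
    hent⟩
  · have hxz : x = z * y := by rw [← hxy, div_mul_cancel₀ _ hy]
    refine ⟨fun r => ?_, fun r => ?_, fun r => ?_, fun r => ?_⟩ <;>
      refine LinearMap.ext fun w => hinj ?_ <;>
      rw [Module.End.mul_apply, Module.End.mul_apply, hR]
    · rw [latExt₂_map K (lifts_k x g hp0 him r) (lifts_k y g hp0 him r), hR,
        (qOscillator_k_apply hp0 him x g r).1, (qOscillator_k_apply hp0 him y g r).1, hF,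
        solExt_diag ι g h0 hq _ fun a b i j => kCoef_mul_kCoef hp0 g r]
    · rw [latExt₂_map K (lifts_kinv x g hp0 him r) (lifts_kinv y g hp0 him r), hR,
        (qOscillator_k_apply hp0 him x g r).2, (qOscillator_k_apply hp0 him y g r).2, hF,
        solExt_diag ι g (c := fun m => (kCoef p im N g r m)⁻¹)
          (d := fun m => (kCoef p im N g r m)⁻¹) h0 hq _ fun a b i j h => by
            rw [← mul_inv, ← mul_inv, kCoef_mul_kCoef hp0 g r h]]
    · rw [latExt₂_e K x y g hp0 him, hR, hF, solExt_e ι g h0 hq hp0 him hQ hz hxz]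
    · rw [latExt₂_f K x y g hp0 him, hR, hF, solExt_f ι g h0 hq hp0 him hQ hz hxz hx]
  · have hu := unitVec_zero_ne_zero (N := N)
    have hone : vacuumValue p im z (0 : Fin (N + 1) → ℕ) 0 = 1 := if_pos ⟨rfl, rfl⟩
    cases g
    · exact (hvac (i := 0) (j := 0) ⟨rfl, rfl⟩).trans (by rw [hone, one_smul])
    · exact (hvac (i := 0) (j := 0) ⟨rfl, rfl⟩).trans (by rw [hone, one_smul])
    · refine ⟨fun ε₁ ε₂ => ?_, ?_, ?_, ?_, ?_⟩
      · suffices sector E (N + 1) ε₁ ε₂ ≤ (sector E (N + 1) ε₁ ε₂).comap R from fun v hv => this hv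
        refine Submodule.span_le.2 ?_
        rintro _ ⟨i, j, rfl, rfl, rfl⟩
        refine mem_sector_of fun a b hab => ?_
        change entry R a b i j ≠ 0 at hab
        rw [← (map_ne_zero (algebraMap E K)), hent] at hab
        have hw := weight_of_gaugedSol_ne_zero ι h0 hq hab
        have hpar := parity_of_gaugedSol_ne_zero ι hab
        have hsum : ∑ r, (a r : ℤ) + ∑ r, (b r : ℤ) = ∑ r, (i r : ℤ) + ∑ r, (j r : ℤ) := by
          rw [← Finset.sum_add_distrib, ← Finset.sum_add_distrib]
          exact Finset.sum_congr rfl fun r _ => congrFun hw r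
        rw [Finset.sum_sub_distrib] at hpar
        simp only [natVec] at hpar
        rw [← Nat.cast_sum, ← Nat.cast_sum] at hpar hsum
        rw [← Nat.cast_sum, ← Nat.cast_sum] at hsum
        have e {k l : ℕ} (h : (2 : ℤ) ∣ k - l) : (-1 : ℤˣ) ^ k = (-1) ^ l := by
          rw [Int.units_pow_eq_pow_mod_two _ k, Int.units_pow_eq_pow_mod_two _ l]
          congr 1
          omega
        exact ⟨e (by omega), e hpar⟩
      · rw [hvac ⟨.inl rfl, .inl rfl⟩, hone, one_smul]
      · rw [hvac ⟨.inl rfl, .inr rfl⟩, vacuumValue, if_neg (by simp [hu]), if_pos (.inl rfl)]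
      · rw [hvac ⟨.inr rfl, .inl rfl⟩, vacuumValue, if_neg (by simp [hu]), if_pos (.inr rfl)]
      · rw [hvac ⟨.inr rfl, .inr rfl⟩, vacuumValue, if_neg (by simp [hu]),
          if_neg (by simp [hu])]

end QuantumR

/-! ### Reaching all multi-indices by elementary moves -/

section Reach

variable {N : ℕ}

theorem sum_add_nsmul_unitVec {n : ℕ} (j : Fin n → ℕ) (k : ℕ) (r : Fin n) :
    ∑ s, (j + k • unitVec r) s = ∑ s, j s + k := by
  simp [Finset.sum_add_distrib, unitVec, ← Finset.mul_sum]

theorem sum_sub_nsmul_unitVec {n : ℕ} {j : Fin n → ℕ} {k : ℕ} {r : Fin n} (h : k ≤ j r) :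
    ∑ s, (j - k • unitVec r) s + k = ∑ s, j s := by
  rw [← sum_add_nsmul_unitVec, tsub_add_cancel_of_le (nsmul_unitVec_le h)]

theorem sum_add_unitVec {n : ℕ} (j : Fin n → ℕ) (r : Fin n) :
    ∑ s, (j + unitVec r) s = ∑ s, j s + 1 := by
  simpa using sum_add_nsmul_unitVec j 1 r

theorem sum_sub_unitVec {n : ℕ} {j : Fin n → ℕ} {r : Fin n} (h : j r ≠ 0) :
    ∑ s, (j - unitVec r) s + 1 = ∑ s, j s := by
  rw [← sum_add_unitVec, tsub_add_cancel_of_le (unitVec_le h)]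

theorem sum_move {n : ℕ} {j : Fin n → ℕ} {r : Fin n} (h : j r ≠ 0) (r' : Fin n) :
    ∑ s, (j - unitVec r + unitVec r') s = ∑ s, j s := by
  rw [sum_add_unitVec, sum_sub_unitVec h]

theorem sum_move' {n : ℕ} {j : Fin n → ℕ} {r : Fin n} (h : j r ≠ 0) (r' : Fin n) :
    ∑ s, (j + unitVec r' - unitVec r) s = ∑ s, j s := by
  rw [← tsub_add_eq_add_tsub (unitVec_le h), sum_move h]

theorem nsmul_unitVec_induction {n : ℕ} {P : (Fin n → ℕ) → Prop} {k : ℕ} (hk : k ≠ 0) {r : Fin n}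
    (hadd : ∀ j, P j → P (j + k • unitVec r)) (base : ∀ m, m < k → P (m • unitVec r)) (m : ℕ) :
    P (m • unitVec r) := by
  induction m using Nat.strong_induction_on with
  | _ m ih =>
    by_cases hm : m < k
    · exact base m hm
    · have h := hadd _ (ih (m - k) (by omega))
      rwa [← add_smul, Nat.sub_add_cancel (by omega)] at h

theorem eq_nsmul_unitVec {n : ℕ} {j : Fin n → ℕ} {r : Fin n} (h : ∀ s, s ≠ r → j s = 0) :
    j = j r • unitVec r := by
  ext s
  by_cases hs : s = r
  · subst hs
    simp [unitVec_same]
  · simp [unitVec_of_ne hs, h s hs]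

/-- Every multi-index is reached from the first site by adding quanta there and moving quanta to
the right. -/
theorem induction_right {P : (Fin (N + 1) → ℕ) → Prop} {k : ℕ} (hk : k ≠ 0)
    (hadd : ∀ j, P j → P (j + k • unitVec 0))
    (hmove : ∀ (r : Fin N) j, j r.castSucc ≠ 0 → P j → P (j - unitVec r.castSucc + unitVec r.succ))
    (base : ∀ m, m < k → P (m • unitVec 0)) (j : Fin (N + 1) → ℕ) : P j := by
  induction h : ∑ r : Fin (N + 1), (r : ℕ) * j r using Nat.strong_induction_on generalizing j with
  | _ w ih =>
    by_cases hr : ∃ r : Fin N, j r.succ ≠ 0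
    · obtain ⟨r, hr⟩ := hr
      have hle := unitVec_le hr
      have hne : r.castSucc ≠ r.succ := r.castSucc_lt_succ.ne
      -- Putting one quantum of site r + 1 back to site r lowers the weighted sum ∑ s·j_s by one,
      -- and the move then restores `j`.
      have h1 := hmove r (j - unitVec r.succ + unitVec r.castSucc) (by simp [unitVec_same])
        (ih _ ?_ _ rfl)
      · rwa [add_tsub_cancel_right, tsub_add_cancel_of_le hle] at h1
      · rw [← h]
        have e : j = j - unitVec r.succ + unitVec r.succ := (tsub_add_cancel_of_le hle).symm
        conv_rhs => rw [e]
        have hu (s : Fin (N + 1)) : ∑ x : Fin (N + 1), (x : ℕ) * unitVec s x = s := by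
          simp [unitVec, Pi.single_apply]
        simp only [Pi.add_apply, mul_add, Finset.sum_add_distrib, hu]
        simp
    · push Not at hr
      rw [eq_nsmul_unitVec (j := j) (r := 0) fun s hs => by
        obtain ⟨s, rfl⟩ := Fin.exists_succ_eq.2 hs
        exact hr s]
      exact nsmul_unitVec_induction hk hadd base _

/-- Every multi-index is reached from the last site by adding quanta there and moving quanta to
the left. -/
theorem induction_left {P : (Fin (N + 1) → ℕ) → Prop} {k : ℕ} (hk : k ≠ 0)
    (hadd : ∀ j, P j → P (j + k • unitVec (Fin.last N)))
    (hmove : ∀ (r : Fin N) j, j r.succ ≠ 0 → P j → P (j + unitVec r.castSucc - unitVec r.succ))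
    (base : ∀ m, m < k → P (m • unitVec (Fin.last N))) (j : Fin (N + 1) → ℕ) : P j := by
  induction h : ∑ r : Fin (N + 1), (N - r : ℕ) * j r using Nat.strong_induction_on
    generalizing j with
  | _ w ih =>
    by_cases hr : ∃ r : Fin N, j r.castSucc ≠ 0
    · obtain ⟨r, hr⟩ := hr
      have hle := unitVec_le hr
      have hne : r.castSucc ≠ r.succ := r.castSucc_lt_succ.ne
      have h1 := hmove r (j - unitVec r.castSucc + unitVec r.succ) (by simp [unitVec_same])
        (ih _ ?_ _ rfl)
      · rwa [add_right_comm, add_tsub_cancel_right, tsub_add_cancel_of_le hle] at h1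
      · rw [← h]
        have e : j = j - unitVec r.castSucc + unitVec r.castSucc := (tsub_add_cancel_of_le hle).symm
        conv_rhs => rw [e]
        have hu (s : Fin (N + 1)) : ∑ x : Fin (N + 1), (N - x : ℕ) * unitVec s x = N - s := by
          simp [unitVec, Pi.single_apply]
        simp only [Pi.add_apply, mul_add, Finset.sum_add_distrib, hu]
        simp
        omega
    · push Not at hr
      rw [eq_nsmul_unitVec (j := j) (r := Fin.last N) fun s hs => by
        obtain ⟨s, rfl⟩ := Fin.exists_castSucc_eq.2 hs
        exact hr s]
      exact nsmul_unitVec_induction hk hadd base _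

end Reach

/-! ### Coproducts on basis vectors -/

section Coproduct

variable {E : Type*} [Field E] {N : ℕ} {p im : E}

theorem coproduct_e_ket (hp : p ≠ 0) (him : im ^ 2 = -1) (x y : E) (g : AffineType)
    (r : Fin (N + 2)) (i j : Fin (N + 1) → ℕ) :
    (TensorProduct.map 1 ((qOscillator p im y N g).e r) +
      TensorProduct.map ((qOscillator p im x N g).e r) ((qOscillator p im y N g).k r) :
        Module.End E _) (ket E i ⊗ₜ ket E j) =
      eCoef p im y N g r (natVec j) • (ket E i ⊗ₜ ket E (eMap N g r j)) +
        (eCoef p im x N g r (natVec i) * kCoef p im N g r (natVec j)) •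
          (ket E (eMap N g r i) ⊗ₜ ket E j) := by
  rw [LinearMap.add_apply, TensorProduct.map_tmul, TensorProduct.map_tmul,
    Module.End.one_apply, (qOscillator_k_apply hp him y g r).1, ketOp_ket, qOscillator_e_ket,
    qOscillator_e_ket, TensorProduct.tmul_smul, TensorProduct.tmul_smul,
    ← TensorProduct.smul_tmul', smul_smul, mul_comm, id]

theorem coproduct_f_ket (hp : p ≠ 0) (him : im ^ 2 = -1) (x y : E) (g : AffineType)
    (r : Fin (N + 2)) (i j : Fin (N + 1) → ℕ) :
    (TensorProduct.map ((qOscillator p im x N g).f r) 1 +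
      TensorProduct.map ((qOscillator p im x N g).kinv r) ((qOscillator p im y N g).f r) :
        Module.End E _) (ket E i ⊗ₜ ket E j) =
      fCoef p im x N g r (natVec i) • (ket E (fMap N g r i) ⊗ₜ ket E j) +
        ((kCoef p im N g r (natVec i))⁻¹ * fCoef p im y N g r (natVec j)) •
          (ket E i ⊗ₜ ket E (fMap N g r j)) := by
  rw [LinearMap.add_apply, TensorProduct.map_tmul, TensorProduct.map_tmul,
    Module.End.one_apply, (qOscillator_k_apply hp him x g r).2, ketOp_ket, qOscillator_f_ket,
    qOscillator_f_ket, TensorProduct.tmul_smul, ← TensorProduct.smul_tmul',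
    ← TensorProduct.smul_tmul', smul_smul, mul_comm, id]

end Coproduct

/-! ### Lattices over 𝕜[z] and reduction modulo z -/

section Lattice

open Polynomial

variable {𝕜 : Type*} [Field 𝕜] {n : ℕ}

/-- The tensor square of the Fock space over the rational functions. -/
abbrev FockSq (𝕜 : Type*) [Field 𝕜] (n : ℕ) : Type _ :=
  Fock (RatFunc 𝕜) n ⊗[RatFunc 𝕜] Fock (RatFunc 𝕜) n

/-- The basis vectors of `V ⊗ V`. -/
def ketSq (𝕜 : Type*) [Field 𝕜] (i j : Fin n → ℕ) : FockSq 𝕜 n := ket _ i ⊗ₜ ket _ j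

/-- The lattice spanned over `𝕜[z]` by the basis vectors of total degree `d`. -/
def degLattice (𝕜 : Type*) [Field 𝕜] (n d : ℕ) : Submodule 𝕜[X] (FockSq 𝕜 n) :=
  Submodule.span _ {v | ∃ i j : Fin n → ℕ, ∑ r, i r + ∑ r, j r = d ∧ v = ketSq 𝕜 i j}

/-- The vectors of the lattice that lie in `W` modulo `z`. -/
def approx (W : Submodule (RatFunc 𝕜) (FockSq 𝕜 n)) (d : ℕ) : Submodule 𝕜[X] (FockSq 𝕜 n) :=
  (W.restrictScalars 𝕜[X] ⊓ degLattice 𝕜 n d) ⊔ Ideal.span {(X : 𝕜[X])} • degLattice 𝕜 n d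

variable {W : Submodule (RatFunc 𝕜) (FockSq 𝕜 n)} {d d' : ℕ}

theorem C_smul_eq (c : 𝕜) (v : FockSq 𝕜 n) : RatFunc.C c • v = (C c : 𝕜[X]) • v := by
  rw [← RatFunc.algebraMap_C, algebraMap_smul]

theorem C_smul_mem (P : Submodule 𝕜[X] (FockSq 𝕜 n)) (c : 𝕜) {v : FockSq 𝕜 n} (h : v ∈ P) :
    RatFunc.C c • v ∈ P := by
  rw [C_smul_eq]
  exact P.smul_mem _ h

theorem mem_of_C_smul_mem {P : Submodule 𝕜[X] (FockSq 𝕜 n)} {c : 𝕜} (hc : c ≠ 0) {v : FockSq 𝕜 n}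
    (h : RatFunc.C c • v ∈ P) : v ∈ P := by
  have := C_smul_mem P c⁻¹ h
  rwa [smul_smul, ← map_mul, inv_mul_cancel₀ hc, map_one, one_smul] at this

theorem ketSq_mem {i j : Fin n → ℕ} (h : ∑ r, i r + ∑ r, j r = d) :
    ketSq 𝕜 i j ∈ degLattice 𝕜 n d :=
  Submodule.subset_span ⟨i, j, h, rfl⟩

theorem C_smul_ketSq_mem {c : 𝕜} {i j : Fin n → ℕ} (h : c ≠ 0 → ∑ r, i r + ∑ r, j r = d) :
    RatFunc.C c • ketSq 𝕜 i j ∈ degLattice 𝕜 n d := by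
  by_cases hc : c = 0
  · rw [hc, map_zero, zero_smul]
    exact zero_mem _
  · exact C_smul_mem _ _ (ketSq_mem (h hc))

theorem X_smul_mem {v : FockSq 𝕜 n} (h : v ∈ degLattice 𝕜 n d) :
    (RatFunc.X : RatFunc 𝕜) • v ∈ degLattice 𝕜 n d := by
  rw [← RatFunc.algebraMap_X, algebraMap_smul]
  exact Submodule.smul_mem _ _ h

theorem X_smul_mem_approx (W : Submodule (RatFunc 𝕜) (FockSq 𝕜 n)) {v : FockSq 𝕜 n}
    (h : v ∈ degLattice 𝕜 n d) : (RatFunc.X : RatFunc 𝕜) • v ∈ approx W d := by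
  rw [← RatFunc.algebraMap_X, algebraMap_smul]
  exact Submodule.mem_sup_right
    (Submodule.smul_mem_smul (Ideal.mem_span_singleton_self _) h)

theorem mem_approx_of_mem {i j : Fin n → ℕ} (h : ketSq 𝕜 i j ∈ W) :
    ketSq 𝕜 i j ∈ approx W (∑ r, i r + ∑ r, j r) :=
  Submodule.mem_sup_left ⟨h, ketSq_mem rfl⟩

/-- `A` is linear over the rational functions, so it commutes with multiplication by z and preserves
the error term as soon as it maps basis vectors of degree d into the lattice of degree d'. -/
theorem map_mem_approx {A : Module.End (RatFunc 𝕜) (FockSq 𝕜 n)} (hW : ∀ w ∈ W, A w ∈ W)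
    (hA : ∀ i j : Fin n → ℕ, ∑ r, i r + ∑ r, j r = d → A (ketSq 𝕜 i j) ∈ degLattice 𝕜 n d')
    {v : FockSq 𝕜 n} (hv : v ∈ approx W d) : A v ∈ approx W d' := by
  have hL : (degLattice 𝕜 n d).map (A.restrictScalars 𝕜[X]) ≤ degLattice 𝕜 n d' := by
    rw [degLattice, Submodule.map_span_le]
    rintro _ ⟨i, j, h, rfl⟩
    exact hA i j h
  obtain ⟨y, hy, z, hz, rfl⟩ := Submodule.mem_sup.1 hv
  rw [map_add]
  refine add_mem (Submodule.mem_sup_left ⟨hW y hy.1, hL ⟨y, hy.2, rfl⟩⟩)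
    (Submodule.mem_sup_right ?_)
  have h : A z ∈ (Ideal.span {(X : 𝕜[X])} • degLattice 𝕜 n d).map (A.restrictScalars 𝕜[X]) :=
    ⟨z, hz, rfl⟩
  rw [Submodule.map_smul''] at h
  exact Submodule.smul_mono le_rfl hL h

theorem fg_degLattice (𝕜 : Type*) [Field 𝕜] (n d : ℕ) : (degLattice 𝕜 n d).FG := by
  refine Submodule.fg_span (Set.Finite.subset (((Set.finite_Iic (fun _ : Fin n => d)).prod
    (Set.finite_Iic (fun _ : Fin n => d))).image fun m => ketSq 𝕜 m.1 m.2) ?_)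
  rintro _ ⟨i, j, h, rfl⟩
  refine ⟨(i, j), ⟨fun r => ?_, fun r => ?_⟩, rfl⟩
  · have := Finset.single_le_sum (f := i) (fun _ _ => Nat.zero_le _) (Finset.mem_univ r)
    change i r ≤ d
    omega
  · have := Finset.single_le_sum (f := j) (fun _ _ => Nat.zero_le _) (Finset.mem_univ r)
    change j r ≤ d
    omega

/-- Nakayama's lemma in each total degree: if L = (W ∩ L) + zL with L finitely generated, some r ≡ 1
modulo z satisfies rL ⊆ W, and r is invertible in 𝕜(z). -/
theorem mem_of_forall_mem_approx
    (h : ∀ i j : Fin n → ℕ, ketSq 𝕜 i j ∈ approx W (∑ r, i r + ∑ r, j r)) : W = ⊤ := by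
  have key (i j : Fin n → ℕ) : ketSq 𝕜 i j ∈ W := by
    set d := ∑ r, i r + ∑ r, j r with hd
    obtain ⟨r, hr, hrL⟩ := Submodule.exists_sub_one_mem_and_smul_le_of_fg_of_le_sup
      (N := W.restrictScalars 𝕜[X] ⊓ degLattice 𝕜 n d) (fg_degLattice 𝕜 n d) le_rfl
      (I := Ideal.span {(X : 𝕜[X])}) (Submodule.span_le.2 (by
        rintro _ ⟨i', j', h', rfl⟩
        rw [← h']
        exact h i' j'))
    have h1 : r • ketSq 𝕜 i j ∈ W :=
      (hrL (Submodule.smul_mem_pointwise_smul _ _ _ (ketSq_mem hd.symm))).1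
    -- Otherwise 1 would be divisible by z.
    have hr0 : r ≠ 0 := by
      rintro rfl
      rw [zero_sub, Ideal.neg_mem_iff, Ideal.mem_span_singleton] at hr
      exact Polynomial.not_isUnit_X (isUnit_of_dvd_one hr)
    have hr1 : algebraMap 𝕜[X] (RatFunc 𝕜) r ≠ 0 := RatFunc.algebraMap_ne_zero hr0
    rw [← algebraMap_smul (RatFunc 𝕜)] at h1
    have := W.smul_mem (algebraMap 𝕜[X] (RatFunc 𝕜) r)⁻¹ h1
    rwa [inv_smul_smul₀ hr1] at this
  refine Submodule.eq_top_iff'.2 fun v => ?_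
  have : W.mkQ = 0 := tensor_ext_ket fun i j => by
    rw [LinearMap.zero_apply, Submodule.mkQ_apply, Submodule.Quotient.mk_eq_zero]
    exact key i j
  rw [← Submodule.Quotient.mk_eq_zero, ← Submodule.mkQ_apply, this, LinearMap.zero_apply]

end Lattice

/-! ### The coproducts at z = 0 -/

section Generation

variable {𝕜 : Type*} [Field 𝕜] {N : ℕ} {p im : 𝕜} {g : AffineType}
  {W : Submodule (RatFunc 𝕜) (FockSq 𝕜 (N + 1))}

/-- `Δ(e_r)` on `V_z ⊗ V_1`. -/
def coE (p im : 𝕜) (N : ℕ) (g : AffineType) (r : Fin (N + 2)) :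
    Module.End (RatFunc 𝕜) (FockSq 𝕜 (N + 1)) :=
  TensorProduct.map 1 ((qOscillator (RatFunc.C p) (RatFunc.C im) 1 N g).e r) +
    TensorProduct.map ((qOscillator (RatFunc.C p) (RatFunc.C im) RatFunc.X N g).e r)
      ((qOscillator (RatFunc.C p) (RatFunc.C im) 1 N g).k r)

/-- `Δ(f_r)` on `V_z ⊗ V_1`. -/
def coF (p im : 𝕜) (N : ℕ) (g : AffineType) (r : Fin (N + 2)) :
    Module.End (RatFunc 𝕜) (FockSq 𝕜 (N + 1)) :=
  TensorProduct.map ((qOscillator (RatFunc.C p) (RatFunc.C im) RatFunc.X N g).f r) 1 +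
    TensorProduct.map ((qOscillator (RatFunc.C p) (RatFunc.C im) RatFunc.X N g).kinv r)
      ((qOscillator (RatFunc.C p) (RatFunc.C im) 1 N g).f r)

theorem coE_ketSq (hp0 : p ≠ 0) (him : im ^ 2 = -1) (r : Fin (N + 2)) (i j : Fin (N + 1) → ℕ) :
    coE p im N g r (ketSq 𝕜 i j) =
      eCoef (RatFunc.C p) (RatFunc.C im) 1 N g r (natVec j) • ketSq 𝕜 i (eMap N g r j) +
        (eCoef (RatFunc.C p) (RatFunc.C im) RatFunc.X N g r (natVec i) *
          RatFunc.C (kCoef p im N g r (natVec j))) • ketSq 𝕜 (eMap N g r i) j := by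
  rw [map_kCoef]
  exact coproduct_e_ket ((map_ne_zero _).2 hp0) (by rw [← map_pow, him, map_neg, map_one]) _ _ g r
    i j

theorem coF_ketSq (hp0 : p ≠ 0) (him : im ^ 2 = -1) (r : Fin (N + 2)) (i j : Fin (N + 1) → ℕ) :
    coF p im N g r (ketSq 𝕜 i j) =
      fCoef (RatFunc.C p) (RatFunc.C im) RatFunc.X N g r (natVec i) • ketSq 𝕜 (fMap N g r i) j +
        (RatFunc.C (kCoef p im N g r (natVec i))⁻¹ *
          fCoef (RatFunc.C p) (RatFunc.C im) 1 N g r (natVec j)) • ketSq 𝕜 i (fMap N g r j) := by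
  rw [map_inv₀, map_kCoef]
  exact coproduct_f_ket ((map_ne_zero _).2 hp0) (by rw [← map_pow, him, map_neg, map_one]) _ _ g r
    i j

/-- Modulo z the coproduct of e_0 only adds quanta to the second factor. -/
theorem coE_zero_ketSq (hp0 : p ≠ 0) (him : im ^ 2 = -1) (i j : Fin (N + 1) → ℕ) :
    coE p im N g 0 (ketSq 𝕜 i j) = ketSq 𝕜 i (j + leftExp g • unitVec 0) +
      (RatFunc.X : RatFunc 𝕜) • (RatFunc.C (kCoef p im N g 0 (natVec j)) •
        ketSq 𝕜 (i + leftExp g • unitVec 0) j) := by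
  rw [coE_ketSq hp0 him, smul_smul]
  simp only [eCoef, eScale, eDeg, eMap, onVertices_zero, qFall_zero, mul_one, one_smul]

theorem coE_mid_ketSq (hp0 : p ≠ 0) (him : im ^ 2 = -1) (r : Fin N) (i j : Fin (N + 1) → ℕ) :
    coE p im N g r.castSucc.succ (ketSq 𝕜 i j) =
      RatFunc.C (qInt (p ^ 2) (j r.castSucc)) •
        ketSq 𝕜 i (j - unitVec r.castSucc + unitVec r.succ) +
      RatFunc.C (qInt (p ^ 2) (i r.castSucc) * kCoef p im N g r.castSucc.succ (natVec j)) •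
        ketSq 𝕜 (i - unitVec r.castSucc + unitVec r.succ) j := by
  rw [coE_ketSq hp0 him, map_mul, map_qInt, map_qInt, map_pow]
  simp only [eCoef, eScale, eDeg, eSite, eMap, onVertices_mid, qFall_one, one_mul]
  rfl

theorem coE_last_ketSq (hp0 : p ≠ 0) (him : im ^ 2 = -1) (i j : Fin (N + 1) → ℕ) :
    coE p im N g (Fin.last (N + 1)) (ketSq 𝕜 i j) =
      RatFunc.C (lowScale p im (rightExp g) * qFall (p ^ 2) (rightExp g) (j (Fin.last N))) •
        ketSq 𝕜 i (j - rightExp g • unitVec (Fin.last N)) +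
      RatFunc.C (lowScale p im (rightExp g) * qFall (p ^ 2) (rightExp g) (i (Fin.last N)) *
          kCoef p im N g (Fin.last (N + 1)) (natVec j)) •
        ketSq 𝕜 (i - rightExp g • unitVec (Fin.last N)) j := by
  rw [coE_ketSq hp0 him, map_mul, map_mul, map_mul, map_qFall, map_qFall, map_pow, map_lowScale]
  simp only [eCoef, eScale, eDeg, eSite, eMap, onVertices_last]
  rfl

theorem coF_mid_ketSq (hp0 : p ≠ 0) (him : im ^ 2 = -1) (r : Fin N) (i j : Fin (N + 1) → ℕ) :
    coF p im N g r.castSucc.succ (ketSq 𝕜 i j) =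
      RatFunc.C (qInt (p ^ 2) (i r.succ)) •
        ketSq 𝕜 (i + unitVec r.castSucc - unitVec r.succ) j +
      RatFunc.C ((kCoef p im N g r.castSucc.succ (natVec i))⁻¹ * qInt (p ^ 2) (j r.succ)) •
        ketSq 𝕜 i (j + unitVec r.castSucc - unitVec r.succ) := by
  rw [coF_ketSq hp0 him, map_mul, map_qInt, map_qInt, map_pow]
  simp only [fCoef, fScale, fDeg, fSite, fMap, onVertices_mid, qFall_one, one_mul]
  rfl

theorem coF_last_ketSq (hp0 : p ≠ 0) (him : im ^ 2 = -1) (i j : Fin (N + 1) → ℕ) :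
    coF p im N g (Fin.last (N + 1)) (ketSq 𝕜 i j) =
      ketSq 𝕜 (i + rightExp g • unitVec (Fin.last N)) j +
        RatFunc.C (kCoef p im N g (Fin.last (N + 1)) (natVec i))⁻¹ •
          ketSq 𝕜 i (j + rightExp g • unitVec (Fin.last N)) := by
  rw [coF_ketSq hp0 him]
  simp only [fCoef, fScale, fDeg, fMap, onVertices_last, qFall_zero, mul_one, one_smul]

/-- The factor z cancels the inverse spectral parameter in f_0 on the first factor; modulo z only
the removal of quanta from that factor survives. -/
theorem X_coF_zero_ketSq (hp0 : p ≠ 0) (him : im ^ 2 = -1) (i j : Fin (N + 1) → ℕ) :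
    ((RatFunc.X : RatFunc 𝕜) • coF p im N g 0) (ketSq 𝕜 i j) =
      RatFunc.C (lowScale p im (leftExp g) * qFall (p ^ 2) (leftExp g) (i 0)) •
        ketSq 𝕜 (i - leftExp g • unitVec 0) j +
      (RatFunc.X : RatFunc 𝕜) • (RatFunc.C ((kCoef p im N g 0 (natVec i))⁻¹ *
          (lowScale p im (leftExp g) * qFall (p ^ 2) (leftExp g) (j 0))) •
        ketSq 𝕜 i (j - leftExp g • unitVec 0)) := by
  rw [LinearMap.smul_apply, coF_ketSq hp0 him, map_mul, map_mul, map_mul, map_qFall, map_qFall,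
    map_pow, map_lowScale, smul_add, smul_smul, smul_smul, smul_smul]
  simp only [fCoef, fScale, fDeg, fSite, fMap, onVertices_zero, inv_one, mul_one]
  congr 2
  rw [mul_comm _ (RatFunc.X)⁻¹, mul_assoc, mul_inv_cancel_left₀ RatFunc.X_ne_zero]
  rfl

/-- The basis vector lies in the lattice of `W` modulo `z`. -/
def IsApprox (W : Submodule (RatFunc 𝕜) (FockSq 𝕜 (N + 1))) (i j : Fin (N + 1) → ℕ) : Prop :=
  ketSq 𝕜 i j ∈ approx W (∑ r, i r + ∑ r, j r)

theorem qInt_sq_ne_zero (hp0 : p ≠ 0) (hp : ∀ m : ℕ, m ≠ 0 → p ^ m ≠ 1) {m : ℕ} (hm : m ≠ 0) :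
    qInt (p ^ 2) m ≠ 0 :=
  qInt_natCast_ne_zero (pow_ne_zero _ hp0) (pow_pow_ne_one' hp two_ne_zero) hm

theorem lowScale_ne_zero (hp0 : p ≠ 0) (hp : ∀ m : ℕ, m ≠ 0 → p ^ m ≠ 1) (him : im ^ 2 = -1)
    (k : ℕ) : lowScale p im k ≠ 0 := by
  unfold lowScale
  split_ifs
  · refine mul_ne_zero (im_ne_zero him) (div_ne_zero (fun h => hp 4 (by norm_num) ?_)
      (sub_ne_zero.2 (hp 2 two_ne_zero)))
    linear_combination (p ^ 2 - 1) * h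
  · exact inv_ne_zero (pow_ne_zero _ (qInt_sq_ne_zero hp0 hp (m := 2) two_ne_zero))

theorem qFall_sq_ne_zero (hp0 : p ≠ 0) (hp : ∀ m : ℕ, m ≠ 0 → p ^ m ≠ 1) {k m : ℕ} (h : k ≤ m) :
    qFall (p ^ 2) k m ≠ 0 := by
  refine Finset.prod_ne_zero_iff.2 fun s hs => ?_
  rw [Finset.mem_range] at hs
  rw [← Nat.cast_sub (by omega)]
  exact qInt_sq_ne_zero hp0 hp (by omega)

theorem ne_zero_of_qInt_mul {m : ℕ} {b c : 𝕜} (h : qInt b m * c ≠ 0) : m ≠ 0 := by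
  rintro rfl
  exact h (by rw [Nat.cast_zero, qInt_zero, zero_mul])

theorem ne_zero_of_mul_qInt {m : ℕ} {b c : 𝕜} (h : c * qInt b m ≠ 0) : m ≠ 0 :=
  ne_zero_of_qInt_mul (by rwa [mul_comm] at h)

theorem ne_zero_of_qInt {m : ℕ} {b : 𝕜} (h : qInt b m ≠ 0) : m ≠ 0 :=
  ne_zero_of_qInt_mul (b := b) (c := 1) (by rwa [mul_one])

theorem IsApprox.coE_zero (hp0 : p ≠ 0) (him : im ^ 2 = -1)
    (hE : ∀ r, ∀ w ∈ W, coE p im N g r w ∈ W) {i j : Fin (N + 1) → ℕ} (h : IsApprox W i j) :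
    IsApprox W i (j + leftExp g • unitVec 0) := by
  have e : ∑ r, i r + ∑ r, (j + leftExp g • unitVec 0 : Fin (N + 1) → ℕ) r =
      ∑ r, i r + ∑ r, j r + leftExp g := by rw [sum_add_nsmul_unitVec, add_assoc]
  have hX (i' j' : Fin (N + 1) → ℕ) : RatFunc.C (kCoef p im N g 0 (natVec j')) •
      ketSq 𝕜 (i' + leftExp g • unitVec 0) j' ∈
        degLattice 𝕜 (N + 1) (∑ r, i' r + ∑ r, j' r + leftExp g) :=
    C_smul_ketSq_mem fun _ => by rw [sum_add_nsmul_unitVec]; ring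
  have := map_mem_approx (hE 0) (d' := ∑ r, i r + ∑ r, j r + leftExp g) (fun i' j' h => by
    rw [coE_zero_ketSq hp0 him]
    refine add_mem (ketSq_mem ?_) (X_smul_mem ?_)
    · rw [sum_add_nsmul_unitVec, ← add_assoc, h]
    · rw [← h]
      exact hX i' j') h
  rw [coE_zero_ketSq hp0 him] at this
  rw [IsApprox, e]
  exact (Submodule.add_mem_iff_left _ (X_smul_mem_approx W (hX i j))).1 this

theorem IsApprox.coE_mid (hp0 : p ≠ 0) (him : im ^ 2 = -1)
    (hE : ∀ r, ∀ w ∈ W, coE p im N g r w ∈ W) (r : Fin N) {v : FockSq 𝕜 (N + 1)} {d : ℕ}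
    (h : v ∈ approx W d) : coE p im N g r.castSucc.succ v ∈ approx W d := by
  refine map_mem_approx (hE _) (fun i j h => ?_) h
  rw [coE_mid_ketSq hp0 him]
  refine add_mem (C_smul_ketSq_mem fun h => ?_) (C_smul_ketSq_mem fun h => ?_)
  · rwa [sum_move (ne_zero_of_qInt h)]
  · rwa [sum_move (ne_zero_of_qInt_mul h)]

theorem IsApprox.move_right (hp0 : p ≠ 0) (hp : ∀ m : ℕ, m ≠ 0 → p ^ m ≠ 1) (him : im ^ 2 = -1)
    (hE : ∀ r, ∀ w ∈ W, coE p im N g r w ∈ W) (r : Fin N) {i j : Fin (N + 1) → ℕ}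
    (hi : i r.castSucc = 0) (hj : j r.castSucc ≠ 0) (h : IsApprox W i j) :
    IsApprox W i (j - unitVec r.castSucc + unitVec r.succ) := by
  have := IsApprox.coE_mid hp0 him hE r h
  rw [coE_mid_ketSq hp0 him, hi, Nat.cast_zero, qInt_zero, zero_mul, map_zero, zero_smul,
    add_zero] at this
  rw [IsApprox, sum_move hj]
  exact mem_of_C_smul_mem (qInt_sq_ne_zero hp0 hp hj) this

theorem IsApprox.move_right_left (hp0 : p ≠ 0) (hp : ∀ m : ℕ, m ≠ 0 → p ^ m ≠ 1)
    (him : im ^ 2 = -1) (hE : ∀ r, ∀ w ∈ W, coE p im N g r w ∈ W) (r : Fin N)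
    {i j : Fin (N + 1) → ℕ} (hi : i r.castSucc ≠ 0) (hj : j r.castSucc = 0) (h : IsApprox W i j) :
    IsApprox W (i - unitVec r.castSucc + unitVec r.succ) j := by
  have := IsApprox.coE_mid hp0 him hE r h
  rw [coE_mid_ketSq hp0 him, hj, Nat.cast_zero, qInt_zero, map_zero, zero_smul,
    zero_add] at this
  rw [IsApprox, sum_move hi]
  exact mem_of_C_smul_mem (mul_ne_zero (qInt_sq_ne_zero hp0 hp hi)
    (kCoef_ne_zero hp0 him g _ _)) this

/-- The hypothesis covers all `j` at once, so the second term of the coproduct, which changes j, is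
already known to lie in the approximation and can be subtracted. -/
theorem IsApprox.coF_last (hp0 : p ≠ 0) (him : im ^ 2 = -1)
    (hF : ∀ r, ∀ w ∈ W, coF p im N g r w ∈ W) {i : Fin (N + 1) → ℕ} (h : ∀ j, IsApprox W i j)
    (j : Fin (N + 1) → ℕ) : IsApprox W (i + rightExp g • unitVec (Fin.last N)) j := by
  have := map_mem_approx (hF (Fin.last (N + 1)))
    (d' := ∑ r, i r + ∑ r, j r + rightExp g) (fun i' j' h => by
      rw [coF_last_ketSq hp0 him]
      refine add_mem (ketSq_mem ?_) (C_smul_ketSq_mem fun _ => ?_) <;>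
      · rw [sum_add_nsmul_unitVec, ← h]
        ring) (h j)
  rw [coF_last_ketSq hp0 him] at this
  have h' := h (j + rightExp g • unitVec (Fin.last N))
  rw [IsApprox, sum_add_nsmul_unitVec, ← add_assoc] at h'
  rw [IsApprox, sum_add_nsmul_unitVec, add_right_comm]
  exact (Submodule.add_mem_iff_left _ (C_smul_mem _ _ h')).1 this

theorem IsApprox.move_left (hp0 : p ≠ 0) (hp : ∀ m : ℕ, m ≠ 0 → p ^ m ≠ 1) (him : im ^ 2 = -1)
    (hF : ∀ r, ∀ w ∈ W, coF p im N g r w ∈ W) (r : Fin N) {i : Fin (N + 1) → ℕ}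
    (hi : i r.succ ≠ 0) (h : ∀ j, IsApprox W i j) (j : Fin (N + 1) → ℕ) :
    IsApprox W (i + unitVec r.castSucc - unitVec r.succ) j := by
  have := map_mem_approx (hF r.castSucc.succ) (d' := ∑ r, i r + ∑ r, j r) (fun i' j' h => by
      rw [coF_mid_ketSq hp0 him]
      refine add_mem (C_smul_ketSq_mem fun h => ?_) (C_smul_ketSq_mem fun h => ?_)
      · rwa [sum_move' (ne_zero_of_qInt h)]
      · rwa [sum_move' (ne_zero_of_mul_qInt h)]) (h j)
  rw [coF_mid_ketSq hp0 him] at this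
  rw [IsApprox, sum_move' hi]
  refine mem_of_C_smul_mem (qInt_sq_ne_zero hp0 hp hi)
    ((Submodule.add_mem_iff_left _ ?_).1 this)
  by_cases hj : j r.succ = 0
  · rw [hj, Nat.cast_zero, qInt_zero, mul_zero, map_zero, zero_smul]
    exact zero_mem _
  · have h' := h (j + unitVec r.castSucc - unitVec r.succ)
    rw [IsApprox, sum_move' hj] at h'
    exact C_smul_mem _ _ h'

theorem IsApprox.coF_zero (hp0 : p ≠ 0) (hp : ∀ m : ℕ, m ≠ 0 → p ^ m ≠ 1) (him : im ^ 2 = -1)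
    (hF : ∀ r, ∀ w ∈ W, coF p im N g r w ∈ W) {i j : Fin (N + 1) → ℕ} (hi : leftExp g ≤ i 0)
    (h : IsApprox W i j) : IsApprox W (i - leftExp g • unitVec 0) j := by
  have e := sum_sub_nsmul_unitVec hi
  set d := ∑ r, (i - leftExp g • unitVec 0 : Fin (N + 1) → ℕ) r + ∑ r, j r with hd
  have hle {i' : Fin (N + 1) → ℕ} {c c' : 𝕜} (h : c * (c' * qFall (p ^ 2) (leftExp g) (i' 0)) ≠ 0) :
      ∑ r, (i' - leftExp g • unitVec 0 : Fin (N + 1) → ℕ) r + leftExp g = ∑ r, i' r :=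
    sum_sub_nsmul_unitVec (le_of_qFall_ne_zero (right_ne_zero_of_mul (right_ne_zero_of_mul h)))
  have hX (i' j' : Fin (N + 1) → ℕ) (h : ∑ r, i' r + ∑ r, j' r = ∑ r, i r + ∑ r, j r) :
      RatFunc.C ((kCoef p im N g 0 (natVec i'))⁻¹ *
        (lowScale p im (leftExp g) * qFall (p ^ 2) (leftExp g) (j' 0))) •
        ketSq 𝕜 i' (j' - leftExp g • unitVec 0) ∈ degLattice 𝕜 (N + 1) d :=
    C_smul_ketSq_mem fun h' => by
      have := hle h'
      omega
  have := map_mem_approx (A := (RatFunc.X : RatFunc 𝕜) • coF p im N g 0) (d' := d)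
    (fun w hw => W.smul_mem _ (hF 0 w hw)) (fun i' j' h => by
      rw [X_coF_zero_ketSq hp0 him]
      refine add_mem (C_smul_ketSq_mem fun h' => ?_) (X_smul_mem (hX i' j' h))
      have := hle (c := 1) (by rwa [one_mul])
      omega) h
  rw [X_coF_zero_ketSq hp0 him] at this
  exact mem_of_C_smul_mem (mul_ne_zero (lowScale_ne_zero hp0 hp him _) (qFall_sq_ne_zero hp0 hp hi))
    ((Submodule.add_mem_iff_left _ (X_smul_mem_approx W (hX i j rfl))).1 this)

/-- The first factor has too few quanta at the last site for e_n to act on it, so only the term in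
the second factor remains. -/
theorem IsApprox.coE_last (hp0 : p ≠ 0) (hp : ∀ m : ℕ, m ≠ 0 → p ^ m ≠ 1) (him : im ^ 2 = -1)
    (hE : ∀ r, ∀ w ∈ W, coE p im N g r w ∈ W) {i j : Fin (N + 1) → ℕ}
    (hi : i (Fin.last N) < rightExp g) (hj : rightExp g ≤ j (Fin.last N)) (h : IsApprox W i j) :
    IsApprox W i (j - rightExp g • unitVec (Fin.last N)) := by
  have e := sum_sub_nsmul_unitVec hj
  set d := ∑ r, i r + ∑ r, (j - rightExp g • unitVec (Fin.last N)) r with hd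
  have hle {i' : Fin (N + 1) → ℕ} {c c' : 𝕜}
      (h : c' * qFall (p ^ 2) (rightExp g) (i' (Fin.last N)) * c ≠ 0) :
      ∑ r, (i' - rightExp g • unitVec (Fin.last N)) r + rightExp g = ∑ r, i' r :=
    sum_sub_nsmul_unitVec (le_of_qFall_ne_zero (right_ne_zero_of_mul (left_ne_zero_of_mul h)))
  have := map_mem_approx (hE (Fin.last (N + 1))) (d' := d) (fun i' j' h => by
      rw [coE_last_ketSq hp0 him]
      refine add_mem (C_smul_ketSq_mem fun h' => ?_) (C_smul_ketSq_mem fun h' => ?_)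
      · have := hle (c := 1) (by rwa [mul_one])
        omega
      · have := hle h'
        omega) h
  rw [coE_last_ketSq hp0 him, show qFall (p ^ 2) (rightExp g) (i (Fin.last N)) = 0 by
    by_contra hne
    exact absurd (le_of_qFall_ne_zero hne) (by omega), mul_zero, zero_mul, map_zero, zero_smul,
    add_zero] at this
  exact mem_of_C_smul_mem (mul_ne_zero (lowScale_ne_zero hp0 hp him _) (qFall_sq_ne_zero hp0 hp hj))
    this

end Generation

/-! ### Generation by the vacua -/

section Generation

variable {𝕜 : Type*} [Field 𝕜] {N : ℕ} {p im : 𝕜} {g : AffineType}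
  {W : Submodule (RatFunc 𝕜) (FockSq 𝕜 (N + 1))}

theorem isVacuum_zero_nsmul {m : ℕ} (hm : m < leftExp g) :
    IsVacuum g (0 : Fin (N + 1) → ℕ) (m • unitVec 0) := by
  cases g <;> simp only [leftExp] at hm <;> interval_cases m <;> simp [IsVacuum]

theorem leftExp_ne_zero (g : AffineType) : leftExp g ≠ 0 := by cases g <;> simp [leftExp]

theorem rightExp_ne_zero (g : AffineType) : rightExp g ≠ 0 := by cases g <;> simp [rightExp]

/-- With first factor |0⟩ the inner e_r act only on the second factor. Modulo z, e_0 and these moves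
reach every |0⟩ ⊗ |j⟩. -/
theorem isApprox_zero (hp0 : p ≠ 0) (hp : ∀ m : ℕ, m ≠ 0 → p ^ m ≠ 1) (him : im ^ 2 = -1)
    (hE : ∀ r, ∀ w ∈ W, coE p im N g r w ∈ W) (hV : ∀ i j, IsVacuum g i j → ketSq 𝕜 i j ∈ W)
    (j : Fin (N + 1) → ℕ) : IsApprox W 0 j :=
  induction_right (leftExp_ne_zero g) (fun _ h => h.coE_zero hp0 him hE)
    (fun r _ hj h => h.move_right hp0 hp him hE r rfl hj)
    (fun _ hm => mem_approx_of_mem (hV _ _ (isVacuum_zero_nsmul hm))) j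

/-- The first factor is built from the last site by f_n and the inner f_r, with all `j` treated
together. If t = 2, f_n adds quanta in pairs, so |e_n⟩ is needed as a second starting point. -/
theorem isApprox_of_last (hp0 : p ≠ 0) (hp : ∀ m : ℕ, m ≠ 0 → p ^ m ≠ 1) (him : im ^ 2 = -1)
    (hE : ∀ r, ∀ w ∈ W, coE p im N g r w ∈ W) (hF : ∀ r, ∀ w ∈ W, coF p im N g r w ∈ W)
    (hV : ∀ i j, IsVacuum g i j → ketSq 𝕜 i j ∈ W)
    (hlast : rightExp g = 2 → ∀ j, IsApprox W (unitVec (Fin.last N)) j)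
    (i j : Fin (N + 1) → ℕ) : IsApprox W i j := by
  refine induction_left (P := fun i => ∀ j, IsApprox W i j) (rightExp_ne_zero g)
    (fun i h => IsApprox.coF_last hp0 him hF h)
    (fun r i hi h => IsApprox.move_left hp0 hp him hF r hi h) (fun m hm j => ?_) i j
  have := rightExp_le g
  rcases m with _ | _ | m
  · rw [zero_smul]
    exact isApprox_zero hp0 hp him hE hV j
  · rw [zero_add, one_smul]
    exact hlast (by omega) j
  · omega

/-- Two quanta are created at the last site, one of them is moved to the first site and removed
there by z f_0, which takes out single quanta in this type. -/
theorem isApprox_last_A2 (hp0 : p ≠ 0) (hp : ∀ m : ℕ, m ≠ 0 → p ^ m ≠ 1) (him : im ^ 2 = -1)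
    (hE : ∀ r, ∀ w ∈ W, coE p im N .A2 r w ∈ W) (hF : ∀ r, ∀ w ∈ W, coF p im N .A2 r w ∈ W)
    (hV : ∀ i j, IsVacuum .A2 i j → ketSq 𝕜 i j ∈ W) (j : Fin (N + 1) → ℕ) :
    IsApprox W (unitVec (Fin.last N)) j := by
  have key (s : Fin (N + 1)) (j : Fin (N + 1) → ℕ) :
      IsApprox W (unitVec (Fin.last N) + unitVec s) j := by
    induction s using Fin.reverseInduction generalizing j with
    | last =>
      have := IsApprox.coF_last hp0 him hF (isApprox_zero hp0 hp him hE hV) j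
      rwa [rightExp, zero_add, two_smul] at this
    | cast r ih =>
      have := IsApprox.move_left hp0 hp him hF r (by simp [unitVec_same]) ih j
      rwa [add_right_comm, add_tsub_cancel_right] at this
  have := (key 0 j).coF_zero hp0 hp him hF (by simp [leftExp, unitVec_same])
  rwa [leftExp, one_smul, add_tsub_cancel_right] at this

theorem isApprox_unitVec_zero (hp0 : p ≠ 0) (hp : ∀ m : ℕ, m ≠ 0 → p ^ m ≠ 1) (him : im ^ 2 = -1)
    (hE : ∀ r, ∀ w ∈ W, coE p im N g r w ∈ W) (hV : ketSq 𝕜 (unitVec 0) 0 ∈ W)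
    (s : Fin (N + 1)) : IsApprox W (unitVec s) 0 := by
  induction s using Fin.induction with
  | zero => exact mem_approx_of_mem hV
  | succ r ih =>
    have := ih.move_right_left hp0 hp him hE r (by simp [unitVec_same]) rfl
    rwa [tsub_self, zero_add] at this

theorem isApprox_unitVec_self (hp0 : p ≠ 0) (hp : ∀ m : ℕ, m ≠ 0 → p ^ m ≠ 1) (him : im ^ 2 = -1)
    (hE : ∀ r, ∀ w ∈ W, coE p im N g r w ∈ W) (hV : ketSq 𝕜 (unitVec 0) (unitVec 0) ∈ W)
    (s : Fin (N + 1)) : IsApprox W (unitVec s) (unitVec s) := by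
  induction s using Fin.induction with
  | zero => exact mem_approx_of_mem hV
  | succ r ih =>
    -- Applying Δ(e_r) twice moves both quanta one site to the right, with coefficient q + q⁻¹; its
    -- vanishing would imply p⁸ = 1.
    have h := IsApprox.coE_mid hp0 him hE r (IsApprox.coE_mid hp0 him hE r ih)
    have hne : r.castSucc ≠ r.succ := r.castSucc_lt_succ.ne
    have hq0 : p ^ 2 ≠ 0 := pow_ne_zero _ hp0
    rw [coE_mid_ketSq hp0 him, tsub_self, zero_add, map_add, map_smul, map_smul,
      coE_mid_ketSq hp0 him, coE_mid_ketSq hp0 him, unitVec_same, unitVec_of_ne hne, tsub_self,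
      zero_add, Nat.cast_one,
      Nat.cast_zero, qInt_zero, qInt_one hq0 (pow_pow_ne_one' hp two_ne_zero), zero_mul, map_zero,
      zero_smul, zero_smul, map_one, one_smul, one_smul, zero_add, add_zero, one_mul, one_mul,
      ← add_smul, ← map_add, kCoef_mid hp0 him, kCoef_mid hp0 him] at h
    rw [IsApprox]
    rw [sum_unitVec] at h ⊢
    refine mem_of_C_smul_mem ?_ h
    simp only [natVec, unitVec_same, unitVec_of_ne hne, unitVec_of_ne hne.symm]
    simp only [Nat.cast_zero, Nat.cast_one, neg_zero, zero_add, add_zero, zpow_one, zpow_neg]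
    intro h0
    refine hp 8 (by norm_num) ?_
    have := mul_inv_cancel₀ hq0
    linear_combination (p ^ 6 - p ^ 2) * h0 - (p ^ 4 - 1) * this

/-- Here e_0 adds pairs, so both |0⟩ and |e_1⟩ are needed as starting points in the second factor.
The first comes from the vacuum |e_1⟩ ⊗ |0⟩ by moving the quantum. For the second, |e_n⟩ ⊗ |e_n⟩
receives a pair at the first site, one quantum of the pair is moved to the last site, and e_n
removes the two quanta now there. -/
theorem isApprox_last_C1 (hp0 : p ≠ 0) (hp : ∀ m : ℕ, m ≠ 0 → p ^ m ≠ 1) (him : im ^ 2 = -1)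
    (hE : ∀ r, ∀ w ∈ W, coE p im N .C1 r w ∈ W) (hV : ∀ i j, IsVacuum .C1 i j → ketSq 𝕜 i j ∈ W)
    (j : Fin (N + 1) → ℕ) : IsApprox W (unitVec (Fin.last N)) j := by
  have hne (r : Fin N) : unitVec (Fin.last N) r.castSucc = 0 := unitVec_of_ne r.castSucc_lt_last.ne
  have key (s : Fin (N + 1)) :
      IsApprox W (unitVec (Fin.last N)) (unitVec (Fin.last N) + unitVec 0 + unitVec s) := by
    induction s using Fin.induction with
    | zero =>
      have := (isApprox_unitVec_self hp0 hp him hE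
        (hV _ _ ⟨.inr rfl, .inr rfl⟩) (Fin.last N)).coE_zero hp0 him hE
      rwa [leftExp, two_smul, ← add_assoc] at this
    | succ r ih =>
      have := ih.move_right hp0 hp him hE r (hne r) (by simp [unitVec_same])
      rwa [add_tsub_cancel_right] at this
  refine induction_right (leftExp_ne_zero .C1) (fun _ h => h.coE_zero hp0 him hE)
    (fun r _ hj h => h.move_right hp0 hp him hE r (hne r) hj) (fun m hm => ?_) j
  rw [leftExp] at hm
  interval_cases m
  · rw [zero_smul]
    exact isApprox_unitVec_zero hp0 hp him hE (hV _ _ ⟨.inr rfl, .inl rfl⟩) _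
  · have h := (key (Fin.last N)).coE_last hp0 hp him hE (by simp [rightExp, unitVec_same]) (by
      simp only [rightExp, Pi.add_apply, unitVec_same]
      omega)
    rwa [rightExp, add_right_comm, ← two_smul ℕ (unitVec (Fin.last N)), add_tsub_cancel_left,
      ← one_smul ℕ (unitVec 0)] at h

theorem generatedByVacua (hp0 : p ≠ 0) (hp : ∀ m : ℕ, m ≠ 0 → p ^ m ≠ 1) (him : im ^ 2 = -1)
    (N : ℕ) (g : AffineType) :
    GeneratedByVacua (RatFunc.C p) (RatFunc.C im) RatFunc.X 1 N g := by
  intro W hV hE hF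
  refine mem_of_forall_mem_approx (isApprox_of_last hp0 hp him hE hF hV fun h => ?_)
  cases g
  · simp [rightExp] at h
  · exact isApprox_last_A2 hp0 hp him hE hF hV
  · exact isApprox_last_C1 hp0 hp him hE hV

end Generation

/-! ### Conclusion over the Laurent series -/

section Main

open scoped RatFunc LaurentSeries

variable {𝕜 : Type*} [NormedField 𝕜]

/-- The existence theorem is applied with 𝕜(z) inside the Laurent series. The entries of R are the
solution times γ^{|a| - |j|}, and the gauge transformation removes exactly this power. -/
theorem isQuantumR_of_eq_solZ {p im : 𝕜} (hp₀ : 0 < ‖p‖) (hp₁ : ‖p‖ < 1) (him : im ^ 2 = -1)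
    (N : ℕ) (g : AffineType) {S : (Fin (N + 1) → ℕ) → (Fin (N + 1) → ℕ) → (Fin (N + 1) → ℕ) →
      (Fin (N + 1) → ℕ) → PowerSeries 𝕜}
    (hS : ∀ a b i j, S a b i j = solZ (p ^ 2) g (natVec a) (natVec b) i j) :
    (∃! R, IsQuantumR (RatFunc.C p) (RatFunc.C im) RatFunc.X N g R) ∧
      ∀ R, IsQuantumR (RatFunc.C p) (RatFunc.C im) RatFunc.X N g R →
        ∀ a b i j : Fin (N + 1) → ℕ,
          ((S a b i j : PowerSeries 𝕜) : LaurentSeries 𝕜) =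
            ((entry (gaugeTransform (RatFunc.C p) (RatFunc.C im) R) a b i j :
              RatFunc 𝕜) : LaurentSeries 𝕜) := by
  have hp0 : p ≠ 0 := norm_pos_iff.1 hp₀
  have hp (m : ℕ) (hm : m ≠ 0) : p ^ m ≠ 1 := fun h => by
    have := pow_lt_one₀ (norm_nonneg p) hp₁ hm
    rw [← norm_pow, h, norm_one] at this
    exact lt_irrefl _ this
  have hpC (m : ℕ) (hm : m ≠ 0) : RatFunc.C p ^ m ≠ 1 := fun h => hp m hm (by
    rw [← map_pow] at h
    exact (RatFunc.C (K := 𝕜)).injective (h.trans (map_one _).symm))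
  have hpC0 : RatFunc.C p ≠ 0 := (map_ne_zero _).2 hp0
  have himC : RatFunc.C im ^ 2 = -1 := by rw [← map_pow, him, map_neg, map_one]
  have hgen := generatedByVacua hp0 hp him N g
  have hC (c : 𝕜) : HahnSeries.ofPowerSeries ℤ 𝕜 (PowerSeries.C c) =
      algebraMap (RatFunc 𝕜) (LaurentSeries 𝕜) (RatFunc.C c) := by
    rw [← RatFunc.algebraMap_C, ← Polynomial.coe_C]
    exact RatFunc.coe_coe _
  have hX : algebraMap (RatFunc 𝕜) (LaurentSeries 𝕜) RatFunc.X =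
      HahnSeries.ofPowerSeries ℤ 𝕜 PowerSeries.X := by
    rw [← RatFunc.algebraMap_X, ← Polynomial.coe_X]
    exact (RatFunc.coe_coe _).symm
  obtain ⟨R₀, hR₀, hent⟩ := exists_isQuantumR (HahnSeries.ofPowerSeries ℤ 𝕜) (q := p ^ 2) g
    (pow_ne_zero _ hp0) (by rw [norm_pow]; exact pow_lt_one₀ (norm_nonneg p) hp₁ two_ne_zero)
    (pow_pow_ne_one' hp two_ne_zero) hpC hpC0 himC (by rw [hC, map_pow, map_pow]) hX
    RatFunc.X_ne_zero hgen
  have huniq : ∀ R, IsQuantumR (RatFunc.C p) (RatFunc.C im) RatFunc.X N g R → R = R₀ :=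
    fun R hR => hR.unique RatFunc.X_ne_zero hgen hR₀
  refine ⟨⟨R₀, hR₀, huniq⟩, fun R hR a b i j => ?_⟩
  rw [huniq R hR, gaugeTransform_entry]
  change _ = algebraMap (RatFunc 𝕜) (LaurentSeries 𝕜) _
  rw [map_mul, map_mul, hent, gaugedSol, solK, ← hS, map_inv₀, map_pow, map_pow]
  have hγ : algebraMap (RatFunc 𝕜) (LaurentSeries 𝕜) (-RatFunc.C im * RatFunc.C p) ≠ 0 :=
    (map_ne_zero _).2 (mul_ne_zero (neg_ne_zero.2 (im_ne_zero himC)) hpC0)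
  simp only [natVec]
  rw [zpow_sub₀ hγ, ← Nat.cast_sum, ← Nat.cast_sum, zpow_natCast, zpow_natCast]
  generalize algebraMap (RatFunc 𝕜) (LaurentSeries 𝕜) (-RatFunc.C im * RatFunc.C p) = γ at hγ ⊢
  field_simp

end Main

end QOsc

end

theorem theorem4p1 {𝕜 : Type*} [NormedField 𝕜] [CompleteSpace 𝕜] [CharZero 𝕜] (p im : 𝕜)
    (hp₀ : 0 < ‖p‖) (hp₁ : ‖p‖ < 1) (him : im ^ 2 = -1) (N : ℕ) :
    ((∃! R, QOsc.IsQuantumR (RatFunc.C p) (RatFunc.C im) RatFunc.X N .D2 R) ∧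
      ∀ R, QOsc.IsQuantumR (RatFunc.C p) (RatFunc.C im) RatFunc.X N .D2 R →
        ∀ a b i j : Fin (N + 1) → ℕ,
          ((QOsc.S11 (p ^ 2) a b i j : PowerSeries 𝕜) : LaurentSeries 𝕜) =
            ((QOsc.entry (QOsc.gaugeTransform (RatFunc.C p) (RatFunc.C im) R) a b i j :
              RatFunc 𝕜) : LaurentSeries 𝕜)) ∧
    ((∃! R, QOsc.IsQuantumR (RatFunc.C p) (RatFunc.C im) RatFunc.X N .A2 R) ∧
      ∀ R, QOsc.IsQuantumR (RatFunc.C p) (RatFunc.C im) RatFunc.X N .A2 R →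
        ∀ a b i j : Fin (N + 1) → ℕ,
          ((QOsc.S12 (p ^ 2) a b i j : PowerSeries 𝕜) : LaurentSeries 𝕜) =
            ((QOsc.entry (QOsc.gaugeTransform (RatFunc.C p) (RatFunc.C im) R) a b i j :
              RatFunc 𝕜) : LaurentSeries 𝕜)) ∧
    ((∃! R, QOsc.IsQuantumR (RatFunc.C p) (RatFunc.C im) RatFunc.X N .C1 R) ∧
      ∀ R, QOsc.IsQuantumR (RatFunc.C p) (RatFunc.C im) RatFunc.X N .C1 R →
        ∀ a b i j : Fin (N + 1) → ℕ,
          ((QOsc.S22 (p ^ 2) a b i j : PowerSeries 𝕜) : LaurentSeries 𝕜) =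
            ((QOsc.entry (QOsc.gaugeTransform (RatFunc.C p) (RatFunc.C im) R) a b i j :
              RatFunc 𝕜) : LaurentSeries 𝕜)) := by
  exact ⟨QOsc.isQuantumR_of_eq_solZ hp₀ hp₁ him N .D2 (QOsc.S11_eq _),
    QOsc.isQuantumR_of_eq_solZ hp₀ hp₁ him N .A2 (QOsc.S12_eq _),
    QOsc.isQuantumR_of_eq_solZ hp₀ hp₁ him N .C1 (QOsc.S22_eq _)⟩
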